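/- Fix a number $n$ of processes and a sequential specification $Spec$ over methods $m$, arguments $a$ and return values $b$, given by an LTS whose labels are operations $m(a)\Rightarrow b$; assume that $Spec$ is deterministic and non-blocking, i.e. from each state of this LTS there is, for all $m$ and $a$, exactly one transition with a label of the form $m(a)\Rightarrow\cdot$. A concurrent object $\mathcal O$ consists of a shared memory and, for each method, code made of atomic (possibly nondeterministic, never blocking) commands that ends in a return command. $\llbracket\mathcal O,n\rrbracket$ is the LTS of $n$ processes, each of which repeatedly calls an arbitrary method of $\mathcal O$ with an arbitrary argument; its labels are calls $call(P_i,m,a)$, returns $return(P_i,m,b)$, and internal actions of a process. $A_1\preceq_{(c,r)}A_2$ means that there is a relation $R$ between the states of the LTSs $A_1$ and $A_2$ that relates the initial states and such that, whenever $(c_1,c_2)\in R$ and $c_1\xrightarrow{\alpha}c_1'$, there is a finite path of $A_2$ from $c_2$ to some $c_2'$ with $(c_1',c_2')\in R$ whose sequence of call and return actions is that of $\alpha$. $\mathcal O$ is linearizable w.r.t. $Spec$ (for $n$ processes) if the sequence $h$ of call and return actions of every finite trace of $\llbracket\mathcal O,n\rrbracket$ has a linearization: a sequence of operations of $Spec$,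 assigned to processes, whose sequential history $s$ has the same process subhistories as $complete(h')$ for some extension $h'$ of $h$ by return actions (where $complete$ removes pending calls), and such that $o_1<_ho_2$ implies $o_1<_so_2$ for all operations $o_1,o_2$ of $complete(h')$, where $o_1<_ho_2$ means that $o_1$ returns in $h$ before $o_2$ is called in $h$. $\mathcal O$ satisfies wait-freedom (WF), lock-freedom (LF), obstruction-freedom (OF) if every infinite trace $t$ of $\llbracket\mathcal O,n\rrbracket$ satisfies $sched(t)\Rightarrow prog_t(t)$, $sched(t)\Rightarrow prog_s(t)$, $sched(t)\wedge iso(t)\Rightarrow prog_t(t)$, respectively. Here $prog_t$ says that every call returns; $prog_s$ that whenever a call is pending, some return follows; $sched$ that if there are calls which never return, then the process of one of them is scheduled infinitely often; $iso$ that from some moment on only one process is scheduled. $\mathcal A_{Spec}$ is Herlihy's wait-free universal construction: process $i$ announces a new node $(m,a)$ in $announce[i]$, sets $head[i]$ to a node of maximal sequence number among the entries of $head$, and while $announce[i].seq=0$ it sets $before:=head[i]$, proposes the node $announce[(before.seq+1)\bmod n]$ if its $seq$ is $0$ and $announce[i]$ otherwise to the consensus object $before.decideNext$, appends the decided node $after$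 ($before.next:=after$, $after.seq:=before.seq+1$), and sets $head[i]:=after$; then it sets $head[i]:=announce[i]$ and returns the response obtained by replaying the list on $Spec$ up to its own node. $\mathcal U_{Spec}$ is the following variant. An operation first obtains a unique identity and stores its call action in a shared history recorder. Immediately after each $decide$ it reads the recorder, sets $after.hist$ to the history read if it was null, computes nondeterministically a linearization $l$ of $after.hist$ that contains the operation of $after$ and, for each node of the list up to $before$, the operation of that node with the same return value as in the $lin$-field of that node, and sets $after.lin$ to $l$ if it was null. At the end, instead of replaying the list, it takes as return value the one of its operation in the $lin$-field of its own node, stores its return action in the recorder, and returns. Let $Prog\in\{WF,LF,OF\}$. A $Prog$-class is a nonempty set $S$ of LTSs $\llbracket\mathcal O,n\rrbracket$ of objects $\mathcal O$ that are linearizable w.r.t. $Spec$ and satisfy $Prog$ for $n$ processes, such that any two elements of $S$ simulate each other ($\preceq_{(c,r)}$ in both directions) and such that $\llbracket\mathcal O,n\rrbracket\in S$ whenever $\mathcal O$ is linearizable w.r.t. $Spec$, satisfies $Prog$, and $\llbracket\mathcal O,n\rrbracket$ and some element of $S$ simulate each other. For $Prog$-classes, $S_1\preceq_{(c,r)}S_2$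 means that $A_1\preceq_{(c,r)}A_2$ for some $A_1\in S_1$ and $A_2\in S_2$. Theorem. The set of $Prog$-classes with $\preceq_{(c,r)}$ is a bounded join-semilattice: $\preceq_{(c,r)}$ is a partial order on it, any two $Prog$-classes have a least upper bound, there is a unique $Prog$-class containing $\llbracket\mathcal U_{Spec},n\rrbracket$, which is the maximum element, and there is a unique $Prog$-class containing $\llbracket\mathcal A_{Spec},n\rrbracket$, which is the minimum element. -/

import Mathlib

universe u

namespace ConcLat

/-! ## Sequential specifications -/

/-- A sequential specification over methods `M`, arguments `A` and return values `B`, presented by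
an LTS whose transition labels are the operations `m(a) ⇒ b`. -/
structure SeqSpec (M A B : Type u) where
  State : Type u
  init : State
  step : State → M → A → B → State → Prop

namespace SeqSpec

variable {M A B : Type u}

/-- From each state there is at most one transition labelled `m(a) ⇒ ·`. -/
def Deterministic (S : SeqSpec M A B) : Prop :=
  ∀ q m a b b' q' q'', S.step q m a b q' → S.step q m a b' q'' → b = b' ∧ q' = q''

/-- From each state there is at least one transition labelled `m(a) ⇒ ·`. -/
def NonBlocking (S : SeqSpec M A B) : Prop :=
  ∀ q m a, ∃ b q', S.step q m a b q'

/-- `S.Run q w q'`: the operation sequence `w` leads from `q` to `q'`. -/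
inductive Run (S : SeqSpec M A B) : S.State → List (M × A × B) → S.State → Prop
  | nil (q : S.State) : Run S q [] q
  | cons {q q' q'' : S.State} {m : M} {a : A} {b : B} {w : List (M × A × B)} :
      S.step q m a b q' → Run S q' w q'' → Run S q ((m, a, b) :: w) q''

/-- The (prefix-closed) set of operation sequences of the specification. -/
def traces (S : SeqSpec M A B) : Set (List (M × A × B)) :=
  {w | ∃ q, S.Run S.init w q}

end SeqSpec

/-! ## Histories and linearizations -/

/-- Call and return actions of `n` processes. Each action carries a tag of type `T`: histories of
objects are untagged (`T = Unit`), the history recorder used by the universal object below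
additionally stores operation identities (`T = ℕ`). -/
inductive Act (n : ℕ) (M A B : Type u) (T : Type) : Type u
  | call (i : Fin n) (m : M) (a : A) (t : T)
  | ret (i : Fin n) (m : M) (b : B) (t : T)

namespace Act

variable {n : ℕ} {M A B : Type u} {T : Type}

/-- The process of an action. -/
def pid : Act n M A B T → Fin n
  | call i _ _ _ => i
  | ret i _ _ _ => i

/-- Is it a call action? -/
def isCall : Act n M A B T → Bool
  | call _ _ _ _ => true
  | ret _ _ _ _ => false

/-- Is it a return action? -/
def isRet : Act n M A B T → Bool
  | call _ _ _ _ => false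
  | ret _ _ _ _ => true

end Act

/-- A finite sequence of call and return actions. -/
abbrev History (n : ℕ) (M A B : Type u) (T : Type) : Type u := List (Act n M A B T)

namespace History

variable {n : ℕ} {M A B : Type u} {T : Type}

/-- The process subhistory `h |ᵢ`. -/
def proj (h : History n M A B T) (i : Fin n) : History n M A B T :=
  List.filter (fun x => decide (x.pid = i)) h

/-- The number of call actions of process `i`. -/
def calls (i : Fin n) (h : History n M A B T) : ℕ :=
  List.countP (fun x => x.isCall && decide (x.pid = i)) h

/-- The number of return actions of process `i`. -/
def rets (i : Fin n) (h : History n M A B T) : ℕ :=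
  List.countP (fun x => x.isRet && decide (x.pid = i)) h

/-- `complete h`: drop the pending call actions of `h`, i.e. those which are not followed by a
return action of the same process. -/
def complete : History n M A B T → History n M A B T
  | [] => []
  | Act.call i m a t :: h =>
      if 0 < rets i h then Act.call i m a t :: complete h else complete h
  | Act.ret i m b t :: h => Act.ret i m b t :: complete h

/-- An operation of a history is identified by its process `i` and its index `k` among the
operations of that process (counted from `0`). `h.Before o₁ o₂` is the happen-before relation
`o₁ <ₕ o₂`: the call of `o₂` occurs in `h`, and at some moment (after some prefix `h₁` of `h`) `o₁`
has already returned while `o₂` has not been called yet. -/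
def Before (h : History n M A B T) (o₁ o₂ : Fin n × ℕ) : Prop :=
  ∃ h₁ : History n M A B T, h₁ <+: h ∧
    o₁.2 < rets o₁.1 h₁ ∧ calls o₂.1 h₁ ≤ o₂.2 ∧ o₂.2 < calls o₂.1 h

end History

/-- An operation `m(a) ⇒ b` executed by process `pid`, with a tag. -/
structure OpInst (n : ℕ) (M A B : Type u) (T : Type) : Type u where
  pid : Fin n
  m : M
  a : A
  b : B
  tag : T

section Linearization

variable {n : ℕ} {M A B : Type u} {T : Type}

/-- The sequential history of a sequence of operations. -/
def seqHistory (l : List (OpInst n M A B T)) : History n M A B T :=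
  l.flatMap fun o => [Act.call o.pid o.m o.a o.tag, Act.ret o.pid o.m o.b o.tag]

/-- The operation sequence `l` is a linearization of `h` w.r.t. `S`. Here `h ++ r` is the extension
of `h` by the return actions in `r`. (Equivalence of its completion with a sequential history forces
every return action to match a call.) The order has to be preserved for all operations
of the linearization, that is, those which are complete in `h ++ r`. -/
def IsLinearization (S : SeqSpec M A B) (h : History n M A B T)
    (l : List (OpInst n M A B T)) : Prop :=
  (l.map fun o => (o.m, o.a, o.b)) ∈ S.traces ∧
  ∃ r : History n M A B T, (∀ x ∈ r, x.isRet = true) ∧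
    (∀ i, (History.complete (h ++ r)).proj i = (seqHistory l).proj i) ∧
    ∀ o₁ o₂ : Fin n × ℕ, o₂.2 < History.rets o₂.1 (h ++ r) →
      History.Before h o₁ o₂ → History.Before (seqHistory l) o₁ o₂

end Linearization

/-! ## Labelled transition systems of `n` processes, forward simulation -/

/-- Transition labels: calls, returns, and internal actions of a process. -/
inductive Label (n : ℕ) (M A B : Type u) : Type u
  | call (i : Fin n) (m : M) (a : A)
  | ret (i : Fin n) (m : M) (b : B)
  | tau (i : Fin n)

namespace Label

variable {n : ℕ} {M A B : Type u}

/-- The process of a label. -/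
def pid : Label n M A B → Fin n
  | call i _ _ => i
  | ret i _ _ => i
  | tau i => i

/-- `l` is a call action of process `i`. -/
def IsCallOf (l : Label n M A B) (i : Fin n) : Prop := ∃ m a, l = call i m a

/-- `l` is a return action of process `i`. -/
def IsRetOf (l : Label n M A B) (i : Fin n) : Prop := ∃ m b, l = ret i m b

/-- The visible part of a label. -/
def visible : Label n M A B → Option (Act n M A B Unit)
  | call i m a => some (Act.call i m a ())
  | ret i m b => some (Act.ret i m b ())
  | tau _ => none

end Label

/-- The projection of a finite trace into call and return actions. -/
def historyOf {n : ℕ} {M A B : Type u} (w : List (Label n M A B)) :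
    History n M A B Unit :=
  w.filterMap Label.visible

/-- Labelled transition systems over the actions of `n` processes. -/
structure LTS (n : ℕ) (M A B : Type u) : Type (u + 1) where
  State : Type u
  init : State
  step : State → Label n M A B → State → Prop

namespace LTS

variable {n : ℕ} {M A B : Type u}

/-- `L.Exec q w q'`: there is a finite path from `q` to `q'` labelled `w`. -/
inductive Exec (L : LTS n M A B) : L.State → List (Label n M A B) → L.State → Prop
  | nil (q : L.State) : Exec L q [] q
  | cons {q q' q'' : L.State} {α : Label n M A B} {w : List (Label n M A B)} :
      L.step q α q' → Exec L q' w q'' → Exec L q (α :: w) q''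

/-- `t` is an infinite trace of `L`. -/
def IsInfTrace (L : LTS n M A B) (t : ℕ → Label n M A B) : Prop :=
  ∃ q : ℕ → L.State, q 0 = L.init ∧ ∀ k, L.step (q k) (t k) (q (k + 1))

/-- Forward simulation where exactly the call and return actions are visible. -/
def Sim (L₁ L₂ : LTS n M A B) : Prop :=
  ∃ R : L₁.State → L₂.State → Prop, R L₁.init L₂.init ∧
    ∀ c₁ c₂ α c₁', R c₁ c₂ → L₁.step c₁ α c₁' →
      ∃ w c₂', L₂.Exec c₂ w c₂' ∧ historyOf w = historyOf [α] ∧ R c₁' c₂'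

/-- The history of every finite trace is linearizable w.r.t. `S`. -/
def Linearizable (S : SeqSpec M A B) (L : LTS n M A B) : Prop :=
  ∀ w q, L.Exec L.init w q → ∃ l, IsLinearization S (historyOf w) l

end LTS

/-! ## Liveness -/

section Liveness

variable {n : ℕ} {M A B : Type u}

/-- Process `i` has a call in `t` that is never matched by a return. -/
def Unanswered (t : ℕ → Label n M A B) (i : Fin n) : Prop :=
  ∃ k, (t k).IsCallOf i ∧ ∀ j, k < j → ¬ (t j).IsRetOf i

/-- Process `i` has a pending call in the finite prefix `t 0, …, t k`. -/
def PendingAt (t : ℕ → Label n M A B) (k : ℕ) (i : Fin n) : Prop :=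
  ∃ k₀ ≤ k, (t k₀).IsCallOf i ∧ ∀ j, k₀ < j → j ≤ k → ¬ (t j).IsRetOf i

/-- Every call returns. -/
def ProgT (t : ℕ → Label n M A B) : Prop :=
  ∀ k i, PendingAt t k i → ∃ j, k < j ∧ (t j).IsRetOf i

/-- Whenever some call is pending, some return follows. -/
def ProgS (t : ℕ → Label n M A B) : Prop :=
  ∀ k, (∃ i, PendingAt t k i) → ∃ j, k < j ∧ ∃ i, (t j).IsRetOf i

/-- If there are calls that never return, then the process of at least one such call is scheduled
infinitely often. -/
def Sched (t : ℕ → Label n M A B) : Prop :=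
  (∃ i, Unanswered t i) → ∃ i, Unanswered t i ∧ ∀ N, ∃ j, N ≤ j ∧ (t j).pid = i

/-- From some moment on only one process is scheduled. -/
def Iso (t : ℕ → Label n M A B) : Prop :=
  ∃ i N, ∀ j, N ≤ j → (t j).pid = i

/-- The three liveness properties: wait-freedom, lock-freedom, obstruction-freedom. -/
inductive Liveness
  | WF
  | LF
  | OF

/-- Satisfaction of a liveness property by an infinite trace. -/
def Liveness.HoldsOn : Liveness → (ℕ → Label n M A B) → Prop
  | .WF, t => Sched t → ProgT t
  | .LF, t => Sched t → ProgS t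
  | .OF, t => Sched t → Iso t → ProgT t

/-- Every infinite trace of `L` satisfies the liveness property. -/
def LTS.Satisfies (L : LTS n M A B) (P : Liveness) : Prop :=
  ∀ t, L.IsInfTrace t → P.HoldsOn t

end Liveness

/-! ## Concurrent objects and their operational semantics -/

/-- A concurrent object accessed by `n` processes. `Mem` is the set of contents of the shared memory
and `Loc` the set of local states (program counter and local variables) that a process may be in
while it executes a method. `start m a` is the local state in which the code of `m` with argument `a`
begins. A local state is either at a return command (`ret l = some b`), or at a command that may be
executed atomically, possibly nondeterministically, according to `step`; as usual for program code,
some outcome of that command always exists. -/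
structure ConcObject (n : ℕ) (M A B : Type u) : Type (u + 1) where
  Mem : Type u
  Loc : Type u
  mem₀ : Mem
  start : M → A → Loc
  ret : Loc → Option B
  step : Fin n → Mem → Loc → Mem → Loc → Prop
  step_total : ∀ i s l, ret l = none → ∃ s' l', step i s l s' l'

namespace ConcObject

variable {n : ℕ} {M A B : Type u}

/-- Configurations: the shared memory, and for each process either `none` (between two operations)
or the method being executed with the current local state. -/
structure Config (O : ConcObject n M A B) : Type u where
  mem : O.Mem
  proc : Fin n → Option (M × O.Loc)

/-- Transitions of `n` processes, each running a most general client of the object. -/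
inductive Step (O : ConcObject n M A B) : O.Config → Label n M A B → O.Config → Prop
  | call (c : O.Config) (i : Fin n) (m : M) (a : A) : c.proc i = none →
      Step O c (Label.call i m a) ⟨c.mem, Function.update c.proc i (some (m, O.start m a))⟩
  | tau (c : O.Config) (i : Fin n) (m : M) (l l' : O.Loc) (s' : O.Mem) :
      c.proc i = some (m, l) → O.ret l = none → O.step i c.mem l s' l' →
      Step O c (Label.tau i) ⟨s', Function.update c.proc i (some (m, l'))⟩
  | ret (c : O.Config) (i : Fin n) (m : M) (l : O.Loc) (b : B) :
      c.proc i = some (m, l) → O.ret l = some b →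
      Step O c (Label.ret i m b) ⟨c.mem, Function.update c.proc i none⟩

/-- The operational semantics `⟦O, n⟧`. -/
def sem (O : ConcObject n M A B) : LTS n M A B where
  State := O.Config
  init := ⟨O.mem₀, fun _ => none⟩
  step := O.Step

end ConcObject

/-- The command semantics `r`, where a command without an outcome (such as a null dereference)
makes its process spin forever. -/
def orSpin {Mem Loc : Type u} (r : Mem → Loc → Mem → Loc → Prop) (s : Mem) (l : Loc)
    (s' : Mem) (l' : Loc) : Prop :=
  r s l s' l' ∨ ((¬ ∃ s₁ l₁, r s l s₁ l₁) ∧ s' = s ∧ l' = l)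

theorem orSpin_total {Mem Loc : Type u} (r : Mem → Loc → Mem → Loc → Prop) (s : Mem) (l : Loc) :
    ∃ s' l', orSpin r s l s' l' := by
  by_cases h : ∃ s₁ l₁, r s l s₁ l₁
  · obtain ⟨s₁, l₁, h₁⟩ := h
    exact ⟨s₁, l₁, Or.inl h₁⟩
  · exact ⟨s, l, Or.inr ⟨h, rfl, rfl⟩⟩

/-! ## The linked list shared by the universal constructions -/

/-- A node of the linked list. Pointers to nodes are natural numbers. `decideNext` is the state of
a consensus object: `none` as long as nothing has been decided. The sequence number is `0` until
the node has been inserted into the list. -/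
structure Node (D : Type u) : Type u where
  data : D
  decideNext : Option ℕ
  seq : ℕ
  next : Option ℕ

/-- A new node. -/
def Node.fresh {D : Type u} (d : D) : Node D := ⟨d, none, 0, none⟩

/-- The heap, the pointer to the next free node, and the arrays `announce` and `head`. -/
structure ListMem (n : ℕ) (D : Type u) : Type u where
  heap : ℕ → Node D
  alloc : ℕ
  announce : Fin n → ℕ
  head : Fin n → ℕ

namespace ListMem

variable {n : ℕ} {D : Type u}

/-- Initially the list consists of the sentinel node `tail`, stored at `0` and with sequence number
`1`, and all entries of both arrays point to it. -/
def init (n : ℕ) (d : D) : ListMem n D where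
  heap := fun p => if p = 0 then ⟨d, none, 1, none⟩ else Node.fresh d
  alloc := 1
  announce := fun _ => 0
  head := fun _ => 0

/-- Modify the node at `p`. -/
def modify (s : ListMem n D) (p : ℕ) (f : Node D → Node D) : ListMem n D :=
  { s with heap := Function.update s.heap p (f (s.heap p)) }

/-- `announce[i] := new Node(d)`. -/
def announceNew (s : ListMem n D) (i : Fin n) (d : D) : ListMem n D :=
  { s with
    heap := Function.update s.heap s.alloc (Node.fresh d)
    alloc := s.alloc + 1
    announce := Function.update s.announce i s.alloc }

/-- `head[i] := p`. -/
def setHead (s : ListMem n D) (i : Fin n) (p : ℕ) : ListMem n D :=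
  { s with head := Function.update s.head i p }

/-- One of the nodes `p`, `q` with maximal sequence number, `p` in case of a tie. -/
def maxNode (s : ListMem n D) (p q : ℕ) : ℕ :=
  if (s.heap p).seq < (s.heap q).seq then q else p

/-- The entry `announce[(before.seq + 1) % n]`, read by process `i`. -/
def helpOf (s : ListMem n D) (i : Fin n) (before : ℕ) : ℕ :=
  s.announce ⟨((s.heap before).seq + 1) % n, Nat.mod_lt _ i.pos⟩

/-- `q` is the successor of `p` in the list. -/
def Next (s : ListMem n D) (p q : ℕ) : Prop := (s.heap p).next = some q

/-- `p` is a node of the list other than the sentinel. -/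
def InList (s : ListMem n D) (p : ℕ) : Prop := Relation.TransGen s.Next 0 p

end ListMem

/-! ## Herlihy's wait-free universal construction `𝒜`

```
    announce[i] := new Node(m, a)
    head[i] := Node.max(head)
    while announce[i].seq == 0
      before := head[i]
      help := announce[(before.seq + 1) % n]
      if help.seq == 0 then prefer := help else prefer := announce[i]
      after := before.decideNext.decide(prefer)
      before.next := after
      after.seq := before.seq + 1
      head[i] := after
    replay the list on a private copy of the sequential object, from tail.next up to announce[i]
    head[i] := announce[i]
    return the response to the last invocation replayed
``` -/

section ASpec

variable {n : ℕ} {M A B : Type u}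

/-- Nodes of `𝒜` store an invocation (none for the sentinel). -/
abbrev AMem (n : ℕ) (M A : Type u) : Type u := ListMem n (Option (M × A))

/-- Local states of `𝒜`; `Q` is the state space of the private copy of the sequential object. -/
inductive ALoc (M A B Q : Type u) : Type u
  | announce (m : M) (a : A)
  | scan (j : ℕ) (cur : ℕ)
  | test
  | before
  | help (bef : ℕ)
  | prefer (bef hlp : ℕ)
  | decide (bef prf : ℕ)
  | link (bef aft : ℕ)
  | setSeq (bef aft : ℕ)
  | setHead (aft : ℕ)
  | startReplay
  | replay (cur : ℕ) (q : Q)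
  | setHeadOwn (cur : ℕ) (q : Q)
  | respond (cur : ℕ) (q : Q)
  | done (b : B)

/-- The commands of `𝒜`, executed by process `i`. -/
inductive AStep (S : SeqSpec M A B) (i : Fin n) :
    AMem n M A → ALoc M A B S.State → AMem n M A → ALoc M A B S.State → Prop
  | announce (s : AMem n M A) (m : M) (a : A) :
      AStep S i s (.announce m a) (s.announceNew i (some (m, a))) (.scan 0 0)
  /- `Node.max(head)` reads the array entry by entry, starting from the sentinel as maximum -/
  | scan (s : AMem n M A) (j cur : ℕ) (hj : j < n) :
      AStep S i s (.scan j cur) s (.scan (j + 1) (s.maxNode cur (s.head ⟨j, hj⟩)))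
  | scanEnd (s : AMem n M A) (j cur : ℕ) (hj : n ≤ j) :
      AStep S i s (.scan j cur) (s.setHead i cur) .test
  | testLoop (s : AMem n M A) (h : (s.heap (s.announce i)).seq = 0) :
      AStep S i s .test s .before
  | testExit (s : AMem n M A) (h : (s.heap (s.announce i)).seq ≠ 0) :
      AStep S i s .test s .startReplay
  | before (s : AMem n M A) :
      AStep S i s .before s (.help (s.head i))
  | help (s : AMem n M A) (bef : ℕ) :
      AStep S i s (.help bef) s (.prefer bef (s.helpOf i bef))
  | preferHelp (s : AMem n M A) (bef hlp : ℕ) (h : (s.heap hlp).seq = 0) :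
      AStep S i s (.prefer bef hlp) s (.decide bef hlp)
  | preferOwn (s : AMem n M A) (bef hlp : ℕ) (h : (s.heap hlp).seq ≠ 0) :
      AStep S i s (.prefer bef hlp) s (.decide bef (s.announce i))
  | decideFirst (s : AMem n M A) (bef prf : ℕ) (h : (s.heap bef).decideNext = none) :
      AStep S i s (.decide bef prf)
        (s.modify bef fun x => { x with decideNext := some prf }) (.link bef prf)
  | decideLater (s : AMem n M A) (bef prf aft : ℕ) (h : (s.heap bef).decideNext = some aft) :
      AStep S i s (.decide bef prf) s (.link bef aft)
  | link (s : AMem n M A) (bef aft : ℕ) :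
      AStep S i s (.link bef aft)
        (s.modify bef fun x => { x with next := some aft }) (.setSeq bef aft)
  | setSeq (s : AMem n M A) (bef aft : ℕ) :
      AStep S i s (.setSeq bef aft)
        (s.modify aft fun x => { x with seq := (s.heap bef).seq + 1 }) (.setHead aft)
  | setHead (s : AMem n M A) (aft : ℕ) :
      AStep S i s (.setHead aft) (s.setHead i aft) .test
  | startReplay (s : AMem n M A) (cur : ℕ) (h : (s.heap 0).next = some cur) :
      AStep S i s .startReplay s (.replay cur S.init)
  | replay (s : AMem n M A) (cur nxt : ℕ) (q q' : S.State) (m : M) (a : A) (b : B)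
      (hne : cur ≠ s.announce i) (hd : (s.heap cur).data = some (m, a)) (hq : S.step q m a b q')
      (hn : (s.heap cur).next = some nxt) :
      AStep S i s (.replay cur q) s (.replay nxt q')
  | replayEnd (s : AMem n M A) (cur : ℕ) (q : S.State) (h : cur = s.announce i) :
      AStep S i s (.replay cur q) s (.setHeadOwn cur q)
  | setHeadOwn (s : AMem n M A) (cur : ℕ) (q : S.State) :
      AStep S i s (.setHeadOwn cur q) (s.setHead i (s.announce i)) (.respond cur q)
  | respond (s : AMem n M A) (cur : ℕ) (q q' : S.State) (m : M) (a : A) (b : B)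
      (hd : (s.heap cur).data = some (m, a)) (hq : S.step q m a b q') :
      AStep S i s (.respond cur q) s (.done b)

/-- Herlihy's universal construction for `S` and `n` processes. -/
def ASpec (n : ℕ) (S : SeqSpec M A B) : ConcObject n M A B where
  Mem := AMem n M A
  Loc := ALoc M A B S.State
  mem₀ := ListMem.init n none
  start := ALoc.announce
  ret := fun
    | .done b => some b
    | _ => none
  step := fun i => orSpin (AStep S i)
  step_total := fun i s l _ => orSpin_total (AStep S i) s l

end ASpec

/-! ## The universal object `𝒰`

```
    oid := idGen.genID()
    his.storeCall(m, a, i, oid)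
    announce[i] := new Node(m, a, oid)
    head[i] := Node.max(head)
    while announce[i].seq == 0
      before := head[i]
      help := announce[(before.seq + 1) % n]
      if help.seq == 0 then prefer := help else prefer := announce[i]
      after := before.decideNext.decide(prefer)
      h := his.read()
      cas(after.hist, null, h)
      l := genLin()
      cas(after.lin, null, l)
      before.next := after
      after.seq := before.seq + 1
      head[i] := after
    head[i] := announce[i]
    b := getRetValue(oid)
    his.storeReturn(m, b, i, oid)
    return b
``` -/

section USpec

variable {n : ℕ} {M A B : Type u}

/-- Histories whose actions carry operation identities. -/
abbrev IdHistory (n : ℕ) (M A B : Type u) : Type u := History n M A B ℕ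

/-- Operations with process and operation identity. -/
abbrev IdOp (n : ℕ) (M A B : Type u) : Type u := OpInst n M A B ℕ

/-- The contents of a node of `𝒰`: the identity, method and argument of its operation (none for the
sentinel), a history, and a linearization; `none` represents `null`. -/
structure UData (n : ℕ) (M A B : Type u) : Type u where
  op : Option (ℕ × M × A)
  hist : Option (IdHistory n M A B)
  lin : Option (List (IdOp n M A B))

/-- The shared memory of `𝒰`: the linked list, the content of the history recorder, and the
state of the identity generator. -/
structure UMem (n : ℕ) (M A B : Type u) : Type u where
  list : ListMem n (UData n M A B)
  record : IdHistory n M A B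
  nextId : ℕ

/-- The operation with identity `oid` occurs in `l` with return value `b`. -/
def RetIn (l : List (IdOp n M A B)) (oid : ℕ) (b : B) : Prop :=
  ∃ o ∈ l, o.tag = oid ∧ o.b = b

/-- The operation with identity `oid` is the one of node `p`. -/
def UMem.HasOp (s : UMem n M A B) (p : ℕ) (oid : ℕ) : Prop :=
  ∃ m a, (s.list.heap p).data.op = some (oid, m, a)

/-- `oid` has return value `b` in the `lin`-field of node `p`. -/
def UMem.NodeRet (s : UMem n M A B) (p : ℕ) (oid : ℕ) (b : B) : Prop :=
  ∃ l, (s.list.heap p).data.lin = some l ∧ RetIn l oid b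

/-- The possible results `l` of `genLin()`, called when `aft` is to be inserted behind `bef`:
`l` is a linearization of the history stored in `aft`, it contains the operation of `aft`, and
for every node of the list (from `tail` to `bef`) it contains the operation of that node,
with the same return value as in the `lin`-field of that node. -/
def UMem.GenLin (S : SeqSpec M A B) (s : UMem n M A B) (bef aft : ℕ)
    (l : List (IdOp n M A B)) : Prop :=
  (∃ h, (s.list.heap aft).data.hist = some h ∧ IsLinearization S h l) ∧
  (∃ oid b, s.HasOp aft oid ∧ RetIn l oid b) ∧
  ∀ p, s.list.InList p → Relation.ReflTransGen s.list.Next p bef →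
    ∃ oid b, s.HasOp p oid ∧ s.NodeRet p oid b ∧ RetIn l oid b

/-- Update the linked list. -/
def UMem.withList (s : UMem n M A B) (x : ListMem n (UData n M A B)) : UMem n M A B :=
  { s with list := x }

/-- `cas(p.hist, null, h)`. -/
def UMem.casHist (s : UMem n M A B) (p : ℕ) (h : IdHistory n M A B) : UMem n M A B :=
  s.withList (s.list.modify p fun x =>
    { x with data := { x.data with hist := some (x.data.hist.getD h) } })

/-- `cas(p.lin, null, l)`. -/
def UMem.casLin (s : UMem n M A B) (p : ℕ) (l : List (IdOp n M A B)) : UMem n M A B :=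
  s.withList (s.list.modify p fun x =>
    { x with data := { x.data with lin := some (x.data.lin.getD l) } })

/-- Program counters of `𝒰`, with the local variables in use. -/
inductive UPc (n : ℕ) (M A B : Type u) : Type u
  | storeCall
  | announce
  | scan (j : ℕ) (cur : ℕ)
  | test
  | before
  | help (bef : ℕ)
  | prefer (bef hlp : ℕ)
  | decide (bef prf : ℕ)
  | readHist (bef aft : ℕ)
  | casHist (bef aft : ℕ) (h : IdHistory n M A B)
  | genLin (bef aft : ℕ)
  | casLin (bef aft : ℕ) (l : List (IdOp n M A B))
  | link (bef aft : ℕ)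
  | setSeq (bef aft : ℕ)
  | setHead (aft : ℕ)
  | setHeadOwn
  | getRet
  | storeRet (b : B)
  | done (b : B)

/-- Local states of `𝒰`: at the generation of the operation identity, or at a later program counter
with the method, the argument and the operation identity. -/
inductive ULoc (n : ℕ) (M A B : Type u) : Type u
  | genId (m : M) (a : A)
  | run (m : M) (a : A) (oid : ℕ) (pc : UPc n M A B)

/-- The commands of the operation `m(a)` of `𝒰` with identity `oid`, executed by process `i`. -/
inductive UPcStep (S : SeqSpec M A B) (i : Fin n) (m : M) (a : A) (oid : ℕ) :
    UMem n M A B → UPc n M A B → UMem n M A B → UPc n M A B → Prop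
  | storeCall (s : UMem n M A B) :
      UPcStep S i m a oid s .storeCall { s with record := s.record ++ [Act.call i m a oid] } .announce
  | announce (s : UMem n M A B) :
      UPcStep S i m a oid s .announce
        (s.withList (s.list.announceNew i ⟨some (oid, m, a), none, none⟩)) (.scan 0 0)
  /- `Node.max(head)` reads the array entry by entry, starting from the sentinel as maximum -/
  | scan (s : UMem n M A B) (j cur : ℕ) (hj : j < n) :
      UPcStep S i m a oid s (.scan j cur) s
        (.scan (j + 1) (s.list.maxNode cur (s.list.head ⟨j, hj⟩)))
  | scanEnd (s : UMem n M A B) (j cur : ℕ) (hj : n ≤ j) :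
      UPcStep S i m a oid s (.scan j cur) (s.withList (s.list.setHead i cur)) .test
  | testLoop (s : UMem n M A B) (h : (s.list.heap (s.list.announce i)).seq = 0) :
      UPcStep S i m a oid s .test s .before
  | testExit (s : UMem n M A B) (h : (s.list.heap (s.list.announce i)).seq ≠ 0) :
      UPcStep S i m a oid s .test s .setHeadOwn
  | before (s : UMem n M A B) :
      UPcStep S i m a oid s .before s (.help (s.list.head i))
  | help (s : UMem n M A B) (bef : ℕ) :
      UPcStep S i m a oid s (.help bef) s (.prefer bef (s.list.helpOf i bef))
  | preferHelp (s : UMem n M A B) (bef hlp : ℕ) (h : (s.list.heap hlp).seq = 0) :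
      UPcStep S i m a oid s (.prefer bef hlp) s (.decide bef hlp)
  | preferOwn (s : UMem n M A B) (bef hlp : ℕ) (h : (s.list.heap hlp).seq ≠ 0) :
      UPcStep S i m a oid s (.prefer bef hlp) s (.decide bef (s.list.announce i))
  | decideFirst (s : UMem n M A B) (bef prf : ℕ) (h : (s.list.heap bef).decideNext = none) :
      UPcStep S i m a oid s (.decide bef prf)
        (s.withList (s.list.modify bef fun x => { x with decideNext := some prf }))
        (.readHist bef prf)
  | decideLater (s : UMem n M A B) (bef prf aft : ℕ)
      (h : (s.list.heap bef).decideNext = some aft) :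
      UPcStep S i m a oid s (.decide bef prf) s (.readHist bef aft)
  | readHist (s : UMem n M A B) (bef aft : ℕ) :
      UPcStep S i m a oid s (.readHist bef aft) s (.casHist bef aft s.record)
  | casHist (s : UMem n M A B) (bef aft : ℕ) (h : IdHistory n M A B) :
      UPcStep S i m a oid s (.casHist bef aft h) (s.casHist aft h) (.genLin bef aft)
  | genLin (s : UMem n M A B) (bef aft : ℕ) (l : List (IdOp n M A B))
      (hl : s.GenLin S bef aft l) :
      UPcStep S i m a oid s (.genLin bef aft) s (.casLin bef aft l)
  | casLin (s : UMem n M A B) (bef aft : ℕ) (l : List (IdOp n M A B)) :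
      UPcStep S i m a oid s (.casLin bef aft l) (s.casLin aft l) (.link bef aft)
  | link (s : UMem n M A B) (bef aft : ℕ) :
      UPcStep S i m a oid s (.link bef aft)
        (s.withList (s.list.modify bef fun x => { x with next := some aft })) (.setSeq bef aft)
  | setSeq (s : UMem n M A B) (bef aft : ℕ) :
      UPcStep S i m a oid s (.setSeq bef aft)
        (s.withList (s.list.modify aft fun x => { x with seq := (s.list.heap bef).seq + 1 }))
        (.setHead aft)
  | setHead (s : UMem n M A B) (aft : ℕ) :
      UPcStep S i m a oid s (.setHead aft) (s.withList (s.list.setHead i aft)) .test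
  | setHeadOwn (s : UMem n M A B) :
      UPcStep S i m a oid s .setHeadOwn
        (s.withList (s.list.setHead i (s.list.announce i))) .getRet
  | getRet (s : UMem n M A B) (p : ℕ) (b : B) (hp : s.list.InList p) (ho : s.HasOp p oid)
      (hb : s.NodeRet p oid b) :
      UPcStep S i m a oid s .getRet s (.storeRet b)
  | storeRet (s : UMem n M A B) (b : B) :
      UPcStep S i m a oid s (.storeRet b) { s with record := s.record ++ [Act.ret i m b oid] } (.done b)

/-- The commands of `𝒰`, executed by process `i`. -/
inductive UStep (S : SeqSpec M A B) (i : Fin n) :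
    UMem n M A B → ULoc n M A B → UMem n M A B → ULoc n M A B → Prop
  | genId (s : UMem n M A B) (m : M) (a : A) :
      UStep S i s (.genId m a) { s with nextId := s.nextId + 1 } (.run m a s.nextId .storeCall)
  | run (s s' : UMem n M A B) (m : M) (a : A) (oid : ℕ) (pc pc' : UPc n M A B) :
      UPcStep S i m a oid s pc s' pc' → UStep S i s (.run m a oid pc) s' (.run m a oid pc')

/-- The universal object for `S` and `n` processes. A call of `apply` with argument `(m, a)` is
regarded as a call of the method `m` with argument `a`. -/
def USpec (n : ℕ) (S : SeqSpec M A B) : ConcObject n M A B where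
  Mem := UMem n M A B
  Loc := ULoc n M A B
  mem₀ := { list := ListMem.init n ⟨none, none, none⟩, record := [], nextId := 0 }
  start := ULoc.genId
  ret := fun
    | .run _ _ _ (.done b) => some b
    | _ => none
  step := fun i => orSpin (UStep S i)
  step_total := fun i s l _ => orSpin_total (UStep S i) s l

end USpec

/-! ## Classes of mutually simulating objects and their order -/

section Classes

variable {n : ℕ} {M A B : Type u}

/-- The object is linearizable w.r.t. `S` and satisfies `P` for `n` processes. -/
def ConcObject.Admissible (S : SeqSpec M A B) (P : Liveness) (O : ConcObject n M A B) : Prop :=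
  O.sem.Linearizable S ∧ O.sem.Satisfies P

/-- `K` is a `P`-class for `S`: a nonempty set of operational semantics of admissible objects that
pairwise simulate each other, closed under mutual simulation with admissible objects. -/
structure IsClass (S : SeqSpec M A B) (P : Liveness) (K : Set (LTS n M A B)) : Prop where
  nonempty : K.Nonempty
  mem_sem : ∀ L ∈ K, ∃ O : ConcObject n M A B, O.Admissible S P ∧ L = O.sem
  sim : ∀ L₁ ∈ K, ∀ L₂ ∈ K, L₁.Sim L₂ ∧ L₂.Sim L₁
  closed : ∀ O : ConcObject n M A B, O.Admissible S P →
    ∀ L ∈ K, O.sem.Sim L → L.Sim O.sem → O.sem ∈ K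

/-- The set of `P`-classes for `S` and `n` processes. -/
def ClassSet (n : ℕ) (S : SeqSpec M A B) (P : Liveness) : Type (u + 1) :=
  {K : Set (LTS n M A B) // IsClass S P K}

/-- The underlying set of LTSs of a class. -/
def ClassSet.carrier {S : SeqSpec M A B} {P : Liveness} (K : ClassSet n S P) :
    Set (LTS n M A B) := K.1

/-- The lifted simulation relation. -/
instance (S : SeqSpec M A B) (P : Liveness) : LE (ClassSet n S P) where
  le K₁ K₂ := ∃ L₁ ∈ K₁.carrier, ∃ L₂ ∈ K₂.carrier, L₁.Sim L₂

end Classes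

end ConcLat

open ConcLat

namespace ConcLat

/-! ### Simulation and the partial order of classes -/

namespace LTS

variable {n : ℕ} {M A B : Type u}

/-! The order-theoretic part is formal. Simulations compose along whole paths (`exec_of_rel`). Since
the members of a class simulate each other, the order does not depend on representatives
(`sim_of_le`), and closure of classes under mutual simulation gives antisymmetry. The substance lies
in four constructions.

Join. `joinObject` lets the first command executed choose, once and for all, which of two objects is
run. Up to entering steps, a trace of the join is a trace of one component; this yields
linearizability and liveness. If `O₃` simulates both components, it simulates the join, although it
does not know the coming choice: before the choice only calls have occurred, and calls can be moved
in front of internal steps (`calls_first`), so `O₃` may postpone its internal steps until the choice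
is known.

Minimum. Everything goes through an atomic object that executes each operation in one internal step.
It simulates `𝒜` (`aSpec_sim_atomic`): the first decision behind a node of the list executes the
operation decided upon. Conversely, every admissible object simulates the atomic one
(`atomicLTS_sim`). Each of the liveness properties forces a process that runs alone to return
(`solo_terminates`), so the object can run an operation in one go when the atomic object executes
it. The value is the right one because the same memory is reached by a sequential run, a sequential
history has only one linearization, and the specification is deterministic.

Maximum. `𝒰` simulates every linearizable `O` (`sim_uSpec`) by delaying its choices. It records
calls at once and waits at the announcements while `O` computes. When `O` returns a value, the
history with this return has a linearization; the process of `𝒰` then runs alone to its end and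
picks this linearization in `genLin()`. That is permitted, since all older nodes belong to
operations that have returned, and their values occur in every linearization of the record.

Admissibility of `𝒜` and `𝒰`. Both maintain the same list (`ListInv`), and helping (`Helped`) puts a
node announced at list length `K` into the list at position `K + n + 1` at the latest. A
well-founded rank then shows that no process starves, which gives all three liveness properties
(`holdsOn_iff`). For linearizability of `𝒰`, the linearization stored in the last completed node
remains one of the whole record (`exists_lin_record`), and the record preserves the real-time order
of the actual history. -/

theorem Exec.append {L : LTS n M A B} {q q' q'' : L.State} {v w : List (Label n M A B)}
    (h₁ : L.Exec q v q') (h₂ : L.Exec q' w q'') : L.Exec q (v ++ w) q'' := by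
  induction h₁ with
  | nil => exact h₂
  | cons hs _ ih => exact .cons hs (ih h₂)

theorem Exec.single {L : LTS n M A B} {q q' : L.State} {α : Label n M A B}
    (h : L.step q α q') : L.Exec q [α] q' := .cons h (.nil _)

/-- `Exec` grows at its front, whereas invariants of reachable states are pushed through the latest
step. The generalised claim splits a path into a part already treated and a rest. -/
theorem Exec.snoc_induction {L : LTS n M A B} {q₀ : L.State}
    {p : List (Label n M A B) → L.State → Prop} (nil : p [] q₀)
    (snoc : ∀ w q α q', L.Exec q₀ w q → p w q → L.step q α q' → p (w ++ [α]) q')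
    {w : List (Label n M A B)} {q : L.State} (h : L.Exec q₀ w q) : p w q := by
  suffices key : ∀ q₁ w₂ q₂, L.Exec q₁ w₂ q₂ → ∀ w₁, L.Exec q₀ w₁ q₁ → p w₁ q₁ →
      p (w₁ ++ w₂) q₂ from key _ _ _ h [] (.nil _) nil
  intro q₁ w₂ q₂ h
  induction h with
  | nil => intro w₁ _ hp; simpa using hp
  | @cons a b c α w hs _ ih =>
    intro w₁ hw hp
    have := ih (w₁ ++ [α]) (hw.append (.single hs)) (snoc _ _ _ _ hw hp hs)
    simpa using this

end LTS

variable {n : ℕ} {M A B : Type u}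

theorem historyOf_append (v w : List (Label n M A B)) :
    historyOf (v ++ w) = historyOf v ++ historyOf w := List.filterMap_append

theorem historyOf_cons (α : Label n M A B) (w : List (Label n M A B)) :
    historyOf (α :: w) = historyOf [α] ++ historyOf w := historyOf_append [α] w

@[simp] theorem historyOf_call (i : Fin n) (m : M) (a : A) :
    historyOf [(Label.call i m a : Label n M A B)] = [Act.call i m a ()] := rfl

@[simp] theorem historyOf_ret (i : Fin n) (m : M) (b : B) :
    historyOf [(Label.ret i m b : Label n M A B)] = [Act.ret i m b ()] := rfl

@[simp] theorem historyOf_tau (i : Fin n) :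
    historyOf [(Label.tau i : Label n M A B)] = [] := rfl

namespace LTS

theorem Sim.refl (L : LTS n M A B) : L.Sim L := by
  refine ⟨Eq, rfl, ?_⟩
  rintro c _ α c' rfl h
  exact ⟨[α], c', .single h, rfl, rfl⟩

/-- Matching paths are concatenated step by step. Apart from transitivity this shows that along a
simulation every history of `L₁` is a history of `L₂`. -/
theorem exec_of_rel {L₁ L₂ : LTS n M A B} {R : L₁.State → L₂.State → Prop}
    (hR : ∀ c₁ c₂ α c₁', R c₁ c₂ → L₁.step c₁ α c₁' →
      ∃ w c₂', L₂.Exec c₂ w c₂' ∧ historyOf w = historyOf [α] ∧ R c₁' c₂')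
    {c₁ c₁' : L₁.State} {w : List (Label n M A B)} (hw : L₁.Exec c₁ w c₁') :
    ∀ c₂, R c₁ c₂ → ∃ v c₂', L₂.Exec c₂ v c₂' ∧ historyOf v = historyOf w ∧ R c₁' c₂' := by
  induction hw with
  | nil => intro c₂ h; exact ⟨[], c₂, .nil _, rfl, h⟩
  | cons hs _ ih =>
    intro c₂ h
    obtain ⟨v₁, d, hv₁, hh₁, hd⟩ := hR _ _ _ _ h hs
    obtain ⟨v₂, e, hv₂, hh₂, he⟩ := ih d hd
    refine ⟨v₁ ++ v₂, e, hv₁.append hv₂, ?_, he⟩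
    rw [historyOf_append, hh₁, hh₂, ← historyOf_cons]

theorem Sim.trans {L₁ L₂ L₃ : LTS n M A B} (h₁ : L₁.Sim L₂) (h₂ : L₂.Sim L₃) : L₁.Sim L₃ := by
  obtain ⟨R, hR₀, hR⟩ := h₁
  obtain ⟨Q, hQ₀, hQ⟩ := h₂
  refine ⟨fun a c => ∃ b, R a b ∧ Q b c, ⟨_, hR₀, hQ₀⟩, ?_⟩
  rintro a c α a' ⟨b, hab, hbc⟩ hs
  obtain ⟨w, b', hw, hh, hab'⟩ := hR _ _ _ _ hab hs
  obtain ⟨v, c', hv, hh', hbc'⟩ := exec_of_rel hQ hw c hbc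
  exact ⟨v, c', hv, hh'.trans hh, b', hab', hbc'⟩

/-- Linearizability depends on the set of histories only. There is no such transfer for liveness,
because a step may be matched by an empty path. -/
theorem Sim.linearizable {S : SeqSpec M A B} {L₁ L₂ : LTS n M A B} (h : L₁.Sim L₂)
    (hL : L₂.Linearizable S) : L₁.Linearizable S := by
  obtain ⟨R, hR₀, hR⟩ := h
  intro w q hw
  obtain ⟨v, d, hv, hh, -⟩ := exec_of_rel hR hw _ hR₀
  rw [← hh]
  exact hL _ _ hv

end LTS

variable {S : SeqSpec M A B} {P : Liveness}

/-- The class of an admissible object. -/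
def classOf (O : ConcObject n M A B) (hO : O.Admissible S P) : ClassSet n S P :=
  ⟨{L | ∃ O' : ConcObject n M A B, O'.Admissible S P ∧ L = O'.sem ∧ L.Sim O.sem ∧ O.sem.Sim L},
    { nonempty := ⟨O.sem, O, hO, rfl, .refl _, .refl _⟩
      mem_sem := fun _ ⟨O', h, e, _⟩ => ⟨O', h, e⟩
      sim := fun _ ⟨_, _, _, h₁, h₁'⟩ _ ⟨_, _, _, h₂, h₂'⟩ => ⟨h₁.trans h₂', h₂.trans h₁'⟩
      closed := fun O' hO' _ ⟨_, _, _, h₁, h₂⟩ h h' =>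
        ⟨O', hO', rfl, h.trans h₁, h₂.trans h'⟩ }⟩

theorem mem_classOf (O : ConcObject n M A B) (hO : O.Admissible S P) :
    O.sem ∈ (classOf O hO).carrier := ⟨O, hO, rfl, .refl _, .refl _⟩

namespace ClassSet

/-- The order asks for one pair of representatives; as the members of a class simulate each other,
any other pair is as good. -/
theorem sim_of_le {K₁ K₂ : ClassSet n S P} (h : K₁ ≤ K₂) {L₁ L₂ : LTS n M A B}
    (h₁ : L₁ ∈ K₁.carrier) (h₂ : L₂ ∈ K₂.carrier) : L₁.Sim L₂ := by
  obtain ⟨L, hL, L', hL', hs⟩ := h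
  exact ((K₁.2.sim _ h₁ _ hL).1.trans hs).trans (K₂.2.sim _ hL' _ h₂).1

/-- Mutual simulation composes with that inside `K₁`, and closure of `K₂` then captures each member
of `K₁`. Hence the order is antisymmetric, and a class is determined by any one of its members. -/
theorem subset_of_sim {K₁ K₂ : ClassSet n S P} {L₁ L₂ : LTS n M A B} (h₁ : L₁ ∈ K₁.carrier)
    (h₂ : L₂ ∈ K₂.carrier) (h : L₁.Sim L₂) (h' : L₂.Sim L₁) : K₁.1 ⊆ K₂.1 := by
  intro L hL
  obtain ⟨O, hO, rfl⟩ := K₁.2.mem_sem L hL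
  have := K₁.2.sim _ hL _ h₁
  exact K₂.2.closed O hO L₂ h₂ (this.1.trans h) (h'.trans this.2)

theorem eq_of_sim {K₁ K₂ : ClassSet n S P} {L₁ L₂ : LTS n M A B} (h₁ : L₁ ∈ K₁.carrier)
    (h₂ : L₂ ∈ K₂.carrier) (h : L₁.Sim L₂) (h' : L₂.Sim L₁) : K₁ = K₂ :=
  Subtype.ext ((subset_of_sim h₁ h₂ h h').antisymm (subset_of_sim h₂ h₁ h' h))

theorem eq_of_mem {K₁ K₂ : ClassSet n S P} {L : LTS n M A B} (h₁ : L ∈ K₁.carrier)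
    (h₂ : L ∈ K₂.carrier) : K₁ = K₂ := eq_of_sim h₁ h₂ (.refl _) (.refl _)

theorem exists_object (K : ClassSet n S P) :
    ∃ O : ConcObject n M A B, O.Admissible S P ∧ O.sem ∈ K.carrier := by
  obtain ⟨L, hL⟩ := K.2.nonempty
  obtain ⟨O, hO, rfl⟩ := K.2.mem_sem L hL
  exact ⟨O, hO, hL⟩

theorem isPartialOrder : IsPartialOrder (ClassSet n S P) (fun K₁ K₂ => K₁ ≤ K₂) where
  refl K := by
    obtain ⟨O, _, h⟩ := K.exists_object
    exact ⟨_, h, _, h, .refl _⟩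
  trans K₁ K₂ K₃ h h' := by
    obtain ⟨L₁, h₁, L₂, h₂, hs⟩ := h
    obtain ⟨O, _, h₃⟩ := K₃.exists_object
    exact ⟨L₁, h₁, _, h₃, hs.trans (sim_of_le h' h₂ h₃)⟩
  antisymm K₁ K₂ h h' := by
    obtain ⟨O₁, _, h₁⟩ := K₁.exists_object
    obtain ⟨O₂, _, h₂⟩ := K₂.exists_object
    exact eq_of_sim h₁ h₂ (sim_of_le h h₁ h₂) (sim_of_le h' h₂ h₁)

end ClassSet

end ConcLat

namespace ConcLat

/-! ### Liveness as tolerance of starvation -/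

section Starvation

variable {n : ℕ} {M A B : Type u}

/-- Process `i` takes infinitely many steps, but one of its calls never returns. -/
def Starved (t : ℕ → Label n M A B) (i : Fin n) : Prop :=
  Unanswered t i ∧ ∀ N, ∃ j, N ≤ j ∧ (t j).pid = i

/-- The circumstances under which a liveness property tolerates a starved process. -/
def Liveness.Tolerates : Liveness → (ℕ → Label n M A B) → Prop
  | .WF, _ => False
  | .LF, t => ∀ N, ∃ j, N ≤ j ∧ ∃ i, (t j).IsRetOf i
  | .OF, t => ¬ Iso t

theorem PendingAt.unanswered {t : ℕ → Label n M A B} {k : ℕ} {i : Fin n} (h : PendingAt t k i)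
    (hr : ∀ j, k < j → ¬ (t j).IsRetOf i) : Unanswered t i := by
  obtain ⟨k₀, _, hc, h₀⟩ := h
  refine ⟨k₀, hc, fun j hj => ?_⟩
  by_cases hjk : j ≤ k
  · exact h₀ j hj hjk
  · exact hr j (by omega)

theorem Unanswered.exists_pendingAt {t : ℕ → Label n M A B} {i : Fin n} (h : Unanswered t i) :
    ∃ k, ∀ k' ≥ k, PendingAt t k' i ∧ ∀ j, k' < j → ¬ (t j).IsRetOf i := by
  obtain ⟨k, hc, h⟩ := h
  exact ⟨k, fun k' hk' => ⟨⟨k, hk', hc, fun j hj _ => h j hj⟩, fun j hj => h j (by omega)⟩⟩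

/-- A starved process makes `Sched` true and `ProgT` false; conversely, if `Sched` holds and some
call is never answered, then some process is starved. So the three properties differ only in what
excuses starvation: nothing, infinitely many returns, or absence of isolation. -/
theorem Liveness.holdsOn_iff (P : Liveness) (t : ℕ → Label n M A B) :
    P.HoldsOn t ↔ ∀ i, Starved t i → P.Tolerates t := by
  have hsched : ∀ i, Starved t i → Sched t := fun i h _ => ⟨i, h⟩
  have noProgT : ∀ i, Unanswered t i → ¬ ProgT t := by
    intro i hi hp
    obtain ⟨k, hk⟩ := hi.exists_pendingAt
    obtain ⟨j, hj, hr⟩ := hp k i (hk k le_rfl).1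
    exact (hk k le_rfl).2 j hj hr
  have progT : (∀ i, ¬ Unanswered t i) → ProgT t := by
    intro h k i hp
    by_contra! hc
    exact h i (hp.unanswered hc)
  cases P with
  | WF =>
    refine ⟨fun h i hi => noProgT i hi.1 (h (hsched i hi)), fun h hs => progT fun i hi => ?_⟩
    obtain ⟨j, hj⟩ := hs ⟨i, hi⟩
    exact h j hj
  | LF =>
    constructor
    · intro h i hi N
      obtain ⟨k, hk⟩ := hi.1.exists_pendingAt
      obtain ⟨j, hj, hr⟩ := h (hsched i hi) (max k N) ⟨i, (hk _ (le_max_left _ _)).1⟩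
      exact ⟨j, by omega, hr⟩
    · rintro h hs k ⟨i, hp⟩
      by_contra! hc
      obtain ⟨j, hj⟩ := hs ⟨i, hp.unanswered fun j hj => hc j hj i⟩
      obtain ⟨j', hj', i', hr⟩ := h j hj (k + 1)
      exact hc j' (by omega) i' hr
  | OF =>
    refine ⟨fun h i hi hiso => noProgT i hi.1 (h (hsched i hi) hiso),
      fun h hs hiso => progT fun i hi => ?_⟩
    obtain ⟨j, hj⟩ := hs ⟨i, hi⟩
    exact h j hj hiso

/-- All three properties restrict only traces with a starved process. This is how they are obtained
for `𝒜` and `𝒰` at once. -/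
theorem LTS.satisfies_of_not_starved {L : LTS n M A B}
    (h : ∀ t, L.IsInfTrace t → ∀ i, ¬ Starved t i) (P : Liveness) : L.Satisfies P :=
  fun t ht => (P.holdsOn_iff t).2 fun i hi => (h t ht i hi).elim

/-- No process starves if its steps decrease a well-founded rank, which is not increased by the
other processes, while one of its calls is pending. -/
theorem LTS.not_starved_of_rank {L : LTS n M A B} {W : Type*} [Preorder W] [WellFoundedLT W]
    (Inv : L.State → Prop) (i : Fin n) (G : W → L.State → Prop) (hinit : Inv L.init)
    (hstep : ∀ c α c', Inv c → L.step c α c' → Inv c')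
    (hcall : ∀ c m a c', Inv c → L.step c (.call i m a) c' → ∃ w, G w c')
    (hother : ∀ w c α c', Inv c → G w c → L.step c α c' → α.pid ≠ i → G w c')
    (hown : ∀ w c α c', Inv c → G w c → L.step c α c' → α.pid = i → ¬ α.IsRetOf i →
      ∃ w' < w, G w' c')
    (t : ℕ → Label n M A B) (ht : L.IsInfTrace t) : ¬ Starved t i := by
  rintro ⟨⟨k₀, ⟨m, a, hc⟩, hr⟩, hinf⟩
  obtain ⟨q, hq₀, hq⟩ := ht
  have hI : ∀ k, Inv (q k) := by
    intro k
    induction k with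
    | zero => exact hq₀ ▸ hinit
    | succ k ih => exact hstep _ _ _ ih (hq k)
  -- Outer induction on the rank, inner induction on the distance `j - k` to some later step of `i`:
  -- steps of other processes keep `w`, and the first step of `i` lowers it.
  have key : ∀ w k, k₀ < k → ¬ G w (q k) := by
    intro w
    induction w using WellFoundedLT.induction with
    | ind w ih =>
      intro k hk hG
      obtain ⟨j, hj, hji⟩ := hinf k
      induction hd : j - k generalizing k with
      | zero =>
        obtain rfl : j = k := by omega
        obtain ⟨w', hw', hG'⟩ := hown w _ _ _ (hI j) hG (hq j) hji (hr j hk)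
        exact ih w' hw' (j + 1) (by omega) hG'
      | succ d ihd =>
        by_cases hki : (t k).pid = i
        · obtain ⟨w', hw', hG'⟩ := hown w _ _ _ (hI k) hG (hq k) hki (hr k hk)
          exact ih w' hw' (k + 1) (by omega) hG'
        · exact ihd (k + 1) (by omega) (hother w _ _ _ (hI k) hG (hq k) hki) (by omega) (by omega)
  obtain ⟨w, hw⟩ := hcall _ m a _ (hI k₀) (hc ▸ hq k₀)
  exact key w (k₀ + 1) (by omega) hw

/-- A liveness property carries over along a projection `f` of the states of an infinite trace, where
the steps in `stutter` are invisible internal steps, and no process takes only such steps from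
some moment on. -/
theorem Liveness.holdsOn_of_stutter {L : LTS n M A B} {P : Liveness} (hL : L.Satisfies P)
    (t : ℕ → Label n M A B) (f : ℕ → L.State) (stutter : ℕ → Prop) (h₀ : f 0 = L.init)
    (hstep : ∀ k, ¬ stutter k → L.step (f k) (t k) (f (k + 1)))
    (hstut : ∀ k, stutter k → f (k + 1) = f k ∧ ∃ i, t k = .tau i)
    (hinf : ∀ i, (∀ N, ∃ j, N ≤ j ∧ (t j).pid = i) →
      ∀ N, ∃ j, N ≤ j ∧ (t j).pid = i ∧ ¬ stutter j) : P.HoldsOn t := by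
  classical
  set p : ℕ → Prop := fun k => ¬ stutter k with hp
  have hpinf : {k | p k}.Infinite := by
    -- There are finitely many processes, so one of them is scheduled infinitely often; its proper
    -- steps keep the trace infinite after stuttering has been removed.
    obtain ⟨i, hi⟩ := Finite.exists_infinite_fiber fun k => (t k).pid
    have hi' : ∀ N, ∃ j, N ≤ j ∧ (t j).pid = i := by
      intro N
      obtain ⟨j, hj, hN⟩ := (Set.infinite_coe_iff.1 hi).exists_gt N
      exact ⟨j, hN.le, hj⟩
    refine Set.infinite_of_forall_exists_gt fun N => ?_
    obtain ⟨j, hj, -, hs⟩ := hinf i hi' (N + 1)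
    exact ⟨j, hs, by omega⟩
  -- `φ` enumerates the proper steps. The state is constant in the gaps, hence `t ∘ φ` is a trace of
  -- `L`; it retains all calls and returns because stuttering steps are internal.
  set φ := Nat.nth p with hφ
  have hmono : StrictMono φ := Nat.nth_strictMono hpinf
  have hφp : ∀ k, p (φ k) := Nat.nth_mem_of_infinite hpinf
  have hsurj : ∀ j, p j → ∃ k, φ k = j := fun j hj => ⟨Nat.count p j, Nat.nth_count hj⟩
  have hconst : ∀ a d, (∀ j, a ≤ j → j < a + d → stutter j) → f (a + d) = f a := by
    intro a d
    induction d with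
    | zero => intros; rfl
    | succ d ih =>
      intro h
      rw [← ih fun j h₁ h₂ => h j h₁ (by omega)]
      exact (hstut (a + d) (h _ (by omega) (by omega))).1
  have hgap : ∀ a b, a ≤ b → (∀ j, a ≤ j → j < b → stutter j) → f b = f a := by
    intro a b hab h
    obtain ⟨d, rfl⟩ := Nat.exists_eq_add_of_le hab
    exact hconst a d h
  have htr : L.IsInfTrace (t ∘ φ) := by
    refine ⟨fun k => f (φ k), ?_, fun k => ?_⟩
    · show f (φ 0) = _
      rw [← h₀]
      refine hgap 0 _ (Nat.zero_le _) fun j _ hj => ?_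
      by_contra hs
      obtain ⟨k, rfl⟩ := hsurj j hs
      exact absurd (hmono.lt_iff_lt.1 hj) (by omega)
    · show L.step (f (φ k)) (t (φ k)) (f (φ (k + 1)))
      rw [hgap (φ k + 1) (φ (k + 1)) (hmono (Nat.lt_succ_self k))]
      · exact hstep _ (hφp k)
      · intro j h₁ h₂
        by_contra hs
        obtain ⟨l, rfl⟩ := hsurj j hs
        have := hmono.lt_iff_lt.1 h₂
        have := hmono.lt_iff_lt.1 (show φ k < φ l by omega)
        omega
  have hvis : ∀ k, ¬ (∃ i, t k = .tau i) → ∃ k', φ k' = k := fun k hk =>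
    hsurj k fun hs => hk (hstut k hs).2
  have hle : ∀ k, k ≤ φ k := fun _ => hmono.le_apply
  rw [P.holdsOn_iff]
  intro i hi
  have hi' : Starved (t ∘ φ) i := by
    obtain ⟨⟨k, ⟨m, a, hc⟩, hr⟩, hs⟩ := hi
    obtain ⟨k', rfl⟩ := hvis k (by rw [hc]; rintro ⟨_, ⟨⟩⟩)
    refine ⟨⟨k', ⟨m, a, hc⟩, fun j hj => hr _ (hmono hj)⟩, fun N => ?_⟩
    obtain ⟨j, hj, hji, hp⟩ := hinf i hs (φ N)
    obtain ⟨j', rfl⟩ := hsurj j hp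
    exact ⟨j', hmono.le_iff_le.1 hj, hji⟩
  have := (P.holdsOn_iff _).1 (hL _ htr) i hi'
  cases P with
  | WF => exact this
  | LF =>
    intro N
    obtain ⟨j, hj, hr⟩ := this N
    exact ⟨φ j, hj.trans (hle j), hr⟩
  | OF =>
    rintro ⟨i', N, h⟩
    exact this ⟨i', N, fun j hj => h _ (hj.trans (hle j))⟩

/-- A finite path followed by an infinite one. -/
theorem LTS.Exec.exists_append_infinite {L : LTS n M A B} {q q' : L.State}
    {w : List (Label n M A B)} (hw : L.Exec q w q') (f : ℕ → L.State) (t : ℕ → Label n M A B)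
    (hf : f 0 = q') (ht : ∀ k, L.step (f k) (t k) (f (k + 1))) :
    ∃ (g : ℕ → L.State) (s : ℕ → Label n M A B), g 0 = q ∧
      (∀ k, L.step (g k) (s k) (g (k + 1))) ∧ (∀ k, s (w.length + k) = t k) ∧
      ∀ k (hk : k < w.length), s k = w[k] := by
  induction hw with
  | nil => exact ⟨f, t, hf, ht, by simp, by simp⟩
  | @cons a b c α w hs _ ih =>
    obtain ⟨g, s, hg, hgs, h₁, h₂⟩ := ih hf
    refine ⟨fun k => Nat.casesOn k a g, fun k => Nat.casesOn k α s, rfl, ?_, ?_, ?_⟩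
    · rintro (_ | k)
      · show L.step a α (g 0)
        rwa [hg]
      · exact hgs k
    · intro k
      rw [← h₁ k, List.length_cons, show w.length + 1 + k = (w.length + k) + 1 by omega]
    · rintro (_ | k) hk
      · rfl
      · exact h₂ k (by simpa using hk)

end Starvation

end ConcLat

namespace ConcLat

/-! ### Commuting calls with internal steps -/

section CallsFirst

variable {n : ℕ} {M A B : Type u}

/-- The label of an action. -/
def Act.label {T : Type} : Act n M A B T → Label n M A B
  | .call i m a _ => .call i m a
  | .ret i m b _ => .ret i m b

theorem historyOf_map_label (h : History n M A B Unit) : historyOf (h.map Act.label) = h := by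
  induction h with
  | nil => rfl
  | cons x h ih => rw [List.map_cons, historyOf_cons, ih]; cases x <;> rfl

namespace ConcObject

variable {O : ConcObject n M A B}

/-- A call touches neither the memory nor other processes. The two steps belong to different
processes, because after its internal step `j` is still inside an operation and cannot call. -/
theorem call_comm_tau {c d e : O.Config} {i j : Fin n} {m : M} {a : A}
    (h₁ : O.Step c (.tau j) d) (h₂ : O.Step d (.call i m a) e) :
    ∃ d', O.Step c (.call i m a) d' ∧ O.Step d' (.tau j) e := by
  cases h₁ with
  | tau _ m' l l' s' hp hr hs =>
    cases h₂ with
    | call _ _ _ hi =>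
      have hij : i ≠ j := by rintro rfl; simp at hi
      simp only [Function.update_of_ne hij] at hi
      refine ⟨_, .call c i m a hi, ?_⟩
      rw [Function.update_comm hij.symm]
      exact .tau _ j m' l l' s' (by simpa [Function.update_of_ne hij.symm] using hp) hr hs

theorem call_comm_exec {c d e : O.sem.State} {u : List (Label n M A B)} {i : Fin n} {m : M} {a : A}
    (h₁ : O.sem.Exec c u d) (hu : historyOf u = []) (h₂ : O.Step d (.call i m a) e) :
    ∃ d', O.Step c (.call i m a) d' ∧ O.sem.Exec d' u e := by
  induction h₁ with
  | nil => exact ⟨e, h₂, .nil _⟩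
  | @cons x y z α u hs _ ih =>
    rw [historyOf_cons, List.append_eq_nil_iff] at hu
    obtain ⟨d', hd', he⟩ := ih hu.2 h₂
    cases α with
    | call => simp at hu
    | ret => simp at hu
    | tau j =>
      obtain ⟨x', h, h'⟩ := call_comm_tau hs hd'
      exact ⟨x', h, .cons h' he⟩

/-- A path without returns may be rearranged such that the calls come first. -/
theorem calls_first {c d : O.sem.State} {v : List (Label n M A B)} (h : O.sem.Exec c v d)
    (hv : ∀ x ∈ historyOf v, x.isCall = true) :
    ∃ e u, O.sem.Exec c ((historyOf v).map Act.label) e ∧ O.sem.Exec e u d ∧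
      historyOf u = [] := by
  revert hv
  refine LTS.Exec.snoc_induction (L := O.sem) (p := fun v d => (∀ x ∈ historyOf v, x.isCall = true) →
    ∃ e u, O.sem.Exec c ((historyOf v).map Act.label) e ∧ O.sem.Exec e u d ∧
      historyOf u = []) ?_ ?_ h
  · exact fun _ => ⟨c, [], .nil _, .nil _, rfl⟩
  · intro w q α q' _ ih hs hv
    rw [historyOf_append] at hv ⊢
    obtain ⟨e, u, h₁, h₂, hu⟩ := ih fun x hx => hv x (List.mem_append_left _ hx)
    cases α with
    | call i m a =>
      obtain ⟨e', h₃, h₄⟩ := call_comm_exec h₂ hu hs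
      refine ⟨e', u, ?_, h₄, hu⟩
      rw [List.map_append]
      exact h₁.append (.single h₃)
    | ret i m b => simpa [Act.isCall] using hv (.ret i m b ()) (by simp)
    | tau i =>
      refine ⟨e, u ++ [.tau i], by simpa using h₁, h₂.append (.single hs), ?_⟩
      rw [historyOf_append, hu]; rfl

/-- A call is a deterministic transition. Together with `calls_first` this identifies the
intermediate configuration of a rearranged path with the current one when the join makes its choice.
-/
theorem exec_calls_unique {c d e : O.sem.State} {h : History n M A B Unit}
    (hh : ∀ x ∈ h, x.isCall = true) (h₁ : O.sem.Exec c (h.map Act.label) d)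
    (h₂ : O.sem.Exec c (h.map Act.label) e) : d = e := by
  induction h generalizing c with
  | nil => cases h₁; cases h₂; rfl
  | cons x h ih =>
    cases x with
    | ret => simpa [Act.isCall] using hh _ List.mem_cons_self
    | call i m a =>
      cases h₁ with
      | cons hs₁ h₁ =>
        cases h₂ with
        | cons hs₂ h₂ =>
          cases hs₁; cases hs₂
          exact ih (fun x hx => hh x (List.mem_cons_of_mem _ hx)) h₁ h₂

end ConcObject

end CallsFirst

/-! ### The join of two objects and least upper bounds -/

section Join

variable {n : ℕ} {M A B : Type u}

/-- The commands of the join of two objects. -/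
inductive JoinStep (O : Bool → ConcObject n M A B) (i : Fin n) :
    Option (Σ b, (O b).Mem) → (M × A) ⊕ (Σ b, (O b).Loc) →
    Option (Σ b, (O b).Mem) → (M × A) ⊕ (Σ b, (O b).Loc) → Prop
  | choose (b : Bool) (m : M) (a : A) :
      JoinStep O i none (.inl (m, a)) (some ⟨b, (O b).mem₀⟩) (.inr ⟨b, (O b).start m a⟩)
  | enter (b : Bool) (s : (O b).Mem) (m : M) (a : A) :
      JoinStep O i (some ⟨b, s⟩) (.inl (m, a)) (some ⟨b, s⟩) (.inr ⟨b, (O b).start m a⟩)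
  | run (b : Bool) (s s' : (O b).Mem) (l l' : (O b).Loc) : (O b).step i s l s' l' →
      JoinStep O i (some ⟨b, s⟩) (.inr ⟨b, l⟩) (some ⟨b, s'⟩) (.inr ⟨b, l'⟩)

/-- The join of two objects: the first command executed chooses one of them nondeterministically;
from then on all processes execute that object. -/
def joinObject (O : Bool → ConcObject n M A B) : ConcObject n M A B where
  Mem := Option (Σ b, (O b).Mem)
  Loc := (M × A) ⊕ (Σ b, (O b).Loc)
  mem₀ := none
  start m a := .inl (m, a)
  ret := fun
    | .inl _ => none
    | .inr ⟨b, l⟩ => (O b).ret l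
  step := fun i => orSpin (JoinStep O i)
  step_total := fun i s l _ => orSpin_total (JoinStep O i) s l

namespace Join

variable {O : Bool → ConcObject n M A B}

/-- The process states of the join and of the component `b` correspond to each other. -/
inductive ProcRel (b : Bool) : Option (M × (joinObject O).Loc) → Option (M × (O b).Loc) → Prop
  | none : ProcRel b none none
  | start (m : M) (a : A) : ProcRel b (some (m, .inl (m, a))) (some (m, (O b).start m a))
  | run (m : M) (l : (O b).Loc) : ProcRel b (some (m, .inr ⟨b, l⟩)) (some (m, l))

/-- The configuration of the join corresponds to a configuration of the component `b`. -/
structure Rel (b : Bool) (c : (joinObject O).Config) (d : (O b).Config) : Prop where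
  mem : c.mem = some ⟨b, d.mem⟩ ∨ c.mem = none ∧ d.mem = (O b).mem₀
  start : c.mem = none → ∀ i m l, c.proc i = some (m, l) → ∃ a, l = .inl (m, a)
  proc : ∀ i, ProcRel b (c.proc i) (d.proc i)

theorem Rel.init (b : Bool) : Rel b (joinObject O).sem.init (O b).sem.init :=
  ⟨.inr ⟨rfl, rfl⟩, fun _ i m l h => (by cases h), fun _ => .none⟩

theorem ProcRel.update {b : Bool} {f : Fin n → Option (M × (joinObject O).Loc)}
    {g : Fin n → Option (M × (O b).Loc)} (h : ∀ i, ProcRel b (f i) (g i)) (i : Fin n)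
    {x : Option (M × (joinObject O).Loc)} {y : Option (M × (O b).Loc)} (hxy : ProcRel b x y)
    (j : Fin n) : ProcRel b (Function.update f i x j) (Function.update g i y j) := by
  rcases eq_or_ne j i with rfl | hj
  · simpa using hxy
  · simpa [hj] using h j

/-- The component `b` has been chosen, or none has. -/
def Side (b : Bool) (c : (joinObject O).Config) : Prop := ∀ s, c.mem = some s → s.1 = b

/-- The invisible steps: a process enters the chosen component. -/
def Entering (c : (joinObject O).Config) (α : Label n M A B) : Prop :=
  ∃ i m p, α = .tau i ∧ c.proc i = some (m, .inl p)

/-- Once a component has been chosen, commands only change its own memory; the choice is never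
revised. -/
theorem step_mem {c c' : (joinObject O).Config} {α : Label n M A B}
    (h : (joinObject O).Step c α c') {b : Bool} {s : (O b).Mem} (hc : c.mem = some ⟨b, s⟩) :
    ∃ s', c'.mem = some ⟨b, s'⟩ := by
  cases h with
  | call => exact ⟨s, hc⟩
  | ret => exact ⟨s, hc⟩
  | tau i m l l' s' hp hr hs =>
    rcases hs with hs | ⟨-, rfl, -⟩
    · rw [hc] at hs
      cases hs with
      | enter => exact ⟨s, rfl⟩
      | run => exact ⟨_, rfl⟩
    · exact ⟨s, hc⟩

/-- A different component chosen before the step would still be chosen after it. -/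
theorem Side.of_step {c c' : (joinObject O).Config} {α : Label n M A B}
    (h : (joinObject O).Step c α c') {b : Bool} (hc : Side b c') : Side b c := by
  rintro ⟨b', s⟩ hs
  obtain ⟨s', hs'⟩ := step_mem h hs
  exact hc ⟨b', s'⟩ hs'

/-- The relation allows the component to be at the start of an operation that the process has not
entered in the join. So choosing and entering are stuttering steps, and all other steps are matched
one to one. `Side b c'` rules out a choice of the other component. -/
theorem Rel.step {b : Bool} {c c' : (joinObject O).Config} {d : (O b).Config}
    {α : Label n M A B} (h : Rel b c d) (hs : (joinObject O).Step c α c') (hc' : Side b c') :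
    ∃ d', Rel b c' d' ∧ ((¬ Entering c α ∧ (O b).Step d α d') ∨ (Entering c α ∧ d' = d)) := by
  cases hs with
  | call i m a hp =>
    refine ⟨⟨d.mem, Function.update d.proc i (some (m, (O b).start m a))⟩,
      ⟨h.mem, fun hn j m' l hj => ?_, ProcRel.update h.proc i (.start m a)⟩, .inl ⟨?_, .call _ _ _ _ ?_⟩⟩
    · rcases eq_or_ne j i with rfl | hji
      · simp only [Function.update_self, Option.some.injEq, Prod.mk.injEq] at hj
        exact ⟨a, by rw [← hj.2, ← hj.1]; rfl⟩
      · simp only [Function.update_of_ne hji] at hj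
        exact h.start hn j m' l hj
    · rintro ⟨_, _, _, ⟨⟩, _⟩
    · have := h.proc i
      rw [hp] at this
      generalize d.proc i = di at this
      cases this
      rfl
  | ret i m l x hp hr =>
    have hpi := h.proc i
    rw [hp] at hpi
    generalize hdi : d.proc i = di at hpi
    cases hpi with
    | start => cases hr
    | run m l =>
      refine ⟨⟨d.mem, Function.update d.proc i none⟩, ⟨h.mem, fun hn j m' l' hj => ?_,
        ProcRel.update h.proc i .none⟩, .inl ⟨?_, .ret _ _ _ _ _ hdi hr⟩⟩
      · rcases eq_or_ne j i with rfl | hji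
        · simp only [Function.update_self] at hj
          cases hj
        · simp only [Function.update_of_ne hji] at hj
          exact h.start hn j m' l' hj
      · rintro ⟨_, _, _, ⟨⟩, _⟩
  | tau i m l l' s' hp hr hs =>
    have hpi := h.proc i
    rw [hp] at hpi
    generalize hdi : d.proc i = di at hpi
    -- The spinning alternative of `orSpin` never applies: choosing and entering always have an
    -- outcome, and the commands of the component are total.
    have hJ : JoinStep O i c.mem l s' l' := by
      rcases hs with hs | ⟨hne, -⟩
      · exact hs
      · exfalso
        apply hne
        cases hpi with
        | start m a =>
          rcases h.mem with hm | ⟨hm, -⟩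
          · rw [hm]; exact ⟨_, _, .enter _ _ _ _⟩
          · rw [hm]; exact ⟨_, _, .choose true _ _⟩
        | run m l =>
          rcases h.mem with hm | ⟨hm, -⟩
          · obtain ⟨s₁, l₁, h₁⟩ := (O b).step_total i d.mem l hr
            rw [hm]; exact ⟨_, _, .run _ _ _ _ _ h₁⟩
          · obtain ⟨a, ha⟩ := h.start hm i m _ hp
            cases ha
    cases hpi with
    | start m a =>
      refine ⟨d, ?_, .inr ⟨⟨i, m, (m, a), rfl, hp⟩, rfl⟩⟩
      have hup : ∀ j, ProcRel b (Function.update c.proc i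
          (some (m, (.inr ⟨b, (O b).start m a⟩ : (joinObject O).Loc))) j) (d.proc j) := by
        intro j
        have := ProcRel.update h.proc i (.run m ((O b).start m a)) j
        rwa [← hdi, Function.update_eq_self] at this
      rcases h.mem with hm | ⟨hm, hm'⟩
      · rw [hm] at hJ
        cases hJ
        exact ⟨.inl rfl, fun hn => (by cases hn), hup⟩
      · rw [hm] at hJ
        cases hJ with
        | choose b' =>
          obtain rfl : b' = b := hc' _ rfl
          exact ⟨.inl (by rw [hm']), fun hn => (by cases hn), hup⟩
    | run m l =>
      rcases h.mem with hm | ⟨hm, -⟩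
      · rw [hm] at hJ
        cases hJ with
        | run _ _ s' _ l' hs' =>
          refine ⟨⟨s', Function.update d.proc i (some (m, l'))⟩, ⟨.inl rfl, fun hn => (by cases hn),
            ProcRel.update h.proc i (.run m l')⟩, .inl ⟨?_, .tau _ _ _ _ _ _ hdi hr hs'⟩⟩
          rintro ⟨_, _, _, ⟨⟩, hq⟩
          rw [hp] at hq
          cases hq
      · obtain ⟨a, ha⟩ := h.start hm i m _ hp
        cases ha

theorem exec_component {c : (joinObject O).Config} {w : List (Label n M A B)}
    (h : (joinObject O).sem.Exec (joinObject O).sem.init w c) {b : Bool} (hc : Side b c) :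
    ∃ d v, (O b).sem.Exec (O b).sem.init v d ∧ historyOf v = historyOf w ∧ Rel b c d := by
  revert hc
  refine LTS.Exec.snoc_induction (L := (joinObject O).sem) (p := fun w c => Side b c →
    ∃ d v, (O b).sem.Exec (O b).sem.init v d ∧ historyOf v = historyOf w ∧ Rel b c d) ?_ ?_ h
  · exact fun _ => ⟨_, [], .nil _, rfl, .init b⟩
  · intro w q α q' _ ih hs hq'
    obtain ⟨d, v, hv, hh, hr⟩ := ih (hq'.of_step hs)
    obtain ⟨d', hr', ⟨_, hs'⟩ | ⟨⟨i, _, _, rfl, _⟩, rfl⟩⟩ := hr.step hs hq'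
    · exact ⟨d', v ++ [α], hv.append (.single hs'), by rw [historyOf_append, historyOf_append, hh],
        hr'⟩
    · exact ⟨d', v, hv, by rw [historyOf_append, hh]; simp, hr'⟩

theorem exists_side (c : (joinObject O).Config) : ∃ b, Side b c := by
  rcases h : c.mem with _ | ⟨b, s⟩
  · exact ⟨true, fun s hs => by simp [h] at hs⟩
  · exact ⟨b, fun s' hs => by rw [h] at hs; cases hs; rfl⟩

theorem linearizable {S : SeqSpec M A B} (h : ∀ b, (O b).sem.Linearizable S) :
    (joinObject O).sem.Linearizable S := by
  intro w c hw
  obtain ⟨b, hb⟩ := exists_side c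
  obtain ⟨d, v, hv, hh, -⟩ := exec_component hw hb
  rw [← hh]
  exact h b v d hv

/-- If the memory is ever set, later configurations agree by `step_mem` and earlier ones by
`Side.of_step`; if it is never set, either component will do. -/
theorem exists_side_of_trace {q : ℕ → (joinObject O).Config} {t : ℕ → Label n M A B}
    (hq : ∀ k, (joinObject O).Step (q k) (t k) (q (k + 1))) : ∃ b, ∀ k, Side b (q k) := by
  by_cases h : ∃ k, ∃ s, (q k).mem = some s
  · obtain ⟨k, ⟨b, s⟩, hk⟩ := h
    have later : ∀ d, ∃ s, (q (k + d)).mem = some ⟨b, s⟩ := by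
      intro d
      induction d with
      | zero => exact ⟨s, hk⟩
      | succ d ih =>
        obtain ⟨s', hs'⟩ := ih
        exact step_mem (hq _) hs'
    have late : ∀ d, Side b (q (k + d)) := by
      intro d s' hs'
      obtain ⟨s, hs⟩ := later d
      rw [hs] at hs'
      cases hs'
      rfl
    refine ⟨b, fun j => ?_⟩
    have early : ∀ d j, k ≤ j + d → Side b (q j) := by
      intro d
      induction d with
      | zero =>
        intro j hj
        obtain ⟨e, rfl⟩ := Nat.exists_eq_add_of_le (show k ≤ j by omega)
        exact late e
      | succ d ih => exact fun j hj => (ih (j + 1) (by omega)).of_step (hq j)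
    exact early k j (by omega)
  · refine ⟨true, fun k s hs => (h ⟨k, s, hs⟩).elim⟩

/-- An infinite trace projects to one of the chosen component, with the entering steps as stutter.
No process takes entering steps only, since it enters at most once per call and a call is not an
entering step. -/
theorem satisfies {P : Liveness} (h : ∀ b, (O b).sem.Satisfies P) :
    (joinObject O).sem.Satisfies P := by
  rintro t ⟨(q : ℕ → (joinObject O).Config), hq₀, hq⟩
  obtain ⟨b, hb⟩ := exists_side_of_trace hq
  choose! next hnext using fun (k : ℕ) (d : (O b).Config) (hd : Rel b (q k) d) =>
    hd.step (hq k) (hb (k + 1))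
  let f : ℕ → (O b).Config := fun k => Nat.rec (O b).sem.init next k
  have hf : ∀ k, Rel b (q k) (f k) := by
    intro k
    induction k with
    | zero => rw [hq₀]; exact .init b
    | succ k ih => exact (hnext k (f k) ih).1
  have hf' : ∀ k, (¬ Entering (q k) (t k) ∧ (O b).Step (f k) (t k) (f (k + 1))) ∨
      (Entering (q k) (t k) ∧ f (k + 1) = f k) := fun k => (hnext k (f k) (hf k)).2
  refine Liveness.holdsOn_of_stutter (h b) t f (fun k => Entering (q k) (t k)) rfl ?_ ?_ ?_
  · intro k hk
    rcases hf' k with h | h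
    · exact h.2
    · exact (hk h.1).elim
  · intro k hk
    rcases hf' k with h | h
    · exact (h.1 hk).elim
    · obtain ⟨i, _, _, h', _⟩ := hk
      exact ⟨h.2, i, h'⟩
  · intro i hi N
    -- Suppose all steps of `i` from `N` on are entering steps. After one of them `i` is inside the
    -- component and the steps of others leave it there, so its next step cannot be an entering one.
    by_contra! hcon
    have entered : ∀ k, N ≤ k → (t k).pid = i → ∃ m p, (q k).proc i = some (m, .inl p) := by
      intro k hk hki
      obtain ⟨i', m, p, h₁, h₂⟩ := hcon k hk hki
      rw [h₁] at hki
      cases hki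
      exact ⟨m, p, h₂⟩
    obtain ⟨j, hj, hji⟩ := hi N
    have inside : ∀ d, ∃ m l, (q (j + 1 + d)).proc i = some (m, .inr l) := by
      intro d
      induction d with
      | zero =>
        obtain ⟨i', m, p, h₁, h₂⟩ := hcon j hj hji
        have hs := hq j
        rw [h₁] at hs
        rw [h₁] at hji
        obtain rfl : i' = i := hji
        have hr := (hf j).step (hq j) (hb (j + 1))
        generalize q (j + 1) = q' at hs hr
        cases hs with
        | tau _ m' l l' s' hp hr' hs =>
          rw [hp] at h₂
          cases h₂
          have hJ : JoinStep O i' (q j).mem (.inl p) s' l' := by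
            rcases hs with hs | ⟨hne, -⟩
            · exact hs
            · exfalso
              apply hne
              rcases hm : (q j).mem with _ | ⟨b', s⟩
              · exact ⟨_, _, .choose true _ _⟩
              · exact ⟨_, _, .enter _ _ _ _⟩
          generalize hx : (q j).mem = x at hJ
          cases hJ <;> exact ⟨_, _, Function.update_self _ _ _⟩
      | succ d ih =>
        obtain ⟨m, l, hl⟩ := ih
        have hne : (t (j + 1 + d)).pid ≠ i := by
          intro hi'
          obtain ⟨m', p, h'⟩ := entered _ (by omega) hi'
          rw [hl] at h'
          cases h'
        have hs := hq (j + 1 + d)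
        refine ⟨m, l, ?_⟩
        rw [← hl]
        show (q (j + 1 + d + 1)).proc i = _
        generalize q (j + 1 + d + 1) = q' at hs
        generalize t (j + 1 + d) = α at hs hne
        cases hs <;> exact Function.update_of_ne (Ne.symm hne) _ _
    obtain ⟨j', hj', hji'⟩ := hi (j + 1)
    obtain ⟨d, rfl⟩ := Nat.exists_eq_add_of_le hj'
    obtain ⟨m, p, h'⟩ := entered _ (by omega) hji'
    obtain ⟨m', l, hl⟩ := inside d
    rw [hl] at h'
    cases h'

/-- Each component is simulated by the join. -/
theorem sim_join (b : Bool) : (O b).sem.Sim (joinObject O).sem := by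
  -- In addition to `Rel`, no process of the join waits at its entry: a call is matched by the call
  -- followed at once by the entering step, and the first of these chooses `b`.
  refine ⟨fun d c => Rel b c d ∧ (∀ i m p, c.proc i = some (m, .inl p) → False), ⟨.init b, ?_⟩, ?_⟩
  · intro i m p h; cases h
  rintro (d : (O b).Config) (c : (joinObject O).Config) α (d' : (O b).Config) ⟨hr, hin⟩ hs
  have entered : ∀ {i : Fin n} {m : M} {x : (O b).Loc}, d.proc i = some (m, x) →
      c.proc i = some (m, .inr ⟨b, x⟩) ∧ c.mem = some ⟨b, d.mem⟩ := by
    intro i m x hd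
    have hpi := hr.proc i
    rw [hd] at hpi
    generalize hci : c.proc i = ci at hpi
    cases hpi with
    | start => exact (hin _ _ _ hci).elim
    | run =>
      refine ⟨rfl, ?_⟩
      rcases hr.mem with hm | ⟨hm, -⟩
      · exact hm
      · obtain ⟨a, ha⟩ := hr.start hm _ _ _ hci
        cases ha
  have hin' : ∀ (i : Fin n) (x : Option (M × (joinObject O).Loc)), (∀ m p, x ≠ some (m, .inl p)) →
      ∀ j m p, Function.update c.proc i x j = some (m, .inl p) → False := by
    intro i x hx j m p hj
    rcases eq_or_ne j i with rfl | hji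
    · rw [Function.update_self] at hj; exact hx _ _ hj
    · rw [Function.update_of_ne hji] at hj; exact hin _ _ _ hj
  cases hs with
  | call i m a hp =>
    have hci : c.proc i = none := by
      have := hr.proc i
      rw [hp] at this
      generalize c.proc i = ci at this
      cases this
      rfl
    refine ⟨[.call i m a, .tau i], ⟨some ⟨b, d.mem⟩, Function.update c.proc i
      (some (m, .inr ⟨b, (O b).start m a⟩))⟩, .cons (.call c i m a hci) (.single ?_), rfl,
      ⟨.inl rfl, fun hn => (by cases hn), ProcRel.update hr.proc i (.run _ _)⟩, hin' i _ fun _ _ h => by cases h⟩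
    have := ConcObject.Step.tau (O := joinObject O)
      ⟨c.mem, Function.update c.proc i (some (m, (joinObject O).start m a))⟩ i m (.inl (m, a))
      (.inr ⟨b, (O b).start m a⟩) (some ⟨b, d.mem⟩) (Function.update_self _ _ _) rfl (by
        refine .inl ?_
        rcases hr.mem with hm | ⟨hm, hm'⟩
        · show JoinStep O i c.mem _ _ _
          rw [hm]; exact .enter _ _ _ _
        · show JoinStep O i c.mem _ _ _
          rw [hm, hm']; exact .choose _ _ _)
    simp only [Function.update_idem] at this
    exact this
  | ret i m l x hp hr' =>
    obtain ⟨hci, hm⟩ := entered hp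
    exact ⟨[.ret i m x], ⟨c.mem, Function.update c.proc i none⟩,
      .single (.ret _ _ _ _ _ hci hr'), rfl,
      ⟨.inl hm, fun hn => by simp [hm] at hn, ProcRel.update hr.proc i .none⟩, hin' i _ fun _ _ h => by cases h⟩
  | tau i m l l' s' hp hr' hs =>
    obtain ⟨hci, hm⟩ := entered hp
    refine ⟨[.tau i], ⟨some ⟨b, s'⟩, Function.update c.proc i (some (m, .inr ⟨b, l'⟩))⟩,
      .single (.tau _ _ _ _ _ _ hci hr' (.inl ?_)), rfl,
      ⟨.inl rfl, fun hn => (by cases hn), ProcRel.update hr.proc i (.run _ _)⟩, hin' i _ fun _ _ h => by cases h⟩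
    rw [hm]
    exact .run _ _ _ _ _ hs

/-- The join is simulated by every object that simulates both components. -/
theorem join_sim {O₃ : ConcObject n M A B} (h : ∀ b, (O b).sem.Sim O₃.sem) :
    (joinObject O).sem.Sim O₃.sem := by
  choose R hR₀ hR using h
  -- Before the choice only the calls `h` have occurred; `O₃` has performed just these calls, and
  -- both components are kept in play after the same calls. After the choice the given simulation of
  -- the chosen component takes over.
  refine ⟨fun c e => (∃ b d, c.mem ≠ none ∧ Rel b c d ∧ R b d e) ∨
    (c.mem = none ∧ (∀ i, c.proc i = none → e.proc i = none) ∧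
      ∃ h : History n M A B Unit, (∀ x ∈ h, x.isCall = true) ∧
        O₃.sem.Exec O₃.sem.init (h.map Act.label) e ∧
        ∀ b, ∃ d, (O b).sem.Exec (O b).sem.init (h.map Act.label) d ∧ Rel b c d),
    .inr ⟨rfl, fun _ _ => rfl, [], by simp, .nil _, fun b => ⟨_, .nil _, .init b⟩⟩, ?_⟩
  rintro (c : (joinObject O).Config) e α (c' : (joinObject O).Config) hce hs
  rcases hce with ⟨b, d, hm, hr, hd⟩ | ⟨hm, hproc, h, hcalls, he, hh⟩
  · have hc' : ∃ s, c'.mem = some ⟨b, s⟩ := by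
      rcases hr.mem with h | ⟨h, -⟩
      · exact step_mem hs h
      · exact (hm h).elim
    have hne : c'.mem ≠ none := by
      obtain ⟨s, hs⟩ := hc'
      intro hn
      rw [hs] at hn
      cases hn
    have hside : Side b c' := by
      obtain ⟨s, hs⟩ := hc'
      intro s' hs'
      rw [hs] at hs'
      cases hs'
      rfl
    obtain ⟨d', hr', ⟨_, hs'⟩ | ⟨⟨i, _, _, rfl, _⟩, rfl⟩⟩ := hr.step hs hside
    · obtain ⟨w, e', hw, hwh, hd'⟩ := hR b _ _ _ _ hd hs'
      exact ⟨w, e', hw, hwh, .inl ⟨b, d', hne, hr', hd'⟩⟩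
    · exact ⟨[], e, .nil _, rfl, .inl ⟨b, d', hne, hr', hd⟩⟩
  · rcases hm' : c'.mem with _ | ⟨b, s⟩
    · have side : ∀ b, Side b c' := fun b s hs => by simp [hm'] at hs
      cases hs with
      | ret i m l x hp hr' =>
        obtain ⟨d, -, hr⟩ := hh true
        obtain ⟨a, rfl⟩ := hr.start hm i m l hp
        cases hr'
      | tau i m l l' s' hp hr' hs =>
        obtain ⟨d, -, hr⟩ := hh true
        obtain ⟨a, rfl⟩ := hr.start hm i m l hp
        rcases hs with hs | ⟨hne, -⟩
        · rw [hm] at hs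
          cases hs
          cases hm'
        · rw [hm] at hne
          exact (hne ⟨_, _, .choose true _ _⟩).elim
      | call i m a hp =>
        have hs := ConcObject.Step.call c i m a hp
        refine ⟨[.call i m a], _, .single (.call e i m a (hproc i hp)), rfl,
          .inr ⟨hm, fun j hj => ?_, h ++ [.call i m a ()], ?_, ?_, fun b => ?_⟩⟩
        · rcases eq_or_ne j i with rfl | hji
          · simp at hj
          · simp only [Function.update_of_ne hji] at hj ⊢
            exact hproc j hj
        · intro x hx
          rcases List.mem_append.1 hx with hx | hx
          · exact hcalls x hx
          · rw [List.mem_singleton.1 hx]; rfl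
        · rw [List.map_append]
          exact he.append (.single (.call e i m a (hproc i hp)))
        · obtain ⟨d, hd, hr⟩ := hh b
          obtain ⟨d', hr', ⟨_, hs'⟩ | ⟨⟨_, _, _, ⟨⟩, _⟩, _⟩⟩ := hr.step hs (side b)
          refine ⟨d', ?_, hr'⟩
          rw [List.map_append]
          exact hd.append (.single hs')
    · have side : Side b c' := fun s' hs' => by rw [hm'] at hs'; cases hs'; rfl
      obtain ⟨d, hd, hr⟩ := hh b
      -- The choice of `b` is matched here. The simulation of component `b` supplies a path of `O₃`
      -- with the calls `h` to some `e'`. With its calls moved to the front, this path passes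
      -- through the current configuration `e`, and its silent remainder `u` leads from `e` to `e'`.
      obtain ⟨v, e', hv, hvh, hde⟩ := LTS.exec_of_rel (hR b) hd _ (hR₀ b)
      rw [historyOf_map_label] at hvh
      obtain ⟨e₁, u, h₁, h₂, hu⟩ := ConcObject.calls_first hv (hvh ▸ hcalls)
      rw [hvh] at h₁
      obtain rfl := ConcObject.exec_calls_unique hcalls he h₁
      obtain ⟨d', hr', ⟨hne, hs'⟩ | ⟨⟨i, _, _, rfl, _⟩, rfl⟩⟩ := hr.step hs side
      · exfalso
        cases hs with
        | call => simp [hm] at hm'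
        | ret => simp [hm] at hm'
        | tau i m l l' s' hp =>
          obtain ⟨a, rfl⟩ := hr.start hm i m l hp
          exact hne ⟨i, m, _, rfl, hp⟩
      · exact ⟨u, e', h₂, hu, .inl ⟨b, d', fun hn => (by rw [hm'] at hn; cases hn), hr', hde⟩⟩

theorem admissible {S : SeqSpec M A B} {P : Liveness} (h : ∀ b, (O b).Admissible S P) :
    (joinObject O).Admissible S P :=
  ⟨linearizable fun b => (h b).1, satisfies fun b => (h b).2⟩

end Join

namespace ClassSet

theorem exists_isLUB {S : SeqSpec M A B} {P : Liveness} (K₁ K₂ : ClassSet n S P) :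
    ∃ K, IsLUB {K₁, K₂} K := by
  obtain ⟨O₁, hO₁, h₁⟩ := K₁.exists_object
  obtain ⟨O₂, hO₂, h₂⟩ := K₂.exists_object
  have hadm : ∀ b, (Bool.rec O₁ O₂ b : ConcObject n M A B).Admissible S P :=
    fun b => by cases b <;> assumption
  refine ⟨classOf _ (Join.admissible hadm), ?_, ?_⟩
  · rintro K (rfl | rfl)
    · exact ⟨_, h₁, _, mem_classOf _ _, Join.sim_join (O := fun b => Bool.rec O₁ O₂ b) false⟩
    · exact ⟨_, h₂, _, mem_classOf _ _, Join.sim_join (O := fun b => Bool.rec O₁ O₂ b) true⟩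
  · intro K hK
    obtain ⟨O₃, _, h₃⟩ := K.exists_object
    refine ⟨_, mem_classOf _ _, _, h₃, Join.join_sim fun b => ?_⟩
    cases b
    · exact sim_of_le (hK (.inl rfl)) h₁ h₃
    · exact sim_of_le (hK (.inr rfl)) h₂ h₃

end ClassSet

end Join

end ConcLat

namespace ConcLat

/-! ### Histories and linearizations, process by process -/

section Histories

variable {n : ℕ} {M A B : Type u} {T : Type}

/-- The data of a call action of process `i`. -/
def Act.callData (i : Fin n) : Act n M A B T → Option (M × A × T)
  | .call j m a t => if j = i then some (m, a, t) else none
  | .ret _ _ _ _ => none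

/-- The data of a return action of process `i`. -/
def Act.retData (i : Fin n) : Act n M A B T → Option (M × B × T)
  | .call _ _ _ _ => none
  | .ret j m b t => if j = i then some (m, b, t) else none

/-- The data of the call of an operation. -/
def OpInst.callData (o : OpInst n M A B T) : M × A × T := (o.m, o.a, o.tag)

/-- The data of the return of an operation. -/
def OpInst.retData (o : OpInst n M A B T) : M × B × T := (o.m, o.b, o.tag)

/-- The operations of process `i`. -/
def opsOf (i : Fin n) (l : List (OpInst n M A B T)) : List (OpInst n M A B T) :=
  l.filter fun o => decide (o.pid = i)

/-- The underlying word of the specification. -/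
def opWord (l : List (OpInst n M A B T)) : List (M × A × B) := l.map fun o => (o.m, o.a, o.b)

@[simp] theorem opsOf_nil (i : Fin n) : opsOf i ([] : List (OpInst n M A B T)) = [] := rfl

theorem opsOf_append (i : Fin n) (l l' : List (OpInst n M A B T)) :
    opsOf i (l ++ l') = opsOf i l ++ opsOf i l' := List.filter_append ..

theorem opsOf_cons_self (o : OpInst n M A B T) (l : List (OpInst n M A B T)) :
    opsOf o.pid (o :: l) = o :: opsOf o.pid l := by simp [opsOf]

theorem opsOf_cons_of_ne {i : Fin n} {o : OpInst n M A B T} (h : o.pid ≠ i)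
    (l : List (OpInst n M A B T)) : opsOf i (o :: l) = opsOf i l := by simp [opsOf, h]

theorem opsOf_singleton_self (o : OpInst n M A B T) : opsOf o.pid [o] = [o] :=
  opsOf_cons_self o []

theorem opsOf_singleton_of_ne {i : Fin n} {o : OpInst n M A B T} (h : o.pid ≠ i) :
    opsOf i [o] = [] := opsOf_cons_of_ne h []

theorem mem_opsOf {i : Fin n} {o : OpInst n M A B T} {l : List (OpInst n M A B T)} :
    o ∈ opsOf i l ↔ o ∈ l ∧ o.pid = i := by simp [opsOf]

theorem opsOf_prefix {l l' : List (OpInst n M A B T)} (h : l <+: l') (i : Fin n) :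
    opsOf i l <+: opsOf i l' := h.filter _

namespace History

/-- The data of the calls of process `i`. -/
def callsOf (i : Fin n) (h : History n M A B T) : List (M × A × T) := h.filterMap (Act.callData i)

/-- The data of the returns of process `i`. -/
def retsOf (i : Fin n) (h : History n M A B T) : List (M × B × T) := h.filterMap (Act.retData i)

@[simp] theorem callsOf_nil (i : Fin n) : callsOf i ([] : History n M A B T) = [] := rfl
@[simp] theorem retsOf_nil (i : Fin n) : retsOf i ([] : History n M A B T) = [] := rfl

@[simp] theorem callsOf_append (i : Fin n) (h h' : History n M A B T) :
    callsOf i (h ++ h') = callsOf i h ++ callsOf i h' := List.filterMap_append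

@[simp] theorem retsOf_append (i : Fin n) (h h' : History n M A B T) :
    retsOf i (h ++ h') = retsOf i h ++ retsOf i h' := List.filterMap_append

@[simp] theorem callsOf_cons_ret (i j : Fin n) (m : M) (b : B) (t : T) (h : History n M A B T) :
    callsOf i (.ret j m b t :: h) = callsOf i h := rfl

@[simp] theorem retsOf_cons_call (i j : Fin n) (m : M) (a : A) (t : T) (h : History n M A B T) :
    retsOf i (.call j m a t :: h) = retsOf i h := rfl

@[simp] theorem callsOf_cons_call_self (i : Fin n) (m : M) (a : A) (t : T)
    (h : History n M A B T) : callsOf i (.call i m a t :: h) = (m, a, t) :: callsOf i h := by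
  simp [callsOf, Act.callData]

@[simp] theorem retsOf_cons_ret_self (i : Fin n) (m : M) (b : B) (t : T)
    (h : History n M A B T) : retsOf i (.ret i m b t :: h) = (m, b, t) :: retsOf i h := by
  simp [retsOf, Act.retData]

theorem callsOf_cons_call_of_ne {i j : Fin n} (hij : j ≠ i) (m : M) (a : A) (t : T)
    (h : History n M A B T) : callsOf i (.call j m a t :: h) = callsOf i h := by
  simp [callsOf, Act.callData, hij]

theorem retsOf_cons_ret_of_ne {i j : Fin n} (hij : j ≠ i) (m : M) (b : B) (t : T)
    (h : History n M A B T) : retsOf i (.ret j m b t :: h) = retsOf i h := by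
  simp [retsOf, Act.retData, hij]

theorem calls_eq (i : Fin n) (h : History n M A B T) : calls i h = (callsOf i h).length := by
  induction h with
  | nil => rfl
  | cons x h ih =>
    cases x with
    | call j m a t =>
      rcases eq_or_ne j i with rfl | hj
      · simp [calls, Act.isCall, Act.pid] at ih ⊢; exact ih
      · rw [callsOf_cons_call_of_ne hj, ← ih]; simp [calls, Act.pid, hj]
    | ret j m b t => rw [callsOf_cons_ret, ← ih]; simp [calls, Act.isCall]

theorem rets_eq (i : Fin n) (h : History n M A B T) : rets i h = (retsOf i h).length := by
  induction h with
  | nil => rfl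
  | cons x h ih =>
    cases x with
    | ret j m a t =>
      rcases eq_or_ne j i with rfl | hj
      · simp [rets, Act.isRet, Act.pid] at ih ⊢; exact ih
      · rw [retsOf_cons_ret_of_ne hj, ← ih]; simp [rets, Act.pid, hj]
    | call j m b t => rw [retsOf_cons_call, ← ih]; simp [rets, Act.isRet]

theorem callsOf_prefix {h h' : History n M A B T} (hp : h <+: h') (i : Fin n) :
    callsOf i h <+: callsOf i h' := hp.filterMap _

theorem retsOf_prefix {h h' : History n M A B T} (hp : h <+: h') (i : Fin n) :
    retsOf i h <+: retsOf i h' := hp.filterMap _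

theorem before_iff (h : History n M A B T) (o₁ o₂ : Fin n × ℕ) : h.Before o₁ o₂ ↔
    ∃ h₁, h₁ <+: h ∧ o₁.2 < (retsOf o₁.1 h₁).length ∧ (callsOf o₂.1 h₁).length ≤ o₂.2 ∧
      o₂.2 < (callsOf o₂.1 h).length := by
  simp only [Before, calls_eq, rets_eq]

theorem Before.mono {h h' : History n M A B T} {o₁ o₂ : Fin n × ℕ} (hb : h.Before o₁ o₂)
    (hp : h <+: h') : h'.Before o₁ o₂ := by
  rw [before_iff] at *
  obtain ⟨h₁, h₂, h₃, h₄, h₅⟩ := hb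
  exact ⟨h₁, h₂.trans hp, h₃, h₄, h₅.trans_le (callsOf_prefix hp _).length_le⟩

/-- The witnessing prefix does not contain the call of `o₂`, but `h` does; so it lies inside `h`.
Later events thus create no precedence among operations that have already been called. -/
theorem Before.of_prefix {h h' : History n M A B T} {o₁ o₂ : Fin n × ℕ} (hb : h'.Before o₁ o₂)
    (hp : h <+: h') (hc : o₂.2 < (callsOf o₂.1 h).length) : h.Before o₁ o₂ := by
  rw [before_iff] at *
  obtain ⟨h₁, h₂, h₃, h₄, -⟩ := hb
  refine ⟨h₁, ?_, h₃, h₄, hc⟩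
  rcases List.prefix_or_prefix_of_prefix h₂ hp with h | h
  · exact h
  · have := (callsOf_prefix h o₂.1).length_le
    omega

theorem Before.lt_rets {h : History n M A B T} {o₁ o₂ : Fin n × ℕ} (hb : h.Before o₁ o₂) :
    o₁.2 < (retsOf o₁.1 h).length := by
  rw [before_iff] at hb
  obtain ⟨h₁, h₂, h₃, -⟩ := hb
  exact h₃.trans_le (retsOf_prefix h₂ _).length_le

theorem before_of_lt {h : History n M A B T} {o₁ o₂ : Fin n × ℕ} {h' : History n M A B T}
    (hp : h <+: h') (h₁ : o₁.2 < (retsOf o₁.1 h).length) (h₂ : (callsOf o₂.1 h).length ≤ o₂.2)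
    (h₃ : o₂.2 < (callsOf o₂.1 h').length) : h'.Before o₁ o₂ :=
  (before_iff _ _ _).2 ⟨h, hp, h₁, h₂, h₃⟩

theorem callsOf_proj (i : Fin n) (h : History n M A B T) : callsOf i (h.proj i) = callsOf i h := by
  induction h with
  | nil => rfl
  | cons x h ih =>
    cases x with
    | call j m a t =>
      rcases eq_or_ne j i with rfl | hj
      · simpa [proj, Act.pid] using ih
      · rw [callsOf_cons_call_of_ne hj, ← ih]; simp [proj, Act.pid, hj]
    | ret j m b t =>
      rcases eq_or_ne j i with rfl | hj
      · simpa [proj, Act.pid] using ih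
      · rw [callsOf_cons_ret, ← ih]; simp [proj, Act.pid, hj]

theorem retsOf_proj (i : Fin n) (h : History n M A B T) : retsOf i (h.proj i) = retsOf i h := by
  induction h with
  | nil => rfl
  | cons x h ih =>
    cases x with
    | call j m a t =>
      rcases eq_or_ne j i with rfl | hj
      · simpa [proj, Act.pid] using ih
      · rw [retsOf_cons_call, ← ih]; simp [proj, Act.pid, hj]
    | ret j m b t =>
      rcases eq_or_ne j i with rfl | hj
      · simpa [proj, Act.pid] using ih
      · rw [retsOf_cons_ret_of_ne hj, ← ih]; simp [proj, Act.pid, hj]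

theorem retsOf_complete (i : Fin n) (h : History n M A B T) :
    retsOf i h.complete = retsOf i h := by
  induction h with
  | nil => rfl
  | cons x h ih =>
    cases x with
    | call j m a t => rw [complete]; split <;> simpa using ih
    | ret j m b t =>
      rw [complete]
      rcases eq_or_ne j i with rfl | hj
      · simpa using ih
      · simpa [retsOf_cons_ret_of_ne hj] using ih

theorem callsOf_complete_of_rets {i : Fin n} {h : History n M A B T} (hr : rets i h = 0) :
    callsOf i h.complete = [] := by
  induction h with
  | nil => rfl
  | cons x h ih =>
    have hr' : rets i h = 0 := by
      rw [rets_eq] at *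
      have := (List.sublist_cons_self x h).filterMap (Act.retData i)
      exact Nat.le_zero.1 (hr ▸ this.length_le)
    cases x with
    | call j m a t =>
      rw [complete]
      split
      · rename_i h0
        have hj : j ≠ i := by rintro rfl; omega
        rw [callsOf_cons_call_of_ne hj]; exact ih hr'
      · exact ih hr'
    | ret j m b t => rw [complete]; exact ih hr'

/-- If no return of `i` follows a call, none follows a later call. So completion cuts off a tail of
the calls of each process. -/
theorem callsOf_complete_prefix (i : Fin n) (h : History n M A B T) :
    callsOf i h.complete <+: callsOf i h := by
  induction h with
  | nil => exact List.prefix_rfl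
  | cons x h ih =>
    cases x with
    | call j m a t =>
      rw [complete]
      rcases eq_or_ne j i with rfl | hj
      · split
        · simpa using ih
        · rename_i h0
          rw [callsOf_complete_of_rets (by omega)]
          exact List.nil_prefix
      · rw [callsOf_cons_call_of_ne hj]
        split
        · rwa [callsOf_cons_call_of_ne hj]
        · exact ih
    | ret j m b t => rw [complete]; exact ih

theorem rets_proj (i : Fin n) (h : History n M A B T) : rets i (h.proj i) = rets i h := by
  rw [rets_eq, rets_eq, retsOf_proj]

/-- Whether a call is pending depends on the returns of its own process only. -/
theorem complete_proj (i : Fin n) (h : History n M A B T) :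
    h.complete.proj i = (h.proj i).complete := by
  induction h with
  | nil => rfl
  | cons x h ih =>
    have hself : ∀ y : Act n M A B T, y.pid = i → ∀ h : History n M A B T,
        proj (y :: h) i = y :: proj h i := fun y hy h => by simp [proj, hy]
    have hne : ∀ y : Act n M A B T, y.pid ≠ i → ∀ h : History n M A B T,
        proj (y :: h) i = proj h i := fun y hy h => by simp [proj, hy]
    by_cases hx : x.pid = i
    · rw [hself x hx]
      cases x with
      | call j m a t =>
        obtain rfl : j = i := hx
        rw [complete, complete, rets_proj]
        split
        · rw [hself _ rfl, ih]
        · exact ih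
      | ret j m b t =>
        rw [complete, complete, hself _ hx, ih]
    · rw [hne x hx, ← ih]
      cases x with
      | call j m a t =>
        rw [complete]
        split
        · exact hne _ hx _
        · rfl
      | ret j m b t => rw [complete]; exact hne _ hx _

/-- The history of a single process in which calls and returns alternate. -/
def interleave (i : Fin n) : List (M × A × T) → List (M × B × T) → History n M A B T
  | c :: cs, r :: rs => .call i c.1 c.2.1 c.2.2 :: .ret i r.1 r.2.1 r.2.2 :: interleave i cs rs
  | cs, [] => cs.map fun c => .call i c.1 c.2.1 c.2.2
  | [], rs => rs.map fun r => .ret i r.1 r.2.1 r.2.2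

theorem interleave_snoc_call (i : Fin n) {cs : List (M × A × T)} {rs : List (M × B × T)}
    (h : cs.length = rs.length) (c : M × A × T) :
    interleave i (cs ++ [c]) rs = interleave i cs rs ++ [.call i c.1 c.2.1 c.2.2] := by
  induction cs generalizing rs with
  | nil => cases rs with
    | nil => rfl
    | cons => simp at h
  | cons d cs ih => cases rs with
    | nil => simp at h
    | cons r rs => simp [interleave, ih (by simpa using h)]

theorem interleave_snoc_ret (i : Fin n) {cs : List (M × A × T)} {rs : List (M × B × T)}
    (h : cs.length = rs.length + 1) (r : M × B × T) :
    interleave i cs (rs ++ [r]) = interleave i cs rs ++ [.ret i r.1 r.2.1 r.2.2] := by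
  induction cs generalizing rs with
  | nil => simp at h
  | cons d cs ih => cases rs with
    | nil =>
      obtain rfl : cs = [] := by simpa using h
      rfl
    | cons r rs => simp [interleave, ih (by simpa using h)]

/-- A call that has a partner in `rs` is followed by it, while no return follows the calls beyond
the last one. -/
theorem complete_interleave (i : Fin n) {cs : List (M × A × T)} {rs : List (M × B × T)}
    (h : rs.length ≤ cs.length) :
    (interleave i cs rs).complete = interleave i (cs.take rs.length) rs := by
  induction cs generalizing rs with
  | nil =>
    obtain rfl : rs = [] := by simpa using h
    rfl
  | cons c cs ih => cases rs with
    | nil =>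
      have hr : ∀ cs : List (M × A × T), rets i
          (cs.map fun c => (Act.call i c.1 c.2.1 c.2.2 : Act n M A B T)) = 0 := by
        intro cs; simp [rets, Act.isRet]
      have : ∀ cs : List (M × A × T), complete
          (cs.map fun c => (Act.call i c.1 c.2.1 c.2.2 : Act n M A B T)) = [] := by
        intro cs
        induction cs with
        | nil => rfl
        | cons c cs ih => rw [List.map_cons, complete, hr, if_neg (by simp), ih]
      simp only [interleave]
      rw [this]; rfl
    | cons r rs =>
      rw [interleave, complete, complete, ih (by simpa using h), if_pos]
      · rfl
      · rw [rets_eq, retsOf_cons_ret_self]; simp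

/-- Every process alternates between calls and returns. -/
def Alternating (h : History n M A B T) : Prop :=
  ∀ i, h.proj i = interleave i (callsOf i h) (retsOf i h) ∧
    (retsOf i h).length ≤ (callsOf i h).length ∧
    (callsOf i h).length ≤ (retsOf i h).length + 1

theorem alternating_nil : Alternating ([] : History n M A B T) :=
  fun _ => ⟨rfl, le_rfl, Nat.zero_le _⟩

theorem proj_append (h h' : History n M A B T) (i : Fin n) :
    (h ++ h').proj i = h.proj i ++ h'.proj i := List.filter_append ..

theorem Alternating.snoc_call {h : History n M A B T} (hh : h.Alternating) {i : Fin n}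
    (hi : (callsOf i h).length = (retsOf i h).length) (m : M) (a : A) (t : T) :
    Alternating (h ++ [.call i m a t]) := by
  intro j
  obtain ⟨h₁, h₂, h₃⟩ := hh j
  rcases eq_or_ne i j with rfl | hij
  · simp only [proj_append, callsOf_append, retsOf_append, retsOf_cons_call, retsOf_nil,
      callsOf_cons_call_self, callsOf_nil, List.append_nil, List.length_append,
      List.length_singleton]
    refine ⟨?_, by omega, by omega⟩
    rw [interleave_snoc_call i hi, ← h₁]
    simp [proj, Act.pid]
  · simp only [proj_append, callsOf_append, retsOf_append, retsOf_cons_call, retsOf_nil,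
      callsOf_cons_call_of_ne hij, callsOf_nil, List.append_nil]
    refine ⟨?_, h₂, h₃⟩
    rw [← h₁]
    simp [proj, Act.pid, hij]

theorem Alternating.snoc_ret {h : History n M A B T} (hh : h.Alternating) {i : Fin n}
    (hi : (callsOf i h).length = (retsOf i h).length + 1) (m : M) (b : B) (t : T) :
    Alternating (h ++ [.ret i m b t]) := by
  intro j
  obtain ⟨h₁, h₂, h₃⟩ := hh j
  rcases eq_or_ne i j with rfl | hij
  · simp only [proj_append, callsOf_append, retsOf_append, callsOf_cons_ret, retsOf_nil,
      retsOf_cons_ret_self, callsOf_nil, List.append_nil, List.length_append,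
      List.length_singleton]
    refine ⟨?_, by omega, by omega⟩
    rw [interleave_snoc_ret i hi, ← h₁]
    simp [proj, Act.pid]
  · simp only [proj_append, callsOf_append, retsOf_append, callsOf_cons_ret, retsOf_nil,
      retsOf_cons_ret_of_ne hij, callsOf_nil, List.append_nil]
    refine ⟨?_, h₂, h₃⟩
    rw [← h₁]
    simp [proj, Act.pid, hij]

end History

open History

theorem seqHistory_cons (o : OpInst n M A B T) (l : List (OpInst n M A B T)) :
    seqHistory (o :: l) =
      .call o.pid o.m o.a o.tag :: .ret o.pid o.m o.b o.tag :: seqHistory l := rfl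

theorem seqHistory_append (l l' : List (OpInst n M A B T)) :
    seqHistory (l ++ l') = seqHistory l ++ seqHistory l' := List.flatMap_append

theorem callsOf_seqHistory (i : Fin n) (l : List (OpInst n M A B T)) :
    callsOf i (seqHistory l) = (opsOf i l).map OpInst.callData := by
  induction l with
  | nil => rfl
  | cons o l ih =>
    rw [seqHistory_cons]
    by_cases h : o.pid = i
    · subst h
      rw [callsOf_cons_call_self, callsOf_cons_ret, ih, opsOf_cons_self]; rfl
    · rw [callsOf_cons_call_of_ne h, callsOf_cons_ret, ih, opsOf_cons_of_ne h]

theorem retsOf_seqHistory (i : Fin n) (l : List (OpInst n M A B T)) :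
    retsOf i (seqHistory l) = (opsOf i l).map OpInst.retData := by
  induction l with
  | nil => rfl
  | cons o l ih =>
    rw [seqHistory_cons]
    by_cases h : o.pid = i
    · subst h
      rw [retsOf_cons_call, retsOf_cons_ret_self, ih, opsOf_cons_self]; rfl
    · rw [retsOf_cons_call, retsOf_cons_ret_of_ne h, ih, opsOf_cons_of_ne h]

theorem proj_seqHistory (i : Fin n) (l : List (OpInst n M A B T)) : (seqHistory l).proj i =
    interleave i ((opsOf i l).map OpInst.callData) ((opsOf i l).map OpInst.retData) := by
  induction l with
  | nil => rfl
  | cons o l ih =>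
    rw [seqHistory_cons]
    by_cases h : o.pid = i
    · subst h
      rw [opsOf_cons_self]
      simp only [List.map_cons, interleave, ← ih]
      simp [proj, Act.pid, OpInst.callData, OpInst.retData]
    · rw [opsOf_cons_of_ne h, ← ih]
      simp [proj, Act.pid, h]

/-- The real-time order of a sequence of operations. -/
def OpBefore (l : List (OpInst n M A B T)) (o₁ o₂ : Fin n × ℕ) : Prop :=
  ∃ l₁, l₁ <+: l ∧ o₁.2 < (opsOf o₁.1 l₁).length ∧ (opsOf o₂.1 l₁).length ≤ o₂.2 ∧
    o₂.2 < (opsOf o₂.1 l).length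

theorem OpBefore.mono {l l' : List (OpInst n M A B T)} {o₁ o₂ : Fin n × ℕ} (h : OpBefore l o₁ o₂)
    (hp : l <+: l') : OpBefore l' o₁ o₂ := by
  obtain ⟨l₁, h₁, h₂, h₃, h₄⟩ := h
  exact ⟨l₁, h₁.trans hp, h₂, h₃, h₄.trans_le (opsOf_prefix hp _).length_le⟩

/-- The only cut that does not fall between two operations separates the call of an operation from
its return. -/
theorem prefix_seqHistory {h : History n M A B T} {l : List (OpInst n M A B T)}
    (hp : h <+: seqHistory l) : ∃ l₁, l₁ <+: l ∧ (h = seqHistory l₁ ∨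
      ∃ o : OpInst n M A B T, h = seqHistory l₁ ++ [.call o.pid o.m o.a o.tag]) := by
  induction l generalizing h with
  | nil =>
    obtain rfl : h = [] := List.prefix_nil.1 hp
    exact ⟨[], List.prefix_rfl, .inl rfl⟩
  | cons o l ih =>
    rw [seqHistory_cons] at hp
    rcases h with _ | ⟨x, _ | ⟨y, h⟩⟩
    · exact ⟨[], List.nil_prefix, .inl rfl⟩
    · refine ⟨[], List.nil_prefix, .inr ⟨o, ?_⟩⟩
      rw [(List.cons_prefix_cons.1 hp).1]; rfl
    · obtain ⟨rfl, hp₁⟩ := List.cons_prefix_cons.1 hp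
      obtain ⟨rfl, hp₂⟩ := List.cons_prefix_cons.1 hp₁
      obtain ⟨l₁, h₁, h₂⟩ := ih hp₂
      refine ⟨o :: l₁, List.cons_prefix_cons.2 ⟨rfl, h₁⟩, ?_⟩
      rcases h₂ with rfl | ⟨o', rfl⟩
      · exact .inl rfl
      · exact .inr ⟨o', rfl⟩

theorem seqHistory_prefix {l l' : List (OpInst n M A B T)} (h : l <+: l') :
    seqHistory l <+: seqHistory l' := by
  obtain ⟨k, rfl⟩ := h
  rw [seqHistory_append]
  exact List.prefix_append _ _

/-- A prefix that ends inside an operation may be shortened by the dangling call: this removes no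
return and cannot increase the number of calls. So precedence can be read off the list of
operations. -/
theorem before_seqHistory {l : List (OpInst n M A B T)} {o₁ o₂ : Fin n × ℕ} :
    (seqHistory l).Before o₁ o₂ ↔ OpBefore l o₁ o₂ := by
  rw [before_iff]
  simp only [callsOf_seqHistory, List.length_map]
  constructor
  · rintro ⟨h₁, hp, h₂, h₃, h₄⟩
    obtain ⟨l₁, hl, rfl | ⟨o, rfl⟩⟩ := prefix_seqHistory hp
    · simp only [callsOf_seqHistory, retsOf_seqHistory, List.length_map] at h₂ h₃
      exact ⟨l₁, hl, h₂, h₃, h₄⟩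
    · simp only [retsOf_append, callsOf_append, retsOf_cons_call, retsOf_nil, callsOf_seqHistory,
        retsOf_seqHistory, List.length_map, List.length_append, List.append_nil] at h₂ h₃
      exact ⟨l₁, hl, h₂, by omega, h₄⟩
  · rintro ⟨l₁, hp, h₂, h₃, h₄⟩
    refine ⟨seqHistory l₁, seqHistory_prefix hp, ?_, ?_, h₄⟩
    · simpa [retsOf_seqHistory] using h₂
    · simpa [callsOf_seqHistory] using h₃

/-- A description of linearizations by process: `l` contains, for each process, all operations that
have returned in `h` and possibly the pending one, and respects the order of `h`. -/
structure Lin (S : SeqSpec M A B) (h : History n M A B T) (l : List (OpInst n M A B T)) :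
    Prop where
  word : opWord l ∈ S.traces
  calls : ∀ i, (opsOf i l).map OpInst.callData <+: callsOf i h
  rets : ∀ i, retsOf i h <+: (opsOf i l).map OpInst.retData
  order : ∀ o₁ o₂ : Fin n × ℕ, o₂.2 < (opsOf o₂.1 l).length → h.Before o₁ o₂ → OpBefore l o₁ o₂

theorem callsOf_of_isRet {r : History n M A B T} (hr : ∀ x ∈ r, x.isRet = true) (i : Fin n) :
    callsOf i r = [] := by
  refine List.filterMap_eq_nil_iff.2 fun x hx => ?_
  cases x with
  | call => simpa [Act.isRet] using hr _ hx
  | ret => rfl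

/-- The appended events are returns, so the calls are those of `h`, and completion drops no return.
Equality of process subhistories then compares calls with calls and returns with returns. -/
theorem IsLinearization.lin {S : SeqSpec M A B} {h : History n M A B T}
    {l : List (OpInst n M A B T)} (hl : IsLinearization S h l) : Lin S h l := by
  obtain ⟨hw, r, hr, hp, ho⟩ := hl
  have hrets : ∀ i, retsOf i (h ++ r) = (opsOf i l).map OpInst.retData := fun i => by
    rw [← retsOf_seqHistory, ← retsOf_proj i (seqHistory l), ← hp, retsOf_proj, retsOf_complete]
  refine ⟨hw, fun i => ?_, fun i => ?_, fun o₁ o₂ h₂ hb => ?_⟩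
  · have := callsOf_complete_prefix i (h ++ r)
    rwa [callsOf_append, callsOf_of_isRet hr, List.append_nil, ← callsOf_proj, hp, callsOf_proj,
      callsOf_seqHistory] at this
  · rw [← hrets, retsOf_append]
    exact List.prefix_append _ _
  · refine before_seqHistory.1 (ho o₁ o₂ ?_ hb)
    rwa [rets_eq, hrets, List.length_map]

/-- Only the subhistories of the processes matter, so their blocks of returns may be concatenated in
any order. -/
theorem exists_returns (f : Fin n → List (M × B × T)) : ∃ r : History n M A B T,
    (∀ x ∈ r, x.isRet = true) ∧
      ∀ i, r.proj i = (f i).map fun d => Act.ret i d.1 d.2.1 d.2.2 := by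
  suffices h : ∀ L : List (Fin n), L.Nodup → ∃ r : History n M A B T,
      (∀ x ∈ r, x.isRet = true) ∧
        (∀ i ∈ L, r.proj i = (f i).map fun d => Act.ret i d.1 d.2.1 d.2.2) ∧
        ∀ i ∉ L, r.proj i = [] by
    obtain ⟨r, h₁, h₂, -⟩ := h _ (List.nodup_finRange n)
    exact ⟨r, h₁, fun i => h₂ i (List.mem_finRange i)⟩
  intro L
  induction L with
  | nil => exact fun _ => ⟨[], by simp, by simp, fun _ _ => rfl⟩
  | cons j L ih =>
    intro hL
    obtain ⟨r, h₁, h₂, h₃⟩ := ih (List.nodup_cons.1 hL).2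
    have hself : History.proj ((f j).map fun d => (Act.ret j d.1 d.2.1 d.2.2 : Act n M A B T)) j =
        (f j).map fun d => Act.ret j d.1 d.2.1 d.2.2 := by
      refine List.filter_eq_self.2 fun x hx => ?_
      obtain ⟨d, -, rfl⟩ := List.mem_map.1 hx
      simp [Act.pid]
    have hne : ∀ i, i ≠ j → History.proj
        ((f j).map fun d => (Act.ret j d.1 d.2.1 d.2.2 : Act n M A B T)) i = [] := by
      refine fun i hi => List.filter_eq_nil_iff.2 fun x hx => ?_
      obtain ⟨d, -, rfl⟩ := List.mem_map.1 hx
      simp [Act.pid, hi.symm]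
    refine ⟨((f j).map fun d => Act.ret j d.1 d.2.1 d.2.2) ++ r, ?_, ?_, ?_⟩
    · intro x hx
      rcases List.mem_append.1 hx with hx | hx
      · obtain ⟨d, -, rfl⟩ := List.mem_map.1 hx; rfl
      · exact h₁ x hx
    · intro i hi
      rw [proj_append]
      rcases List.mem_cons.1 hi with rfl | hiL
      · rw [hself, h₃ i (List.nodup_cons.1 hL).1, List.append_nil]
      · rw [hne i (by rintro rfl; exact (List.nodup_cons.1 hL).1 hiL), h₂ i hiL, List.nil_append]
    · intro i hi
      rw [List.mem_cons, not_or] at hi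
      rw [proj_append, hne i hi.1, h₃ i hi.2]; rfl

/-- Each process appends the returns that `l` has in excess of `h`; by alternation there is at most
one. Alternation is also what allows a process subhistory to be rebuilt from its calls and its
returns. -/
theorem Lin.isLinearization {S : SeqSpec M A B} {h : History n M A B T}
    {l : List (OpInst n M A B T)} (hl : Lin S h l) (hh : h.Alternating) :
    IsLinearization S h l := by
  choose f hf using hl.rets
  obtain ⟨r, hr, hp⟩ := exists_returns (A := A) f
  have hrets : ∀ i, retsOf i r = f i := by
    intro i
    rw [← retsOf_proj, hp]
    induction f i with
    | nil => rfl
    | cons d ds ih => rw [List.map_cons, retsOf_cons_ret_self, ih]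
  refine ⟨hl.word, r, hr, fun i => ?_, fun o₁ o₂ h₂ hb => before_seqHistory.2
    (hl.order o₁ o₂ ?_ hb)⟩
  · obtain ⟨h₁, h₂, h₃⟩ := hh i
    have hlen := (hl.calls i).length_le
    have hflen := congrArg List.length (hf i)
    rw [List.length_append, List.length_map] at hflen
    rw [List.length_map] at hlen
    have key : (h ++ r).proj i =
        interleave i (callsOf i h) ((opsOf i l).map OpInst.retData) := by
      rw [proj_append, h₁, hp, ← hf]
      -- `f i` lists the missing returns of `i`; two of them would require two pending calls.
      rcases hfi : f i with _ | ⟨d, _ | ⟨e, ds⟩⟩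
      · simp
      · rw [hfi, List.length_singleton] at hflen
        rw [interleave_snoc_ret i (by omega)]; rfl
      · rw [hfi] at hflen
        simp only [List.length_cons] at hflen
        omega
    rw [complete_proj, key, complete_interleave i (by simpa using hlen), proj_seqHistory]
    congr 1
    have := List.prefix_iff_eq_take.1 (hl.calls i)
    rw [List.length_map] at *
    exact this.symm
  · rw [rets_eq, retsOf_append, hrets, hf, List.length_map] at h₂
    exact h₂

theorem eq_of_map_eq {l l' : List (OpInst n M A B T)} {i : Fin n} (hl : ∀ o ∈ l, o.pid = i)
    (hl' : ∀ o ∈ l', o.pid = i) (h₁ : l.map OpInst.callData = l'.map OpInst.callData)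
    (h₂ : l.map OpInst.retData = l'.map OpInst.retData) : l = l' := by
  induction l generalizing l' with
  | nil => cases l' with
    | nil => rfl
    | cons => simp at h₁
  | cons o l ih => cases l' with
    | nil => simp at h₁
    | cons o' l' =>
      simp only [List.map_cons, List.cons.injEq] at h₁ h₂
      rw [ih (fun x hx => hl x (List.mem_cons_of_mem _ hx))
        (fun x hx => hl' x (List.mem_cons_of_mem _ hx)) h₁.2 h₂.2]
      congr 1
      have e₁ := hl o List.mem_cons_self
      have e₂ := hl' o' List.mem_cons_self
      obtain ⟨e₃, e₄⟩ := And.intro h₁.1 h₂.1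
      cases o; cases o'
      simp_all [OpInst.callData, OpInst.retData]

/-- A sequential history has at most one linearization. -/
theorem Lin.eq_of_seqHistory {S : SeqSpec M A B} {l l' : List (OpInst n M A B T)}
    (h : Lin S (seqHistory l) l') : l' = l := by
  have hops : ∀ i, opsOf i l' = opsOf i l := by
    intro i
    have h₁ := h.calls i
    have h₂ := h.rets i
    rw [callsOf_seqHistory] at h₁
    rw [retsOf_seqHistory] at h₂
    have l₁ := h₁.length_le
    have l₂ := h₂.length_le
    rw [List.length_map, List.length_map] at l₁ l₂
    refine eq_of_map_eq (i := i) (fun o ho => (mem_opsOf.1 ho).2) (fun o ho => (mem_opsOf.1 ho).2)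
      (h₁.eq_of_length (by simp; omega)) (h₂.eq_of_length (by simp; omega)).symm
  -- The operations agree for each process by `hops`, so only the interleaving is in question; the
  -- prefixes of `l` are recovered in `l'` one operation at a time.
  have key : ∀ l₁, l₁ <+: l → l₁ <+: l' := by
    intro l₁
    induction l₁ using List.reverseRecOn with
    | nil => exact fun _ => List.nil_prefix
    | append_singleton l₁ o ih =>
      intro hp
      obtain ⟨k, hk⟩ := ih ((List.prefix_append _ _).trans hp)
      obtain ⟨k', hk'⟩ := hp
      have hcount : (opsOf o.pid l).length > (opsOf o.pid l₁).length := by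
        rw [← hk', opsOf_append, opsOf_append, opsOf_singleton_self]
        simp
      rcases k with _ | ⟨o', k⟩
      · rw [List.append_nil] at hk
        rw [← hops, ← hk] at hcount
        omega
      by_cases hpid : o'.pid = o.pid
      · have e := hops o.pid
        rw [← hk, ← hk', List.append_assoc, opsOf_append, opsOf_append, List.singleton_append,
          opsOf_cons_self, ← hpid, opsOf_cons_self, List.append_cancel_left_eq] at e
        obtain rfl := (List.cons.inj e).1
        exact ⟨k, by rw [← hk]; simp⟩
      · exfalso
        -- If `l'` continued with an operation `o'` of another process instead of `o`, then `o`
        -- would precede `o'` in `l`, and some prefix of `l'` would contain `o` but not `o'`.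
        -- Comparison with `l₁ ++ [o']` excludes this.
        have hb : OpBefore l (o.pid, (opsOf o.pid l₁).length)
            (o'.pid, (opsOf o'.pid l₁).length) := by
          refine ⟨l₁ ++ [o], ⟨k', hk'⟩, ?_, ?_, ?_⟩
          · simp [opsOf_append, opsOf_singleton_self]
          · simp [opsOf_append, opsOf_singleton_of_ne (Ne.symm hpid)]
          · rw [← hops, ← hk, opsOf_append, opsOf_cons_self]; simp
        obtain ⟨l₂, hl₂, h₁, h₂, -⟩ :=
          h.order _ _ (by simpa [hops] using hb.choose_spec.2.2.2) (before_seqHistory.2 hb)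
        simp only at h₁ h₂
        have hl₃ : l₁ ++ [o'] <+: l' := ⟨k, by rw [← hk]; simp⟩
        rcases List.prefix_or_prefix_of_prefix hl₂ hl₃ with hc | hc
        · have := (opsOf_prefix hc o.pid).length_le
          rw [opsOf_append, opsOf_singleton_of_ne hpid, List.append_nil] at this
          omega
        · have := (opsOf_prefix hc o'.pid).length_le
          rw [opsOf_append, opsOf_singleton_self, List.length_append, List.length_singleton] at this
          omega
  obtain ⟨k, hk⟩ := key l List.prefix_rfl
  have : k = [] := by
    rcases k with _ | ⟨o, k⟩
    · rfl
    · have := congrArg List.length (hops o.pid)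
      rw [← hk, opsOf_append, opsOf_cons_self] at this
      simp at this
  rw [← hk, this, List.append_nil]

theorem lin_nil (S : SeqSpec M A B) : Lin S ([] : History n M A B T) [] :=
  ⟨⟨_, .nil _⟩, fun _ => List.prefix_rfl, fun _ => List.prefix_rfl, fun _ _ h => by simp at h⟩

end Histories

end ConcLat

namespace ConcLat

/-! ### The atomic object, which every admissible object simulates -/

section AtomicObject

open History

variable {n : ℕ} {M A B : Type u}

namespace SeqSpec

variable {S : SeqSpec M A B}

theorem Run.append {q q' q'' : S.State} {v w : List (M × A × B)} (h₁ : S.Run q v q')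
    (h₂ : S.Run q' w q'') : S.Run q (v ++ w) q'' := by
  induction h₁ with
  | nil => exact h₂
  | cons hs _ ih => exact .cons hs (ih h₂)

theorem run_append_iff {q q'' : S.State} {v w : List (M × A × B)} :
    S.Run q (v ++ w) q'' ↔ ∃ q', S.Run q v q' ∧ S.Run q' w q'' := by
  refine ⟨fun h => ?_, fun ⟨_, h₁, h₂⟩ => h₁.append h₂⟩
  induction v generalizing q with
  | nil => exact ⟨q, .nil q, h⟩
  | cons o v ih =>
    cases h with
    | cons hs h =>
      obtain ⟨q', h₁, h₂⟩ := ih h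
      exact ⟨q', .cons hs h₁, h₂⟩

theorem run_singleton_iff {q q' : S.State} {o : M × A × B} :
    S.Run q [o] q' ↔ S.step q o.1 o.2.1 o.2.2 q' := by
  constructor
  · intro h
    cases h with
    | cons hs h => cases h; exact hs
  · exact fun h => .cons h (.nil _)

theorem Run.snoc {q q' q'' : S.State} {w : List (M × A × B)} {m : M} {a : A} {b : B}
    (h : S.Run q w q') (hs : S.step q' m a b q'') : S.Run q (w ++ [(m, a, b)]) q'' :=
  h.append (run_singleton_iff.2 hs)

theorem Run.unique (hdet : S.Deterministic) {q q' q'' : S.State} {w : List (M × A × B)}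
    (h₁ : S.Run q w q') (h₂ : S.Run q w q'') : q' = q'' := by
  induction h₁ with
  | nil => cases h₂; rfl
  | cons hs _ ih =>
    cases h₂ with
    | cons hs₂ h₂ =>
      obtain ⟨-, rfl⟩ := hdet _ _ _ _ _ _ _ hs hs₂
      exact ih h₂

end SeqSpec

theorem opWord_append {T : Type} (l l' : List (OpInst n M A B T)) :
    opWord (l ++ l') = opWord l ++ opWord l' := List.map_append

/-- The process states of the atomic object. -/
inductive AtomicPc (M A B : Type u) : Type u
  | idle
  | called (m : M) (a : A)
  | done (m : M) (b : B)

/-- The transitions of the atomic object, which executes each operation in a single step between its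
call and its return. -/
inductive AtomicStep (n : ℕ) (S : SeqSpec M A B) : S.State × (Fin n → AtomicPc M A B) →
    Label n M A B → S.State × (Fin n → AtomicPc M A B) → Prop
  | call (q : S.State) (f : Fin n → AtomicPc M A B) (i : Fin n) (m : M) (a : A) :
      f i = .idle → AtomicStep n S (q, f) (.call i m a) (q, Function.update f i (.called m a))
  | apply (q q' : S.State) (f : Fin n → AtomicPc M A B) (i : Fin n) (m : M) (a : A) (b : B) :
      f i = .called m a → S.step q m a b q' →
      AtomicStep n S (q, f) (.tau i) (q', Function.update f i (.done m b))
  | ret (q : S.State) (f : Fin n → AtomicPc M A B) (i : Fin n) (m : M) (b : B) :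
      f i = .done m b → AtomicStep n S (q, f) (.ret i m b) (q, Function.update f i .idle)

/-- The atomic object. -/
def atomicLTS (n : ℕ) (S : SeqSpec M A B) : LTS n M A B where
  State := S.State × (Fin n → AtomicPc M A B)
  init := (S.init, fun _ => .idle)
  step := AtomicStep n S

/-- The history `h` and the executed operations `l` agree on process `i`. -/
def AtomicPc.Agrees (i : Fin n) (h : History n M A B Unit) (l : List (OpInst n M A B Unit)) :
    AtomicPc M A B → Prop
  | .idle => callsOf i h = (opsOf i l).map OpInst.callData ∧
      retsOf i h = (opsOf i l).map OpInst.retData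
  | .called m a => callsOf i h = (opsOf i l).map OpInst.callData ++ [(m, a, ())] ∧
      retsOf i h = (opsOf i l).map OpInst.retData
  | .done m b => callsOf i h = (opsOf i l).map OpInst.callData ∧
      retsOf i h ++ [(m, b, ())] = (opsOf i l).map OpInst.retData

theorem AtomicPc.Agrees.congr {i : Fin n} {h h' : History n M A B Unit}
    {l l' : List (OpInst n M A B Unit)} {x : AtomicPc M A B} (hx : x.Agrees i h l)
    (h₁ : callsOf i h' = callsOf i h) (h₂ : retsOf i h' = retsOf i h)
    (h₃ : opsOf i l' = opsOf i l) : x.Agrees i h' l' := by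
  cases x <;> simpa only [AtomicPc.Agrees, h₁, h₂, h₃] using hx

theorem AtomicPc.Agrees.rets_prefix {i : Fin n} {h : History n M A B Unit}
    {l : List (OpInst n M A B Unit)} {x : AtomicPc M A B} (hx : x.Agrees i h l) :
    retsOf i h <+: (opsOf i l).map OpInst.retData := by
  cases x with
  | idle => exact hx.2 ▸ List.prefix_rfl
  | called => exact hx.2 ▸ List.prefix_rfl
  | done => exact ⟨_, hx.2⟩

theorem AtomicPc.Agrees.calls_prefix {i : Fin n} {h : History n M A B Unit}
    {l : List (OpInst n M A B Unit)} {x : AtomicPc M A B} (hx : x.Agrees i h l) :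
    (opsOf i l).map OpInst.callData <+: callsOf i h := by
  cases x with
  | idle => exact hx.1 ▸ List.prefix_rfl
  | called => exact ⟨_, hx.1.symm⟩
  | done => exact hx.1 ▸ List.prefix_rfl

theorem AtomicPc.agrees_update {f : Fin n → AtomicPc M A B} {h h' : History n M A B Unit}
    {l l' : List (OpInst n M A B Unit)} (hf : ∀ j, (f j).Agrees j h l) (i : Fin n)
    (h₁ : ∀ j, j ≠ i → callsOf j h' = callsOf j h) (h₂ : ∀ j, j ≠ i → retsOf j h' = retsOf j h)
    (h₃ : ∀ j, j ≠ i → opsOf j l' = opsOf j l) {x : AtomicPc M A B} (hx : x.Agrees i h' l') (j : Fin n) :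
    (Function.update f i x j).Agrees j h' l' := by
  rcases eq_or_ne j i with rfl | hj
  · simpa using hx
  · simpa [hj] using (hf j).congr (h₁ j hj) (h₂ j hj) (h₃ j hj)

/-- The operations in the order of their internal steps form a linearization, as each takes effect
between its call and its return. Calls that have not been executed are left pending. -/
theorem atomicLTS_linearizable (n : ℕ) (S : SeqSpec M A B) : (atomicLTS n S).Linearizable S := by
  intro w q hw
  suffices h : (historyOf w).Alternating ∧ ∃ l, S.Run S.init (opWord l) q.1 ∧
      (∀ i, (q.2 i).Agrees i (historyOf w) l) ∧
      ∀ o₁ o₂ : Fin n × ℕ, o₂.2 < (opsOf o₂.1 l).length → (historyOf w).Before o₁ o₂ →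
        OpBefore l o₁ o₂ by
    obtain ⟨halt, l, hr, hp, ho⟩ := h
    exact ⟨l, Lin.isLinearization ⟨⟨_, hr⟩, fun i => (hp i).calls_prefix,
      fun i => (hp i).rets_prefix, ho⟩ halt⟩
  refine LTS.Exec.snoc_induction (L := atomicLTS n S)
    (p := fun w q => (historyOf w).Alternating ∧ ∃ l, S.Run S.init (opWord l) q.1 ∧
      (∀ i, (q.2 i).Agrees i (historyOf w) l) ∧
      ∀ o₁ o₂ : Fin n × ℕ, o₂.2 < (opsOf o₂.1 l).length → (historyOf w).Before o₁ o₂ →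
        OpBefore l o₁ o₂) ?_ ?_ hw
  · exact ⟨alternating_nil, [], .nil _, fun _ => ⟨rfl, rfl⟩, fun _ _ h => by simp at h⟩
  rintro w q α q' - ⟨halt, l, hr, hp, ho⟩ hs
  have hlen : ∀ {i : Fin n}, (opsOf i l).length ≤ (callsOf i (historyOf w)).length := by
    intro i
    simpa using (hp i).calls_prefix.length_le
  rw [historyOf_append]
  generalize historyOf w = h at *
  -- A new event creates no precedence among executed operations, since these have already been
  -- called.
  have hbefore : ∀ x, ∀ o₁ o₂ : Fin n × ℕ, o₂.2 < (opsOf o₂.1 l).length →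
      (h ++ [x]).Before o₁ o₂ → OpBefore l o₁ o₂ := fun x o₁ o₂ h₂ hb =>
    ho o₁ o₂ h₂ (hb.of_prefix (List.prefix_append _ _) (h₂.trans_le hlen))
  cases hs with
  | call q f i m a hi =>
    have hpi := hp i
    simp only [hi] at hpi
    obtain ⟨hc, hr'⟩ := hpi
    rw [historyOf_call]
    refine ⟨halt.snoc_call (by simp [hc, hr']) _ _ _, l, hr, ?_, hbefore _⟩
    refine AtomicPc.agrees_update hp i (fun j hj => ?_) (fun j _ => by simp) (fun _ _ => rfl) ?_
    · simp [callsOf_cons_call_of_ne hj.symm]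
    · simp [AtomicPc.Agrees, hc, hr']
  | ret q f i m b hi =>
    have hpi := hp i
    simp only [hi] at hpi
    obtain ⟨hc, hr'⟩ := hpi
    rw [historyOf_ret]
    have hl := congrArg List.length hr'
    simp only [List.length_append, List.length_map, List.length_singleton] at hl
    refine ⟨halt.snoc_ret (by simp [hc, ← hl]) _ _ _, l, hr, ?_, hbefore _⟩
    refine AtomicPc.agrees_update hp i (fun j hj => by simp) (fun j hj => ?_) (fun _ _ => rfl) ?_
    · simp [retsOf_cons_ret_of_ne hj.symm]
    · simp [AtomicPc.Agrees, hc, hr']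
  | apply q q' f i m a b hi hs =>
    have hpi := hp i
    simp only [hi] at hpi
    obtain ⟨hc, hr'⟩ := hpi
    rw [historyOf_tau, List.append_nil]
    refine ⟨halt, l ++ [⟨i, m, a, b, ()⟩], ?_, ?_, ?_⟩
    · rw [opWord_append]
      exact hr.snoc hs
    · have hself : opsOf i [(⟨i, m, a, b, ()⟩ : OpInst n M A B Unit)] = [⟨i, m, a, b, ()⟩] :=
        opsOf_singleton_self _
      refine AtomicPc.agrees_update hp i (fun _ _ => rfl) (fun _ _ => rfl) (fun j hj => ?_) ?_
      · rw [opsOf_append, opsOf_singleton_of_ne (Ne.symm hj), List.append_nil]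
      · simp [AtomicPc.Agrees, hc, hr', opsOf_append, hself, OpInst.callData, OpInst.retData]
    · intro o₁ o₂ h₂ hb
      by_cases h₃ : o₂.2 < (opsOf o₂.1 l).length
      · exact (ho o₁ o₂ h₃ hb).mono (List.prefix_append _ _)
      -- `o₂` is the operation just executed; an operation before it has returned and is therefore
      -- already in `l`.
      · refine ⟨l, List.prefix_append _ _, ?_, by omega, h₂⟩
        have := hb.lt_rets.trans_le (hp o₁.1).rets_prefix.length_le
        simpa using this

namespace ConcObject

variable {O : ConcObject n M A B}

/-- A command of process `i` on the shared memory and its local state. -/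
def SoloStep (O : ConcObject n M A B) (i : Fin n) (x y : O.Mem × O.Loc) : Prop :=
  O.ret x.2 = none ∧ O.step i x.1 x.2 y.1 y.2

/-- The commands of a process see only the memory and its own local state, so a solo run can be
replayed whatever the other processes are doing. `atomicLTS_sim` uses the same run in two contexts.
-/
theorem exec_of_solo {i : Fin n} {x y : O.Mem × O.Loc}
    (h : Relation.ReflTransGen (O.SoloStep i) x y) (m : M) (f : Fin n → Option (M × O.Loc)) :
    ∃ w, historyOf w = [] ∧ O.sem.Exec (⟨x.1, Function.update f i (some (m, x.2))⟩ : O.Config) w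
      (⟨y.1, Function.update f i (some (m, y.2))⟩ : O.Config) := by
  induction h with
  | refl => exact ⟨[], rfl, .nil _⟩
  | @tail y z _ hs ih =>
    obtain ⟨w, hw, he⟩ := ih
    refine ⟨w ++ [.tau i], by rw [historyOf_append, hw]; rfl, he.append (.single ?_)⟩
    have := Step.tau (O := O) ⟨y.1, Function.update f i (some (m, y.2))⟩ i m y.2 z.2 z.1
      (Function.update_self _ _ _) hs.1 hs.2
    rwa [Function.update_idem] at this

/-- Under each of the liveness properties, a process that is run alone completes its operation. -/
theorem solo_terminates {P : Liveness} (hP : O.sem.Satisfies P) {w : List (Label n M A B)}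
    {c : O.Config} (hw : O.sem.Exec O.sem.init w c) {i : Fin n} (hi : c.proc i = none) (m : M)
    (a : A) : ∃ y b, Relation.ReflTransGen (O.SoloStep i) (c.mem, O.start m a) y ∧
      O.ret y.2 = some b := by
  by_contra! hcon
  have hnone : ∀ y, Relation.ReflTransGen (O.SoloStep i) (c.mem, O.start m a) y →
      O.ret y.2 = none := fun y hy => by
    cases h : O.ret y.2 with
    | none => rfl
    | some b => exact (hcon y b hy h).elim
  have hnext : ∀ y : {y // Relation.ReflTransGen (O.SoloStep i) (c.mem, O.start m a) y},
      ∃ z : {y // Relation.ReflTransGen (O.SoloStep i) (c.mem, O.start m a) y},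
        O.SoloStep i y.1 z.1 := by
    rintro ⟨y, hy⟩
    obtain ⟨s', l', hs⟩ := O.step_total i y.1 y.2 (hnone y hy)
    exact ⟨⟨(s', l'), hy.tail ⟨hnone y hy, hs⟩⟩, hnone y hy, hs⟩
  -- If no return command is reachable, totality of the commands yields an infinite solo run. In the
  -- resulting trace `i` is starved, no return follows its call and only `i` is scheduled from then
  -- on, which none of the three properties tolerates.
  choose next hstep using hnext
  let g : ℕ → {y // Relation.ReflTransGen (O.SoloStep i) (c.mem, O.start m a) y} :=
    fun k => Nat.rec ⟨_, .refl⟩ (fun _ => next) k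
  let conf : ℕ → O.Config := fun k => ⟨(g k).1.1, Function.update c.proc i (some (m, (g k).1.2))⟩
  have hconf : ∀ k, O.Step (conf k) (.tau i) (conf (k + 1)) := by
    intro k
    have hs := hstep (g k)
    have := Step.tau (O := O) (conf k) i m (g k).1.2 (g (k + 1)).1.2 (g (k + 1)).1.1
      (Function.update_self _ _ _) hs.1 hs.2
    simpa only [conf, Function.update_idem] using this
  have hw' : O.sem.Exec O.sem.init (w ++ [.call i m a]) (conf 0) :=
    hw.append (.single (Step.call c i m a hi))
  obtain ⟨q, t, hq₀, hq, ht₁, ht₂⟩ := hw'.exists_append_infinite conf (fun _ => .tau i) rfl hconf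
  have ht₁' : ∀ k, w.length < k → t k = .tau i := by
    intro k hk
    obtain ⟨d, rfl⟩ := Nat.exists_eq_add_of_le hk
    simpa using ht₁ d
  have hcall : t w.length = .call i m a := by
    rw [ht₂ w.length (by simp)]; simp
  have hstarved : Starved t i := by
    refine ⟨⟨w.length, ⟨m, a, hcall⟩, fun j hj => ?_⟩, fun N => ⟨max N (w.length + 1), by omega, ?_⟩⟩
    · rw [ht₁' j hj]; rintro ⟨_, _, ⟨⟩⟩
    · rw [ht₁' _ (by omega)]; rfl
  have := (P.holdsOn_iff t).1 (hP t ⟨q, hq₀, hq⟩) i hstarved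
  cases P with
  | WF => exact this
  | LF =>
    obtain ⟨j, hj, i', hr⟩ := this (w.length + 1)
    rw [ht₁' j (by omega)] at hr
    obtain ⟨_, _, ⟨⟩⟩ := hr
  | OF => exact this ⟨i, w.length + 1, fun j hj => by rw [ht₁' j (by omega)]; rfl⟩

end ConcObject

/-- The correspondence of process states of the atomic object and of an object executing
operations in one go. -/
def AtomicPc.Matches (O : ConcObject n M A B) :
    AtomicPc M A B → Option (M × O.Loc) → Prop
  | .idle, x => x = none
  | .called m a, x => x = some (m, O.start m a)
  | .done m b, x => ∃ l, x = some (m, l) ∧ O.ret l = some b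

theorem AtomicPc.matches_update {O : ConcObject n M A B} {f : Fin n → AtomicPc M A B}
    {g : Fin n → Option (M × O.Loc)} (h : ∀ j, (f j).Matches O (g j)) (i : Fin n)
    {x : AtomicPc M A B} {y : Option (M × O.Loc)} (hxy : x.Matches O y) (j : Fin n) :
    (Function.update f i x j).Matches O (Function.update g i y j) := by
  rcases eq_or_ne j i with rfl | hj
  · simpa using hxy
  · simpa [hj] using h j

/-- Every admissible object simulates the atomic one: it can execute each operation without
interruption. -/
theorem atomicLTS_sim {S : SeqSpec M A B} (hdet : S.Deterministic) {P : Liveness}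
    {O : ConcObject n M A B} (hO : O.Admissible S P) : (atomicLTS n S).Sim O.sem := by
  -- The memory of `c` is also the memory after a sequential run of the operations `l` with all
  -- processes idle. Linearizability is applied to this run and not to the concurrent one, because
  -- its history has only one linearization.
  refine ⟨fun q c => ∃ l w, S.Run S.init (opWord l) q.1 ∧
    O.sem.Exec O.sem.init w (⟨c.mem, fun _ => none⟩ : O.Config) ∧ historyOf w = seqHistory l ∧
      ∀ i, (q.2 i).Matches O (c.proc i), ⟨[], [], .nil _, .nil _, rfl, fun _ => rfl⟩, ?_⟩
  rintro q (c : O.Config) α q' ⟨l, w, hl, hw, hh, hp⟩ hs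
  cases hs with
  | call q f i m a hi =>
    have hpi := hp i
    simp only [hi] at hpi
    exact ⟨[.call i m a], ⟨c.mem, Function.update c.proc i (some (m, O.start m a))⟩,
      .single (.call c i m a hpi), rfl, l, w, hl, hw, hh, AtomicPc.matches_update hp i rfl⟩
  | ret q f i m b hi =>
    have hpi := hp i
    simp only [hi] at hpi
    obtain ⟨x, hx, hb⟩ := hpi
    exact ⟨[.ret i m b], ⟨c.mem, Function.update c.proc i none⟩,
      .single (.ret c i m x b hx hb), rfl, l, w, hl, hw, hh, AtomicPc.matches_update hp i rfl⟩
  | apply q q' f i m a b hi hs =>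
    have hpi := hp i
    simp only [hi] at hpi
    obtain ⟨y, b', hy, hb'⟩ := ConcObject.solo_terminates hO.2 hw (i := i) rfl m a
    -- The solo run is carried out twice: in the concurrent configuration, as the matching path, and
    -- in the idle one, where it prolongs the sequential run.
    obtain ⟨u, hu, hu'⟩ := ConcObject.exec_of_solo hy m c.proc
    obtain ⟨v, hv, hv'⟩ := ConcObject.exec_of_solo hy m (fun _ => none)
    have hc : (⟨c.mem, Function.update c.proc i (some (m, O.start m a))⟩ : O.Config) = c := by
      rw [← hpi, Function.update_eq_self]
    simp only [hc] at hu'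
    have hseq : O.sem.Exec O.sem.init (w ++ ([.call i m a] ++ (v ++ [.ret i m b'])))
        (⟨y.1, fun _ => none⟩ : O.Config) := by
      refine hw.append (LTS.Exec.append (.single (.call _ i m a rfl)) (hv'.append (.single ?_)))
      have := ConcObject.Step.ret (O := O) ⟨y.1, Function.update (fun _ => none) i (some (m, y.2))⟩
        i m y.2 b' (by simp) hb'
      have hnone : Function.update (fun _ : Fin n => (none : Option (M × O.Loc))) i none =
          fun _ => none := Function.update_eq_self (f := fun _ => none) i
      rwa [Function.update_idem, hnone] at this
    have hhist : historyOf (w ++ ([.call i m a] ++ (v ++ [.ret i m b']))) =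
        seqHistory (l ++ [⟨i, m, a, b', ()⟩]) := by
      rw [historyOf_append, historyOf_append, historyOf_append, hv, hh, seqHistory_append]
      rfl
    -- The linearization of the sequential history is that very sequence, so `b'` is a value that
    -- `S` allows; by determinism it is the value `b` of the atomic step.
    obtain ⟨l', hl'⟩ := hO.1 _ _ hseq
    rw [hhist] at hl'
    obtain rfl := hl'.lin.eq_of_seqHistory
    obtain ⟨q'', hq''⟩ := hl'.1
    have hq₂ : S.Run S.init (opWord (l ++ [⟨i, m, a, b', ()⟩])) q'' := hq''
    rw [opWord_append, SeqSpec.run_append_iff] at hq₂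
    obtain ⟨q₁, h₁, h₂⟩ := hq₂
    obtain rfl := h₁.unique hdet hl
    obtain ⟨rfl, rfl⟩ := hdet _ _ _ _ _ _ _ hs (SeqSpec.run_singleton_iff.1 h₂)
    refine ⟨u, ⟨y.1, Function.update c.proc i (some (m, y.2))⟩, hu', hu, _, _, ?_, hseq, hhist,
      AtomicPc.matches_update hp i ⟨y.2, rfl, hb'⟩⟩
    rw [opWord_append]
    exact hl.snoc hs

end AtomicObject

end ConcLat

namespace ConcLat

/-! ### The shared list: invariant and helping -/

section ListAlgorithm

variable {n : ℕ} {D : Type u}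

/-- The program counters of the algorithm that maintains the linked list, as far as they are common to
both universal constructions. `link` comprises everything between the decision on the next node
and its insertion, and `post` what follows the loop. -/
inductive ListPc
  | idle
  | scan (cur : ℕ)
  | test
  | before
  | help (bef : ℕ)
  | prefer (bef hlp : ℕ)
  | decide (bef prf : ℕ)
  | link (bef aft : ℕ)
  | setSeq (bef aft : ℕ)
  | setHead (aft : ℕ)
  | post

/-- The commands of process `i` on the linked list; the last argument contains the node that is
decided upon. -/
inductive ListStep (i : Fin n) :
    ListMem n D → ListPc → ListMem n D → ListPc → List ℕ → Prop
  | skip (s : ListMem n D) (pc : ListPc) : ListStep i s pc s pc []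
  | announce (s : ListMem n D) (d : D) : ListStep i s .idle (s.announceNew i d) (.scan 0) []
  | scan (s : ListMem n D) (cur : ℕ) (j : Fin n) :
      ListStep i s (.scan cur) s (.scan (s.maxNode cur (s.head j))) []
  | scanEnd (s : ListMem n D) (cur : ℕ) : ListStep i s (.scan cur) (s.setHead i cur) .test []
  | testLoop (s : ListMem n D) (h : (s.heap (s.announce i)).seq = 0) :
      ListStep i s .test s .before []
  | testLeave (s : ListMem n D) (h : (s.heap (s.announce i)).seq ≠ 0) :
      ListStep i s .test s .post []
  | before (s : ListMem n D) : ListStep i s .before s (.help (s.head i)) []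
  | help (s : ListMem n D) (bef : ℕ) :
      ListStep i s (.help bef) s (.prefer bef (s.helpOf i bef)) []
  | preferHelp (s : ListMem n D) (bef hlp : ℕ) (h : (s.heap hlp).seq = 0) :
      ListStep i s (.prefer bef hlp) s (.decide bef hlp) []
  | preferOwn (s : ListMem n D) (bef hlp : ℕ) (h : (s.heap hlp).seq ≠ 0) :
      ListStep i s (.prefer bef hlp) s (.decide bef (s.announce i)) []
  | decideFirst (s : ListMem n D) (bef prf : ℕ) (h : (s.heap bef).decideNext = none) :
      ListStep i s (.decide bef prf)
        (s.modify bef fun x => { x with decideNext := some prf }) (.link bef prf) [prf]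
  | decideLater (s : ListMem n D) (bef prf aft : ℕ) (h : (s.heap bef).decideNext = some aft) :
      ListStep i s (.decide bef prf) s (.link bef aft) []
  | data (s : ListMem n D) (bef aft : ℕ) (f : D → D) :
      ListStep i s (.link bef aft) (s.modify aft fun x => { x with data := f x.data })
        (.link bef aft) []
  | link (s : ListMem n D) (bef aft : ℕ) :
      ListStep i s (.link bef aft) (s.modify bef fun x => { x with next := some aft })
        (.setSeq bef aft) []
  | setSeq (s : ListMem n D) (bef aft : ℕ) :
      ListStep i s (.setSeq bef aft)
        (s.modify aft fun x => { x with seq := (s.heap bef).seq + 1 }) (.setHead aft) []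
  | setHead (s : ListMem n D) (aft : ℕ) :
      ListStep i s (.setHead aft) (s.setHead i aft) .test []
  | own (s : ListMem n D) : ListStep i s .post (s.setHead i (s.announce i)) .post []
  | finish (s : ListMem n D) : ListStep i s .post s .idle []

/-- `p` is the node at position `k` of the list with nodes `chain` behind the sentinel. -/
def NodeAt (chain : List ℕ) (k p : ℕ) : Prop := (0 :: chain)[k]? = some p

theorem NodeAt.le_length {chain : List ℕ} {k p : ℕ} (h : NodeAt chain k p) :
    k ≤ chain.length := by
  have := (List.getElem?_eq_some_iff.1 h).1
  simpa using Nat.le_of_lt_succ this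

theorem NodeAt.right_unique {chain : List ℕ} {k p q : ℕ} (h : NodeAt chain k p)
    (h' : NodeAt chain k q) : p = q := Option.some.inj (h.symm.trans h')

theorem NodeAt.mem {chain : List ℕ} {k p : ℕ} (h : NodeAt chain k p) : p ∈ 0 :: chain :=
  List.mem_of_getElem? h

theorem exists_nodeAt {chain : List ℕ} {p : ℕ} (h : p ∈ 0 :: chain) : ∃ k, NodeAt chain k p :=
  List.getElem?_of_mem h

theorem exists_nodeAt_of_le {chain : List ℕ} {k : ℕ} (h : k ≤ chain.length) :
    ∃ p, NodeAt chain k p :=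
  ⟨_, List.getElem?_eq_getElem (by simpa using Nat.lt_succ_of_le h)⟩

theorem NodeAt.left_unique {chain : List ℕ} (hn : (0 :: chain).Nodup) {k k' p : ℕ}
    (h : NodeAt chain k p) (h' : NodeAt chain k' p) : k = k' :=
  List.getElem?_inj (by simpa using Nat.lt_succ_of_le h.le_length) hn |>.1 (h.trans h'.symm)

theorem nodeAt_zero (chain : List ℕ) : NodeAt chain 0 0 := rfl

theorem nodeAt_append {chain new : List ℕ} {k p : ℕ} (hk : k ≤ chain.length) :
    NodeAt (chain ++ new) k p ↔ NodeAt chain k p := by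
  unfold NodeAt
  rw [← List.cons_append, List.getElem?_append_left (by simpa using Nat.lt_succ_of_le hk)]

theorem NodeAt.append {chain new : List ℕ} {k p : ℕ} (h : NodeAt chain k p) :
    NodeAt (chain ++ new) k p := (nodeAt_append h.le_length).2 h

theorem nodeAt_snoc {chain : List ℕ} {k p q : ℕ} :
    NodeAt (chain ++ [q]) k p ↔ NodeAt chain k p ∨ k = chain.length + 1 ∧ p = q := by
  rcases Nat.lt_or_ge chain.length k with hk | hk
  · constructor
    · intro h
      have := h.le_length
      rw [List.length_append, List.length_singleton] at this
      obtain rfl : k = chain.length + 1 := by omega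
      unfold NodeAt at h
      rw [← List.cons_append, List.getElem?_append_right (by simp)] at h
      simp at h
      exact .inr ⟨rfl, h.symm⟩
    · rintro (h | ⟨rfl, rfl⟩)
      · exact absurd h.le_length (by omega)
      · unfold NodeAt
        rw [← List.cons_append, List.getElem?_append_right (by simp)]
        simp
  · rw [nodeAt_append hk]
    exact ⟨.inl, fun h => h.resolve_right (by omega)⟩

/-- The linked list in `s` consists of the sentinel and the nodes `chain`. The last node may not have
obtained its sequence number, or not even have been linked, so far. -/
structure ListOk (chain : List ℕ) (s : ListMem n D) : Prop where
  nodup : (0 :: chain).Nodup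
  alloc : ∀ p ∈ 0 :: chain, p < s.alloc
  dec : ∀ k p, NodeAt chain k p → (s.heap p).decideNext = (0 :: chain)[k + 1]?
  dec_out : ∀ p, p ∉ 0 :: chain → (s.heap p).decideNext = none
  seq : ∀ k p, NodeAt chain k p →
    (s.heap p).seq = k + 1 ∨ (s.heap p).seq = 0 ∧ 0 < k ∧ k = chain.length
  seq_out : ∀ p, p ∉ 0 :: chain → (s.heap p).seq = 0
  next_dec : ∀ p q, (s.heap p).next = some q → (s.heap p).decideNext = some q
  next_seq : ∀ p q, (s.heap p).decideNext = some q → (s.heap q).seq ≠ 0 →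
    (s.heap p).next = some q

/-- `p` does not occur in the list up to the node `bef`. -/
def Behind (chain : List ℕ) (bef p : ℕ) : Prop :=
  ∃ k, NodeAt chain k bef ∧ ∀ k', NodeAt chain k' p → k < k'

theorem Behind.append {chain new : List ℕ} {bef p : ℕ} (h : Behind chain bef p) :
    Behind (chain ++ new) bef p := by
  obtain ⟨k, hk, h⟩ := h
  refine ⟨k, hk.append, fun k' hk' => ?_⟩
  by_cases hl : k' ≤ chain.length
  · exact h k' ((nodeAt_append hl).1 hk')
  · have := hk.le_length
    omega

namespace ListOk

variable {chain : List ℕ} {s : ListMem n D}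

theorem mem_of_seq (h : ListOk chain s) {p : ℕ} (hp : (s.heap p).seq ≠ 0) : p ∈ 0 :: chain := by
  by_contra hc
  exact hp (h.seq_out p hc)

theorem nodeAt_of_seq (h : ListOk chain s) {p : ℕ} (hp : (s.heap p).seq ≠ 0) :
    ∃ k, NodeAt chain k p ∧ (s.heap p).seq = k + 1 := by
  obtain ⟨k, hk⟩ := exists_nodeAt (h.mem_of_seq hp)
  exact ⟨k, hk, (h.seq k p hk).resolve_right fun hc => hp hc.1⟩

theorem seq_zero (h : ListOk chain s) : (s.heap 0).seq ≠ 0 := by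
  rcases h.seq 0 0 (nodeAt_zero _) with h | h <;> omega

theorem nodeAt_of_dec (h : ListOk chain s) {p q : ℕ} (hd : (s.heap p).decideNext = some q) :
    ∃ k, NodeAt chain k p ∧ NodeAt chain (k + 1) q := by
  have hp : p ∈ 0 :: chain := by
    by_contra hc
    rw [h.dec_out p hc] at hd
    cases hd
  obtain ⟨k, hk⟩ := exists_nodeAt hp
  exact ⟨k, hk, by rw [NodeAt, ← h.dec k p hk, hd]⟩

theorem dec_of_nodeAt (h : ListOk chain s) {k p q : ℕ} (hp : NodeAt chain k p)
    (hq : NodeAt chain (k + 1) q) : (s.heap p).decideNext = some q := by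
  rw [h.dec k p hp]; exact hq

theorem dec_unique (h : ListOk chain s) {p p' q : ℕ} (hp : (s.heap p).decideNext = some q)
    (hp' : (s.heap p').decideNext = some q) : p = p' := by
  obtain ⟨k, h₁, h₂⟩ := h.nodeAt_of_dec hp
  obtain ⟨k', h₁', h₂'⟩ := h.nodeAt_of_dec hp'
  obtain rfl : k = k' := by simpa using h₂.left_unique h.nodup h₂'
  exact h₁.right_unique h₁'

theorem seq_of_lt (h : ListOk chain s) {k p : ℕ} (hp : NodeAt chain k p) (hk : k < chain.length) :
    (s.heap p).seq = k + 1 := (h.seq k p hp).resolve_right (by omega)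

/-- All nodes of the list except perhaps the last have a sequence number. So a node without one is
the last node or outside the list, and in both cases it lies behind every numbered node. -/
theorem behind_of_seq (h : ListOk chain s) {bef p : ℕ} (hb : (s.heap bef).seq ≠ 0)
    (hp : (s.heap p).seq = 0) : Behind chain bef p := by
  obtain ⟨k, hk, -⟩ := h.nodeAt_of_seq hb
  refine ⟨k, hk, fun k' hk' => ?_⟩
  have := hk.le_length
  rcases h.seq k' p hk' with h' | h'
  · omega
  · refine lt_of_le_of_ne (by omega) ?_
    rintro rfl
    exact hb (hk.right_unique hk' ▸ hp)

theorem last_of_dec (h : ListOk chain s) {bef : ℕ} (hb : (s.heap bef).seq ≠ 0)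
    (hd : (s.heap bef).decideNext = none) : NodeAt chain chain.length bef := by
  obtain ⟨k, hk, -⟩ := h.nodeAt_of_seq hb
  rw [h.dec k bef hk] at hd
  have h₁ := hk.le_length
  have : k = chain.length := by simp at hd; omega
  exact this ▸ hk

/-- No node of the list lies behind its last node. Thus a first decision always selects a new node,
and no node is inserted twice. -/
theorem not_mem_of_last (h : ListOk chain s) {bef p : ℕ} (hb : NodeAt chain chain.length bef)
    (hp : Behind chain bef p) : p ∉ 0 :: chain := by
  intro hm
  obtain ⟨k, hk⟩ := exists_nodeAt hm
  obtain ⟨k', hk', h'⟩ := hp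
  have := h' k hk
  have := hk.le_length
  have := hk'.left_unique h.nodup hb
  omega

/-- Every node with a sequence number can be reached via the `next`-pointers. -/
theorem inList_of_seq (h : ListOk chain s) {p : ℕ} (hp : (s.heap p).seq ≠ 0) (h0 : p ≠ 0) :
    s.InList p := by
  obtain ⟨k, hk, -⟩ := h.nodeAt_of_seq hp
  suffices key : ∀ k p, NodeAt chain k p → (s.heap p).seq ≠ 0 → 0 < k → s.InList p by
    refine key k p hk hp (Nat.pos_of_ne_zero ?_)
    rintro rfl
    exact h0 (hk.right_unique (nodeAt_zero _))
  intro k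
  induction k with
  | zero => intro _ _ _ h; omega
  | succ k ih =>
    intro p hk hp _
    obtain ⟨q, hq⟩ := exists_nodeAt_of_le (chain := chain) (k := k) (by have := hk.le_length; omega)
    have hn : s.Next q p := h.next_seq q p (h.dec_of_nodeAt hq hk) hp
    rcases Nat.eq_zero_or_pos k with rfl | h0
    · obtain rfl := hq.right_unique (nodeAt_zero _)
      exact .single hn
    · refine .tail (ih q hq ?_ h0) hn
      rw [h.seq_of_lt hq hk.le_length]
      omega

theorem nodeAt_of_inList (h : ListOk chain s) {p : ℕ} (hp : s.InList p) :
    ∃ k, 0 < k ∧ NodeAt chain k p := by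
  cases hp with
  | single hn =>
    obtain ⟨k, -, h'⟩ := h.nodeAt_of_dec (h.next_dec _ _ hn)
    exact ⟨k + 1, by omega, h'⟩
  | tail _ hn =>
    obtain ⟨k, -, h'⟩ := h.nodeAt_of_dec (h.next_dec _ _ hn)
    exact ⟨k + 1, by omega, h'⟩

theorem le_of_next (h : ListOk chain s) {p q : ℕ} (hpq : Relation.ReflTransGen s.Next p q)
    {k k' : ℕ} (hp : NodeAt chain k p) (hq : NodeAt chain k' q) : k ≤ k' := by
  induction hpq generalizing k' with
  | refl => exact (hp.left_unique h.nodup hq).le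
  | tail _ hn ih =>
    obtain ⟨l, h₁, h₂⟩ := h.nodeAt_of_dec (h.next_dec _ _ hn)
    have := ih h₁
    have := h₂.left_unique h.nodup hq
    omega

end ListOk

/-- What is known about the local state of process `i`. -/
def ListPc.Ok (chain : List ℕ) (s : ListMem n D) (i : Fin n) : ListPc → Prop
  | .idle => True
  | .scan cur => (s.heap cur).seq ≠ 0
  | .test => True
  | .before => Behind chain (s.head i) (s.announce i)
  | .help bef => bef = s.head i ∧ Behind chain (s.head i) (s.announce i)
  | .prefer bef hlp => bef = s.head i ∧ Behind chain (s.head i) (s.announce i) ∧ hlp < s.alloc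
  | .decide bef prf => bef = s.head i ∧ Behind chain (s.head i) (s.announce i) ∧
      Behind chain (s.head i) prf ∧ prf < s.alloc
  | .link bef aft => bef = s.head i ∧ Behind chain (s.head i) (s.announce i) ∧
      (s.heap bef).decideNext = some aft
  | .setSeq bef aft => bef = s.head i ∧ Behind chain (s.head i) (s.announce i) ∧
      (s.heap bef).decideNext = some aft ∧ (s.heap bef).next = some aft
  | .setHead aft => Behind chain (s.head i) (s.announce i) ∧
      (s.heap aft).seq = (s.heap (s.head i)).seq + 1
  | .post => (s.heap (s.announce i)).seq ≠ 0

/-- The invariant of the algorithm. -/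
structure ListInv (chain : List ℕ) (s : ListMem n D) (pcs : Fin n → ListPc) : Prop where
  list : ListOk chain s
  head : ∀ i, (s.heap (s.head i)).seq ≠ 0
  ann_lt : ∀ i, s.announce i < s.alloc
  ann_inj : ∀ i j, s.announce i = s.announce j → i = j ∨ s.announce i = 0
  ann_ne : ∀ i, pcs i ≠ .idle → s.announce i ≠ 0
  owner : ∀ p < s.alloc, (s.heap p).seq ≠ 0 ∨ ∃ j, s.announce j = p ∧ pcs j ≠ .idle
  pc : ∀ i, (pcs i).Ok chain s i

theorem ListInv.init (d : D) : ListInv [] (ListMem.init n d) fun _ => .idle where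
  list :=
    { nodup := by simp
      alloc := by simp [ListMem.init]
      dec := by
        intro k p h
        obtain rfl : k = 0 := by simpa using h.le_length
        obtain rfl := h.right_unique (nodeAt_zero _)
        simp [ListMem.init]
      dec_out := by
        intro p hp
        simp only [List.mem_singleton] at hp
        simp [ListMem.init, hp, Node.fresh]
      seq := by
        intro k p h
        obtain rfl : k = 0 := by simpa using h.le_length
        obtain rfl := h.right_unique (nodeAt_zero _)
        simp [ListMem.init]
      seq_out := by
        intro p hp
        simp only [List.mem_singleton] at hp
        simp [ListMem.init, hp, Node.fresh]
      next_dec := by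
        intro p q h
        by_cases hp : p = 0 <;> simp [ListMem.init, hp, Node.fresh] at h
      next_seq := by
        intro p q h
        by_cases hp : p = 0 <;> simp [ListMem.init, hp, Node.fresh] at h }
  head _ := by simp [ListMem.init]
  ann_lt _ := by simp [ListMem.init]
  ann_inj _ _ _ := .inr rfl
  ann_ne _ h := (h rfl).elim
  owner p hp := by
    obtain rfl : p = 0 := by simpa [ListMem.init] using hp
    simp [ListMem.init]
  pc _ := trivial

/-- The changes of the list that the processes other than `i` have to expect when `i` takes a step. -/
structure ListExt (i : Fin n) (chain : List ℕ) (s : ListMem n D) (chain' : List ℕ)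
    (s' : ListMem n D) : Prop where
  chain : chain <+: chain'
  alloc : s.alloc ≤ s'.alloc
  seq : ∀ p, (s.heap p).seq ≠ 0 → (s'.heap p).seq = (s.heap p).seq
  dec : ∀ p q, (s.heap p).decideNext = some q → (s'.heap p).decideNext = some q
  next : ∀ p q, (s.heap p).next = some q → (s'.heap p).next = some q
  head : ∀ j, j ≠ i → s'.head j = s.head j
  ann : ∀ j, j ≠ i → s'.announce j = s.announce j

/-- The assertions of a process concern its own entries of `head` and `announce` and fields that
keep their value once set, so other processes cannot invalidate them. A sequence number is final
only if it is nonzero, hence the hypothesis on `head j`. -/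
theorem ListPc.Ok.ext {chain chain' : List ℕ} {s s' : ListMem n D} {i j : Fin n} {pc : ListPc}
    (h : pc.Ok chain s j) (he : ListExt i chain s chain' s') (hji : j ≠ i)
    (hhead : (s.heap (s.head j)).seq ≠ 0) : pc.Ok chain' s' j := by
  have hB : ∀ {p q}, Behind chain p q → Behind chain' p q := by
    obtain ⟨new, rfl⟩ := he.chain
    exact fun h => h.append
  have hs : ∀ {p}, (s.heap p).seq ≠ 0 → (s'.heap p).seq ≠ 0 := fun hp => by rwa [he.seq _ hp]
  have hh := he.head j hji
  have ha := he.ann j hji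
  cases pc with
  | idle => trivial
  | scan cur => exact hs h
  | test => trivial
  | before => rw [Ok, hh, ha]; exact hB h
  | help => rw [Ok, hh, ha]; exact ⟨h.1, hB h.2⟩
  | prefer => rw [Ok, hh, ha]; exact ⟨h.1, hB h.2.1, h.2.2.trans_le he.alloc⟩
  | decide =>
    rw [Ok, hh, ha]
    exact ⟨h.1, hB h.2.1, hB h.2.2.1, h.2.2.2.trans_le he.alloc⟩
  | link => rw [Ok, hh, ha]; exact ⟨h.1, hB h.2.1, he.dec _ _ h.2.2⟩
  | setSeq =>
    rw [Ok, hh, ha]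
    exact ⟨h.1, hB h.2.1, he.dec _ _ h.2.2.1, he.next _ _ h.2.2.2⟩
  | setHead aft =>
    rw [Ok, hh, ha, he.seq _ hhead, he.seq aft (by rw [h.2]; omega)]
    exact ⟨hB h.1, h.2⟩
  | post => rw [Ok, ha]; exact hs h

theorem ListExt.refl_of {i : Fin n} {chain : List ℕ} {s s' : ListMem n D}
    (heap : s'.heap = s.heap) (alloc : s'.alloc = s.alloc)
    (head : ∀ j, j ≠ i → s'.head j = s.head j) (ann : s'.announce = s.announce) :
    ListExt i chain s chain s' :=
  ⟨List.prefix_rfl, alloc.ge, fun p _ => by rw [heap], fun p q h => by rwa [heap],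
    fun p q h => by rwa [heap], head, fun j _ => by rw [ann]⟩

theorem ListOk.congr {chain : List ℕ} {s s' : ListMem n D} (h : ListOk chain s)
    (alloc : s.alloc ≤ s'.alloc) (seq : ∀ p, (s'.heap p).seq = (s.heap p).seq)
    (dec : ∀ p, (s'.heap p).decideNext = (s.heap p).decideNext)
    (next : ∀ p, (s'.heap p).next = (s.heap p).next) : ListOk chain s' where
  nodup := h.nodup
  alloc p hp := (h.alloc p hp).trans_le alloc
  dec := by simpa only [dec] using h.dec
  dec_out := by simpa only [dec] using h.dec_out
  seq := by simpa only [seq] using h.seq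
  seq_out := by simpa only [seq] using h.seq_out
  next_dec := by simpa only [dec, next] using h.next_dec
  next_seq := by simpa only [dec, next, seq] using h.next_seq

@[simp] theorem ListMem.modify_heap (s : ListMem n D) (p q : ℕ) (f : Node D → Node D) :
    (s.modify p f).heap q = if q = p then f (s.heap q) else s.heap q := by
  by_cases h : q = p
  · subst h; simp [modify]
  · simp [modify, h]

@[simp] theorem ListMem.modify_head (s : ListMem n D) (p : ℕ) (f : Node D → Node D) :
    (s.modify p f).head = s.head := rfl

theorem ListMem.announceNew_heap (s : ListMem n D) (i : Fin n) (d : D) (q : ℕ) :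
    (s.announceNew i d).heap q = if q = s.alloc then Node.fresh d else s.heap q := by
  by_cases h : q = s.alloc
  · subst h; simp [announceNew]
  · simp [announceNew, h]

namespace ListInv

variable {chain : List ℕ} {s : ListMem n D} {pcs : Fin n → ListPc}

/-- The part of the invariant that concerns a step of `i` which keeps announcements. -/
theorem of_ext {i : Fin n} {new : List ℕ} {s' : ListMem n D} {pc' : ListPc}
    (h : ListInv chain s pcs) (list : ListOk (chain ++ new) s')
    (ext : ListExt i chain s (chain ++ new) s') (alloc : s'.alloc = s.alloc)
    (ann : s'.announce = s.announce) (head : (s'.heap (s'.head i)).seq ≠ 0)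
    (act : pcs i ≠ .idle) (act' : pc' = .idle → (s.heap (s.announce i)).seq ≠ 0)
    (ok : pc'.Ok (chain ++ new) s' i) :
    ListInv (chain ++ new) s' (Function.update pcs i pc') where
  list := list
  head j := by
    rcases eq_or_ne j i with rfl | hj
    · exact head
    · rw [ext.head j hj, ext.seq _ (h.head j)]; exact h.head j
  ann_lt j := by rw [alloc, ann]; exact h.ann_lt j
  ann_inj j k := by rw [ann]; exact h.ann_inj j k
  ann_ne j hj := by
    rw [ann]
    rcases eq_or_ne j i with rfl | hji
    · exact h.ann_ne j act
    · exact h.ann_ne j (by simpa [hji] using hj)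
  owner p hp := by
    rw [alloc] at hp
    rcases h.owner p hp with hs | ⟨j, hj, hj'⟩
    · exact .inl (by rwa [ext.seq p hs])
    · rcases eq_or_ne j i with rfl | hji
      · by_cases hpc : pc' = .idle
        · left
          subst hj
          rw [ext.seq _ (act' hpc)]
          exact act' hpc
        · exact .inr ⟨j, by rw [ann, hj], by simpa using hpc⟩
      · exact .inr ⟨j, by rw [ann, hj], by simpa [hji] using hj'⟩
  pc j := by
    rcases eq_or_ne j i with rfl | hji
    · simpa using ok
    · simpa [hji] using (h.pc j).ext ext hji (h.head j)

theorem of_ext_and {i : Fin n} {new : List ℕ} {s' : ListMem n D} {pc' : ListPc}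
    (h : ListInv chain s pcs) (list : ListOk (chain ++ new) s')
    (ext : ListExt i chain s (chain ++ new) s') (alloc : s'.alloc = s.alloc)
    (ann : s'.announce = s.announce) (head : (s'.heap (s'.head i)).seq ≠ 0)
    (act : pcs i ≠ .idle) (act' : pc' = .idle → (s.heap (s.announce i)).seq ≠ 0)
    (ok : pc'.Ok (chain ++ new) s' i) :
    ListInv (chain ++ new) s' (Function.update pcs i pc') ∧
      ListExt i chain s (chain ++ new) s' :=
  ⟨h.of_ext list ext alloc ann head act act' ok, ext⟩

theorem step_local {i : Fin n} {pc' : ListPc} (h : ListInv chain s pcs)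
    (act : pcs i ≠ .idle) (act' : pc' = .idle → (s.heap (s.announce i)).seq ≠ 0)
    (ok : pc'.Ok chain s i) : ListInv (chain ++ []) s (Function.update pcs i pc') ∧ ListExt i chain s (chain ++ []) s := by
  refine h.of_ext_and (new := []) ?_ ?_ rfl rfl (h.head i) act act' ?_ <;> rw [List.append_nil]
  · exact h.list
  · exact .refl_of rfl rfl (fun _ _ => rfl) rfl
  · exact ok

theorem step_setHead {i : Fin n} {pc' : ListPc} {p : ℕ} (h : ListInv chain s pcs)
    (act : pcs i ≠ .idle) (hp : (s.heap p).seq ≠ 0) (hpc : pc' ≠ .idle)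
    (ok : pc'.Ok chain (s.setHead i p) i) :
    ListInv (chain ++ []) (s.setHead i p) (Function.update pcs i pc') ∧
      ListExt i chain s (chain ++ []) (s.setHead i p) := by
  refine h.of_ext_and (new := []) ?_ ?_ rfl rfl ?_ act (fun h => (hpc h).elim) ?_ <;>
    try rw [List.append_nil]
  · exact h.list.congr le_rfl (fun _ => rfl) (fun _ => rfl) fun _ => rfl
  · exact .refl_of rfl rfl (fun j hj => by simp [ListMem.setHead, hj]) rfl
  · simpa [ListMem.setHead] using hp
  · exact ok

theorem step_announce {i : Fin n} (h : ListInv chain s pcs) (d : D) (hi : pcs i = .idle) :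
    ListInv (chain ++ []) (s.announceNew i d) (Function.update pcs i (.scan 0)) ∧
      ListExt i chain s (chain ++ []) (s.announceNew i d) := by
  rw [List.append_nil]
  have hout : s.alloc ∉ 0 :: chain := fun hm => (h.list.alloc _ hm).false
  -- The overwritten cell lies outside the list, so its list fields had the values of a fresh node
  -- before.
  have hseq : ∀ p, ((s.announceNew i d).heap p).seq = (s.heap p).seq := by
    intro p
    rw [ListMem.announceNew_heap]
    split
    · rename_i hp; rw [hp, h.list.seq_out _ hout]; rfl
    · rfl
  have hdec : ∀ p, ((s.announceNew i d).heap p).decideNext = (s.heap p).decideNext := by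
    intro p
    rw [ListMem.announceNew_heap]
    split
    · rename_i hp; rw [hp, h.list.dec_out _ hout]; rfl
    · rfl
  have hnext : ∀ p, ((s.announceNew i d).heap p).next = (s.heap p).next := by
    intro p
    rw [ListMem.announceNew_heap]
    split
    · rename_i hp
      rw [hp]
      cases hn : (s.heap s.alloc).next with
      | none => rfl
      | some q =>
        have := h.list.next_dec _ _ hn
        rw [h.list.dec_out _ hout] at this
        cases this
    · rfl
  have hann : (s.announceNew i d).announce = Function.update s.announce i s.alloc := rfl
  have halloc : (s.announceNew i d).alloc = s.alloc + 1 := rfl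
  have hlist : ListOk chain (s.announceNew i d) := h.list.congr (by omega) hseq hdec hnext
  have hext : ListExt i chain s chain (s.announceNew i d) :=
    ⟨List.prefix_rfl, by omega, fun p _ => hseq p, fun p q h => by rwa [hdec],
      fun p q h => by rwa [hnext], fun _ _ => rfl, fun j hj => by simp [hann, hj]⟩
  have hpos : s.alloc ≠ 0 := by have := h.ann_lt i; omega
  refine ⟨⟨hlist, fun j => by rw [hseq]; exact h.head j, fun j => ?_, fun j k hjk => ?_,
    fun j hj => ?_, fun p hp => ?_, fun j => ?_⟩, hext⟩
  · rw [halloc, hann]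
    rcases eq_or_ne j i with rfl | hj
    · simp
    · rw [Function.update_of_ne hj]; have := h.ann_lt j; omega
  · rw [hann] at hjk ⊢
    have hj' := h.ann_lt j
    have hk' := h.ann_lt k
    rcases eq_or_ne j i with rfl | hj
    · rcases eq_or_ne k j with rfl | hk
      · exact .inl rfl
      · rw [Function.update_self, Function.update_of_ne hk] at hjk
        omega
    · rcases eq_or_ne k i with rfl | hk
      · rw [Function.update_self, Function.update_of_ne hj] at hjk
        omega
      · rw [Function.update_of_ne hj, Function.update_of_ne hk] at hjk
        rw [Function.update_of_ne hj]
        exact h.ann_inj j k hjk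
  · rw [hann]
    rcases eq_or_ne j i with rfl | hji
    · simpa using hpos
    · rw [Function.update_of_ne hji] at hj ⊢
      exact h.ann_ne j hj
  · rw [hseq, hann]
    rcases Nat.lt_or_eq_of_le (Nat.le_of_lt_succ (halloc ▸ hp)) with hp | rfl
    · rcases h.owner p hp with h' | ⟨j, hj, hj'⟩
      · exact .inl h'
      · have hji : j ≠ i := by rintro rfl; exact hj' hi
        exact .inr ⟨j, by rw [Function.update_of_ne hji, hj],
          by rwa [Function.update_of_ne hji]⟩
    · exact .inr ⟨i, by simp, by simp⟩
  · rcases eq_or_ne j i with rfl | hji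
    · rw [Function.update_self]
      show ((s.announceNew j d).heap 0).seq ≠ 0
      rw [hseq]
      exact h.list.seq_zero
    · rw [Function.update_of_ne hji]
      exact (h.pc j).ext hext hji (h.head j)

/-- A numbered node without a decision is the last one, and the preferred node lies behind it, hence
outside the list. So the decision extends the list by exactly one node, and no other command changes
`chain`. -/
theorem step_decide {i : Fin n} (h : ListInv chain s pcs) {bef prf : ℕ}
    (hi : pcs i = .decide bef prf) (hd : (s.heap bef).decideNext = none) :
    ListInv (chain ++ [prf]) (s.modify bef fun x => { x with decideNext := some prf })
      (Function.update pcs i (.link bef prf)) ∧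
      ListExt i chain s (chain ++ [prf])
        (s.modify bef fun x => { x with decideNext := some prf }) := by
  have hok := h.pc i
  rw [hi] at hok
  obtain ⟨rfl, hann, hprf, hlt⟩ := hok
  have hlast := h.list.last_of_dec (h.head i) hd
  have hout := h.list.not_mem_of_last hlast hprf
  have hne : ∀ k p, NodeAt chain k p → p ≠ s.head i → k < chain.length := by
    intro k p hk hp
    refine lt_of_le_of_ne hk.le_length ?_
    rintro rfl
    exact hp (hk.right_unique hlast)
  have hdec : ∀ p q, (s.heap p).decideNext = some q → p ≠ s.head i := by
    rintro p q hp rfl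
    rw [hd] at hp
    cases hp
  refine h.of_ext_and ?_ ?_ rfl rfl ?_ (by simp [hi]) (by simp) ?_
  · constructor
    · rw [← List.cons_append]
      exact List.nodup_append'.2 ⟨h.list.nodup, List.nodup_singleton _, by
        rwa [List.disjoint_singleton]⟩
    · intro p hp
      rw [← List.cons_append, List.mem_append, List.mem_singleton] at hp
      rcases hp with hp | rfl
      · exact h.list.alloc p hp
      · exact hlt
    · intro k p hk
      rw [ListMem.modify_heap]
      rcases nodeAt_snoc.1 hk with hk' | ⟨rfl, rfl⟩
      · split
        · rename_i hp
          subst hp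
          obtain rfl := hk'.left_unique h.list.nodup hlast
          exact (nodeAt_snoc.2 (.inr ⟨rfl, rfl⟩)).symm
        · rename_i hp
          have hlt := hne k p hk' hp
          rw [h.list.dec k p hk']
          obtain ⟨q, hq⟩ := exists_nodeAt_of_le hlt
          rw [show (0 :: chain)[k + 1]? = some q from hq]
          exact hq.append.symm
      · rw [if_neg (by intro e; rw [e] at hout; exact hout hlast.mem), h.list.dec_out p hout]
        symm
        rw [List.getElem?_eq_none_iff]
        simp
    · intro p hp
      rw [← List.cons_append, List.mem_append, not_or] at hp
      rw [ListMem.modify_heap, if_neg (by intro e; rw [e] at hp; exact hp.1 hlast.mem)]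
      exact h.list.dec_out p hp.1
    · intro k p hk
      have hs : ((s.modify (s.head i) fun x => { x with decideNext := some prf }).heap p).seq =
          (s.heap p).seq := by rw [ListMem.modify_heap]; split <;> rfl
      rw [hs]
      rcases nodeAt_snoc.1 hk with hk' | ⟨rfl, rfl⟩
      · rcases h.list.seq k p hk' with h' | ⟨h₁, h₂, h₃⟩
        · exact .inl h'
        · subst h₃
          exact (h.head i (hlast.right_unique hk' ▸ h₁)).elim
      · exact .inr ⟨h.list.seq_out p hout, by omega, by simp⟩
    · intro p hp
      rw [← List.cons_append, List.mem_append, not_or] at hp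
      rw [ListMem.modify_heap, if_neg (by intro e; rw [e] at hp; exact hp.1 hlast.mem)]
      exact h.list.seq_out p hp.1
    · intro p q
      rw [ListMem.modify_heap]
      split
      · rename_i hp
        subst hp
        intro hq
        exact (hdec _ _ (h.list.next_dec _ _ hq) rfl).elim
      · exact h.list.next_dec p q
    · intro p q
      have hs : ((s.modify (s.head i) fun x => { x with decideNext := some prf }).heap q).seq =
          (s.heap q).seq := by rw [ListMem.modify_heap]; split <;> rfl
      rw [hs, ListMem.modify_heap]
      split
      · intro hq hseq
        obtain rfl : prf = q := Option.some.inj hq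
        exact (hseq (h.list.seq_out _ hout)).elim
      · exact h.list.next_seq p q
  · refine ⟨List.prefix_append _ _, le_rfl, fun p _ => ?_, fun p q hq => ?_, fun p q hq => ?_,
      fun _ _ => rfl, fun _ _ => rfl⟩
    · rw [ListMem.modify_heap]; split <;> rfl
    · rw [ListMem.modify_heap, if_neg (hdec p q hq)]; exact hq
    · rw [ListMem.modify_heap]; split <;> exact hq
  · simpa using h.head i
  · exact ⟨rfl, hann.append, by simp⟩

/-- Several processes may insert the same node, but each of them writes the pointer that has been
decided, so repeated writes agree. -/
theorem step_link {i : Fin n} (h : ListInv chain s pcs) {bef aft : ℕ}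
    (hi : pcs i = .link bef aft) :
    ListInv (chain ++ []) (s.modify bef fun x => { x with next := some aft })
      (Function.update pcs i (.setSeq bef aft)) ∧
      ListExt i chain s (chain ++ [])
        (s.modify bef fun x => { x with next := some aft }) := by
  have hok := h.pc i
  rw [hi] at hok
  obtain ⟨rfl, hann, hdec⟩ := hok
  have hs : ∀ p, ((s.modify (s.head i) fun x => { x with next := some aft }).heap p).seq =
      (s.heap p).seq := fun p => by rw [ListMem.modify_heap]; split <;> rfl
  have hd : ∀ p, ((s.modify (s.head i) fun x => { x with next := some aft }).heap p).decideNext =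
      (s.heap p).decideNext := fun p => by rw [ListMem.modify_heap]; split <;> rfl
  have hn : ∀ p q, (s.heap p).next = some q →
      ((s.modify (s.head i) fun x => { x with next := some aft }).heap p).next = some q := by
    intro p q hq
    rw [ListMem.modify_heap]
    split
    · rename_i hp
      subst hp
      rw [← hdec]
      exact h.list.next_dec _ _ hq
    · exact hq
  refine h.of_ext_and (new := []) ?_ ?_ rfl rfl ?_ (by simp [hi]) (by simp) ?_ <;>
    try rw [List.append_nil]
  · refine ⟨h.list.nodup, h.list.alloc, by simpa only [hd] using h.list.dec,
      by simpa only [hd] using h.list.dec_out, by simpa only [hs] using h.list.seq,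
      by simpa only [hs] using h.list.seq_out, fun p q hq => ?_, fun p q hq hseq => ?_⟩
    · rw [hd]
      rw [ListMem.modify_heap] at hq
      split at hq
      · rename_i hp
        rw [hp, hdec]
        exact hq
      · exact h.list.next_dec p q hq
    · rw [hd] at hq
      rw [hs] at hseq
      exact hn _ _ (h.list.next_seq p q hq hseq)
  · exact ⟨List.prefix_rfl, le_rfl, fun p _ => hs p, fun p q hq => by rwa [hd], hn,
      fun _ _ => rfl, fun _ _ => rfl⟩
  · rw [hs]; exact h.head i
  · exact ⟨rfl, hann, by rw [hd]; exact hdec, by simp⟩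

/-- The number written is determined by the position of the node, so a repeated write does not
change it. The node has been linked before it is numbered, which maintains `next_seq`. -/
theorem step_setSeq {i : Fin n} (h : ListInv chain s pcs) {bef aft : ℕ}
    (hi : pcs i = .setSeq bef aft) :
    ListInv (chain ++ []) (s.modify aft fun x => { x with seq := (s.heap bef).seq + 1 })
      (Function.update pcs i (.setHead aft)) ∧
      ListExt i chain s (chain ++ [])
        (s.modify aft fun x => { x with seq := (s.heap bef).seq + 1 }) := by
  have hok := h.pc i
  rw [hi] at hok
  obtain ⟨rfl, hann, hdec, hnext⟩ := hok
  obtain ⟨k, hk, hk'⟩ := h.list.nodeAt_of_dec hdec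
  have hseq : (s.heap (s.head i)).seq = k + 1 :=
    (h.list.seq k _ hk).resolve_right fun hc => h.head i hc.1
  have hs : ∀ p, (s.heap p).seq ≠ 0 →
      ((s.modify aft fun x => { x with seq := (s.heap (s.head i)).seq + 1 }).heap p).seq =
        (s.heap p).seq := by
    intro p hp
    rw [ListMem.modify_heap]
    split
    · rename_i e
      subst e
      rcases h.list.seq _ _ hk' with h' | h'
      · rw [h']; simp [hseq]
      · exact (hp h'.1).elim
    · rfl
  have hd : ∀ p, ((s.modify aft fun x => { x with seq := (s.heap (s.head i)).seq + 1 }).heap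
      p).decideNext = (s.heap p).decideNext := fun p => by rw [ListMem.modify_heap]; split <;> rfl
  have hn : ∀ p, ((s.modify aft fun x => { x with seq := (s.heap (s.head i)).seq + 1 }).heap
      p).next = (s.heap p).next := fun p => by rw [ListMem.modify_heap]; split <;> rfl
  refine h.of_ext_and (new := []) ?_ ?_ rfl rfl ?_ (by simp [hi]) (by simp) ?_ <;>
    try rw [List.append_nil]
  · refine ⟨h.list.nodup, h.list.alloc, by simpa only [hd] using h.list.dec,
      by simpa only [hd] using h.list.dec_out, fun l p hl => ?_, fun p hp => ?_,
      by simpa only [hd, hn] using h.list.next_dec, fun p q hq hsq => ?_⟩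
    · rw [ListMem.modify_heap]
      split
      · rename_i e
        subst e
        obtain rfl := hl.left_unique h.list.nodup hk'
        exact .inl (by simp [hseq])
      · exact h.list.seq l p hl
    · rw [ListMem.modify_heap, if_neg (by intro e; rw [e] at hp; exact hp hk'.mem)]
      exact h.list.seq_out p hp
    · rw [hd] at hq
      rw [hn]
      rw [ListMem.modify_heap] at hsq
      split at hsq
      · rename_i e
        subst e
        rw [h.list.dec_unique hq hdec]
        exact hnext
      · exact h.list.next_seq p q hq hsq
  · exact ⟨List.prefix_rfl, le_rfl, hs, fun p q hq => by rwa [hd], fun p q hq => by rwa [hn],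
      fun _ _ => rfl, fun _ _ => rfl⟩
  · show ((s.modify aft _).heap (s.head i)).seq ≠ 0
    rw [hs _ (h.head i)]; exact h.head i
  · refine ⟨hann, ?_⟩
    show ((s.modify aft _).heap aft).seq = ((s.modify aft _).heap (s.head i)).seq + 1
    rw [hs _ (h.head i)]
    simp

theorem step_data {i : Fin n} (h : ListInv chain s pcs) {bef aft : ℕ}
    (hi : pcs i = .link bef aft) (f : D → D) :
    ListInv (chain ++ []) (s.modify aft fun x => { x with data := f x.data })
      (Function.update pcs i (.link bef aft)) ∧
      ListExt i chain s (chain ++ [])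
        (s.modify aft fun x => { x with data := f x.data }) := by
  have hok := h.pc i
  rw [hi] at hok
  have hs : ∀ p, ((s.modify aft fun x => { x with data := f x.data }).heap p).seq =
      (s.heap p).seq := fun p => by rw [ListMem.modify_heap]; split <;> rfl
  have hd : ∀ p, ((s.modify aft fun x => { x with data := f x.data }).heap p).decideNext =
      (s.heap p).decideNext := fun p => by rw [ListMem.modify_heap]; split <;> rfl
  have hn : ∀ p, ((s.modify aft fun x => { x with data := f x.data }).heap p).next =
      (s.heap p).next := fun p => by rw [ListMem.modify_heap]; split <;> rfl
  refine h.of_ext_and (new := []) ?_ ?_ rfl rfl ?_ (by simp [hi]) (by simp) ?_ <;>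
    try rw [List.append_nil]
  · exact h.list.congr le_rfl hs hd hn
  · exact ⟨List.prefix_rfl, le_rfl, fun p _ => hs p, fun p q hq => by rwa [hd],
      fun p q hq => by rwa [hn], fun _ _ => rfl, fun _ _ => rfl⟩
  · rw [hs]; exact h.head i
  · exact ⟨hok.1, hok.2.1, by rw [hd]; exact hok.2.2⟩

theorem step {i : Fin n} {s' : ListMem n D} {pc' : ListPc} {new : List ℕ}
    (h : ListInv chain s pcs) (hs : ListStep i s (pcs i) s' pc' new) :
    ListInv (chain ++ new) s' (Function.update pcs i pc') ∧
      ListExt i chain s (chain ++ new) s' := by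
  have hok := h.pc i
  generalize hi : pcs i = pc at hs
  rw [hi] at hok
  cases hs with
  | skip =>
    rw [← hi, Function.update_eq_self, List.append_nil]
    exact ⟨h, .refl_of rfl rfl (fun _ _ => rfl) rfl⟩
  | announce => exact h.step_announce _ hi
  | scan cur j =>
    refine h.step_local (by simp [hi]) (by simp) ?_
    show (s.heap (s.maxNode cur (s.head j))).seq ≠ 0
    unfold ListMem.maxNode
    split
    · exact h.head j
    · exact hok
  | scanEnd => exact h.step_setHead (by simp [hi]) hok (by simp) trivial
  | testLoop h' =>
    exact h.step_local (by simp [hi]) (by simp) (h.list.behind_of_seq (h.head i) h')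
  | testLeave h' => exact h.step_local (by simp [hi]) (by simp) h'
  | before => exact h.step_local (by simp [hi]) (by simp) ⟨rfl, hok⟩
  | help => exact h.step_local (by simp [hi]) (by simp) ⟨hok.1, hok.2, h.ann_lt _⟩
  | preferHelp bef hlp h' =>
    exact h.step_local (by simp [hi]) (by simp)
      ⟨hok.1, hok.2.1, h.list.behind_of_seq (h.head i) h', hok.2.2⟩
  | preferOwn =>
    exact h.step_local (by simp [hi]) (by simp) ⟨hok.1, hok.2.1, hok.2.1, h.ann_lt _⟩
  | decideFirst _ _ h' => exact h.step_decide hi h'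
  | decideLater _ _ aft h' => exact h.step_local (by simp [hi]) (by simp) ⟨hok.1, hok.2.1, h'⟩
  | data => exact h.step_data hi _
  | link => exact h.step_link hi
  | setSeq => exact h.step_setSeq hi
  | setHead aft =>
    refine h.step_setHead (by simp [hi]) ?_ (by simp) trivial
    rw [hok.2]; omega
  | own => exact h.step_setHead (by simp [hi]) hok (by simp) hok
  | finish => exact h.step_local (by simp [hi]) (fun _ => hok) trivial

theorem head_eq {i j : Fin n} {s' : ListMem n D} {new : List ℕ}
    (h : ListInv chain s pcs) (he : ListExt i chain s (chain ++ new) s') (hij : j ≠ i) :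
    s'.head j = s.head j ∧ s'.announce j = s.announce j ∧
      (s'.heap (s'.head j)).seq = (s.heap (s.head j)).seq :=
  ⟨he.head j hij, he.ann j hij, by rw [he.head j hij]; exact he.seq _ (h.head j)⟩

end ListInv

/-- A process that prefers a node behind a node at a position `k > K` with `k + 2 ≡ i` prefers the
node `p` announced by process `i`. -/
def ListPc.Helps (K : ℕ) (i : Fin n) (p : ℕ) (chain : List ℕ) : ListPc → Prop
  | .prefer bef hlp => ∀ k > K, NodeAt chain k bef → (k + 2) % n = i → hlp = p
  | .decide bef prf => ∀ k > K, NodeAt chain k bef → (k + 2) % n = i → prf = p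
  | _ => True

/-- The effect of helping when process `i` has announced the node `p` while the list had length `K`:
the list does not grow beyond the next position at which `p` is preferred. -/
structure Helped (K : ℕ) (i : Fin n) (p : ℕ) (chain : List ℕ) (pcs : Fin n → ListPc) : Prop where
  length : p ∉ chain → ∀ k > K, (k + 2) % n = i → chain.length ≤ k
  pcs : p ∉ chain → ∀ j, (pcs j).Helps K i p chain
  pos : ∀ k, NodeAt chain k p → k ≤ K + n + 1

/-- One of `n` consecutive positions lies in the required residue class. The shift by `2` arises
because the node at position `k` has number `k + 1` and the algorithm consults the entry `(seq + 1)
% n`. -/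
theorem exists_helping_position (K : ℕ) (i : Fin n) : ∃ k > K, k ≤ K + n ∧ (k + 2) % n = i := by
  have hn : 0 < n := i.pos
  -- Start at `K + 1` and advance by the difference of `i` and `K + 3 = (K + 1) + 2` modulo `n`;
  -- adding `n` first keeps the subtraction exact.
  refine ⟨K + 1 + (i + (n - (K + 3) % n)) % n, by omega, ?_, ?_⟩
  · have := Nat.mod_lt (i + (n - (K + 3) % n)) hn
    omega
  · have h₁ := Nat.mod_lt (K + 3) hn
    have h₂ : K + 1 + (i + (n - (K + 3) % n)) % n + 2 = K + 3 + (i + (n - (K + 3) % n)) % n := by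
      omega
    rw [h₂, Nat.add_mod, Nat.mod_mod, ← Nat.add_mod, Nat.add_mod]
    have h₃ : (K + 3) % n + (↑i + (n - (K + 3) % n)) = i + n := by omega
    simp only [Nat.mod_add_mod, Nat.add_mod_mod]
    rw [← Nat.mod_add_mod, h₃, Nat.add_mod_right, Nat.mod_eq_of_lt i.isLt]

namespace Helped

variable {K : ℕ} {i : Fin n} {p : ℕ} {chain : List ℕ} {pcs : Fin n → ListPc} {s : ListMem n D}

/-- `K` is the length of the list at the announcement. No node has a position beyond `K` yet, so
preferences formed earlier are subject to no condition. -/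
theorem of_announce (hp : p ∉ 0 :: chain) : Helped chain.length i p chain pcs where
  length _ k hk _ := hk.le
  pcs _ j := by
    have : ∀ q, ∀ k > chain.length, ¬ NodeAt chain k q := fun q k hk h => by
      have := h.le_length; omega
    cases pcs j <;> first | trivial | exact fun k hk h => (this _ k hk h).elim
  pos k hk := (hp hk.mem).elim

theorem length_le (h : Helped K i p chain pcs) (hp : p ∉ chain) : chain.length ≤ K + n := by
  obtain ⟨k, hk, hk', hki⟩ := exists_helping_position K i
  exact (h.length hp k hk hki).trans hk'

/-- Either `p` is in the list, and its bounded position exceeds that of `bef`, or it is missing, and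
then the whole list is short. This limits the number of passes through the loop. -/
theorem seq_lt (h : Helped K i p chain pcs) (hl : ListOk chain s) {bef : ℕ}
    (hb : Behind chain bef p) (hs : (s.heap bef).seq ≠ 0) : (s.heap bef).seq < K + n + 2 := by
  obtain ⟨k, hk, hk'⟩ := hb
  obtain ⟨k₁, h₁, h₂⟩ := hl.nodeAt_of_seq hs
  obtain rfl := h₁.left_unique hl.nodup hk
  by_cases hp : p ∈ chain
  · obtain ⟨l, hl⟩ := exists_nodeAt (List.mem_cons_of_mem 0 hp)
    have := hk' l hl
    have := h.pos l hl
    omega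
  · have := h.length_le hp
    have := hk.le_length
    omega

theorem seq_own_le (h : Helped K i p chain pcs) (hl : ListOk chain s) :
    (s.heap p).seq ≤ K + n + 2 := by
  by_cases hs : (s.heap p).seq = 0
  · omega
  · obtain ⟨k, hk, hk'⟩ := hl.nodeAt_of_seq hs
    have := h.pos k hk
    omega

/-- Behind a position `k > K` with `k + 2 ≡ i`, every process consults `announce[i]`, which is `p`,
and prefers it as long as it has no number. Hence `p` is inserted behind the first such position at
the latest, whoever performs the decision. -/
theorem step (h : Helped K i p chain pcs) (hinv : ListInv chain s pcs) (hp : s.announce i = p)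
    (hp0 : p ≠ 0) {j : Fin n} {s' : ListMem n D} {pc' : ListPc} {new : List ℕ}
    (hs : ListStep j s (pcs j) s' pc' new) :
    Helped K i p (chain ++ new) (Function.update pcs j pc') := by
  have hseq0 : p ∉ chain → (s.heap p).seq = 0 := fun hc =>
    hinv.list.seq_out p (by simp [hp0, hc])
  have hinv' := (hinv.step hs).1
  have same : ∀ pc'', (p ∉ chain → pc''.Helps K i p chain) →
      Helped K i p (chain ++ []) (Function.update pcs j pc'') := by
    intro pc'' h'
    rw [List.append_nil]
    refine ⟨h.length, fun hc l => ?_, h.pos⟩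
    rcases eq_or_ne l j with rfl | hl
    · simpa using h' hc
    · simpa [hl] using h.pcs hc l
  have hok := hinv.pc j
  have hj := fun hc => h.pcs hc j
  generalize hi : pcs j = pc at hs hok hj
  cases hs with
  | skip => exact same _ hj
  | help bef =>
    refine same _ fun _ k _ hkb hki => ?_
    have hseq : (s.heap bef).seq = k + 1 := by
      obtain ⟨l, h₁, h₂⟩ := hinv.list.nodeAt_of_seq (hok.1 ▸ hinv.head j)
      rw [h₂, h₁.left_unique hinv.list.nodup hkb]
    unfold ListMem.helpOf
    rw [← hp]
    congr 1
    exact Fin.ext (by rw [← hki]; show ((s.heap bef).seq + 1) % n = _; rw [hseq])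
  | preferHelp bef hlp h' => exact same _ fun hc => hj hc
  | preferOwn bef hlp h' =>
    refine same _ fun hc k hk hkb hki => ?_
    obtain rfl := hj hc k hk hkb hki
    exact (h' (hseq0 hc)).elim
  | decideFirst bef prf hd =>
    obtain ⟨rfl, -, hprf, -⟩ := hok
    have hlast := hinv.list.last_of_dec (hinv.head j) hd
    refine ⟨fun hc k hk hki => ?_, fun hc l => ?_, fun k hk => ?_⟩
    · rw [List.mem_append, not_or, List.mem_singleton] at hc
      have hle := h.length hc.1 k hk hki
      rw [List.length_append, List.length_singleton]
      -- If the list ended at the critical position `k`, the decision would be for `p`, which would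
      -- then belong to the extended list.
      refine Nat.lt_of_le_of_ne hle ?_
      rintro rfl
      exact hc.2 (hj hc.1 _ hk hlast hki).symm
    · have hc' : p ∉ chain := fun hm => hc (List.mem_append_left _ hm)
      rcases eq_or_ne l j with rfl | hl
      · rw [Function.update_self]; trivial
      · rw [Function.update_of_ne hl]
        have h₁ := h.pcs hc' l
        have h₂ := hinv.pc l
        -- The node `head l` is numbered, so it was in the list before the decision, at the same
        -- position.
        have tr : ∀ k, NodeAt (chain ++ [prf]) k (s.head l) → NodeAt chain k (s.head l) := by
          intro k hk
          obtain ⟨k', hk', -⟩ := hinv.list.nodeAt_of_seq (hinv.head l)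
          rwa [hk.left_unique hinv'.list.nodup hk'.append]
        cases hl' : pcs l <;> rw [hl'] at h₁ h₂ <;> try trivial
        · obtain ⟨rfl, -⟩ := h₂
          exact fun k hk hkb => h₁ k hk (tr k hkb)
        · obtain ⟨rfl, -⟩ := h₂
          exact fun k hk hkb => h₁ k hk (tr k hkb)
    · rcases nodeAt_snoc.1 hk with hk' | ⟨rfl, rfl⟩
      · exact h.pos k hk'
      -- Here `p` itself is appended, to a list that had length at most `K + n`.
      · have := h.length_le fun hm =>
          hinv.list.not_mem_of_last hlast hprf (List.mem_cons_of_mem 0 hm)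
        omega
  | _ => exact same _ fun _ => trivial

end Helped

end ListAlgorithm

end ConcLat

namespace ConcLat

/-! ### Herlihy's construction: relation to the atomic object -/

section HerlihyObject

variable {n : ℕ} {M A B : Type u} {S : SeqSpec M A B}

/-- The program counter of `𝒜` with respect to the linked list. -/
def ALoc.pc {Q : Type u} : ALoc M A B Q → ListPc
  | .announce _ _ => .idle
  | .scan _ cur => .scan cur
  | .test => .test
  | .before => .before
  | .help bef => .help bef
  | .prefer bef hlp => .prefer bef hlp
  | .decide bef prf => .decide bef prf
  | .link bef aft => .link bef aft
  | .setSeq bef aft => .setSeq bef aft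
  | .setHead aft => .setHead aft
  | _ => .post

/-- The program counter of a process with respect to the linked list. -/
def procPc {L : Type u} (pc : L → ListPc) : Option (M × L) → ListPc
  | none => .idle
  | some (_, l) => pc l

theorem procPc_update {L : Type u} (pc : L → ListPc) (f : Fin n → Option (M × L)) (i : Fin n)
    (x : Option (M × L)) : (fun j => procPc pc (Function.update f i x j)) =
      Function.update (fun j => procPc pc (f j)) i (procPc pc x) := by
  funext j
  rcases eq_or_ne j i with rfl | hj
  · simp
  · simp [hj]

/-- Only the last node of the list can be without a number, and every numbered node is pointed to by
its predecessor; so the list is linked and numbered up to `own`. This keeps the replay from getting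
stuck. -/
theorem ListOk.exists_next {D : Type u} {chain : List ℕ} {s : ListMem n D} (h : ListOk chain s)
    {k k' p own : ℕ} (hp : NodeAt chain k p) (ho : NodeAt chain k' own)
    (hs : (s.heap own).seq ≠ 0) (hk : k < k') :
    ∃ q, NodeAt chain (k + 1) q ∧ (s.heap p).next = some q ∧ (s.heap q).seq = k + 2 := by
  obtain ⟨q, hq⟩ := exists_nodeAt_of_le (chain := chain) (k := k + 1)
    (by have := ho.le_length; omega)
  have hseq : (s.heap q).seq = k + 2 := by
    refine (h.seq _ _ hq).resolve_right fun hc => ?_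
    have := ho.le_length
    obtain rfl : k' = k + 1 := by omega
    exact hs (ho.right_unique hq ▸ hc.1)
  exact ⟨q, hq, h.next_seq _ _ (h.dec_of_nodeAt hp hq) (by omega), hseq⟩

theorem nodeAt_succ_iff {chain : List ℕ} {k p : ℕ} :
    NodeAt chain (k + 1) p ↔ chain[k]? = some p := by
  unfold NodeAt; rw [List.getElem?_cons_succ]

theorem NodeAt.exists_pred {chain : List ℕ} {k p : ℕ} (h : NodeAt chain k p) (hp : p ≠ 0) :
    ∃ l, k = l + 1 := by
  cases k with
  | zero => exact (hp (h.right_unique (nodeAt_zero _))).elim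
  | succ l => exact ⟨l, rfl⟩

/-- Replaying the operation at position `k` on the state reached by the operations before it. -/
theorem SeqSpec.Run.exists_step (hdet : S.Deterministic) {ops : List (M × A × B)}
    {q q₁ : S.State} {k : ℕ} {o : M × A × B} (h : S.Run S.init ops q)
    (h₁ : S.Run S.init (ops.take k) q₁) (ho : ops[k]? = some o) :
    ∃ q₂, S.step q₁ o.1 o.2.1 o.2.2 q₂ ∧ S.Run S.init (ops.take (k + 1)) q₂ := by
  have hsplit : ops = ops.take (k + 1) ++ ops.drop (k + 1) := (List.take_append_drop _ _).symm
  have htake : ops.take (k + 1) = ops.take k ++ [o] := by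
    rw [List.take_add_one, ho]; rfl
  rw [hsplit, SeqSpec.run_append_iff, htake] at h
  obtain ⟨q₂, h₂, -⟩ := h
  obtain ⟨q₃, h₃, h₄⟩ := SeqSpec.run_append_iff.1 h₂
  obtain rfl := h₃.unique hdet h₁
  exact ⟨q₂, SeqSpec.run_singleton_iff.1 h₄, htake ▸ h₂⟩

/-- The list `chain` contains the invocations of the operations `ops`. -/
def Contents (s : AMem n M A) (chain : List ℕ) (ops : List (M × A × B)) : Prop :=
  List.Forall₂ (fun p o => (s.heap p).data = some (o.1, o.2.1)) chain ops

theorem Contents.get {s : AMem n M A} {chain : List ℕ} {ops : List (M × A × B)}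
    (h : Contents s chain ops) {k p : ℕ} (hk : NodeAt chain (k + 1) p) :
    ∃ o, ops[k]? = some o ∧ (s.heap p).data = some (o.1, o.2.1) := by
  rw [nodeAt_succ_iff] at hk
  unfold Contents at h
  induction h generalizing k with
  | nil => simp at hk
  | @cons p' o chain ops ho _ ih =>
    cases k with
    | zero =>
      obtain rfl : p' = p := by simpa using hk
      exact ⟨o, rfl, ho⟩
    | succ k => exact ih (by simpa using hk)

theorem Contents.congr {s s' : AMem n M A} {chain : List ℕ} {ops : List (M × A × B)}
    (h : Contents s chain ops) (hd : ∀ p ∈ chain, (s'.heap p).data = (s.heap p).data) :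
    Contents s' chain ops := by
  unfold Contents at h ⊢
  induction h with
  | nil => exact .nil
  | cons ho _ ih =>
    exact .cons ((hd _ (by simp)).trans ho) (ih fun p hp => hd p (List.mem_cons_of_mem _ hp))

namespace AInv

/-- The operation of process `i`, and whether it has been executed by the atomic object, that is,
whether its node has been appended to the list. -/
def OpOk (chain : List ℕ) (ops : List (M × A × B)) (s : AMem n M A) (i : Fin n) (m : M)
    (x : AtomicPc M A B) : Prop :=
  ∃ a, (s.heap (s.announce i)).data = some (m, a) ∧
    ((s.announce i ∉ chain ∧ x = .called m a) ∨
      ∃ k b, NodeAt chain (k + 1) (s.announce i) ∧ ops[k]? = some (m, a, b) ∧ x = .done m b)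

/-- What is known about the local state of process `i`. -/
def LocOk (S : SeqSpec M A B) (chain : List ℕ) (ops : List (M × A × B)) (s : AMem n M A)
    (i : Fin n) (m : M) (x : AtomicPc M A B) : ALoc M A B S.State → Prop
  | .announce m' a => m' = m ∧ x = .called m a
  | .replay cur q => OpOk chain ops s i m x ∧ ∃ k, NodeAt chain (k + 1) cur ∧
      (∀ k', NodeAt chain k' (s.announce i) → k + 1 ≤ k') ∧ S.Run S.init (ops.take k) q
  | .setHeadOwn cur q => OpOk chain ops s i m x ∧ cur = s.announce i ∧
      ∃ k, NodeAt chain (k + 1) cur ∧ S.Run S.init (ops.take k) q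
  | .respond cur q => OpOk chain ops s i m x ∧ cur = s.announce i ∧
      ∃ k, NodeAt chain (k + 1) cur ∧ S.Run S.init (ops.take k) q
  | .done b => OpOk chain ops s i m x ∧ ∃ k o, NodeAt chain (k + 1) (s.announce i) ∧
      ops[k]? = some o ∧ o.2.2 = b
  | _ => OpOk chain ops s i m x

def ProcOk (S : SeqSpec M A B) (chain : List ℕ) (ops : List (M × A × B)) (s : AMem n M A)
    (i : Fin n) (x : AtomicPc M A B) : Option (M × ALoc M A B S.State) → Prop
  | none => x = .idle
  | some (m, l) => LocOk S chain ops s i m x l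

variable {chain : List ℕ} {ops : List (M × A × B)} {s s' : AMem n M A} {i : Fin n} {m : M}
  {x : AtomicPc M A B}

theorem LocOk.opOk {l : ALoc M A B S.State} (h : LocOk S chain ops s i m x l)
    (hl : l.pc ≠ .idle) : OpOk chain ops s i m x := by
  cases l <;> first | exact h | exact h.1 | exact (hl rfl).elim

theorem OpOk.congr (h : OpOk chain ops s i m x) (hann : s'.announce i = s.announce i)
    (hdata : (s'.heap (s.announce i)).data = (s.heap (s.announce i)).data) :
    OpOk chain ops s' i m x := by
  unfold OpOk
  rw [hann, hdata]
  exact h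

theorem LocOk.congr {l : ALoc M A B S.State} (h : LocOk S chain ops s i m x l)
    (hann : s'.announce i = s.announce i)
    (hdata : (s'.heap (s.announce i)).data = (s.heap (s.announce i)).data) :
    LocOk S chain ops s' i m x l := by
  cases l <;> simp only [LocOk, hann] at h ⊢ <;>
    first | exact h | exact h.congr hann hdata | exact ⟨h.1.congr hann hdata, h.2⟩

theorem ProcOk.congr {y : Option (M × ALoc M A B S.State)} (h : ProcOk S chain ops s i x y)
    (hann : s'.announce i = s.announce i)
    (hdata : (s'.heap (s.announce i)).data = (s.heap (s.announce i)).data) :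
    ProcOk S chain ops s' i x y := by
  cases y with
  | none => exact h
  | some => exact LocOk.congr h hann hdata

theorem OpOk.append {p : ℕ} {o : M × A × B} (h : OpOk chain ops s i m x)
    (hp : s.announce i ≠ p) : OpOk (chain ++ [p]) (ops ++ [o]) s i m x := by
  obtain ⟨a, ha, ⟨h₁, h₂⟩ | ⟨k, b, h₁, h₂, h₃⟩⟩ := h
  · exact ⟨a, ha, .inl ⟨by simp [h₁, hp], h₂⟩⟩
  · refine ⟨a, ha, .inr ⟨k, b, h₁.append, ?_, h₃⟩⟩
    rw [List.getElem?_append_left (List.getElem?_eq_some_iff.1 h₂).1, h₂]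

/-- If the announced node of `i` is appended, then its operation is executed. -/
theorem OpOk.apply {a : A} {b : B} (hlen : chain.length = ops.length) (hd : (s.heap (s.announce i)).data = some (m, a)) :
    OpOk (chain ++ [s.announce i]) (ops ++ [(m, a, b)]) s i m (.done m b) :=
  ⟨a, hd, .inr ⟨chain.length, b, nodeAt_snoc.2 (.inr ⟨rfl, rfl⟩), by simp [hlen], rfl⟩⟩

/-- A replay refers to positions that exist already; appending one more changes neither these nor
the operations before them. Only the status of the process's own operation may change, and `hop`
supplies it. -/
theorem LocOk.append {p : ℕ} {o : M × A × B} {l : ALoc M A B S.State}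
    (hlen : chain.length = ops.length) (h : LocOk S chain ops s i m x l) (y : AtomicPc M A B)
    (hy : l.pc = .idle → y = x) (hop : l.pc ≠ .idle → OpOk (chain ++ [p]) (ops ++ [o]) s i m y) :
    LocOk S (chain ++ [p]) (ops ++ [o]) s i m y l := by
  have htake : ∀ {k c}, NodeAt chain (k + 1) c → (ops ++ [o]).take k = ops.take k := by
    intro k c hk
    have := hk.le_length
    rw [List.take_append_of_le_length (by omega)]
  cases l with
  | announce => exact ⟨h.1, (hy rfl).trans h.2⟩
  | replay cur q =>
    obtain ⟨-, k, h₁, h₂, h₃⟩ := h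
    refine ⟨hop (by simp [ALoc.pc]), k, h₁.append, fun k' hk' => ?_, by rwa [htake h₁]⟩
    by_cases hl : k' ≤ chain.length
    · exact h₂ k' ((nodeAt_append hl).1 hk')
    · have := h₁.le_length
      omega
  | setHeadOwn cur q =>
    obtain ⟨-, hc, k, h₁, h₃⟩ := h
    exact ⟨hop (by simp [ALoc.pc]), hc, k, h₁.append, by rwa [htake h₁]⟩
  | respond cur q =>
    obtain ⟨-, hc, k, h₁, h₃⟩ := h
    exact ⟨hop (by simp [ALoc.pc]), hc, k, h₁.append, by rwa [htake h₁]⟩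
  | done b =>
    obtain ⟨-, k, o', h₁, h₂, h₃⟩ := h
    refine ⟨hop (by simp [ALoc.pc]), k, o', h₁.append, ?_, h₃⟩
    rw [List.getElem?_append_left (List.getElem?_eq_some_iff.1 h₂).1, h₂]
  | _ => exact hop (by simp [ALoc.pc])

end AInv

open AInv

/-- The simulation relation between `𝒜` and the atomic object. -/
structure AInv (chain : List ℕ) (ops : List (M × A × B)) (s : AMem n M A)
    (g : Fin n → Option (M × ALoc M A B S.State)) (q : S.State) (f : Fin n → AtomicPc M A B) : Prop where
  list : ListInv chain s fun i => procPc ALoc.pc (g i)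
  contents : Contents s chain ops
  run : S.Run S.init ops q
  proc : ∀ i, ProcOk S chain ops s i (f i) (g i)

namespace AInv

variable {chain : List ℕ} {ops : List (M × A × B)} {s : AMem n M A}
  {g : Fin n → Option (M × ALoc M A B S.State)} {q : S.State}
  {f : Fin n → AtomicPc M A B}

theorem init : AInv (n := n) (S := S) [] [] (ListMem.init n none) (fun _ => none) S.init (fun _ => .idle) :=
  ⟨.init _, .nil, .nil _, fun _ => rfl⟩

theorem length (h : AInv chain ops s g q f) : chain.length = ops.length := h.contents.length_eq

theorem locOk (h : AInv chain ops s g q f) {i : Fin n} {m : M} {l : ALoc M A B S.State}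
    (hi : g i = some (m, l)) : LocOk S chain ops s i m (f i) l := by
  have := h.proc i
  rwa [hi] at this

theorem pcOk (h : AInv chain ops s g q f) {i : Fin n} {m : M} {l : ALoc M A B S.State}
    (hi : g i = some (m, l)) : l.pc.Ok chain s i := by
  have := h.list.pc i
  simp only [hi] at this
  exact this

/-- Steps other than calls, returns and first decisions. -/
theorem step_local (h : AInv chain ops s g q f) {i : Fin n} {m : M} {l l' : ALoc M A B S.State}
    {s' : AMem n M A} (hi : g i = some (m, l)) (hs : ListStep i s l.pc s' l'.pc [])
    (hdata : ∀ p < s.alloc, (s'.heap p).data = (s.heap p).data)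
    (hann : ∀ j, j ≠ i → s'.announce j = s.announce j)
    (hok : LocOk S chain ops s' i m (f i) l') :
    AInv chain ops s' (Function.update g i (some (m, l'))) q f := by
  refine ⟨?_, ?_, h.run, fun j => ?_⟩
  · have := (h.list.step (i := i) (s' := s') (pc' := l'.pc) (new := [])
      (by rw [hi]; exact hs)).1
    rw [List.append_nil] at this
    show ListInv chain s' fun j => procPc ALoc.pc (Function.update g i (some (m, l')) j)
    rwa [procPc_update]
  · refine h.contents.congr fun p hp => hdata p (h.list.list.alloc p (List.mem_cons_of_mem 0 hp))
  · show ProcOk S chain ops s' j (f j) (Function.update g i (some (m, l')) j)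
    rcases eq_or_ne j i with rfl | hj
    · rw [Function.update_self]; exact hok
    · rw [Function.update_of_ne hj]
      exact (h.proc j).congr (hann j hj) (hdata _ (h.list.ann_lt j))

/-- The first decision behind a node executes the operation decided upon. -/
theorem step_decide (hnb : S.NonBlocking) (h : AInv chain ops s g q f) {i : Fin n} {m : M}
    {bef prf : ℕ} (hi : g i = some (m, .decide bef prf))
    (hd : (s.heap bef).decideNext = none) :
    ∃ o q' j m' a b, f j = .called m' a ∧ S.step q m' a b q' ∧
      AInv (chain ++ [prf]) (ops ++ [o])
        (s.modify bef fun x => { x with decideNext := some prf })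
        (Function.update g i (some (m, .link bef prf))) q'
        (Function.update f j (.done m' b)) := by
  obtain ⟨hbef, -, hprf, hlt⟩ := h.pcOk hi
  subst hbef
  have hlast := h.list.list.last_of_dec (h.list.head i) hd
  have hout := h.list.list.not_mem_of_last hlast hprf
  have hout' : prf ∉ chain := fun hm => hout (List.mem_cons_of_mem 0 hm)
  -- The node decided upon is unnumbered, so it belongs to an operation in progress, of a process
  -- `j` that need not be `i`. This is the operation that the atomic object executes now.
  obtain ⟨j, rfl, hj⟩ := (h.list.owner prf hlt).resolve_left
    fun hc => hc (h.list.list.seq_out prf hout)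
  have hne0 : s.announce j ≠ 0 := h.list.ann_ne j hj
  obtain ⟨m', l, hpj, hl⟩ : ∃ m' l, g j = some (m', l) ∧ l.pc ≠ .idle := by
    cases hpj : g j with
    | none => simp [hpj, procPc] at hj
    | some y => exact ⟨y.1, y.2, rfl, by simpa [hpj, procPc] using hj⟩
  have hop := (h.locOk hpj).opOk hl
  obtain ⟨a, ha, ⟨-, hf⟩ | ⟨k, b, hk, -⟩⟩ := id hop
  swap
  · exact (hout hk.mem).elim
  obtain ⟨b, q', hq⟩ := hnb q m' a
  refine ⟨(m', a, b), q', j, m', a, b, hf, hq, ?_⟩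
  have hdata : ∀ p, ((s.modify (s.head i) fun x =>
      { x with decideNext := some (s.announce j) }).heap p).data = (s.heap p).data :=
    fun p => by rw [ListMem.modify_heap]; split <;> rfl
  refine ⟨?_, ?_, h.run.snoc hq, fun j' => ?_⟩
  · have := (h.list.step (i := i) (pc' := .link (s.head i) (s.announce j))
      (by rw [hi]; exact .decideFirst _ _ _ hd)).1
    show ListInv _ _ fun j' => procPc ALoc.pc (Function.update g i _ j')
    rwa [procPc_update]
  · refine List.rel_append (R := fun p o => _) ?_ (.cons ?_ .nil)
    · exact h.contents.imp fun p o ho => by rwa [← hdata] at ho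
    · exact (hdata _).trans ha
  · have key : ProcOk S (chain ++ [s.announce j]) (ops ++ [(m', a, b)]) s j'
        (Function.update f j (.done m' b) j') (g j') := by
      cases hpj' : g j' with
      | none =>
        have hne : j' ≠ j := by rintro rfl; rw [hpj] at hpj'; cases hpj'
        rw [Function.update_of_ne hne]
        have := h.proc j'
        rwa [hpj'] at this
      | some y =>
        obtain ⟨m₁, l₁⟩ := y
        have hok := h.locOk hpj'
        rcases eq_or_ne j' j with rfl | hne
        · rw [hpj] at hpj'
          cases hpj'
          rw [Function.update_self]
          exact hok.append h.length _ (fun hc => (hl hc).elim) fun _ =>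
            OpOk.apply h.length ha
        · rw [Function.update_of_ne hne]
          refine hok.append h.length _ (fun _ => rfl) fun hl₁ => (hok.opOk hl₁).append fun he => ?_
          -- Active processes have announced different nodes, so the decision concerns no operation
          -- other than that of `j`.
          rcases h.list.ann_inj _ _ he with h' | h'
          · exact hne h'
          · exact hne0 (he ▸ h')
    have key' := key.congr (s' := s.modify (s.head i) fun x =>
      { x with decideNext := some (s.announce j) }) rfl (hdata _)
    show ProcOk S _ _ _ j' _ (Function.update g i _ j')
    rcases eq_or_ne j' i with rfl | hji
    · rw [Function.update_self]
      rw [hi] at key'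
      exact key'
    · rw [Function.update_of_ne hji]; exact key'

theorem own_ne_zero (h : AInv chain ops s g q f) {i : Fin n} {m : M} {l : ALoc M A B S.State}
    (hi : g i = some (m, l)) (hl : l.pc ≠ .idle) : s.announce i ≠ 0 :=
  h.list.ann_ne i (by simpa [hi, procPc] using hl)

/-- Apart from first decisions, no command extends the list or touches the data of existing nodes,
so the atomic object can stay put. During the replay the private copy follows the run of the atomic
object, by determinism. -/
theorem locOk_of_step (hdet : S.Deterministic) (h : AInv chain ops s g q f) {i : Fin n} {m : M}
    {l l' : ALoc M A B S.State} {s' : AMem n M A} (hi : g i = some (m, l))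
    (hs : AStep S i s l s' l') (hd : ∀ bef prf, l = .decide bef prf →
      (s.heap bef).decideNext ≠ none) :
    ListStep i s l.pc s' l'.pc [] ∧
      (∀ p < s.alloc, (s'.heap p).data = (s.heap p).data) ∧
      (∀ j, j ≠ i → s'.announce j = s.announce j) ∧ LocOk S chain ops s' i m (f i) l' := by
  have hok := h.locOk hi
  have hpc := h.pcOk hi
  have hne0 := h.own_ne_zero hi
  cases hs with
  | announce m' a =>
    obtain ⟨rfl, hx⟩ := hok
    refine ⟨.announce _ _, fun p hp => ?_, fun j hj => by simp [ListMem.announceNew, hj], a, ?_,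
      .inl ⟨?_, hx⟩⟩
    · rw [ListMem.announceNew_heap, if_neg (by omega)]
    · simp [ListMem.announceNew, Node.fresh]
    · intro hm
      have := h.list.list.alloc _ (List.mem_cons_of_mem 0 hm)
      simp [ListMem.announceNew] at this
  | scan j cur hj => exact ⟨.scan _ _ _, fun _ _ => rfl, fun _ _ => rfl, hok⟩
  | scanEnd => exact ⟨.scanEnd _ _, fun _ _ => rfl, fun _ _ => rfl, hok.congr rfl rfl⟩
  | testLoop h' => exact ⟨.testLoop _ h', fun _ _ => rfl, fun _ _ => rfl, hok⟩
  | testExit h' => exact ⟨.testLeave _ h', fun _ _ => rfl, fun _ _ => rfl, hok⟩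
  | before => exact ⟨.before _, fun _ _ => rfl, fun _ _ => rfl, hok⟩
  | help => exact ⟨.help _ _, fun _ _ => rfl, fun _ _ => rfl, hok⟩
  | preferHelp _ _ h' => exact ⟨.preferHelp _ _ _ h', fun _ _ => rfl, fun _ _ => rfl, hok⟩
  | preferOwn _ _ h' => exact ⟨.preferOwn _ _ _ h', fun _ _ => rfl, fun _ _ => rfl, hok⟩
  | decideFirst bef prf h' => exact (hd _ _ rfl h').elim
  | decideLater _ _ _ h' => exact ⟨.decideLater _ _ _ _ h', fun _ _ => rfl, fun _ _ => rfl, hok⟩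
  | link bef aft =>
    have hdata : ∀ p, ((s.modify bef fun x => { x with next := some aft }).heap p).data =
      (s.heap p).data := fun p => by rw [ListMem.modify_heap]; split <;> rfl
    exact ⟨.link _ _ _, fun p _ => hdata p, fun _ _ => rfl, OpOk.congr hok rfl (hdata _)⟩
  | setSeq bef aft =>
    have hdata : ∀ p, ((s.modify aft fun x =>
      { x with seq := (s.heap bef).seq + 1 }).heap p).data =
      (s.heap p).data := fun p => by rw [ListMem.modify_heap]; split <;> rfl
    exact ⟨.setSeq _ _ _, fun p _ => hdata p, fun _ _ => rfl, OpOk.congr hok rfl (hdata _)⟩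
  | setHead => exact ⟨.setHead _ _, fun _ _ => rfl, fun _ _ => rfl, OpOk.congr hok rfl rfl⟩
  | startReplay cur h' =>
    refine ⟨.skip _ _, fun _ _ => rfl, fun _ _ => rfl, hok, 0, ?_, fun k' hk' => ?_, .nil _⟩
    · obtain ⟨k, h₁, h₂⟩ := h.list.list.nodeAt_of_dec (h.list.list.next_dec _ _ h')
      obtain rfl := h₁.left_unique h.list.list.nodup (nodeAt_zero _)
      exact h₂
    · obtain ⟨l, rfl⟩ := hk'.exists_pred (hne0 (by simp [ALoc.pc]))
      omega
  | replay cur nxt q₁ q' m' a b hne hda hq hn =>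
    obtain ⟨hop, k, hk, hmin, hrun⟩ := hok
    refine ⟨.skip _ _, fun _ _ => rfl, fun _ _ => rfl, hop, k + 1, ?_, fun k' hk' => ?_, ?_⟩
    · obtain ⟨l, h₁, h₂⟩ := h.list.list.nodeAt_of_dec (h.list.list.next_dec _ _ hn)
      obtain rfl := h₁.left_unique h.list.list.nodup hk
      exact h₂
    · have := hmin k' hk'
      refine Nat.lt_of_le_of_ne this ?_
      rintro rfl
      exact hne (hk.right_unique hk')
    · obtain ⟨o, ho, hdo⟩ := h.contents.get hk
      rw [hdo] at hda
      obtain ⟨rfl, rfl⟩ := Prod.mk.inj (Option.some.inj hda)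
      obtain ⟨q₂, hq₂, hr₂⟩ := h.run.exists_step hdet hrun ho
      obtain ⟨-, rfl⟩ := hdet _ _ _ _ _ _ _ hq hq₂
      exact hr₂
  | replayEnd cur q₁ h' =>
    obtain ⟨hop, k, hk, -, hrun⟩ := hok
    exact ⟨.skip _ _, fun _ _ => rfl, fun _ _ => rfl, hop, h', k, hk, hrun⟩
  | setHeadOwn cur q₁ =>
    obtain ⟨hop, h₁, h₂⟩ := hok
    exact ⟨.own _, fun _ _ => rfl, fun _ _ => rfl, hop.congr rfl rfl, h₁, h₂⟩
  | respond cur q₁ q' m' a b hda hq =>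
    obtain ⟨hop, rfl, k, hk, hrun⟩ := hok
    obtain ⟨o, ho, hdo⟩ := h.contents.get hk
    rw [hdo] at hda
    obtain ⟨rfl, rfl⟩ := Prod.mk.inj (Option.some.inj hda)
    -- The value found by the replay is the one with which the atomic object has executed the
    -- operation.
    obtain ⟨q₂, hq₂, -⟩ := h.run.exists_step hdet hrun ho
    obtain ⟨rfl, -⟩ := hdet _ _ _ _ _ _ _ hq hq₂
    exact ⟨.skip _ _, fun _ _ => rfl, fun _ _ => rfl, hop, k, o, hk, ho, rfl⟩


end AInv

end HerlihyObject

end ConcLat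

namespace ConcLat

/-! ### Herlihy's construction: simulation and wait-freedom -/

section HerlihyObject

variable {n : ℕ} {M A B : Type u} {S : SeqSpec M A B}

namespace AInv

variable {chain : List ℕ} {ops : List (M × A × B)} {s : AMem n M A}
  {g : Fin n → Option (M × ALoc M A B S.State)} {q : S.State} {f : Fin n → AtomicPc M A B}

theorem call (h : AInv chain ops s g q f) {i : Fin n} (m : M) (a : A) (hi : g i = none) :
    f i = .idle ∧ AInv chain ops s (Function.update g i (some (m, .announce m a))) q
      (Function.update f i (.called m a)) := by
  have hfi : f i = .idle := by have := h.proc i; rwa [hi] at this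
  refine ⟨hfi, ?_, h.contents, h.run, fun j => ?_⟩
  · rw [procPc_update]
    have : procPc ALoc.pc (some (m, (ALoc.announce m a : ALoc M A B S.State))) =
      procPc ALoc.pc (g i) := by rw [hi]; rfl
    rw [this, Function.update_eq_self (f := fun j => procPc ALoc.pc (g j))]
    exact h.list
  · rcases eq_or_ne j i with rfl | hj
    · rw [Function.update_self, Function.update_self]; exact ⟨rfl, rfl⟩
    · rw [Function.update_of_ne hj, Function.update_of_ne hj]; exact h.proc j

/-- The node of a returning operation is in the list, so the atomic object has executed it, with the
value stored in `ops` at its position. -/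
theorem ret (h : AInv chain ops s g q f) {i : Fin n} {m : M} {b : B}
    (hi : g i = some (m, .done b)) :
    f i = .done m b ∧ AInv chain ops s (Function.update g i none) q
      (Function.update f i .idle) := by
  obtain ⟨⟨a, ha, hx⟩, k, o, hk, ho, rfl⟩ := h.locOk hi
  refine ⟨?_, ?_, h.contents, h.run, fun j => ?_⟩
  · rcases hx with ⟨hc, -⟩ | ⟨k', b, hk', ho', hx⟩
    · exact (hc (List.mem_of_getElem? (nodeAt_succ_iff.1 hk))).elim
    · obtain rfl : k' = k := by simpa using hk'.left_unique h.list.list.nodup hk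
      rw [ho] at ho'
      cases ho'
      exact hx
  · have := (h.list.step (i := i) (s' := s) (pc' := .idle) (new := [])
      (by rw [hi]; exact .finish _)).1
    rw [List.append_nil] at this
    rwa [procPc_update]
  · rcases eq_or_ne j i with rfl | hj
    · rw [Function.update_self, Function.update_self]; exact rfl
    · rw [Function.update_of_ne hj, Function.update_of_ne hj]; exact h.proc j

/-- The first decision behind a node is the linearization point. The matching atomic step may belong
to a process other than the deciding one, which is harmless because internal actions are invisible.
-/
theorem tau (hdet : S.Deterministic) (hnb : S.NonBlocking) (h : AInv chain ops s g q f)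
    {i : Fin n} {m : M} {l l' : ALoc M A B S.State} {s' : AMem n M A} (hi : g i = some (m, l))
    (hs : AStep S i s l s' l') :
    ∃ new ops' q' f' w, ListStep i s l.pc s' l'.pc new ∧
      AInv (chain ++ new) ops' s' (Function.update g i (some (m, l'))) q' f' ∧
      (atomicLTS n S).Exec (q, f) w (q', f') ∧ historyOf w = [] := by
  by_cases hd : ∃ bef prf, l = .decide bef prf ∧ (s.heap bef).decideNext = none
  · obtain ⟨bef, prf, rfl, hd⟩ := hd
    have e : s' = (s.modify bef fun x => { x with decideNext := some prf }) ∧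
        l' = .link bef prf := by
      cases hs with
      | decideFirst => exact ⟨rfl, rfl⟩
      | decideLater _ _ _ h' => rw [hd] at h'; cases h'
    obtain ⟨rfl, rfl⟩ := e
    obtain ⟨o, q', j, m', a, b, hf, hq, hinv⟩ := h.step_decide hnb hi hd
    exact ⟨[prf], _, q', _, [.tau j], .decideFirst _ _ _ hd, hinv,
      .single (.apply q q' f j m' a b hf hq), rfl⟩
  · obtain ⟨h₁, h₂, h₃, h₄⟩ := h.locOk_of_step hdet hi hs fun bef prf e hn => hd ⟨bef, prf, e, hn⟩
    refine ⟨[], ops, q, f, [], h₁, ?_, .nil _, rfl⟩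
    rw [List.append_nil]
    exact h.step_local hi h₁ h₂ h₃ h₄

/-- Every step of `𝒜` is a step on the linked list and is matched by the atomic object. -/
theorem step (hdet : S.Deterministic) (hnb : S.NonBlocking) {c c' : (ASpec n S).Config}
    (h : AInv chain ops c.mem c.proc q f) {α : Label n M A B} (hs : (ASpec n S).Step c α c') :
    ∃ new ops' q' f' w, ListStep α.pid c.mem (procPc ALoc.pc (c.proc α.pid)) c'.mem
        (procPc ALoc.pc (c'.proc α.pid)) new ∧
      (∀ j, j ≠ α.pid → c'.proc j = c.proc j) ∧
      AInv (chain ++ new) ops' c'.mem c'.proc q' f' ∧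
      (atomicLTS n S).Exec (q, f) w (q', f') ∧ historyOf w = historyOf [α] := by
  cases hs with
  | call i m a hi =>
    obtain ⟨h₁, h₂⟩ := h.call m a hi
    refine ⟨[], ops, q, _, [.call i m a], ?_, fun j hj => Function.update_of_ne hj _ _, ?_,
      .single (.call q f i m a h₁), rfl⟩
    · simp only [Label.pid, hi, Function.update_self]
      exact .skip _ _
    · rw [List.append_nil]; exact h₂
  | ret i m l b hi hr =>
    have e : l = .done b := by
      cases l <;> first | (cases hr; done) | (cases hr; rfl)
    subst e
    obtain ⟨h₁, h₂⟩ := h.ret hi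
    refine ⟨[], ops, q, _, [.ret i m b], ?_, fun j hj => Function.update_of_ne hj _ _, ?_,
      .single (.ret q f i m b h₁), rfl⟩
    · simp only [Label.pid, hi, Function.update_self]
      exact .finish _
    · rw [List.append_nil]; exact h₂
  | tau i m l l' s' hi hr hs =>
    rcases hs with hs | ⟨-, rfl, rfl⟩
    · obtain ⟨new, ops', q', f', w, h₁, h₂, h₃, h₄⟩ := h.tau hdet hnb hi hs
      refine ⟨new, ops', q', f', w, ?_, fun j hj => Function.update_of_ne hj _ _, h₂, h₃, h₄⟩
      simp only [Label.pid, hi, Function.update_self]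
      exact h₁
    · refine ⟨[], ops, q, f, [], ?_, fun j hj => Function.update_of_ne hj _ _, ?_, .nil _, rfl⟩
      · simp only [Label.pid, hi, Function.update_self]
        exact .skip _ _
      · rw [List.append_nil, ← hi, Function.update_eq_self]
        exact h

/-- The commands of `𝒜` never spin. -/
theorem exists_step (hnb : S.NonBlocking) (h : AInv chain ops s g q f)
    {i : Fin n} {m : M} {l : ALoc M A B S.State} (hi : g i = some (m, l))
    (hl : ∀ b, l ≠ .done b) : ∃ s' l', AStep S i s l s' l' := by
  have hok := h.locOk hi
  have hpc := h.pcOk hi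
  have hne0 := h.own_ne_zero hi
  cases l with
  | announce m' a => exact ⟨_, _, .announce _ _ _⟩
  | scan j cur =>
    by_cases hj : j < n
    · exact ⟨_, _, .scan _ _ _ hj⟩
    · exact ⟨_, _, .scanEnd _ _ _ (not_lt.1 hj)⟩
  | test =>
    by_cases hq : (s.heap (s.announce i)).seq = 0
    · exact ⟨_, _, .testLoop _ hq⟩
    · exact ⟨_, _, .testExit _ hq⟩
  | before => exact ⟨_, _, .before _⟩
  | help => exact ⟨_, _, .help _ _⟩
  | prefer bef hlp =>
    by_cases hq : (s.heap hlp).seq = 0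
    · exact ⟨_, _, .preferHelp _ _ _ hq⟩
    · exact ⟨_, _, .preferOwn _ _ _ hq⟩
  | decide bef prf =>
    cases hq : (s.heap bef).decideNext with
    | none => exact ⟨_, _, .decideFirst _ _ _ hq⟩
    | some aft => exact ⟨_, _, .decideLater _ _ _ _ hq⟩
  | link => exact ⟨_, _, .link _ _ _⟩
  | setSeq => exact ⟨_, _, .setSeq _ _ _⟩
  | setHead => exact ⟨_, _, .setHead _ _⟩
  -- The loop is left only when the own node is numbered, so the list is linked up to it.
  | startReplay =>
    have hs : (s.heap (s.announce i)).seq ≠ 0 := hpc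
    obtain ⟨k, hk, -⟩ := h.list.list.nodeAt_of_seq hs
    obtain ⟨k, rfl⟩ := hk.exists_pred (hne0 (by simp [ALoc.pc]))
    obtain ⟨nxt, -, hn, -⟩ := h.list.list.exists_next (nodeAt_zero _) hk hs (Nat.succ_pos k)
    exact ⟨_, _, .startReplay _ _ hn⟩
  | replay cur q₁ =>
    obtain ⟨hop, k, hk, hmin, hrun⟩ := hok
    by_cases he : cur = s.announce i
    · exact ⟨_, _, .replayEnd _ _ _ he⟩
    · have hs : (s.heap (s.announce i)).seq ≠ 0 := hpc
      obtain ⟨k', hk', -⟩ := h.list.list.nodeAt_of_seq hs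
      have hlt : k + 1 < k' := lt_of_le_of_ne (hmin _ hk') fun e => he (hk.right_unique (e ▸ hk'))
      obtain ⟨nxt, -, hn, -⟩ := h.list.list.exists_next hk hk' hs hlt
      obtain ⟨o, ho, hdo⟩ := h.contents.get hk
      obtain ⟨b, q₂, hb⟩ := hnb q₁ o.1 o.2.1
      exact ⟨_, _, .replay _ _ _ _ _ _ _ _ he hdo hb hn⟩
  | setHeadOwn => exact ⟨_, _, .setHeadOwn _ _ _⟩
  | respond cur q₁ =>
    obtain ⟨-, -, k, hk, -⟩ := hok
    obtain ⟨o, ho, hdo⟩ := h.contents.get hk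
    obtain ⟨b, q₂, hb⟩ := hnb q₁ o.1 o.2.1
    exact ⟨_, _, .respond _ _ _ _ _ _ _ hdo hb⟩
  | done b => exact (hl b rfl).elim

/-- A bound on the number of steps of process `i` until it returns, as long as it is not helped more
than `N` times. -/
def rank {Q : Type u} (N : ℕ) (s : AMem n M A) (i : Fin n) : ALoc M A B Q → ℕ
  | .announce _ _ => 0
  | .scan j _ => N + 20 * (N + 2) + (n - j)
  | .test => N + 7 + 20 * (N - (s.heap (s.head i)).seq) + 15
  | .before => N + 7 + 20 * (N - (s.heap (s.head i)).seq) + 14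
  | .help _ => N + 7 + 20 * (N - (s.heap (s.head i)).seq) + 13
  | .prefer _ _ => N + 7 + 20 * (N - (s.heap (s.head i)).seq) + 12
  | .decide _ _ => N + 7 + 20 * (N - (s.heap (s.head i)).seq) + 11
  | .link _ _ => N + 7 + 20 * (N - (s.heap (s.head i)).seq) + 6
  | .setSeq _ _ => N + 7 + 20 * (N - (s.heap (s.head i)).seq) + 5
  | .setHead _ => N + 7 + 20 * (N - (s.heap (s.head i)).seq) + 4
  | .startReplay => N + 6
  | .replay cur _ => N - (s.heap cur).seq + 5
  | .setHeadOwn _ _ => 3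
  | .respond _ _ => 2
  | .done _ => 1

/-- A pass through the loop raises the number of `head i` by one; this is worth `20` and outweighs
the way back from `setHead` (`4`) to `test` (`15`). With `N = K + n + 2`, `Helped` keeps the number
of `head i` below `N` when `setHead` is executed and the number of the own node at most `N`, so the
truncated subtractions really decrease. -/
theorem rank_lt (h : AInv chain ops s g q f) {i : Fin n} {m : M} {l l' : ALoc M A B S.State}
    {s' : AMem n M A} {new : List ℕ} {K : ℕ} (hi : g i = some (m, l)) (hs : AStep S i s l s' l')
    (he : ListExt i chain s (chain ++ new) s') (hl : l.pc ≠ .idle)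
    (hh : Helped K i (s.announce i) chain fun j => procPc ALoc.pc (g j)) :
    rank (K + n + 2) s' i l' < rank (K + n + 2) s i l := by
  have hok := h.locOk hi
  have hpc := h.pcOk hi
  have hseq := he.seq _ (h.list.head i)
  have hown := hh.seq_own_le h.list.list
  cases hs with
  | announce => exact (hl rfl).elim
  | setHead aft =>
    obtain ⟨h₁, h₂⟩ := hpc
    have := hh.seq_lt h.list.list h₁ (h.list.head i)
    simp only [rank, ListMem.setHead, Function.update_self]
    omega
  | startReplay cur hn => simp only [rank]; omega
  | replay cur nxt q₁ q' m' a b hne hd hq hn =>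
    obtain ⟨-, k, hk, hmin, -⟩ := hok
    have hs : (s.heap (s.announce i)).seq ≠ 0 := hpc
    obtain ⟨k', hk', hs'⟩ := h.list.list.nodeAt_of_seq hs
    have hlt : k + 1 < k' := lt_of_le_of_ne (hmin _ hk') fun e => hne (hk.right_unique (e ▸ hk'))
    obtain ⟨nxt', -, hn', hsn⟩ := h.list.list.exists_next hk hk' hs hlt
    rw [hn] at hn'
    cases hn'
    have hsc := h.list.list.seq_of_lt hk (by have := hk'.le_length; omega)
    simp only [rank]
    omega
  | _ =>
    simp only [rank, ListMem.setHead, ListMem.modify] at hseq ⊢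
    omega

/-- Other processes can neither move `head i` nor change a number already assigned. The node being
replayed has a number, because it does not come after the own node, which has one. -/
theorem rank_eq (h : AInv chain ops s g q f) {i j : Fin n} {m : M} {l : ALoc M A B S.State}
    {s' : AMem n M A} {new : List ℕ} {N : ℕ} (hi : g i = some (m, l))
    (he : ListExt j chain s (chain ++ new) s') (hij : i ≠ j) : rank N s' i l = rank N s i l := by
  obtain ⟨h₁, h₂, h₃⟩ := h.list.head_eq he hij
  have hok := h.locOk hi
  have hpc := h.pcOk hi
  cases l with
  | replay cur q₁ =>
    obtain ⟨-, k, hk, hmin, -⟩ := hok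
    have hs : (s.heap (s.announce i)).seq ≠ 0 := hpc
    obtain ⟨k', hk', hs'⟩ := h.list.list.nodeAt_of_seq hs
    have hsc : (s.heap cur).seq ≠ 0 := by
      rcases h.list.list.seq _ _ hk with hc | ⟨-, -, hc⟩
      · omega
      · have := hmin _ hk'
        have := hk'.le_length
        obtain rfl : k' = k + 1 := by omega
        rwa [hk.right_unique hk']
    simp only [rank, he.seq _ hsc]
  | _ => simp only [rank, h₃]

end AInv

theorem ListStep.new_eq_nil {D : Type u} {i : Fin n} {s s' : ListMem n D} {pc pc' : ListPc}
    {new : List ℕ} (h : ListStep i s pc s' pc' new) (hpc : ∀ bef prf, pc ≠ .decide bef prf) :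
    new = [] := by
  cases h <;> first | rfl | exact (hpc _ _ rfl).elim

theorem ALoc.pc_eq_idle {Q : Type u} {l : ALoc M A B Q} (h : l.pc = .idle) :
    ∃ m a, l = .announce m a := by
  cases l <;> first | exact ⟨_, _, rfl⟩ | cases h

/-- `w` bounds the number of steps that process `i` takes before its next return. -/
def AInv.Bound (i : Fin n) (w : ℕ ×ₗ ℕ) (s : AMem n M A)
    (g : Fin n → Option (M × ALoc M A B S.State)) : Prop :=
  ∃ chain ops q f m l, AInv chain ops s g q f ∧ g i = some (m, l) ∧
    (l.pc = .idle ∧ w = toLex (1, 0) ∨ l.pc ≠ .idle ∧ ∃ K,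
      (Helped K i (s.announce i) chain fun j => procPc ALoc.pc (g j)) ∧
      w = toLex (0, AInv.rank (K + n + 2) s i l))

/-- `K` is the length of the list at the announcement and unknown before; the first component of the
lexicographic rank accounts for the time until then. Afterwards `Helped.step` preserves helping and
`rank_lt` lowers the second component. -/
theorem AInv.Bound.tau (hdet : S.Deterministic) (hnb : S.NonBlocking) {i : Fin n} {w : ℕ ×ₗ ℕ}
    {s s' : AMem n M A} {g : Fin n → Option (M × ALoc M A B S.State)} {m : M}
    {l l' : ALoc M A B S.State} (h : AInv.Bound i w s g) (hi : g i = some (m, l))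
    (hl : ∀ b, l ≠ .done b) (hs : orSpin (AStep S i) s l s' l') :
    ∃ w' < w, AInv.Bound i w' s' (Function.update g i (some (m, l'))) := by
  obtain ⟨chain, ops, q, f, m₁, l₁, h, hi₁, hw⟩ := h
  rw [hi] at hi₁
  cases hi₁
  replace hs : AStep S i s l s' l' := hs.resolve_right fun hc => hc.1 (h.exists_step hnb hi hl)
  obtain ⟨new, ops', q', f', w', hls, h', -⟩ := h.tau hdet hnb hi hs
  have hls' : ListStep i s (procPc ALoc.pc (g i)) s' l'.pc new := by rw [hi]; exact hls
  have hext := (h.list.step hls').2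
  rcases hw with ⟨hl, rfl⟩ | ⟨hl, K, hK, rfl⟩
  · obtain ⟨m', a, rfl⟩ := ALoc.pc_eq_idle hl
    obtain rfl := hls.new_eq_nil (by simp [ALoc.pc])
    cases hs
    refine ⟨toLex (0, _), Prod.Lex.toLex_lt_toLex.2 (.inl Nat.zero_lt_one), _, _, _, _, m, _, h',
      Function.update_self .., .inr ⟨by simp [ALoc.pc], _, .of_announce ?_, rfl⟩⟩
    intro hm
    rw [List.append_nil] at hm
    have := h.list.list.alloc _ hm
    simp [ListMem.announceNew] at this
  · have hl' : l'.pc ≠ .idle := by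
      intro e
      obtain ⟨m', a, rfl⟩ := ALoc.pc_eq_idle e
      cases hs
    refine ⟨toLex (0, AInv.rank (K + n + 2) s' i l'),
      Prod.Lex.toLex_lt_toLex.2 (.inr ⟨rfl, h.rank_lt hi hs hext hl hK⟩),
      _, _, _, _, m, _, h', Function.update_self .., .inr ⟨hl', K, ?_, rfl⟩⟩
    have hann : s'.announce i = s.announce i := by
      cases hs <;> first | rfl | exact (hl rfl).elim
    rw [hann, procPc_update]
    exact hK.step h.list rfl (h.own_ne_zero hi hl) hls'

theorem aSpec_not_starved (hdet : S.Deterministic) (hnb : S.NonBlocking) (i : Fin n)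
    (t : ℕ → Label n M A B) (ht : (ASpec n S).sem.IsInfTrace t) : ¬ Starved t i := by
  refine LTS.not_starved_of_rank
    (fun c : (ASpec n S).Config => ∃ chain ops q f, AInv chain ops c.mem c.proc q f) i
    (fun w (c : (ASpec n S).Config) => AInv.Bound i w c.mem c.proc) ⟨[], [], _, _, .init⟩
    ?_ ?_ ?_ ?_ t ht
  · rintro c α c' ⟨chain, ops, q, f, h⟩ hs
    obtain ⟨new, ops', q', f', w, -, -, h', -⟩ := AInv.step hdet hnb h hs
    exact ⟨_, _, _, _, h'⟩
  · rintro c m a c' ⟨chain, ops, q, f, h⟩ hs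
    obtain ⟨new, ops', q', f', w, -, -, h', -⟩ := AInv.step hdet hnb h hs
    cases hs with
    | call _ _ _ hi =>
      exact ⟨_, _, _, _, _, m, .announce m a, h', Function.update_self .., .inl ⟨rfl, rfl⟩⟩
  · rintro w c α c' - ⟨chain, ops, q, f, m, l, h, hi, hw⟩ hs hα
    obtain ⟨new, ops', q', f', w', hls, hsame, h', -⟩ := AInv.step hdet hnb h hs
    have hext := (h.list.step hls).2
    refine ⟨_, _, _, _, m, l, h', (hsame i (Ne.symm hα)).trans hi, ?_⟩
    rcases hw with hw | ⟨hl, K, hK, rfl⟩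
    · exact .inl hw
    · refine .inr ⟨hl, K, ?_, ?_⟩
      · have := hK.step h.list rfl (h.own_ne_zero hi hl) hls
        rw [(h.list.head_eq hext (Ne.symm hα)).2.1]
        convert this using 1
        funext j
        rcases eq_or_ne j α.pid with rfl | hj
        · rw [Function.update_self]
        · rw [Function.update_of_ne hj, hsame j hj]
      · rw [h.rank_eq hi hext (Ne.symm hα)]
  · rintro w c α c' - h hs hαi hα
    cases hs with
    | call j m' a hj =>
      obtain rfl : j = i := hαi
      obtain ⟨_, _, _, _, m, l, -, hi, -⟩ := h
      rw [show c.proc j = some (m, l) from hi] at hj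
      cases hj
    | ret j m' l' b hj hr =>
      obtain rfl : j = i := hαi
      exact (hα ⟨_, _, rfl⟩).elim
    | tau j m' l₁ l₂ s' hj hr hs =>
      obtain rfl : j = i := hαi
      exact AInv.Bound.tau hdet hnb h hj (fun b e => by subst e; cases hr) hs

theorem aSpec_sim_atomic (hdet : S.Deterministic) (hnb : S.NonBlocking) :
    (ASpec n S).sem.Sim (atomicLTS n S) := by
  refine ⟨fun c q => ∃ chain ops, AInv chain ops c.mem c.proc q.1 q.2, ⟨[], [], .init⟩, ?_⟩
  rintro c ⟨q, f⟩ α c' ⟨chain, ops, h⟩ hs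
  obtain ⟨new, ops', q', f', w, -, -, h', hw, hh⟩ := AInv.step hdet hnb h hs
  exact ⟨w, (q', f'), hw, hh, _, _, h'⟩

theorem aSpec_admissible (hdet : S.Deterministic) (hnb : S.NonBlocking) (P : Liveness) :
    (ASpec n S).Admissible S P :=
  ⟨(aSpec_sim_atomic hdet hnb).linearizable (atomicLTS_linearizable n S),
    LTS.satisfies_of_not_starved (fun t ht i => aSpec_not_starved hdet hnb i t ht) P⟩

end HerlihyObject

end ConcLat

namespace ConcLat

/-! ### Recorded histories with operation identities -/

section Recorder

variable {n : ℕ} {M A B : Type u} {S : SeqSpec M A B}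

open History

/-- The possible contents of the history recorder: calls and returns alternate, a return has the same
method and identity as its call, and the identities of calls are unique. -/
structure RecordOk (r : IdHistory n M A B) : Prop where
  alt : ∀ h : IdHistory n M A B, h <+: r → Alternating h
  rets : ∀ (i : Fin n) (k : ℕ) (d : M × B × ℕ), (retsOf i r)[k]? = some d → ∃ a, (callsOf i r)[k]? = some (d.1, a, d.2.2)
  unique : ∀ (i j : Fin n) (k k' : ℕ) (c c' : M × A × ℕ), (callsOf i r)[k]? = some c → (callsOf j r)[k']? = some c' →
    c.2.2 = c'.2.2 → i = j ∧ k = k'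

theorem getElem?_of_prefix {α : Type*} {l l' : List α} (h : l <+: l') {k : ℕ} {x : α}
    (hk : l[k]? = some x) : l'[k]? = some x := by
  obtain ⟨t, rfl⟩ := h
  rw [List.getElem?_append_left (List.getElem?_eq_some_iff.1 hk).1, hk]

theorem getElem?_of_prefix_of_lt {α : Type*} {l l' : List α} (h : l <+: l') {k : ℕ} {x : α}
    (hk : l'[k]? = some x) (hl : k < l.length) : l[k]? = some x := by
  obtain ⟨t, rfl⟩ := h
  rwa [List.getElem?_append_left hl] at hk

theorem prefix_of_getElem? {α : Type*} {l l' : List α}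
    (h : ∀ (k : ℕ) x, l[k]? = some x → l'[k]? = some x) : l <+: l' := by
  rw [List.prefix_iff_getElem?]
  intro k hk
  exact h k _ (List.getElem?_eq_getElem hk)

theorem recordOk_nil : RecordOk ([] : IdHistory n M A B) where
  alt h hh := by rw [List.prefix_nil.1 hh]; exact alternating_nil
  rets i k d h := by simp at h
  unique i j k k' c c' h := by simp at h

namespace RecordOk

variable {r h : IdHistory n M A B}

theorem alternating (hr : RecordOk r) : r.Alternating := hr.alt r List.prefix_rfl

/-- By alternation, the call with the same index as a return in `h` is in `h` as well. -/
theorem of_prefix (hr : RecordOk r) (hp : h <+: r) : RecordOk h where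
  alt h' hh' := hr.alt h' (hh'.trans hp)
  rets i k d hk := by
    obtain ⟨a, ha⟩ := hr.rets i k d (getElem?_of_prefix (retsOf_prefix hp i) hk)
    refine ⟨a, getElem?_of_prefix_of_lt (callsOf_prefix hp i) ha ?_⟩
    exact (List.getElem?_eq_some_iff.1 hk).1.trans_le (hr.alt h hp i).2.1
  unique i j k k' c c' h₁ h₂ := hr.unique i j k k' c c'
    (getElem?_of_prefix (callsOf_prefix hp i) h₁) (getElem?_of_prefix (callsOf_prefix hp j) h₂)

theorem snoc_call (hr : RecordOk r) {i : Fin n} {m : M} {a : A} {t : ℕ}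
    (hi : (callsOf i r).length = (retsOf i r).length) (ht : ∀ j, ∀ c ∈ callsOf j r, c.2.2 ≠ t) :
    RecordOk (r ++ [.call i m a t]) where
  alt h hh := by
    rcases List.prefix_concat_iff.1 hh with rfl | hh
    · exact hr.alternating.snoc_call hi m a t
    · exact hr.alt h hh
  rets j k d hk := by
    rw [retsOf_append, retsOf_cons_call, retsOf_nil, List.append_nil] at hk
    obtain ⟨b, hb⟩ := hr.rets j k d hk
    exact ⟨b, getElem?_of_prefix (callsOf_prefix (List.prefix_append _ _) j) hb⟩
  unique := by
    have key : ∀ j k c, (callsOf j (r ++ [.call i m a t]))[k]? = some c →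
        (callsOf j r)[k]? = some c ∨ j = i ∧ k = (callsOf i r).length ∧ c.2.2 = t := by
      intro j k c hk
      rw [callsOf_append] at hk
      rcases eq_or_ne i j with rfl | hij
      · rw [callsOf_cons_call_self, callsOf_nil, List.getElem?_append] at hk
        split at hk
        · exact .inl hk
        · rename_i hlt
          obtain ⟨h₁, h₂⟩ := List.getElem?_eq_some_iff.1 hk
          simp at h₁ h₂
          exact .inr ⟨rfl, by omega, by rw [← h₂]⟩
      · rw [callsOf_cons_call_of_ne hij, callsOf_nil, List.append_nil] at hk
        exact .inl hk
    intro j j' k k' c c' h₁ h₂ hc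
    rcases key j k c h₁ with e₁ | ⟨e₁, e₂, e₃⟩ <;> rcases key j' k' c' h₂ with d₁ | ⟨d₁, d₂, d₃⟩
    · exact hr.unique j j' k k' c c' e₁ d₁ hc
    · exact (ht j c (List.mem_of_getElem? e₁) (hc.trans d₃)).elim
    · exact (ht j' c' (List.mem_of_getElem? d₁) (hc.symm.trans e₃)).elim
    · exact ⟨e₁.trans d₁.symm, e₂.trans d₂.symm⟩

theorem snoc_ret (hr : RecordOk r) {i : Fin n} {m : M} {a : A} {b : B} {t : ℕ}
    {cs : List (M × A × ℕ)} (hi : callsOf i r = cs ++ [(m, a, t)])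
    (hl : cs.length = (retsOf i r).length) : RecordOk (r ++ [.ret i m b t]) where
  alt h hh := by
    rcases List.prefix_concat_iff.1 hh with rfl | hh
    · exact hr.alternating.snoc_ret (by simp [hi, hl]) m b t
    · exact hr.alt h hh
  rets j k d hk := by
    rw [callsOf_append, callsOf_cons_ret, callsOf_nil, List.append_nil]
    rw [retsOf_append] at hk
    rcases eq_or_ne i j with rfl | hij
    · rw [retsOf_cons_ret_self, retsOf_nil, List.getElem?_append] at hk
      split at hk
      · exact hr.rets i k d hk
      · rename_i hlt
        obtain ⟨h₁, h₂⟩ := List.getElem?_eq_some_iff.1 hk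
        simp at h₁ h₂
        refine ⟨a, ?_⟩
        rw [hi, ← h₂, List.getElem?_append_right (by omega), show k - cs.length = 0 by omega]
        rfl
    · rw [retsOf_cons_ret_of_ne hij, retsOf_nil, List.append_nil] at hk
      exact hr.rets j k d hk
  unique := by
    simpa only [callsOf_append, callsOf_cons_ret, callsOf_nil, List.append_nil] using hr.unique

end RecordOk

theorem Lin.getElem? {h : IdHistory n M A B} {l : List (IdOp n M A B)} (hl : Lin S h l)
    {o : IdOp n M A B} (ho : o ∈ l) : ∃ k : ℕ, (opsOf o.pid l)[k]? = some o ∧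
      (callsOf o.pid h)[k]? = some (o.m, o.a, o.tag) := by
  obtain ⟨k, hk⟩ := List.getElem?_of_mem (mem_opsOf.2 ⟨ho, rfl⟩)
  refine ⟨k, hk, getElem?_of_prefix (hl.calls o.pid) ?_⟩
  rw [List.getElem?_map, hk]; rfl

/-- Identities of calls are unique, and a linearization lists for each process an initial part of
its calls; so at most one of its operations carries the identity `t`. -/
theorem RetIn.unique {h : IdHistory n M A B} {l : List (IdOp n M A B)} (hr : RecordOk h)
    (hl : Lin S h l) {t : ℕ} {b b' : B} (h₁ : RetIn l t b) (h₂ : RetIn l t b') : b = b' := by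
  obtain ⟨o, ho, rfl, rfl⟩ := h₁
  obtain ⟨o', ho', ht, rfl⟩ := h₂
  obtain ⟨k, h₁, h₂⟩ := hl.getElem? ho
  obtain ⟨k', h₁', h₂'⟩ := hl.getElem? ho'
  obtain ⟨hp, rfl⟩ := hr.unique _ _ _ _ _ _ h₂ h₂' ht.symm
  rw [← hp, h₁] at h₁'
  cases h₁'
  rfl

/-- A linearization of a prefix that contains the operations that have returned. -/
theorem Lin.extend {h hp : IdHistory n M A B} {l : List (IdOp n M A B)} (hr : RecordOk h)
    (hpre : hp <+: h) (hl : Lin S hp l)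
    (hrets : ∀ i, ∀ d ∈ retsOf i h, RetIn l d.2.2 d.2.1) : Lin S h l where
  word := hl.word
  calls i := (hl.calls i).trans (callsOf_prefix hpre i)
  rets i := by
    refine prefix_of_getElem? fun k d hk => ?_
    obtain ⟨o, ho, ht, hb⟩ := hrets i d (List.mem_of_getElem? hk)
    obtain ⟨a, ha⟩ := hr.rets i k d hk
    -- Values are known by identity, whereas `Lin` compares positions. Uniqueness of identities
    -- shows that the operation with the identity of the `k`-th return is itself the `k`-th of its
    -- process.
    obtain ⟨k', h₁, h₂⟩ := hl.getElem? ho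
    have h₃ := getElem?_of_prefix (callsOf_prefix hpre _) h₂
    obtain ⟨hpid, rfl⟩ := hr.unique _ _ _ _ _ _ h₃ ha ht
    rw [hpid] at h₁ h₃
    rw [ha, Option.some.injEq] at h₃
    rw [List.getElem?_map, h₁, Option.map_some, OpInst.retData, hb, ht,
      show o.m = d.1 from (congrArg Prod.fst h₃).symm]
  order o₁ o₂ h₂ hb := by
    refine hl.order o₁ o₂ h₂ (hb.of_prefix hpre (h₂.trans_le ?_))
    simpa using (hl.calls o₂.1).length_le

/-- A linearization can be extended by a pending operation. -/
theorem Lin.exists_snoc (hnb : S.NonBlocking) {h : IdHistory n M A B} {l : List (IdOp n M A B)}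
    (hr : RecordOk h) (hl : Lin S h l) {i : Fin n} {c : M × A × ℕ} (hc : c ∈ callsOf i h) :
    ∃ l', Lin S h l' ∧ l <+: l' ∧ ∃ b, RetIn l' c.2.2 b := by
  obtain ⟨m, a, t⟩ := c
  obtain ⟨k, hk⟩ := List.getElem?_of_mem hc
  have hklt := (List.getElem?_eq_some_iff.1 hk).1
  by_cases hkl : k < (opsOf i l).length
  · obtain ⟨o, ho⟩ : ∃ o, (opsOf i l)[k]? = some o := ⟨_, List.getElem?_eq_getElem hkl⟩
    have h₁ := getElem?_of_prefix (hl.calls i) (k := k) (x := o.callData)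
      (by rw [List.getElem?_map, ho]; rfl)
    rw [hk] at h₁
    refine ⟨l, hl, List.prefix_rfl, o.b, o, (mem_opsOf.1 (List.mem_of_getElem? ho)).1, ?_, rfl⟩
    simp only [OpInst.callData, Option.some.injEq, Prod.mk.injEq] at h₁
    exact h₁.2.2.symm
  -- `l` contains all returned operations of `i`, and at most one call of `i` has not returned; so
  -- the missing operation is the next one of `i`.
  · have hlen : (opsOf i l).length = k := by
      have h₁ := (hr.alternating i).2.2
      have h₂ := (hl.rets i).length_le
      rw [List.length_map] at h₂
      omega
    obtain ⟨q, hq⟩ := hl.word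
    obtain ⟨b, q', hb⟩ := hnb q m a
    set o : IdOp n M A B := ⟨i, m, a, b, t⟩ with ho
    have hself : opsOf i (l ++ [o]) = opsOf i l ++ [o] := by
      rw [opsOf_append]; exact congrArg _ (opsOf_singleton_self o)
    have hne : ∀ j, i ≠ j → opsOf j (l ++ [o]) = opsOf j l := fun j hj => by
      rw [opsOf_append, opsOf_singleton_of_ne (by exact hj), List.append_nil]
    refine ⟨l ++ [o], ⟨⟨q', ?_⟩, fun j => ?_, fun j => ?_, fun o₁ o₂ h₂ hbef => ?_⟩,
      List.prefix_append _ _, b, o, by simp, rfl, rfl⟩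
    · rw [opWord_append]
      exact hq.snoc hb
    · rcases eq_or_ne i j with rfl | hj
      · refine prefix_of_getElem? fun k' x hx => ?_
        rw [hself, List.map_append, List.getElem?_append] at hx
        split at hx
        · exact getElem?_of_prefix (hl.calls i) hx
        · rename_i hlt
          rw [List.length_map] at hlt hx
          obtain ⟨h₁, h₂⟩ := List.getElem?_eq_some_iff.1 hx
          simp at h₁ h₂
          obtain rfl : k' = k := by omega
          rw [hk, ← h₂]; rfl
      · rw [hne j hj]; exact hl.calls j
    · rcases eq_or_ne i j with rfl | hj
      · rw [hself, List.map_append]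
        exact (hl.rets i).trans (List.prefix_append _ _)
      · rw [hne j hj]; exact hl.rets j
    · by_cases h' : o₂.2 < (opsOf o₂.1 l).length
      · exact (hl.order o₁ o₂ h' hbef).mono (List.prefix_append _ _)
      -- The new operation comes last, and whatever precedes it has returned, hence is in `l`.
      · refine ⟨l, List.prefix_append _ _, ?_, by omega, h₂⟩
        have := (hl.rets o₁.1).length_le
        rw [List.length_map] at this
        exact hbef.lt_rets.trans_le this

/-- Calls without their tags. -/
def callPairs {T : Type} (i : Fin n) (h : History n M A B T) : List (M × A) :=
  (callsOf i h).map fun c => (c.1, c.2.1)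

/-- Returns without their tags. -/
def retPairs {T : Type} (i : Fin n) (h : History n M A B T) : List (M × B) :=
  (retsOf i h).map fun c => (c.1, c.2.1)

theorem length_callPairs {T : Type} (i : Fin n) (h : History n M A B T) :
    (callPairs i h).length = (callsOf i h).length := List.length_map _

theorem length_retPairs {T : Type} (i : Fin n) (h : History n M A B T) :
    (retPairs i h).length = (retsOf i h).length := List.length_map _

/-- Forget the tag of an operation. -/
def OpInst.untag {T : Type} (o : OpInst n M A B T) : OpInst n M A B Unit :=
  ⟨o.pid, o.m, o.a, o.b, ()⟩

theorem opsOf_untag {T : Type} (i : Fin n) (l : List (OpInst n M A B T)) :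
    opsOf i (l.map OpInst.untag) = (opsOf i l).map OpInst.untag := by
  unfold opsOf
  rw [List.filter_map]
  rfl

theorem opWord_untag {T : Type} (l : List (OpInst n M A B T)) :
    opWord (l.map OpInst.untag) = opWord l := by
  simp [opWord, OpInst.untag]

theorem prefix_unit {X Y : Type*} {l l' : List (X × Y × Unit)}
    (h : l.map (fun c => (c.1, c.2.1)) <+: l'.map fun c => (c.1, c.2.1)) : l <+: l' := by
  have := h.map fun c => ((c.1, c.2, ()) : X × Y × Unit)
  rw [List.map_map, List.map_map] at this
  convert this <;> exact (List.map_id _).symm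

/-- A linearization of the recorded history is a linearization of the actual history. -/
theorem Lin.untag {T : Type} {r : History n M A B T} {l : List (OpInst n M A B T)} (hl : Lin S r l)
    {h : History n M A B Unit} (hc : ∀ i, callPairs i r <+: callPairs i h)
    (hr : ∀ i, retPairs i h <+: retPairs i r)
    (ho : ∀ o₁ o₂ : Fin n × ℕ, o₂.2 < (callsOf o₂.1 r).length → h.Before o₁ o₂ →
      r.Before o₁ o₂) : Lin S h (l.map OpInst.untag) where
  word := by rw [opWord_untag]; exact hl.word
  calls i := by
    refine prefix_unit (List.IsPrefix.trans ?_ (hc i))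
    have := (hl.calls i).map fun c => (c.1, c.2.1)
    simpa [opsOf_untag, callPairs, OpInst.callData, OpInst.untag, Function.comp_def] using this
  rets i := by
    refine prefix_unit ((hr i).trans ?_)
    have := (hl.rets i).map fun c => (c.1, c.2.1)
    simpa [opsOf_untag, retPairs, OpInst.retData, OpInst.untag, Function.comp_def] using this
  order o₁ o₂ h₂ hb := by
    rw [opsOf_untag, List.length_map] at h₂
    have hlt : o₂.2 < (callsOf o₂.1 r).length :=
      h₂.trans_le (by simpa using (hl.calls o₂.1).length_le)
    obtain ⟨l₁, h₁, h₃, h₄, h₅⟩ := hl.order o₁ o₂ h₂ (ho o₁ o₂ hlt hb)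
    refine ⟨l₁.map OpInst.untag, h₁.map _, ?_, ?_, ?_⟩ <;>
      rwa [opsOf_untag, List.length_map]

end Recorder

end ConcLat

namespace ConcLat

/-! ### The record compared with the actual history -/

section Recorded

variable {n : ℕ} {M A B : Type u}

open History

/-- The process `i` has called `m(a)`, but the call has not been recorded. -/
structure SyncWaiting (i : Fin n) (h : History n M A B Unit) (r : IdHistory n M A B) (m : M)
    (a : A) : Prop where
  calls : callPairs i h = callPairs i r ++ [(m, a)]
  rets : retPairs i r = retPairs i h
  length : (callsOf i r).length = (retsOf i r).length

/-- The call `m(a)` of process `i` has been recorded with identity `t`. -/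
structure SyncActive (i : Fin n) (h : History n M A B Unit) (r : IdHistory n M A B) (m : M)
    (a : A) (t : ℕ) : Prop where
  calls : callPairs i h = callPairs i r
  rets : retPairs i r = retPairs i h
  last : ∃ cs, callsOf i r = cs ++ [(m, a, t)] ∧ cs.length = (retsOf i r).length

/-- The return of the value `b` by process `i` has been recorded. -/
structure SyncFinished (i : Fin n) (h : History n M A B Unit) (r : IdHistory n M A B) (m : M)
    (b : B) : Prop where
  calls : callPairs i h = callPairs i r
  rets : retPairs i r = retPairs i h ++ [(m, b)]
  length : (callsOf i r).length = (retsOf i r).length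

/-- How the history `h` and the recorded history `r` differ for process `i`. -/
def ProcSync (i : Fin n) (h : History n M A B Unit) (r : IdHistory n M A B) :
    Option (M × ULoc n M A B) → Prop
  | none => callPairs i h = callPairs i r ∧ retPairs i r = retPairs i h ∧
      (callsOf i r).length = (retsOf i r).length
  | some (m, .genId m' a) => m' = m ∧ SyncWaiting i h r m a
  | some (m, .run m' a _ .storeCall) => m' = m ∧ SyncWaiting i h r m a
  | some (m, .run m' _ _ (.done b)) => m' = m ∧ SyncFinished i h r m b
  | some (m, .run m' a t _) => m' = m ∧ SyncActive i h r m a t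

/-- The call of the operation has been recorded, but not its return. -/
def UPc.Inner : UPc n M A B → Prop
  | .storeCall => False
  | .done _ => False
  | _ => True

theorem procSync_of_inner {i : Fin n} {h : History n M A B Unit} {r : IdHistory n M A B} {m m' : M}
    {a : A} {t : ℕ} {pc : UPc n M A B} (hpc : pc.Inner) :
    ProcSync i h r (some (m, .run m' a t pc)) ↔ m' = m ∧ SyncActive i h r m a t := by
  cases pc <;> first | exact hpc.elim | exact Iff.rfl

namespace ProcSync

variable {i : Fin n} {h h' : History n M A B Unit} {r r' : IdHistory n M A B}
  {x : Option (M × ULoc n M A B)}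

theorem congr (hx : ProcSync i h r x) (h₁ : callsOf i h' = callsOf i h)
    (h₂ : retsOf i h' = retsOf i h) (h₃ : callsOf i r' = callsOf i r)
    (h₄ : retsOf i r' = retsOf i r) : ProcSync i h' r' x := by
  have hw : ∀ m a, SyncWaiting i h r m a → SyncWaiting i h' r' m a := fun m a ⟨e₁, e₂, e₃⟩ =>
    ⟨by simpa only [callPairs, h₁, h₃] using e₁, by simpa only [retPairs, h₂, h₄] using e₂,
      by simpa only [h₃, h₄] using e₃⟩
  have ha : ∀ m a t, SyncActive i h r m a t → SyncActive i h' r' m a t := fun m a t ⟨e₁, e₂, e₃⟩ =>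
    ⟨by simpa only [callPairs, h₁, h₃] using e₁, by simpa only [retPairs, h₂, h₄] using e₂,
      by simpa only [h₃, h₄] using e₃⟩
  have hf : ∀ m b, SyncFinished i h r m b → SyncFinished i h' r' m b := fun m b ⟨e₁, e₂, e₃⟩ =>
    ⟨by simpa only [callPairs, h₁, h₃] using e₁, by simpa only [retPairs, h₂, h₄] using e₂,
      by simpa only [h₃, h₄] using e₃⟩
  match x, hx with
  | none, ⟨e₁, e₂, e₃⟩ =>
    exact ⟨by simpa only [callPairs, h₁, h₃] using e₁, by simpa only [retPairs, h₂, h₄] using e₂,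
      by simpa only [h₃, h₄] using e₃⟩
  | some (m, .genId m' a), hx => exact ⟨hx.1, hw _ _ hx.2⟩
  | some (m, .run m' a t pc), hx =>
    cases pc <;> first
      | exact ⟨hx.1, hw _ _ hx.2⟩ | exact ⟨hx.1, hf _ _ hx.2⟩ | exact ⟨hx.1, ha _ _ _ hx.2⟩

/-- A call is recorded after it has happened and a return before it happens, so the record lags
behind in calls and runs ahead in returns. `Lin.untag` needs exactly this. -/
theorem prefixes (hx : ProcSync i h r x) :
    callPairs i r <+: callPairs i h ∧ retPairs i h <+: retPairs i r := by
  have ha : ∀ m a t, SyncActive i h r m a t →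
      callPairs i r <+: callPairs i h ∧ retPairs i h <+: retPairs i r :=
    fun m a t hs => ⟨hs.calls ▸ List.prefix_rfl, hs.rets ▸ List.prefix_rfl⟩
  have hw : ∀ m a, SyncWaiting i h r m a →
      callPairs i r <+: callPairs i h ∧ retPairs i h <+: retPairs i r :=
    fun m a hs => ⟨hs.calls ▸ List.prefix_append _ _, hs.rets ▸ List.prefix_rfl⟩
  match x, hx with
  | none, ⟨e₁, e₂, _⟩ => exact ⟨e₁ ▸ List.prefix_rfl, e₂ ▸ List.prefix_rfl⟩
  | some (m, .genId m' a), hx => exact hw _ _ hx.2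
  | some (m, .run m' a t pc), hx =>
    cases pc <;> first
      | exact ha _ _ _ hx.2
      | exact hw _ _ hx.2
      | exact ⟨hx.2.calls ▸ List.prefix_rfl, hx.2.rets ▸ List.prefix_append _ _⟩

end ProcSync

/-- The relation between the actual history `h`, the recorded history `r`, and the local states of
the processes; the identities below `N` have been used. -/
structure Recorded (h : History n M A B Unit) (r : IdHistory n M A B) (N : ℕ)
    (g : Fin n → Option (M × ULoc n M A B)) : Prop where
  alt : Alternating h
  record : RecordOk r
  order : ∀ o₁ o₂ : Fin n × ℕ, o₂.2 < (callsOf o₂.1 r).length → h.Before o₁ o₂ → r.Before o₁ o₂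
  ids : ∀ i, ∀ c ∈ callsOf i r, c.2.2 < N
  sync : ∀ i, ProcSync i h r (g i)
  fresh : ∀ i m m' a t, g i = some (m, .run m' a t .storeCall) →
    t < N ∧ ∀ j, ∀ c ∈ callsOf j r, c.2.2 ≠ t
  fresh_inj : ∀ i j m m' a m₁ m₁' a₁ t, g i = some (m, .run m' a t .storeCall) →
    g j = some (m₁, .run m₁' a₁ t .storeCall) → i = j

namespace Recorded

variable {h : History n M A B Unit} {r : IdHistory n M A B} {N : ℕ}
  {g : Fin n → Option (M × ULoc n M A B)}

theorem init : Recorded (M := M) (A := A) (B := B) [] [] 0 fun _ : Fin n => none where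
  alt := alternating_nil
  record := recordOk_nil
  order _ _ hc := by simp at hc
  ids _ _ hc := by simp at hc
  sync _ := ⟨rfl, rfl, rfl⟩
  fresh _ _ _ _ _ hg := by cases hg
  fresh_inj _ _ _ _ _ _ _ _ _ hg := by cases hg

theorem sync_of (hr : Recorded h r N g) {i : Fin n} {x : Option (M × ULoc n M A B)}
    (hi : g i = x) : ProcSync i h r x := hi ▸ hr.sync i

theorem length_callsOf (hr : Recorded h r N g) (i : Fin n) :
    (callsOf i r).length ≤ (callsOf i h).length := by
  have := (hr.sync i).prefixes.1.length_le
  rwa [length_callPairs, length_callPairs] at this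

/-- The state of process `i` has changed. -/
theorem update (hr : Recorded h r N g) {i : Fin n} {h' : History n M A B Unit}
    {r' : IdHistory n M A B} {N' : ℕ} {x : Option (M × ULoc n M A B)} (alt : Alternating h')
    (record : RecordOk r')
    (order : ∀ o₁ o₂ : Fin n × ℕ, o₂.2 < (callsOf o₂.1 r').length → h'.Before o₁ o₂ →
      r'.Before o₁ o₂)
    (hN : N ≤ N') (ids : ∀ i, ∀ c ∈ callsOf i r', c.2.2 < N')
    (sync : ProcSync i h' r' x)
    (h₁ : ∀ j, i ≠ j → callsOf j h' = callsOf j h) (h₂ : ∀ j, i ≠ j → retsOf j h' = retsOf j h)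
    (h₃ : ∀ j, i ≠ j → callsOf j r' = callsOf j r) (h₄ : ∀ j, i ≠ j → retsOf j r' = retsOf j r)
    (new : ∀ j m m' a t, j ≠ i → g j = some (m, .run m' a t .storeCall) →
      ∀ c ∈ callsOf i r', c.2.2 ≠ t)
    (fresh : ∀ m m' a t, x = some (m, .run m' a t .storeCall) →
      (t < N' ∧ ∀ j, ∀ c ∈ callsOf j r', c.2.2 ≠ t) ∧
      ∀ j m m' a, j ≠ i → g j ≠ some (m, .run m' a t .storeCall)) :
    Recorded h' r' N' (Function.update g i x) where
  alt := alt
  record := record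
  order := order
  ids := ids
  sync j := by
    rcases eq_or_ne j i with rfl | hj
    · rwa [Function.update_self]
    · rw [Function.update_of_ne hj]
      exact (hr.sync j).congr (h₁ j hj.symm) (h₂ j hj.symm) (h₃ j hj.symm) (h₄ j hj.symm)
  fresh j m m' a t hj := by
    rcases eq_or_ne j i with rfl | hji
    · rw [Function.update_self] at hj
      exact (fresh m m' a t hj).1
    · rw [Function.update_of_ne hji] at hj
      obtain ⟨e₁, e₂⟩ := hr.fresh j m m' a t hj
      refine ⟨e₁.trans_le hN, fun k c hc => ?_⟩
      rcases eq_or_ne i k with rfl | hik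
      · exact new j m m' a t hji hj c hc
      · exact e₂ k c (h₃ k hik ▸ hc)
  fresh_inj j k m m' a m₁ m₁' a₁ t hj hk := by
    rcases eq_or_ne j i with rfl | hji <;> rcases eq_or_ne k j with rfl | hkj <;> try rfl
    · rw [Function.update_self] at hj
      rw [Function.update_of_ne hkj] at hk
      exact ((fresh m m' a t hj).2 k _ _ _ hkj hk).elim
    · rw [Function.update_of_ne hji] at hj
      rcases eq_or_ne k i with rfl | hki
      · rw [Function.update_self] at hk
        exact ((fresh _ _ _ t hk).2 j _ _ _ hji hj).elim
      · rw [Function.update_of_ne hki] at hk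
        exact hr.fresh_inj j k _ _ _ _ _ _ t hj hk

theorem call (hr : Recorded h r N g) {i : Fin n} (m : M) (a : A) (hi : g i = none) :
    Recorded (h ++ [.call i m a ()]) r N (Function.update g i (some (m, .genId m a))) := by
  obtain ⟨e₁, e₂, e₃⟩ := hr.sync_of hi
  refine hr.update ?_ hr.record (fun o₁ o₂ hlt hb => ?_) le_rfl hr.ids ⟨rfl, ?_, ?_, e₃⟩ ?_ ?_
    (fun _ _ => rfl) (fun _ _ => rfl) (fun j m m' a t _ hj => (hr.fresh j m m' a t hj).2 i) ?_
  · refine hr.alt.snoc_call ?_ m a ()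
    rw [← length_callPairs, ← length_retPairs, e₁, ← e₂, length_callPairs, length_retPairs, e₃]
  · exact hr.order o₁ o₂ hlt (hb.of_prefix (List.prefix_append _ _)
      (hlt.trans_le (hr.length_callsOf _)))
  · simpa [callPairs] using e₁
  · simpa [retPairs] using e₂
  · exact fun j hj => by simp [callsOf_cons_call_of_ne hj]
  · exact fun j hj => by simp
  · intro m m' a t hx; cases hx

theorem ret (hr : Recorded h r N g) {i : Fin n} {m m' : M} {a : A} {t : ℕ} {b : B}
    (hi : g i = some (m, .run m' a t (.done b))) :
    Recorded (h ++ [.ret i m b ()]) r N (Function.update g i none) := by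
  obtain ⟨-, e₁, e₂, e₃⟩ := hr.sync_of hi
  refine hr.update ?_ hr.record (fun o₁ o₂ hlt hb => ?_) le_rfl hr.ids ⟨?_, ?_, e₃⟩ ?_ ?_
    (fun _ _ => rfl) (fun _ _ => rfl) (fun j m m' a t _ hj => (hr.fresh j m m' a t hj).2 i) ?_
  · refine hr.alt.snoc_ret ?_ m b ()
    have := congrArg List.length e₂
    rw [List.length_append, length_retPairs, length_retPairs] at this
    rw [← length_callPairs, e₁, length_callPairs, e₃, this]
    rfl
  · exact hr.order o₁ o₂ hlt (hb.of_prefix (List.prefix_append _ _)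
      (hlt.trans_le (hr.length_callsOf _)))
  · simpa [callPairs] using e₁
  · simpa [retPairs] using e₂
  · exact fun j hj => by simp
  · exact fun j hj => by simp [retsOf_cons_ret_of_ne hj]
  · intro m m' a t hx; cases hx

theorem genId (hr : Recorded h r N g) {i : Fin n} {m m' : M} {a : A}
    (hi : g i = some (m, .genId m' a)) :
    Recorded h r (N + 1) (Function.update g i (some (m, .run m' a N .storeCall))) := by
  refine hr.update hr.alt hr.record hr.order (Nat.le_succ N)
    (fun j c hc => (hr.ids j c hc).trans (Nat.lt_succ_self N)) (hr.sync_of hi :) (fun _ _ => rfl)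
    (fun _ _ => rfl) (fun _ _ => rfl) (fun _ _ => rfl)
    (fun j m m' a t _ hj => (hr.fresh j m m' a t hj).2 i) ?_
  intro m₁ m₁' a₁ t hx
  cases hx
  refine ⟨⟨Nat.lt_succ_self _, fun j c hc => (hr.ids j c hc).ne⟩, fun j m m' a _ hj => ?_⟩
  exact (hr.fresh j m m' a _ hj).1.ne rfl

/-- Recording a call late moves the start of the operation to a later moment. Everything that
returned before the actual call has been recorded as returned by then, so the record keeps the
real-time order. -/
theorem storeCall (hr : Recorded h r N g) {i : Fin n} {m m' : M} {a : A} {t : ℕ}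
    (hi : g i = some (m, .run m' a t .storeCall)) :
    Recorded h (r ++ [.call i m' a t]) N
      (Function.update g i (some (m, .run m' a t .announce))) := by
  obtain ⟨rfl, e₁, e₂, e₃⟩ := hr.sync_of hi
  obtain ⟨hN, hfr⟩ := hr.fresh i _ _ _ _ hi
  have hlen : ∀ j, (retsOf j h).length ≤ (retsOf j r).length := fun j => by
    have := (hr.sync j).prefixes.2.length_le
    rwa [length_retPairs, length_retPairs] at this
  refine hr.update hr.alt (hr.record.snoc_call e₃ hfr) (fun o₁ o₂ hlt hb => ?_) le_rfl ?_
    ⟨rfl, ?_, ?_, _, ?_, e₃.trans ?_⟩ (fun _ _ => rfl) (fun _ _ => rfl) ?_ ?_ ?_ ?_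
  · by_cases hlt' : o₂.2 < (callsOf o₂.1 r).length
    · exact (hr.order o₁ o₂ hlt' hb).mono (List.prefix_append _ _)
    -- `o₂` is the operation recorded now; the record already contains all returns of `h`, and hence
    -- that of `o₁`.
    · exact before_of_lt (List.prefix_append _ _) (hb.lt_rets.trans_le (hlen _)) (by omega) hlt
  · intro j c hc
    rcases eq_or_ne i j with rfl | hj
    · rw [callsOf_append, callsOf_cons_call_self, callsOf_nil, List.mem_append,
        List.mem_singleton] at hc
      rcases hc with hc | rfl
      · exact hr.ids _ c hc
      · exact hN
    · rw [callsOf_append, callsOf_cons_call_of_ne hj, callsOf_nil, List.append_nil] at hc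
      exact hr.ids _ c hc
  · simpa [callPairs] using e₁
  · simpa [retPairs] using e₂
  · simp
  · simp
  · exact fun j hj => by simp [callsOf_cons_call_of_ne hj]
  · exact fun j hj => by simp
  · intro j m₁ m₁' a₁ t₁ hji hj c hc
    rw [callsOf_append, callsOf_cons_call_self, callsOf_nil, List.mem_append,
      List.mem_singleton] at hc
    rcases hc with hc | rfl
    · exact (hr.fresh j _ _ _ _ hj).2 i c hc
    · rintro rfl
      exact hji (hr.fresh_inj j i _ _ _ _ _ _ _ hj hi)
  · intro m m' a t hx; cases hx

theorem storeRet (hr : Recorded h r N g) {i : Fin n} {m m' : M} {a : A} {t : ℕ} {b : B}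
    (hi : g i = some (m, .run m' a t (.storeRet b))) :
    Recorded h (r ++ [.ret i m' b t]) N
      (Function.update g i (some (m, .run m' a t (.done b)))) := by
  obtain ⟨rfl, e₁, e₂, cs, e₃, e₄⟩ := hr.sync_of hi
  have hcalls : ∀ j, callsOf j (r ++ [.ret i m' b t]) = callsOf j r := fun j => by simp
  refine hr.update hr.alt (hr.record.snoc_ret e₃ e₄) (fun o₁ o₂ hlt hb => ?_) le_rfl ?_
    ⟨rfl, ?_, ?_, ?_⟩ (fun _ _ => rfl) (fun _ _ => rfl) (fun j _ => hcalls j) ?_ ?_ ?_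
  · rw [hcalls] at hlt
    exact (hr.order o₁ o₂ hlt hb).mono (List.prefix_append _ _)
  · intro j
    rw [hcalls]
    exact hr.ids j
  · simpa [callPairs] using e₁
  · simpa [retPairs] using e₂
  · rw [hcalls, e₃]
    simp [e₄]
  · exact fun j hj => by simp [retsOf_cons_ret_of_ne hj]
  · intro j m₁ m₁' a₁ t₁ _ hj
    rw [hcalls]
    exact (hr.fresh j _ _ _ _ hj).2 i
  · intro m m' a t hx; cases hx

theorem inner (hr : Recorded h r N g) {i : Fin n} {m m' : M} {a : A} {t : ℕ}
    {pc pc' : UPc n M A B} (hi : g i = some (m, .run m' a t pc)) (hpc : pc.Inner)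
    (hpc' : pc'.Inner) :
    Recorded h r N (Function.update g i (some (m, .run m' a t pc'))) := by
  have hs := hr.sync_of hi
  rw [procSync_of_inner hpc, ← procSync_of_inner hpc'] at hs
  refine hr.update hr.alt hr.record hr.order le_rfl hr.ids hs (fun _ _ => rfl) (fun _ _ => rfl)
    (fun _ _ => rfl) (fun _ _ => rfl) (fun j m m' a t _ hj => (hr.fresh j m m' a t hj).2 i) ?_
  intro m m' a t hx
  cases hx
  exact hpc'.elim

end Recorded

end Recorded

end ConcLat

namespace ConcLat

/-! ### Histories and linearizations stored in the nodes -/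

section UniversalNodes

variable {n : ℕ} {M A B : Type u} {S : SeqSpec M A B}

open History

theorem ListOk.reflTransGen_next {D : Type u} {chain : List ℕ} {s : ListMem n D}
    (h : ListOk chain s) {k k' p q : ℕ} (hq : NodeAt chain k q) (hp : NodeAt chain k' p)
    (hk : k ≤ k') (hs : (s.heap p).seq ≠ 0) : Relation.ReflTransGen s.Next q p := by
  induction hk generalizing p with
  | refl => exact hq.right_unique hp ▸ .refl
  | @step k' hk ih =>
    obtain ⟨p', hp'⟩ := exists_nodeAt_of_le (chain := chain) (k := k')
      (by have := hp.le_length; omega)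
    refine (ih hp' ?_).tail (h.next_seq p' p (h.dec_of_nodeAt hp' hp) hs)
    rw [h.seq_of_lt hp' hp.le_length]
    omega

/-- The return value `b` of the operation `t` is stored in one of the first `k` nodes. -/
def Determined (chain : List ℕ) (s : UMem n M A B) (k t : ℕ) (b : B) : Prop :=
  ∃ k' q, k' < k ∧ NodeAt chain (k' + 1) q ∧ s.HasOp q t ∧ s.NodeRet q t b

/-- `l` agrees with the return values that are stored in the first `k` nodes. -/
def Covers (chain : List ℕ) (s : UMem n M A B) (k : ℕ) (l : List (IdOp n M A B)) : Prop :=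
  ∀ k' q, k' < k → NodeAt chain (k' + 1) q → ∃ t b, s.HasOp q t ∧ s.NodeRet q t b ∧ RetIn l t b

/-- The history `h` may be stored in the node `p`, which is preceded by `k` nodes. -/
structure HistOk (chain : List ℕ) (s : UMem n M A B) (k p : ℕ) (h : IdHistory n M A B) : Prop where
  node : NodeAt chain (k + 1) p
  record : h <+: s.record
  call : ∃ i m a t, (s.list.heap p).data.op = some (t, m, a) ∧ (m, a, t) ∈ callsOf i h
  rets : ∀ i, ∀ d ∈ retsOf i h, Determined chain s k d.2.2 d.2.1
  hists : ∀ k' q, k' < k → NodeAt chain (k' + 1) q →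
    ∃ h', (s.list.heap q).data.hist = some h' ∧ h' <+: h

/-- The linearization `l` of `h` may be stored in the node `p`, which is preceded by `k` nodes. -/
structure LinOk (S : SeqSpec M A B) (chain : List ℕ) (s : UMem n M A B) (k p : ℕ)
    (h : IdHistory n M A B) (l : List (IdOp n M A B)) : Prop where
  node : NodeAt chain (k + 1) p
  lin : Lin S h l
  own : ∃ t b, s.HasOp p t ∧ RetIn l t b
  prev : Covers chain s k l

/-- The invariant of the nodes of the list. -/
structure NodesOk (S : SeqSpec M A B) (chain : List ℕ) (s : UMem n M A B) : Prop where
  ops : ∀ p, p ≠ 0 → p < s.list.alloc → ∃ i m a t, (s.list.heap p).data.op = some (t, m, a) ∧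
    (m, a, t) ∈ callsOf i s.record
  unalloc : ∀ p, s.list.alloc ≤ p → (s.list.heap p).data.op = none
  hist : ∀ p h, (s.list.heap p).data.hist = some h → ∃ k, HistOk chain s k p h
  lin : ∀ p l, (s.list.heap p).data.lin = some l →
    ∃ k h, (s.list.heap p).data.hist = some h ∧ LinOk S chain s k p h l
  seq : ∀ p, p ≠ 0 → (s.list.heap p).seq ≠ 0 → (s.list.heap p).data.lin ≠ none
  rets : ∀ i, ∀ d ∈ retsOf i s.record, Determined chain s chain.length d.2.2 d.2.1

/-- The data that is never overwritten. -/
structure UExt (chain : List ℕ) (s : UMem n M A B) (chain' : List ℕ) (s' : UMem n M A B) :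
    Prop where
  chain : chain <+: chain'
  record : s.record <+: s'.record
  op : ∀ p o, (s.list.heap p).data.op = some o → (s'.list.heap p).data.op = some o
  hist : ∀ p h, (s.list.heap p).data.hist = some h → (s'.list.heap p).data.hist = some h
  lin : ∀ p l, (s.list.heap p).data.lin = some l → (s'.list.heap p).data.lin = some l

theorem UMem.HasOp.unique {s : UMem n M A B} {p t t' : ℕ} (h : s.HasOp p t) (h' : s.HasOp p t') :
    t = t' := by
  obtain ⟨m, a, h⟩ := h
  obtain ⟨m', a', h'⟩ := h'
  rw [h] at h'
  cases h'
  rfl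

theorem RetIn.mono {l l' : List (IdOp n M A B)} {t : ℕ} {b : B} (h : RetIn l t b)
    (hl : l <+: l') : RetIn l' t b := by
  obtain ⟨o, ho, h⟩ := h
  exact ⟨o, hl.subset ho, h⟩

theorem Covers.mono {chain : List ℕ} {s : UMem n M A B} {k : ℕ} {l l' : List (IdOp n M A B)}
    (h : Covers chain s k l) (hl : l <+: l') : Covers chain s k l' := by
  intro k' q hk hq
  obtain ⟨t, b, h₁, h₂, h₃⟩ := h k' q hk hq
  exact ⟨t, b, h₁, h₂, h₃.mono hl⟩

theorem Determined.mono {chain : List ℕ} {s : UMem n M A B} {k k' t : ℕ} {b : B}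
    (h : Determined chain s k t b) (hk : k ≤ k') : Determined chain s k' t b := by
  obtain ⟨l, q, hl, h⟩ := h
  exact ⟨l, q, hl.trans_le hk, h⟩

namespace UExt

variable {chain chain' : List ℕ} {s s' : UMem n M A B}

theorem hasOp (he : UExt chain s chain' s') {p t : ℕ} (h : s.HasOp p t) : s'.HasOp p t := by
  obtain ⟨m, a, h⟩ := h
  exact ⟨m, a, he.op _ _ h⟩

theorem nodeRet (he : UExt chain s chain' s') {p t : ℕ} {b : B} (h : s.NodeRet p t b) :
    s'.NodeRet p t b := by
  obtain ⟨l, h, h'⟩ := h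
  exact ⟨l, he.lin _ _ h, h'⟩

theorem nodeAt (he : UExt chain s chain' s') {k p : ℕ} (h : NodeAt chain k p) :
    NodeAt chain' k p := by
  obtain ⟨new, rfl⟩ := he.chain
  exact h.append

theorem nodeAt_of_le (he : UExt chain s chain' s') {k p : ℕ} (h : NodeAt chain' k p)
    (hk : k ≤ chain.length) : NodeAt chain k p := by
  obtain ⟨new, rfl⟩ := he.chain
  exact (nodeAt_append hk).1 h

theorem determined (he : UExt chain s chain' s') {k t : ℕ} {b : B} (h : Determined chain s k t b) :
    Determined chain' s' k t b := by
  obtain ⟨l, q, hl, h₁, h₂, h₃⟩ := h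
  exact ⟨l, q, hl, he.nodeAt h₁, he.hasOp h₂, he.nodeRet h₃⟩

theorem histOk (he : UExt chain s chain' s') {k p : ℕ} {h : IdHistory n M A B}
    (hh : HistOk chain s k p h) : HistOk chain' s' k p h where
  node := he.nodeAt hh.node
  record := hh.record.trans he.record
  call := by
    obtain ⟨i, m, a, t, h₁, h₂⟩ := hh.call
    exact ⟨i, m, a, t, he.op _ _ h₁, h₂⟩
  rets i d hd := he.determined (hh.rets i d hd)
  hists k' q hk hq := by
    obtain ⟨h', h₁, h₂⟩ := hh.hists k' q hk
      (he.nodeAt_of_le hq (by have := hh.node.le_length; omega))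
    exact ⟨h', he.hist _ _ h₁, h₂⟩

theorem linOk (he : UExt chain s chain' s') {k p : ℕ} {h : IdHistory n M A B}
    {l : List (IdOp n M A B)} (hl : LinOk S chain s k p h l) : LinOk S chain' s' k p h l where
  node := he.nodeAt hl.node
  lin := hl.lin
  own := by
    obtain ⟨t, b, h₁, h₂⟩ := hl.own
    exact ⟨t, b, he.hasOp h₁, h₂⟩
  prev k' q hk hq := by
    obtain ⟨t, b, h₁, h₂, h₃⟩ := hl.prev k' q hk
      (he.nodeAt_of_le hq (by have := hl.node.le_length; omega))
    exact ⟨t, b, he.hasOp h₁, he.nodeRet h₂, h₃⟩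

theorem of_data {new : List ℕ} (hd : ∀ p, (s'.list.heap p).data = (s.list.heap p).data)
    (hr : s.record <+: s'.record) : UExt chain s (chain ++ new) s' :=
  ⟨List.prefix_append _ _, hr, fun p o h => by rwa [hd], fun p o h => by rwa [hd],
    fun p o h => by rwa [hd]⟩

end UExt

namespace NodesOk

variable {chain chain' : List ℕ} {s s' : UMem n M A B}

theorem init : NodesOk S [] (USpec n S).mem₀ := by
  have hd : ∀ p, (((USpec n S).mem₀ : UMem n M A B).list.heap p).data = ⟨none, none, none⟩ := by
    intro p
    show ((ListMem.init n _).heap p).data = _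
    unfold ListMem.init
    dsimp only
    split <;> rfl
  refine ⟨fun p h0 hp => ?_, fun p _ => by rw [hd], fun p h hh => ?_, fun p l hl => ?_,
    fun p h0 hs => ?_, fun i d h => by cases h⟩
  · have : p < 1 := hp
    omega
  · rw [hd] at hh; cases hh
  · rw [hd] at hl; cases hl
  · refine (hs ?_).elim
    show ((ListMem.init n _).heap p).seq = 0
    simp [ListMem.init, h0, Node.fresh]

/-- Fields are written once and both the record and the list only grow, so statements about stored
data persist under `UExt`. The remaining hypotheses concern only what a step adds. -/
theorem ext (h : NodesOk S chain s) (he : UExt chain s chain' s')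
    (ops : ∀ p, p ≠ 0 → p < s'.list.alloc → p < s.list.alloc ∨ ∃ i m a t,
      (s'.list.heap p).data.op = some (t, m, a) ∧ (m, a, t) ∈ callsOf i s'.record)
    (unalloc : ∀ p, s'.list.alloc ≤ p → (s'.list.heap p).data.op = none)
    (hist : ∀ p h, (s'.list.heap p).data.hist = some h → (s.list.heap p).data.hist = some h ∨
      ∃ k, HistOk chain' s' k p h)
    (lin : ∀ p l, (s'.list.heap p).data.lin = some l → (s.list.heap p).data.lin = some l ∨
      ∃ k h, (s'.list.heap p).data.hist = some h ∧ LinOk S chain' s' k p h l)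
    (seq : ∀ p, p ≠ 0 → (s'.list.heap p).seq ≠ 0 → (s.list.heap p).seq ≠ 0 ∨
      (s.list.heap p).data.lin ≠ none)
    (rets : ∀ i, ∀ d ∈ retsOf i s'.record, d ∈ retsOf i s.record ∨
      Determined chain' s' chain'.length d.2.2 d.2.1) : NodesOk S chain' s' where
  ops p h0 hp := by
    rcases ops p h0 hp with hp | hp
    · obtain ⟨i, m, a, t, h₁, h₂⟩ := h.ops p h0 hp
      exact ⟨i, m, a, t, he.op _ _ h₁, (callsOf_prefix he.record i).subset h₂⟩
    · exact hp
  unalloc := unalloc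
  hist p hh hp := by
    rcases hist p hh hp with hp | hp
    · obtain ⟨k, hk⟩ := h.hist p hh hp
      exact ⟨k, he.histOk hk⟩
    · exact hp
  lin p l hp := by
    rcases lin p l hp with hp | hp
    · obtain ⟨k, hh, h₁, h₂⟩ := h.lin p l hp
      exact ⟨k, hh, he.hist _ _ h₁, he.linOk h₂⟩
    · exact hp
  seq p h0 hp := by
    have hl : (s.list.heap p).data.lin ≠ none := (seq p h0 hp).elim (h.seq p h0) id
    obtain ⟨l, hl⟩ := Option.ne_none_iff_exists'.1 hl
    rw [he.lin _ _ hl]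
    simp
  rets i d hd := by
    rcases rets i d hd with hd | hd
    · exact (he.determined (h.rets i d hd)).mono he.chain.length_le
    · exact hd

/-- Steps that change neither the data of the nodes nor the record. -/
theorem of_data {new : List ℕ} (h : NodesOk S chain s)
    (hd : ∀ p, (s'.list.heap p).data = (s.list.heap p).data) (hr : s'.record = s.record)
    (ha : s'.list.alloc = s.list.alloc)
    (seq : ∀ p, p ≠ 0 → (s'.list.heap p).seq ≠ 0 → (s.list.heap p).seq ≠ 0 ∨
      (s.list.heap p).data.lin ≠ none) : NodesOk S (chain ++ new) s' :=
  h.ext (.of_data hd (hr ▸ List.prefix_rfl)) (fun p _ hp => .inl (ha ▸ hp))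
    (fun p hp => by rw [hd]; exact h.unalloc p (ha ▸ hp)) (fun p x hx => .inl (by rwa [← hd]))
    (fun p x hx => .inl (by rwa [← hd])) seq (fun i d hdr => .inl (hr ▸ hdr))

theorem recordOk_hist (h : NodesOk S chain s) (hr : RecordOk s.record) {p : ℕ}
    {hh : IdHistory n M A B} (hp : (s.list.heap p).data.hist = some hh) : RecordOk hh := by
  obtain ⟨k, hk⟩ := h.hist p hh hp
  exact hr.of_prefix hk.record

theorem nodeRet_unique (h : NodesOk S chain s) (hr : RecordOk s.record) {p t : ℕ} {b b' : B}
    (h₁ : s.NodeRet p t b) (h₂ : s.NodeRet p t b') : b = b' := by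
  obtain ⟨l, hl, h₁⟩ := h₁
  obtain ⟨l', hl', h₂⟩ := h₂
  rw [hl] at hl'
  cases hl'
  obtain ⟨k, hh, hh', hlin⟩ := h.lin p l hl
  exact RetIn.unique (h.recordOk_hist hr hh') hlin.lin h₁ h₂

/-- The history `hh` has a linearization that agrees with the values stored in the first `k` nodes
if these determine all return values in `hh`. -/
theorem exists_lin (h : NodesOk S chain s) (hr : RecordOk s.record) (hc : ListOk chain s.list)
    {k : ℕ} (hk : k ≤ chain.length) {hh : IdHistory n M A B} (hpre : hh <+: s.record)
    (hrets : ∀ i, ∀ d ∈ retsOf i hh, Determined chain s k d.2.2 d.2.1)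
    (hhist : ∀ k' q, k' < k → NodeAt chain (k' + 1) q →
      ∃ h', (s.list.heap q).data.hist = some h' ∧ h' <+: hh)
    (hlin : ∀ k' q, k' < k → NodeAt chain (k' + 1) q → (s.list.heap q).data.lin ≠ none) :
    ∃ l, Lin S hh l ∧ Covers chain s k l := by
  cases k with
  | zero =>
    -- Without nodes nothing can have returned in `hh`, and the empty sequence is a linearization.
    refine ⟨[], (lin_nil S).extend (hr.of_prefix hpre) (List.nil_prefix) fun i d hd => ?_,
      fun k' q hk' => by omega⟩
    obtain ⟨k', _, hk', -⟩ := hrets i d hd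
    omega
  | succ k =>
    -- The linearization in the last of these nodes agrees with the values in all of them. As every
    -- return in `hh` is determined by one of these nodes, it is also a linearization of the longer
    -- history `hh`.
    obtain ⟨q, hq⟩ := exists_nodeAt_of_le (chain := chain) (k := k + 1) hk
    obtain ⟨l, hl⟩ := Option.ne_none_iff_exists'.1 (hlin k q k.lt_succ_self hq)
    obtain ⟨k₁, h₁, hh₁, hl₁⟩ := h.lin q l hl
    obtain rfl : k₁ = k := by simpa using hl₁.node.left_unique hc.nodup hq
    obtain ⟨h₂, hh₂, hpre₂⟩ := hhist k₁ q k₁.lt_succ_self hq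
    rw [hh₁] at hh₂
    cases hh₂
    have hcov : Covers chain s (k₁ + 1) l := by
      intro k' q' hk' hq'
      rcases Nat.lt_succ_iff_lt_or_eq.1 hk' with hlt | rfl
      · exact hl₁.prev k' q' hlt hq'
      · obtain rfl := hq'.right_unique hq
        obtain ⟨t, b, h₃, h₄⟩ := hl₁.own
        exact ⟨t, b, h₃, ⟨l, hl, h₄⟩, h₄⟩
    refine ⟨l, hl₁.lin.extend (hr.of_prefix hpre) hpre₂ fun i d hd => ?_, hcov⟩
    obtain ⟨k', q', hk', hq', h₃, h₄⟩ := hrets i d hd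
    obtain ⟨t, b, h₅, h₆, h₇⟩ := hcov k' q' hk' hq'
    obtain rfl := h₃.unique h₅
    rwa [h.nodeRet_unique hr h₄ h₆]

/-- The nodes up to a numbered node are numbered, and a node with a number already has a
linearization. -/
theorem lin_of_seq (h : NodesOk S chain s) (hc : ListOk chain s.list) {k bef : ℕ}
    (hb : NodeAt chain k bef) (hs : (s.list.heap bef).seq ≠ 0) {k' q : ℕ} (hk : k' < k)
    (hq : NodeAt chain (k' + 1) q) :
    (s.list.heap q).seq ≠ 0 ∧ q ≠ 0 ∧ (s.list.heap q).data.lin ≠ none := by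
  have h0 : q ≠ 0 := by
    rintro rfl
    have := hq.left_unique hc.nodup (nodeAt_zero _)
    omega
  have hsq : (s.list.heap q).seq ≠ 0 := by
    rcases Nat.lt_or_ge (k' + 1) k with hlt | hge
    · rw [hc.seq_of_lt hq (by have := hb.le_length; omega)]
      omega
    · obtain rfl : k = k' + 1 := by omega
      rwa [hq.right_unique hb]
  exact ⟨hsq, h0, h.seq q h0 hsq⟩

/-- The command `genLin()` never blocks. -/
theorem exists_genLin (hnb : S.NonBlocking) (h : NodesOk S chain s) (hr : RecordOk s.record)
    (hc : ListOk chain s.list) {bef aft : ℕ} (hs : (s.list.heap bef).seq ≠ 0)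
    (hd : (s.list.heap bef).decideNext = some aft) (hh : (s.list.heap aft).data.hist ≠ none) :
    ∃ l, s.GenLin S bef aft l := by
  obtain ⟨k, hb, ha⟩ := hc.nodeAt_of_dec hd
  obtain ⟨hh, he⟩ := Option.ne_none_iff_exists'.1 hh
  obtain ⟨k', hk'⟩ := h.hist aft hh he
  obtain rfl : k' = k := by simpa using hk'.node.left_unique hc.nodup ha
  have hrh := hr.of_prefix hk'.record
  obtain ⟨l, hl, hcov⟩ := h.exists_lin hr hc hb.le_length hk'.record hk'.rets hk'.hists
    fun k₁ q hk₁ hq => (h.lin_of_seq hc hb hs hk₁ hq).2.2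
  -- The history stored in `aft` contains the call of its operation, so this operation can be
  -- appended to the linearization if it is missing.
  obtain ⟨i, m, a, t, h₁, h₂⟩ := hk'.call
  obtain ⟨l', hl', hpre, b, hb'⟩ := hl.exists_snoc hnb hrh h₂
  refine ⟨l', ⟨hh, he, hl'.isLinearization hrh.alternating⟩, ⟨t, b, ⟨m, a, h₁⟩, hb'⟩,
    fun p hp hpb => ?_⟩
  obtain ⟨k₁, hk₁, hp₁⟩ := hc.nodeAt_of_inList hp
  have := hc.le_of_next hpb hp₁ hb
  obtain ⟨k₁, rfl⟩ := Nat.exists_eq_succ_of_ne_zero hk₁.ne'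
  exact hcov.mono hpre k₁ p (by omega) hp₁

/-- `genLin()` inspects the nodes that are reachable up to `bef`. Since `bef` is numbered,
everything before it has been linked, so all of the first `k` nodes are inspected. -/
theorem linOk_of_genLin (h : NodesOk S chain s) (hc : ListOk chain s.list) {bef aft : ℕ}
    (hs : (s.list.heap bef).seq ≠ 0) (hd : (s.list.heap bef).decideNext = some aft)
    {l : List (IdOp n M A B)} (hl : s.GenLin S bef aft l) :
    ∃ k hh, (s.list.heap aft).data.hist = some hh ∧ LinOk S chain s k aft hh l := by
  obtain ⟨k, hb, ha⟩ := hc.nodeAt_of_dec hd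
  obtain ⟨⟨hh, he, hl₁⟩, hl₂, hl₃⟩ := hl
  refine ⟨k, hh, he, ha, hl₁.lin, hl₂, fun k' q hk' hq => ?_⟩
  obtain ⟨hsq, h0, -⟩ := h.lin_of_seq hc hb hs hk' hq
  exact hl₃ q (hc.inList_of_seq hsq h0) (hc.reflTransGen_next hq hb hk' hs)

/-- The history recorded so far may be stored in a node without a history. -/
theorem histOk_record (h : NodesOk S chain s) (hc : ListOk chain s.list) {bef aft : ℕ}
    (hs : (s.list.heap bef).seq ≠ 0) (hd : (s.list.heap bef).decideNext = some aft)
    (hlt : aft < s.list.alloc) (hh : (s.list.heap aft).data.hist = none) :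
    ∃ k, HistOk chain s k aft s.record := by
  obtain ⟨k, hb, ha⟩ := hc.nodeAt_of_dec hd
  have h0 : aft ≠ 0 := by
    rintro rfl
    have := ha.left_unique hc.nodup (nodeAt_zero _)
    omega
  have hlin : (s.list.heap aft).data.lin = none := by
    by_contra hl
    obtain ⟨l, hl⟩ := Option.ne_none_iff_exists'.1 hl
    obtain ⟨_, _, he, -⟩ := h.lin aft l hl
    rw [hh] at he
    cases he
  -- Without a history there is no linearization and hence no number, so `aft` is still the last
  -- node. As it stores no value, every return recorded so far is determined by an earlier node.
  have hlast : k + 1 = chain.length := by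
    rcases hc.seq _ _ ha with hq | ⟨-, -, hq⟩
    · exact (h.seq aft h0 (by omega) hlin).elim
    · exact hq
  refine ⟨k, ha, List.prefix_rfl, h.ops aft h0 hlt, fun i d hd => ?_, fun k' q hk' hq => ?_⟩
  · obtain ⟨k', q, hk', hq, h₁, h₂⟩ := h.rets i d hd
    refine ⟨k', q, Nat.lt_of_le_of_ne (by omega) ?_, hq, h₁, h₂⟩
    rintro rfl
    obtain ⟨l, hl, -⟩ := h₂
    rw [hq.right_unique ha, hlin] at hl
    cases hl
  · obtain ⟨l, hl⟩ := Option.ne_none_iff_exists'.1 (h.lin_of_seq hc hb hs hk' hq).2.2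
    obtain ⟨_, hq', he, -⟩ := h.lin q l hl
    obtain ⟨k₁, hk₁⟩ := h.hist q hq' he
    exact ⟨hq', he, hk₁.record⟩

/-- The recorded history is linearizable. -/
theorem exists_lin_record (h : NodesOk S chain s) (hr : RecordOk s.record)
    (hc : ListOk chain s.list) : ∃ l, Lin S s.record l := by
  -- `k` counts the nodes that have a linearization: all of them, or all but the last. Recorded
  -- returns are determined by such nodes, so these `k` nodes suffice.
  have key : ∃ k ≤ chain.length, (∀ k' q, k' < k → NodeAt chain (k' + 1) q →
      (s.list.heap q).data.lin ≠ none) ∧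
      ∀ k' q, k' < chain.length → NodeAt chain (k' + 1) q → (s.list.heap q).data.lin ≠ none →
        k' < k := by
    obtain ⟨p, hp⟩ := exists_nodeAt_of_le (chain := chain) (k := chain.length) le_rfl
    by_cases hlen : chain.length = 0
    · exact ⟨0, by omega, fun k' q hk' => by omega, fun k' q hk' => by omega⟩
    have hlow : ∀ k' q, k' + 1 < chain.length → NodeAt chain (k' + 1) q →
        (s.list.heap q).data.lin ≠ none := by
      intro k' q hk' hq
      refine h.seq q ?_ (by rw [hc.seq_of_lt hq hk']; omega)
      rintro rfl
      have := hq.left_unique hc.nodup (nodeAt_zero _)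
      omega
    by_cases hl : (s.list.heap p).data.lin = none
    · refine ⟨chain.length - 1, by omega, fun k' q hk' => hlow k' q (by omega),
        fun k' q hk' hq hne => Nat.lt_of_le_of_ne (by omega) ?_⟩
      rintro rfl
      rw [show chain.length - 1 + 1 = chain.length by omega] at hq
      exact hne (hq.right_unique hp ▸ hl)
    · refine ⟨chain.length, le_rfl, fun k' q hk' hq => ?_, fun _ _ hk' _ _ => hk'⟩
      by_cases hk : k' + 1 < chain.length
      · exact hlow k' q hk hq
      · rw [show k' + 1 = chain.length by omega] at hq
        exact hq.right_unique hp ▸ hl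
  obtain ⟨k, hk, hlin, hmax⟩ := key
  refine (h.exists_lin hr hc hk List.prefix_rfl (fun i d hd => ?_)
    (fun k' q hk' hq => ?_) hlin).imp fun l hl => hl.1
  · obtain ⟨k', q, hk', hq, h₁, l, hl, h₂⟩ := h.rets i d hd
    exact ⟨k', q, hmax k' q hk' hq (by rw [hl]; simp), hq, h₁, l, hl, h₂⟩
  · obtain ⟨l, hl⟩ := Option.ne_none_iff_exists'.1 (hlin k' q hk' hq)
    obtain ⟨_, hq', he, -⟩ := h.lin q l hl
    obtain ⟨k₁, hk₁⟩ := h.hist q hq' he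
    exact ⟨hq', he, hk₁.record⟩

end NodesOk

end UniversalNodes

end ConcLat

namespace ConcLat

/-! ### The invariant of the universal object -/

section UniversalObject

variable {n : ℕ} {M A B : Type u} {S : SeqSpec M A B}

open History

/-- The program counter of `𝒰` with respect to the linked list. -/
def UPc.pc : UPc n M A B → ListPc
  | .storeCall => .idle
  | .announce => .idle
  | .scan _ cur => .scan cur
  | .test => .test
  | .before => .before
  | .help bef => .help bef
  | .prefer bef hlp => .prefer bef hlp
  | .decide bef prf => .decide bef prf
  | .readHist bef aft => .link bef aft
  | .casHist bef aft _ => .link bef aft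
  | .genLin bef aft => .link bef aft
  | .casLin bef aft _ => .link bef aft
  | .link bef aft => .link bef aft
  | .setSeq bef aft => .setSeq bef aft
  | .setHead aft => .setHead aft
  | .setHeadOwn => .post
  | .getRet => .post
  | .storeRet _ => .post
  | .done _ => .post

/-- The program counter of `𝒰` with respect to the linked list. -/
def ULoc.pc : ULoc n M A B → ListPc
  | .genId _ _ => .idle
  | .run _ _ _ pc => pc.pc

/-- What the operation with identity `t` knows about the data of the nodes. -/
def UPc.NodeOk (S : SeqSpec M A B) (chain : List ℕ) (s : UMem n M A B) (t : ℕ) :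
    UPc n M A B → Prop
  | .casHist _ aft h => (s.list.heap aft).data.hist = none → ∃ k, HistOk chain s k aft h
  | .genLin _ aft => (s.list.heap aft).data.hist ≠ none
  | .casLin _ aft l => ∃ k h, (s.list.heap aft).data.hist = some h ∧ LinOk S chain s k aft h l
  | .link _ aft => (s.list.heap aft).data.lin ≠ none
  | .setSeq _ aft => (s.list.heap aft).data.lin ≠ none
  | .storeRet b => Determined chain s chain.length t b
  | _ => True

/-- What process `i` knows about the data of the nodes. -/
def ProcNodeOk (S : SeqSpec M A B) (chain : List ℕ) (s : UMem n M A B) (i : Fin n) :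
    Option (M × ULoc n M A B) → Prop
  | some (_, .run m a t pc) => pc.NodeOk S chain s t ∧
      (pc.pc ≠ .idle → (s.list.heap (s.list.announce i)).data.op = some (t, m, a))
  | _ => True

theorem UPc.NodeOk.ext {chain chain' : List ℕ} {s s' : UMem n M A B} {t : ℕ} {pc : UPc n M A B}
    (h : pc.NodeOk S chain s t) (he : UExt chain s chain' s') : pc.NodeOk S chain' s' t := by
  have hist : ∀ p, (s.list.heap p).data.hist ≠ none → (s'.list.heap p).data.hist ≠ none := by
    intro p hp
    obtain ⟨x, hx⟩ := Option.ne_none_iff_exists'.1 hp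
    rw [he.hist _ _ hx]
    simp
  have lin : ∀ p, (s.list.heap p).data.lin ≠ none → (s'.list.heap p).data.lin ≠ none := by
    intro p hp
    obtain ⟨x, hx⟩ := Option.ne_none_iff_exists'.1 hp
    rw [he.lin _ _ hx]
    simp
  cases pc with
  | casHist bef aft x =>
    intro hn
    by_cases hc : (s.list.heap aft).data.hist = none
    · obtain ⟨k, hk⟩ := h hc
      exact ⟨k, he.histOk hk⟩
    · exact (hist _ hc hn).elim
  | genLin => exact hist _ h
  | casLin =>
    obtain ⟨k, hh, h₁, h₂⟩ := h
    exact ⟨k, hh, he.hist _ _ h₁, he.linOk h₂⟩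
  | link => exact lin _ h
  | setSeq => exact lin _ h
  | storeRet b => exact (he.determined h).mono he.chain.length_le
  | _ => trivial

theorem ProcNodeOk.ext {chain chain' : List ℕ} {s s' : UMem n M A B} {i : Fin n}
    {x : Option (M × ULoc n M A B)} (h : ProcNodeOk S chain s i x) (he : UExt chain s chain' s')
    (ha : s'.list.announce i = s.list.announce i) : ProcNodeOk S chain' s' i x := by
  match x, h with
  | none, _ => trivial
  | some (_, .genId _ _), _ => trivial
  | some (_, .run m a t pc), h =>
    exact ⟨h.1.ext he, fun hpc => ha ▸ he.op _ _ (h.2 hpc)⟩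

/-- The invariant of `𝒰` after the history `h`. -/
structure UInv (S : SeqSpec M A B) (chain : List ℕ) (s : UMem n M A B)
    (g : Fin n → Option (M × ULoc n M A B)) (h : History n M A B Unit) : Prop where
  list : ListInv chain s.list fun i => procPc ULoc.pc (g i)
  recorded : Recorded h s.record s.nextId g
  nodes : NodesOk S chain s
  procs : ∀ i, ProcNodeOk S chain s i (g i)

theorem UMem.withList_list (s : UMem n M A B) (x : ListMem n (UData n M A B)) :
    (s.withList x).list = x := rfl

@[simp] theorem UMem.casHist_heap (s : UMem n M A B) (p q : ℕ) (h : IdHistory n M A B) :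
    ((s.casHist p h).list.heap q) = if q = p then
      { s.list.heap p with data :=
        { (s.list.heap p).data with hist := some ((s.list.heap p).data.hist.getD h) } }
      else s.list.heap q := by
  unfold UMem.casHist
  rw [UMem.withList_list, ListMem.modify_heap]
  split
  · rename_i e; rw [e]
  · rfl

@[simp] theorem UMem.casLin_heap (s : UMem n M A B) (p q : ℕ) (l : List (IdOp n M A B)) :
    ((s.casLin p l).list.heap q) = if q = p then
      { s.list.heap p with data :=
        { (s.list.heap p).data with lin := some ((s.list.heap p).data.lin.getD l) } }
      else s.list.heap q := by
  unfold UMem.casLin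
  rw [UMem.withList_list, ListMem.modify_heap]
  split
  · rename_i e; rw [e]
  · rfl

theorem UExt.casHist (chain : List ℕ) (s : UMem n M A B) (p : ℕ) (h : IdHistory n M A B) :
    UExt chain s chain (s.casHist p h) where
  chain := List.prefix_rfl
  record := List.prefix_rfl
  op q o hq := by
    rw [UMem.casHist_heap]
    split
    · rename_i e; exact e ▸ hq
    · exact hq
  hist q o hq := by
    rw [UMem.casHist_heap]
    split
    · rename_i e; subst e; simp [hq]
    · exact hq
  lin q o hq := by
    rw [UMem.casHist_heap]
    split
    · rename_i e; exact e ▸ hq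
    · exact hq

theorem UExt.casLin (chain : List ℕ) (s : UMem n M A B) (p : ℕ) (l : List (IdOp n M A B)) :
    UExt chain s chain (s.casLin p l) where
  chain := List.prefix_rfl
  record := List.prefix_rfl
  op q o hq := by
    rw [UMem.casLin_heap]
    split
    · rename_i e; exact e ▸ hq
    · exact hq
  lin q o hq := by
    rw [UMem.casLin_heap]
    split
    · rename_i e; subst e; simp [hq]
    · exact hq
  hist q o hq := by
    rw [UMem.casLin_heap]
    split
    · rename_i e; exact e ▸ hq
    · exact hq

/-- Only the first write to the field has an effect, so the history at hand has to be suitable only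
if the field is still empty. -/
theorem NodesOk.casHist {chain : List ℕ} {s : UMem n M A B} (hn : NodesOk S chain s) {p : ℕ}
    (hp : p < s.list.alloc) {h : IdHistory n M A B}
    (hh : (s.list.heap p).data.hist = none → ∃ k, HistOk chain s k p h) :
    NodesOk S chain (s.casHist p h) := by
  refine hn.ext (.casHist chain s p h) (fun q _ hq => .inl hq) (fun q hq => ?_) (fun q x hx => ?_)
    (fun q x hx => ?_) (fun q _ hq => .inl ?_) fun _ _ hd => .inl hd
  · have hq : s.list.alloc ≤ q := hq
    rw [UMem.casHist_heap, if_neg (by omega)]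
    exact hn.unalloc q hq
  · rw [UMem.casHist_heap] at hx
    split at hx
    · rename_i e
      subst e
      cases hc : (s.list.heap q).data.hist with
      | none =>
        rw [hc] at hx
        obtain ⟨k, hk⟩ := hh hc
        cases hx
        exact .inr ⟨k, (UExt.casHist chain s q _).histOk hk⟩
      | some y =>
        rw [hc] at hx
        exact .inl hx
    · exact .inl hx
  · rw [UMem.casHist_heap] at hx
    split at hx
    · rename_i e; exact .inl (e ▸ hx)
    · exact .inl hx
  · rw [UMem.casHist_heap] at hq
    split at hq
    · rename_i e; exact e ▸ hq
    · exact hq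

theorem NodesOk.casLin {chain : List ℕ} {s : UMem n M A B} (hn : NodesOk S chain s) {p : ℕ}
    (hp : p < s.list.alloc) {l : List (IdOp n M A B)}
    (hl : ∃ k h, (s.list.heap p).data.hist = some h ∧ LinOk S chain s k p h l) :
    NodesOk S chain (s.casLin p l) := by
  refine hn.ext (.casLin chain s p l) (fun q _ hq => .inl hq) (fun q hq => ?_) (fun q x hx => ?_)
    (fun q x hx => ?_) (fun q _ hq => .inl ?_) fun _ _ hd => .inl hd
  · have hq : s.list.alloc ≤ q := hq
    rw [UMem.casLin_heap, if_neg (by omega)]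
    exact hn.unalloc q hq
  · rw [UMem.casLin_heap] at hx
    split at hx
    · rename_i e; exact .inl (e ▸ hx)
    · exact .inl hx
  · rw [UMem.casLin_heap] at hx
    split at hx
    · rename_i e
      subst e
      cases hc : (s.list.heap q).data.lin with
      | none =>
        rw [hc] at hx
        obtain ⟨k, h, hh, hk⟩ := hl
        cases hx
        exact .inr ⟨k, h, (UExt.casLin chain s q _).hist _ _ hh,
          (UExt.casLin chain s q _).linOk hk⟩
      | some y =>
        rw [hc] at hx
        exact .inl hx
    · exact .inl hx
  · rw [UMem.casLin_heap] at hq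
    split at hq
    · rename_i e; exact e ▸ hq
    · exact hq

namespace UInv

variable {chain : List ℕ} {s s' : UMem n M A B} {g : Fin n → Option (M × ULoc n M A B)}
  {h : History n M A B Unit}

theorem init : UInv S [] (USpec n S).mem₀ (fun _ => none) [] :=
  ⟨.init _, .init, .init, fun _ => trivial⟩

theorem update (hu : UInv S chain s g h) {i : Fin n} {h' : History n M A B Unit} {new : List ℕ}
    {x : Option (M × ULoc n M A B)}
    (hs : ListStep i s.list (procPc ULoc.pc (g i)) s'.list (procPc ULoc.pc x) new)
    (hr : Recorded h' s'.record s'.nextId (Function.update g i x))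
    (he : UExt chain s (chain ++ new) s') (hn : NodesOk S (chain ++ new) s')
    (hx : ProcNodeOk S (chain ++ new) s' i x) :
    UInv S (chain ++ new) s' (Function.update g i x) h' := by
  obtain ⟨h₁, h₂⟩ := hu.list.step (i := i) hs
  refine ⟨by rw [procPc_update]; exact h₁, hr, hn, fun j => ?_⟩
  rcases eq_or_ne j i with rfl | hj
  · rwa [Function.update_self]
  · rw [Function.update_of_ne hj]
    exact (hu.procs j).ext he (h₂.ann j hj)

theorem pcOk (hu : UInv S chain s g h) {i : Fin n} {m : M} {l : ULoc n M A B}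
    (hi : g i = some (m, l)) : l.pc.Ok chain s.list i := by
  have := hu.list.pc i
  simp only [hi] at this
  exact this

theorem own_ne_zero (hu : UInv S chain s g h) {i : Fin n} {m : M} {l : ULoc n M A B}
    (hi : g i = some (m, l)) (hl : l.pc ≠ .idle) : s.list.announce i ≠ 0 :=
  hu.list.ann_ne i (by simpa [hi, procPc] using hl)

theorem nodeOk (hu : UInv S chain s g h) {i : Fin n} {m₀ m : M} {a : A} {t : ℕ}
    {pc : UPc n M A B} (hi : g i = some (m₀, .run m a t pc)) : pc.NodeOk S chain s t ∧
      (pc.pc ≠ .idle → (s.list.heap (s.list.announce i)).data.op = some (t, m, a)) := by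
  have := hu.procs i
  rwa [hi] at this

theorem lt_alloc (hu : UInv S chain s g h) {bef aft : ℕ}
    (hd : (s.list.heap bef).decideNext = some aft) : aft < s.list.alloc := by
  obtain ⟨k, -, hk⟩ := hu.list.list.nodeAt_of_dec hd
  exact hu.list.list.alloc _ hk.mem

/-- The effect of a command on the nodes. -/
structure StepOk (S : SeqSpec M A B) (chain : List ℕ) (s s' : UMem n M A B) (i : Fin n) (m : M)
    (a : A) (t : ℕ) (pc pc' : UPc n M A B) (new : List ℕ) : Prop where
  step : ListStep i s.list pc.pc s'.list pc'.pc new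
  ext : UExt chain s (chain ++ new) s'
  nodes : NodesOk S (chain ++ new) s'
  pc : pc'.NodeOk S (chain ++ new) s' t
  own : pc'.pc ≠ .idle → (s'.list.heap (s'.list.announce i)).data.op = some (t, m, a)

theorem stepOk_of_data (hu : UInv S chain s g h) {i : Fin n} {m₀ m : M} {a : A} {t : ℕ}
    {pc pc' : UPc n M A B} {new : List ℕ} (hi : g i = some (m₀, .run m a t pc))
    (hs : ListStep i s.list pc.pc s'.list pc'.pc new)
    (hd : ∀ p, (s'.list.heap p).data = (s.list.heap p).data) (hr : s'.record = s.record)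
    (ha : s'.list.alloc = s.list.alloc) (hann : s'.list.announce i = s.list.announce i)
    (seq : ∀ p, p ≠ 0 → (s'.list.heap p).seq ≠ 0 → (s.list.heap p).seq ≠ 0 ∨
      (s.list.heap p).data.lin ≠ none) (hpc : pc'.pc ≠ .idle → pc.pc ≠ .idle)
    (hok : UExt chain s (chain ++ new) s' → pc'.NodeOk S (chain ++ new) s' t) :
    StepOk S chain s s' i m a t pc pc' new :=
  have he : UExt chain s (chain ++ new) s' := .of_data hd (hr ▸ List.prefix_rfl)
  ⟨hs, he, hu.nodes.of_data hd hr ha seq, hok he,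
    fun hne => by rw [hd, hann]; exact (hu.nodeOk hi).2 (hpc hne)⟩

theorem stepOk (hu : UInv S chain s g h) {i : Fin n} {m₀ m : M} {a : A} {t : ℕ}
    {pc pc' : UPc n M A B} (hi : g i = some (m₀, .run m a t pc))
    (hs : UPcStep S i m a t s pc s' pc') : ∃ new, StepOk S chain s s' i m a t pc pc' new := by
  obtain ⟨hok, hown⟩ := hu.nodeOk hi
  have hpc := hu.pcOk hi
  have same : ∀ {pc'' : UPc n M A B}, ListStep i s.list pc.pc s.list pc''.pc [] →
      (pc''.pc ≠ .idle → pc.pc ≠ .idle) → pc''.NodeOk S chain s t →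
      ∃ new, StepOk S chain s s i m a t pc pc'' new := fun h₁ h₂ h₃ =>
    ⟨[], hu.stepOk_of_data hi h₁ (fun _ => rfl) rfl rfl rfl (fun _ _ hq => .inl hq) h₂
      fun he => h₃.ext he⟩
  cases hs with
  | storeCall =>
    have he : UExt chain s (chain ++ []) { s with record := s.record ++ [.call i m a t] } :=
      .of_data (fun _ => rfl) (List.prefix_append _ _)
    refine ⟨[], .skip _ _, he, hu.nodes.ext he (fun p _ hp => .inl hp) hu.nodes.unalloc
      (fun _ _ hp => .inl hp) (fun _ _ hp => .inl hp) (fun _ _ hp => .inl hp) fun j d hd => .inl ?_,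
      trivial, fun hc => (hc rfl).elim⟩
    simpa using hd
  | announce =>
    have hfr := hu.nodes.unalloc s.list.alloc le_rfl
    have hout : s.list.alloc ∉ 0 :: chain := fun hm => (hu.list.list.alloc _ hm).ne rfl
    have hout' : ∀ k, ¬ NodeAt chain (k + 1) s.list.alloc := fun k hk => hout hk.mem
    have hhist : (s.list.heap s.list.alloc).data.hist = none := by
      by_contra hc
      obtain ⟨x, hx⟩ := Option.ne_none_iff_exists'.1 hc
      obtain ⟨k, hk⟩ := hu.nodes.hist _ _ hx
      exact hout' k hk.node
    have hlin : (s.list.heap s.list.alloc).data.lin = none := by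
      by_contra hc
      obtain ⟨x, hx⟩ := Option.ne_none_iff_exists'.1 hc
      obtain ⟨k, _, -, hk⟩ := hu.nodes.lin _ _ hx
      exact hout' k hk.node
    have hheap : ∀ q, ((s.withList (s.list.announceNew i ⟨some (t, m, a), none, none⟩)).list.heap q) =
        if q = s.list.alloc then Node.fresh ⟨some (t, m, a), none, none⟩ else s.list.heap q :=
      fun q => ListMem.announceNew_heap ..
    have he : UExt chain s (chain ++ [])
        (s.withList (s.list.announceNew i ⟨some (t, m, a), none, none⟩)) := by
      refine ⟨List.prefix_append _ _, List.prefix_rfl, fun p o hp => ?_, fun p o hp => ?_,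
        fun p o hp => ?_⟩ <;> rw [hheap, if_neg] <;> try exact hp
      · rintro rfl; rw [hfr] at hp; cases hp
      · rintro rfl; rw [hhist] at hp; cases hp
      · rintro rfl; rw [hlin] at hp; cases hp
    -- The call is recorded before its node is announced; hence every history read for this node
    -- contains its operation.
    have hcall : (m, a, t) ∈ callsOf i s.record := by
      obtain ⟨e, -, -, cs, hcs, -⟩ := hu.recorded.sync_of hi
      rw [hcs, e]
      simp
    refine ⟨[], .announce _ _, he, hu.nodes.ext he (fun p _ hp => ?_) (fun p hp => ?_)
      (fun p x hp => .inl ?_) (fun p x hp => .inl ?_) (fun p _ hp => .inl ?_) (fun _ _ hd => .inl hd),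
      trivial, fun _ => ?_⟩
    · rcases Nat.lt_succ_iff_lt_or_eq.1 hp with hp | rfl
      · exact .inl hp
      · exact .inr ⟨i, m, a, t, by rw [hheap, if_pos rfl]; rfl, hcall⟩
    · have hp : s.list.alloc + 1 ≤ p := hp
      rw [hheap, if_neg (by omega)]
      exact hu.nodes.unalloc p (by omega)
    · rw [hheap] at hp
      split at hp
      · cases hp
      · exact hp
    · rw [hheap] at hp
      split at hp
      · cases hp
      · exact hp
    · rw [hheap] at hp
      split at hp
      · exact (hp rfl).elim
      · exact hp
    · rw [hheap, if_pos (by simp [UMem.withList, ListMem.announceNew])]; rfl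
  | scan j cur hj => exact same (.scan _ _ _) (fun _ hc => by cases hc) trivial
  | scanEnd =>
    exact ⟨[], hu.stepOk_of_data hi (.scanEnd _ _) (fun _ => rfl) rfl rfl rfl
      (fun _ _ hq => .inl hq) (fun _ hc => by cases hc) fun _ => trivial⟩
  | testLoop h' => exact same (.testLoop _ h') (fun _ hc => by cases hc) trivial
  | testExit h' => exact same (.testLeave _ h') (fun _ hc => by cases hc) trivial
  | before => exact same (.before _) (fun _ hc => by cases hc) trivial
  | help => exact same (.help _ _) (fun _ hc => by cases hc) trivial
  | preferHelp _ _ h' => exact same (.preferHelp _ _ _ h') (fun _ hc => by cases hc) trivial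
  | preferOwn _ _ h' => exact same (.preferOwn _ _ _ h') (fun _ hc => by cases hc) trivial
  | decideFirst bef prf h' =>
    refine ⟨[prf], hu.stepOk_of_data hi (.decideFirst _ _ _ h') (fun p => ?_) rfl rfl rfl
      (fun p _ hq => .inl ?_) (fun _ hc => by cases hc) fun _ => trivial⟩
    · rw [UMem.withList_list, ListMem.modify_heap]; split
      · rename_i e; rw [e]
      · rfl
    · rw [UMem.withList_list, ListMem.modify_heap] at hq
      split at hq <;> exact hq
  | decideLater _ _ _ h' => exact same (.decideLater _ _ _ _ h') (fun _ hc => by cases hc) trivial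
  | readHist bef aft =>
    obtain ⟨rfl, -, hd⟩ := hpc
    -- It suffices to treat the case that the field is empty now: if it is filled before the `cas`,
    -- the `cas` has no effect.
    exact same (.skip _ _) (fun _ hc => by cases hc) fun hn =>
      hu.nodes.histOk_record hu.list.list (hu.list.head i) hd (hu.lt_alloc hd) hn
  | casHist bef aft x =>
    obtain ⟨rfl, -, hd⟩ := hpc
    have he := UExt.casHist chain s aft x
    refine ⟨[], .data _ _ _ (fun d : UData n M A B => { d with hist := some (d.hist.getD x) }), ?_, ?_, ?_, fun _ => he.op _ _ (hown (by simp [UPc.pc]))⟩ <;>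
      try rw [List.append_nil]
    · exact he
    · exact hu.nodes.casHist (hu.lt_alloc hd) hok
    · simp [UPc.NodeOk]
  | genLin bef aft l hl =>
    obtain ⟨rfl, -, hd⟩ := hpc
    exact same (.skip _ _) (fun _ hc => by cases hc)
      (hu.nodes.linOk_of_genLin hu.list.list (hu.list.head i) hd hl)
  | casLin bef aft l =>
    obtain ⟨rfl, -, hd⟩ := hpc
    have he := UExt.casLin chain s aft l
    refine ⟨[], .data _ _ _ (fun d : UData n M A B => { d with lin := some (d.lin.getD l) }), ?_, ?_, ?_, fun _ => he.op _ _ (hown (by simp [UPc.pc]))⟩ <;>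
      try rw [List.append_nil]
    · exact he
    · exact hu.nodes.casLin (hu.lt_alloc hd) hok
    · simp [UPc.NodeOk]
  | link bef aft =>
    refine ⟨[], hu.stepOk_of_data hi (.link _ _ _) (fun p => ?_) rfl rfl rfl
      (fun p _ hq => .inl ?_) (fun _ hc => by cases hc)
      fun he => UPc.NodeOk.ext (pc := .setSeq bef aft) hok he⟩
    · rw [UMem.withList_list, ListMem.modify_heap]; split
      · rename_i e; rw [e]
      · rfl
    · rw [UMem.withList_list, ListMem.modify_heap] at hq
      split at hq <;> exact hq
  | setSeq bef aft =>
    refine ⟨[], hu.stepOk_of_data hi (.setSeq _ _ _) (fun p => ?_) rfl rfl rfl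
      (fun p _ hq => ?_) (fun _ hc => by cases hc) fun _ => trivial⟩
    · rw [UMem.withList_list, ListMem.modify_heap]; split
      · rename_i e; rw [e]
      · rfl
    · rw [UMem.withList_list, ListMem.modify_heap] at hq
      split at hq
      -- The process that assigns the number knows that a linearization has been stored.
      · rename_i e; rw [e]; exact .inr hok
      · exact .inl hq
  | setHead aft =>
    exact ⟨[], hu.stepOk_of_data hi (.setHead _ _) (fun _ => rfl) rfl rfl rfl
      (fun _ _ hq => .inl hq) (fun _ hc => by cases hc) fun _ => trivial⟩
  | setHeadOwn =>
    exact ⟨[], hu.stepOk_of_data hi (.own _) (fun _ => rfl) rfl rfl rfl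
      (fun _ _ hq => .inl hq) (fun _ hc => by cases hc) fun _ => trivial⟩
  | getRet p b hp ho hb =>
    refine same (.skip _ _) (fun _ hc => by cases hc) ?_
    obtain ⟨k, hk, hn⟩ := hu.list.list.nodeAt_of_inList hp
    obtain ⟨k, rfl⟩ := Nat.exists_eq_succ_of_ne_zero hk.ne'
    exact ⟨k, p, hn.le_length, hn, ho, hb⟩
  | storeRet b =>
    have he : UExt chain s (chain ++ []) { s with record := s.record ++ [.ret i m b t] } :=
      .of_data (fun _ => rfl) (List.prefix_append _ _)
    refine ⟨[], .skip _ _, he, hu.nodes.ext he (fun p _ hp => .inl hp) hu.nodes.unalloc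
      (fun _ _ hp => .inl hp) (fun _ _ hp => .inl hp) (fun _ _ hp => .inl hp) fun j d hd => ?_,
      trivial, fun _ => hown (by simp [UPc.pc])⟩
    rw [retsOf_append, List.mem_append] at hd
    rcases hd with hd | hd
    · exact .inl hd
    · rcases eq_or_ne i j with rfl | hij
      · rw [retsOf_cons_ret_self, retsOf_nil, List.mem_singleton] at hd
        subst hd
        exact .inr ((he.determined hok).mono he.chain.length_le)
      · rw [retsOf_cons_ret_of_ne hij] at hd
        cases hd

end UInv

end UniversalObject

end ConcLat

namespace ConcLat

/-! ### The universal object is linearizable and wait-free -/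

section UniversalObjectAdmissible

variable {n : ℕ} {M A B : Type u} {S : SeqSpec M A B}

open History

namespace UInv

variable {chain : List ℕ} {s s' : UMem n M A B} {g : Fin n → Option (M × ULoc n M A B)}
  {h : History n M A B Unit}

theorem call (hu : UInv S chain s g h) {i : Fin n} (m : M) (a : A) (hi : g i = none) :
    UInv S chain s (Function.update g i (some (m, .genId m a))) (h ++ [.call i m a ()]) := by
  have := hu.update (s' := s) (i := i) (x := some (m, .genId m a)) (new := [])
    (by rw [hi]; exact .skip _ _) (hu.recorded.call m a hi)
    (.of_data (fun _ => rfl) List.prefix_rfl) (by rw [List.append_nil]; exact hu.nodes) trivial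
  rwa [List.append_nil] at this

theorem ret (hu : UInv S chain s g h) {i : Fin n} {m m' : M} {a : A} {t : ℕ} {b : B}
    (hi : g i = some (m, .run m' a t (.done b))) :
    UInv S chain s (Function.update g i none) (h ++ [.ret i m b ()]) := by
  have := hu.update (s' := s) (i := i) (x := none) (new := [])
    (by rw [hi]; exact .finish _) (hu.recorded.ret hi)
    (.of_data (fun _ => rfl) List.prefix_rfl) (by rw [List.append_nil]; exact hu.nodes) trivial
  rwa [List.append_nil] at this

theorem genId (hu : UInv S chain s g h) {i : Fin n} {m m' : M} {a : A}
    (hi : g i = some (m, .genId m' a)) :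
    UInv S chain { s with nextId := s.nextId + 1 }
      (Function.update g i (some (m, .run m' a s.nextId .storeCall))) h := by
  have he : UExt chain s (chain ++ []) { s with nextId := s.nextId + 1 } :=
    .of_data (fun _ => rfl) List.prefix_rfl
  have := hu.update (s' := { s with nextId := s.nextId + 1 }) (i := i)
    (x := some (m, .run m' a s.nextId .storeCall)) (new := [])
    (by rw [hi]; exact .skip _ _) (hu.recorded.genId hi) he
    (hu.nodes.of_data (fun _ => rfl) rfl rfl fun _ _ hq => .inl hq)
    ⟨trivial, fun hc => (hc rfl).elim⟩
  rwa [List.append_nil] at this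

theorem run (hu : UInv S chain s g h) {i : Fin n} {m₀ m : M} {a : A} {t : ℕ} {pc pc' : UPc n M A B}
    (hi : g i = some (m₀, .run m a t pc)) (hs : UPcStep S i m a t s pc s' pc') :
    ∃ new, ListStep i s.list pc.pc s'.list pc'.pc new ∧
      UInv S (chain ++ new) s' (Function.update g i (some (m₀, .run m a t pc'))) h := by
  obtain ⟨new, hok⟩ := hu.stepOk hi hs
  have hrec : Recorded h s'.record s'.nextId
      (Function.update g i (some (m₀, .run m a t pc'))) := by
    cases hs with
    | storeCall => exact hu.recorded.storeCall hi
    | storeRet => exact hu.recorded.storeRet hi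
    | _ => exact hu.recorded.inner hi trivial trivial
  exact ⟨new, hok.step, hu.update (by rw [hi]; exact hok.step) hrec hok.ext hok.nodes
    ⟨hok.pc, hok.own⟩⟩

theorem tau (hu : UInv S chain s g h) {i : Fin n} {m : M} {l l' : ULoc n M A B}
    (hi : g i = some (m, l)) (hs : UStep S i s l s' l') :
    ∃ new, ListStep i s.list l.pc s'.list l'.pc new ∧
      UInv S (chain ++ new) s' (Function.update g i (some (m, l'))) h := by
  cases hs with
  | genId m' a => exact ⟨[], .skip _ _, by rw [List.append_nil]; exact hu.genId hi⟩
  | run _ m' a t pc pc' hs => exact hu.run hi hs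

theorem step {c c' : (USpec n S).Config} (hu : UInv S chain c.mem c.proc h) {α : Label n M A B}
    (hs : (USpec n S).Step c α c') :
    ∃ new, ListStep α.pid c.mem.list (procPc ULoc.pc (c.proc α.pid)) c'.mem.list
        (procPc ULoc.pc (c'.proc α.pid)) new ∧
      (∀ j, j ≠ α.pid → c'.proc j = c.proc j) ∧
      UInv S (chain ++ new) c'.mem c'.proc (h ++ historyOf [α]) := by
  cases hs with
  | call i m a hi =>
    refine ⟨[], ?_, fun j hj => Function.update_of_ne hj _ _, ?_⟩
    · simp only [Label.pid, hi, Function.update_self]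
      exact .skip _ _
    · rw [List.append_nil]; exact hu.call m a hi
  | ret i m l b hi hr =>
    obtain ⟨m', a, t, rfl⟩ : ∃ m' a t, l = .run m' a t (.done b) := by
      cases l with
      | genId => cases hr
      | run m' a t pc => cases pc <;> first | (cases hr; done) | (cases hr; exact ⟨_, _, _, rfl⟩)
    refine ⟨[], ?_, fun j hj => Function.update_of_ne hj _ _, ?_⟩
    · simp only [Label.pid, hi, Function.update_self]
      exact .finish _
    · rw [List.append_nil]; exact hu.ret hi
  | tau i m l l' s' hi hr hs =>
    rw [show historyOf [Label.tau i] = ([] : History n M A B Unit) from rfl, List.append_nil]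
    rcases hs with hs | ⟨-, rfl, rfl⟩
    · obtain ⟨new, h₁, h₂⟩ := hu.tau hi hs
      refine ⟨new, ?_, fun j hj => Function.update_of_ne hj _ _, h₂⟩
      simp only [Label.pid, hi, Function.update_self]
      exact h₁
    · refine ⟨[], ?_, fun j hj => Function.update_of_ne hj _ _, ?_⟩
      · simp only [Label.pid, hi, Function.update_self]
        exact .skip _ _
      · rw [List.append_nil, ← hi, Function.update_eq_self]
        exact hu

theorem exists_of_exec {w : List (Label n M A B)} {c : (USpec n S).Config}
    (hw : (USpec n S).sem.Exec (USpec n S).sem.init w c) :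
    ∃ chain, UInv S chain c.mem c.proc (historyOf w) := by
  refine LTS.Exec.snoc_induction (L := (USpec n S).sem)
    (p := fun w c => ∃ chain, UInv S chain c.mem c.proc (historyOf w)) ⟨[], .init⟩ ?_ hw
  rintro w c α c' - ⟨chain, hu⟩ hs
  obtain ⟨new, -, -, h'⟩ := hu.step hs
  exact ⟨_, by rw [historyOf_append]; exact h'⟩

/-- The commands of `𝒰` never spin. -/
theorem exists_step (hnb : S.NonBlocking) (hu : UInv S chain s g h) {i : Fin n} {m : M}
    {l : ULoc n M A B} (hi : g i = some (m, l)) (hl : ∀ m a t b, l ≠ .run m a t (.done b)) :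
    ∃ s' l', UStep S i s l s' l' := by
  cases l with
  | genId m' a => exact ⟨_, _, .genId _ _ _⟩
  | run m' a t pc =>
    suffices hs : ∃ s' pc', UPcStep S i m' a t s pc s' pc' by
      obtain ⟨s', pc', hs⟩ := hs
      exact ⟨_, _, .run _ _ _ _ _ _ _ hs⟩
    obtain ⟨hok, hown⟩ := hu.nodeOk hi
    have hpc := hu.pcOk hi
    cases pc with
    | storeCall => exact ⟨_, _, .storeCall _⟩
    | announce => exact ⟨_, _, .announce _⟩
    | scan j cur =>
      by_cases hj : j < n
      · exact ⟨_, _, .scan _ _ _ hj⟩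
      · exact ⟨_, _, .scanEnd _ _ _ (not_lt.1 hj)⟩
    | test =>
      by_cases hq : (s.list.heap (s.list.announce i)).seq = 0
      · exact ⟨_, _, .testLoop _ hq⟩
      · exact ⟨_, _, .testExit _ hq⟩
    | before => exact ⟨_, _, .before _⟩
    | help => exact ⟨_, _, .help _ _⟩
    | prefer bef hlp =>
      by_cases hq : (s.list.heap hlp).seq = 0
      · exact ⟨_, _, .preferHelp _ _ _ hq⟩
      · exact ⟨_, _, .preferOwn _ _ _ hq⟩
    | decide bef prf =>
      cases hq : (s.list.heap bef).decideNext with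
      | none => exact ⟨_, _, .decideFirst _ _ _ hq⟩
      | some aft => exact ⟨_, _, .decideLater _ _ _ _ hq⟩
    | readHist => exact ⟨_, _, .readHist _ _ _⟩
    | casHist => exact ⟨_, _, .casHist _ _ _ _⟩
    | genLin bef aft =>
      obtain ⟨rfl, -, hd⟩ := hpc
      obtain ⟨x, hx⟩ := hu.nodes.exists_genLin hnb hu.recorded.record hu.list.list
        (hu.list.head i) hd hok
      exact ⟨_, _, .genLin _ _ _ x hx⟩
    | casLin => exact ⟨_, _, .casLin _ _ _ _⟩
    | link => exact ⟨_, _, .link _ _ _⟩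
    | setSeq => exact ⟨_, _, .setSeq _ _ _⟩
    | setHead => exact ⟨_, _, .setHead _ _⟩
    | setHeadOwn => exact ⟨_, _, .setHeadOwn _⟩
    -- The own node is numbered, hence it is in the list and has a linearization, which contains the
    -- operation of the node.
    | getRet =>
      have h0 := hu.own_ne_zero hi (by simp [ULoc.pc, UPc.pc])
      have hs : (s.list.heap (s.list.announce i)).seq ≠ 0 := hpc
      obtain ⟨x, hx⟩ := Option.ne_none_iff_exists'.1 (hu.nodes.seq _ h0 hs)
      obtain ⟨k, hh, -, hlin⟩ := hu.nodes.lin _ _ hx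
      obtain ⟨t', b, h₁, h₂⟩ := hlin.own
      have ho : s.HasOp (s.list.announce i) t := ⟨_, _, hown (by simp [UPc.pc])⟩
      obtain rfl := h₁.unique ho
      exact ⟨_, _, .getRet _ _ b (hu.list.list.inList_of_seq hs h0) ho ⟨x, hx, h₂⟩⟩
    | storeRet => exact ⟨_, _, .storeRet _ _⟩
    | done b => exact (hl _ _ _ _ rfl).elim

/-- A bound on the number of steps of process `i` until it returns, as long as it is not helped more
than `N` times. -/
def rank (N : ℕ) (s : UMem n M A B) (i : Fin n) : UPc n M A B → ℕ
  | .storeCall => 0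
  | .announce => 0
  | .scan j _ => N + 20 * (N + 2) + (n - j)
  | .test => N + 7 + 20 * (N - (s.list.heap (s.list.head i)).seq) + 15
  | .before => N + 7 + 20 * (N - (s.list.heap (s.list.head i)).seq) + 14
  | .help _ => N + 7 + 20 * (N - (s.list.heap (s.list.head i)).seq) + 13
  | .prefer _ _ => N + 7 + 20 * (N - (s.list.heap (s.list.head i)).seq) + 12
  | .decide _ _ => N + 7 + 20 * (N - (s.list.heap (s.list.head i)).seq) + 11
  | .readHist _ _ => N + 7 + 20 * (N - (s.list.heap (s.list.head i)).seq) + 10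
  | .casHist _ _ _ => N + 7 + 20 * (N - (s.list.heap (s.list.head i)).seq) + 9
  | .genLin _ _ => N + 7 + 20 * (N - (s.list.heap (s.list.head i)).seq) + 8
  | .casLin _ _ _ => N + 7 + 20 * (N - (s.list.heap (s.list.head i)).seq) + 7
  | .link _ _ => N + 7 + 20 * (N - (s.list.heap (s.list.head i)).seq) + 6
  | .setSeq _ _ => N + 7 + 20 * (N - (s.list.heap (s.list.head i)).seq) + 5
  | .setHead _ => N + 7 + 20 * (N - (s.list.heap (s.list.head i)).seq) + 4
  | .setHeadOwn => 4
  | .getRet => 3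
  | .storeRet _ => 2
  | .done _ => 1

/-- As for `𝒜`, with four more commands between the decision and the link; a pass through the loop
still costs less than `20`. -/
theorem rank_lt (hu : UInv S chain s g h) {i : Fin n} {m₀ m : M} {a : A} {t : ℕ}
    {pc pc' : UPc n M A B} {new : List ℕ} {K : ℕ} (hi : g i = some (m₀, .run m a t pc))
    (hs : UPcStep S i m a t s pc s' pc') (he : ListExt i chain s.list (chain ++ new) s'.list)
    (hpc' : pc.pc ≠ .idle)
    (hh : Helped K i (s.list.announce i) chain fun j => procPc ULoc.pc (g j)) :
    rank (K + n + 2) s' i pc' < rank (K + n + 2) s i pc := by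
  have hpc := hu.pcOk hi
  have hseq := he.seq _ (hu.list.head i)
  cases hs with
  | storeCall => exact (hpc' rfl).elim
  | announce => exact (hpc' rfl).elim
  | setHead aft =>
    obtain ⟨h₁, h₂⟩ := hpc
    have := hh.seq_lt hu.list.list h₁ (hu.list.head i)
    simp only [rank, UMem.withList, ListMem.setHead, Function.update_self]
    omega
  | _ =>
    simp only [rank, UMem.withList, UMem.casHist, UMem.casLin, ListMem.setHead, ListMem.modify]
      at hseq ⊢
    omega

theorem rank_eq (hu : UInv S chain s g h) {i j : Fin n} {new : List ℕ} {N : ℕ}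
    (he : ListExt j chain s.list (chain ++ new) s'.list) (hij : i ≠ j) (pc : UPc n M A B) :
    rank N s' i pc = rank N s i pc := by
  obtain ⟨h₁, h₂, h₃⟩ := hu.list.head_eq he hij
  cases pc <;> simp only [rank, h₃]

end UInv

/-- The number of commands before the announcement. -/
def ULoc.early : ULoc n M A B → ℕ
  | .genId _ _ => 2
  | .run _ _ _ .storeCall => 1
  | .run _ _ _ _ => 0

/-- `w` bounds the number of steps that process `i` takes before its next return. -/
def UInv.Bound (S : SeqSpec M A B) (i : Fin n) (w : ℕ ×ₗ ℕ) (s : UMem n M A B)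
    (g : Fin n → Option (M × ULoc n M A B)) : Prop :=
  ∃ chain h m l, UInv S chain s g h ∧ g i = some (m, l) ∧
    (l.pc = .idle ∧ w = toLex (1, l.early) ∨
      ∃ m' a t pc, l = .run m' a t pc ∧ pc.pc ≠ .idle ∧ ∃ K,
        (Helped K i (s.list.announce i) chain fun j => procPc ULoc.pc (g j)) ∧
        w = toLex (0, UInv.rank (K + n + 2) s i pc))

/-- Unlike in `𝒜`, two commands precede the announcement. They are counted in the second component
by `ULoc.early` while the first component is `1`. -/
theorem UInv.Bound.tau (hnb : S.NonBlocking) {i : Fin n} {w : ℕ ×ₗ ℕ}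
    {s s' : UMem n M A B} {g : Fin n → Option (M × ULoc n M A B)} {m : M} {l l' : ULoc n M A B}
    (h : UInv.Bound S i w s g) (hi : g i = some (m, l)) (hl : ∀ m a t b, l ≠ .run m a t (.done b))
    (hs : orSpin (UStep S i) s l s' l') :
    ∃ w' < w, UInv.Bound S i w' s' (Function.update g i (some (m, l'))) := by
  obtain ⟨chain, h, m₁, l₁, hu, hi₁, hw⟩ := h
  rw [hi] at hi₁
  cases hi₁
  replace hs : UStep S i s l s' l' := hs.resolve_right fun hc => hc.1 (hu.exists_step hnb hi hl)
  obtain ⟨new, hls, hu'⟩ := hu.tau hi hs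
  have hls' : ListStep i s.list (procPc ULoc.pc (g i)) s'.list l'.pc new := by rw [hi]; exact hls
  have hext := (hu.list.step hls').2
  rcases hw with ⟨hl, rfl⟩ | ⟨m', a, t, pc, rfl, hpc, K, hK, rfl⟩
  · obtain rfl := hls.new_eq_nil (by rw [hl]; simp)
    cases hs with
    | genId m' a =>
      exact ⟨toLex (1, 1), Prod.Lex.toLex_lt_toLex.2 (.inr ⟨rfl, Nat.lt_succ_self 1⟩), _, _, _, _, hu',
        Function.update_self .., .inl ⟨rfl, rfl⟩⟩
    | run _ m' a t pc pc' hs =>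
      cases hs with
      | storeCall =>
        exact ⟨toLex (1, 0), Prod.Lex.toLex_lt_toLex.2 (.inr ⟨rfl, Nat.lt_succ_self 0⟩), _, _, _, _, hu',
          Function.update_self .., .inl ⟨rfl, rfl⟩⟩
      | announce =>
        refine ⟨_, Prod.Lex.toLex_lt_toLex.2 (.inl Nat.zero_lt_one), _, _, m, _, hu',
          Function.update_self .., .inr ⟨_, _, _, _, rfl, by simp [UPc.pc], _, .of_announce ?_, rfl⟩⟩
        intro hm
        rw [List.append_nil] at hm
        have := hu.list.list.alloc _ hm
        simp [UMem.withList, ListMem.announceNew] at this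
      | _ => cases hl
  · cases hs with
    | run _ _ _ _ _ pc' hs =>
      have hpc' : pc'.pc ≠ .idle := by
        cases hs <;> first | (intro hc; cases hc; done) | exact (hpc rfl).elim
      refine ⟨toLex (0, UInv.rank (K + n + 2) s' i pc'),
        Prod.Lex.toLex_lt_toLex.2 (.inr ⟨rfl, hu.rank_lt hi hs hext hpc hK⟩),
        _, _, m, _, hu', Function.update_self .., .inr ⟨_, _, _, _, rfl, hpc', K, ?_, rfl⟩⟩
      have hann : s'.list.announce i = s.list.announce i := by
        cases hs <;> first | rfl | exact (hpc rfl).elim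
      rw [hann, procPc_update]
      exact hK.step hu.list rfl (hu.own_ne_zero hi hpc) hls'

theorem uSpec_not_starved (hnb : S.NonBlocking) (i : Fin n)
    (t : ℕ → Label n M A B) (ht : (USpec n S).sem.IsInfTrace t) : ¬ Starved t i := by
  refine LTS.not_starved_of_rank
    (fun c : (USpec n S).Config => ∃ chain h, UInv S chain c.mem c.proc h) i
    (fun w (c : (USpec n S).Config) => UInv.Bound S i w c.mem c.proc) ⟨[], [], .init⟩
    ?_ ?_ ?_ ?_ t ht
  · rintro c α c' ⟨chain, h, hu⟩ hs
    obtain ⟨new, -, -, h'⟩ := hu.step hs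
    exact ⟨_, _, h'⟩
  · rintro c m a c' ⟨chain, h, hu⟩ hs
    obtain ⟨new, -, -, h'⟩ := hu.step hs
    cases hs with
    | call _ _ _ hi =>
      exact ⟨_, _, _, m, .genId m a, h', Function.update_self .., .inl ⟨rfl, rfl⟩⟩
  · rintro w c α c' - ⟨chain, h, m, l, hu, hi, hw⟩ hs hα
    obtain ⟨new, hls, hsame, h'⟩ := hu.step hs
    have hext := (hu.list.step hls).2
    refine ⟨_, _, m, l, h', (hsame i (Ne.symm hα)).trans hi, ?_⟩
    rcases hw with hw | ⟨m', a, t, pc, rfl, hpc, K, hK, rfl⟩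
    · exact .inl hw
    · refine .inr ⟨_, _, _, _, rfl, hpc, K, ?_, ?_⟩
      · have := hK.step hu.list rfl (hu.own_ne_zero hi hpc) hls
        rw [(hu.list.head_eq hext (Ne.symm hα)).2.1]
        convert this using 1
        funext j
        rcases eq_or_ne j α.pid with rfl | hj
        · rw [Function.update_self]
        · rw [Function.update_of_ne hj, hsame j hj]
      · rw [hu.rank_eq hext (Ne.symm hα)]
  · rintro w c α c' - h hs hαi hα
    cases hs with
    | call j m' a hj =>
      obtain rfl : j = i := hαi
      obtain ⟨_, _, m, l, -, hi, -⟩ := h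
      rw [show c.proc j = some (m, l) from hi] at hj
      cases hj
    | ret j m' l' b hj hr =>
      obtain rfl : j = i := hαi
      exact (hα ⟨_, _, rfl⟩).elim
    | tau j m' l₁ l₂ s' hj hr hs =>
      obtain rfl : j = i := hαi
      exact UInv.Bound.tau hnb h hj (fun m a t b e => by subst e; cases hr) hs

/-- The nodes provide a linearization of the record. The real-time order of the actual history, as
far as it concerns recorded operations, is contained in that of the record, so forgetting the
identities gives a linearization of the actual history. -/
theorem uSpec_linearizable : (USpec n S).sem.Linearizable S := by
  intro w c hw
  obtain ⟨chain, hu⟩ := UInv.exists_of_exec hw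
  obtain ⟨l, hl⟩ := hu.nodes.exists_lin_record hu.recorded.record hu.list.list
  exact ⟨_, (hl.untag (fun i => (hu.recorded.sync i).prefixes.1)
    (fun i => (hu.recorded.sync i).prefixes.2) hu.recorded.order).isLinearization hu.recorded.alt⟩

theorem uSpec_admissible (hnb : S.NonBlocking) (P : Liveness) : (USpec n S).Admissible S P :=
  ⟨uSpec_linearizable,
    LTS.satisfies_of_not_starved (fun t ht i => uSpec_not_starved hnb i t ht) P⟩

end UniversalObjectAdmissible

end ConcLat

namespace ConcLat

/-! ### Transfer of linearizations to the record, and solo runs -/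

section Maximality

variable {n : ℕ} {M A B : Type u} {S : SeqSpec M A B}

open History

/-- Forget the tag of an action. -/
def Act.untag {T : Type} : Act n M A B T → Act n M A B Unit
  | .call i m a _ => .call i m a ()
  | .ret i m b _ => .ret i m b ()

theorem callPairs_untag {T : Type} (i : Fin n) (r : History n M A B T) :
    callPairs i (r.map Act.untag) = callPairs i r := by
  induction r with
  | nil => rfl
  | cons x r ih =>
    rw [List.map_cons]
    cases x with
    | call j m a t =>
      rcases eq_or_ne j i with rfl | hj
      · simpa [callPairs, Act.untag] using ih
      · simpa [callPairs, Act.untag, callsOf_cons_call_of_ne hj] using ih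
    | ret j m b t => simpa [callPairs, Act.untag] using ih

theorem retPairs_untag {T : Type} (i : Fin n) (r : History n M A B T) :
    retPairs i (r.map Act.untag) = retPairs i r := by
  induction r with
  | nil => rfl
  | cons x r ih =>
    rw [List.map_cons]
    cases x with
    | ret j m a t =>
      rcases eq_or_ne j i with rfl | hj
      · simpa [retPairs, Act.untag] using ih
      · simpa [retPairs, Act.untag, retsOf_cons_ret_of_ne hj] using ih
    | call j m b t => simpa [retPairs, Act.untag] using ih

theorem History.Before.untag {T : Type} {r : History n M A B T} {o₁ o₂ : Fin n × ℕ}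
    (h : r.Before o₁ o₂) : History.Before (r.map Act.untag) o₁ o₂ := by
  rw [before_iff] at *
  simp only [← length_callPairs, ← length_retPairs] at *
  obtain ⟨h₁, hp, h₂, h₃, h₄⟩ := h
  refine ⟨h₁.map Act.untag, hp.map _, ?_, ?_, ?_⟩
  · rwa [retPairs_untag]
  · rwa [callPairs_untag]
  · rwa [callPairs_untag]

/-- Process and index determine an operation, so the identities can be distributed along the list
from left to right. -/
theorem exists_tags (f : Fin n → ℕ → ℕ) (l : List (OpInst n M A B Unit)) :
    ∃ l' : List (IdOp n M A B), l'.map OpInst.untag = l ∧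
      ∀ (j : Fin n) (k : ℕ) o, (opsOf j l')[k]? = some o → o.tag = f j k := by
  induction l using List.reverseRecOn with
  | nil => exact ⟨[], rfl, fun j k o h => by simp at h⟩
  | append_singleton l o ih =>
    obtain ⟨l', hl', ht⟩ := ih
    set x : IdOp n M A B := ⟨o.pid, o.m, o.a, o.b, f o.pid (opsOf o.pid l').length⟩ with hx
    refine ⟨l' ++ [x], by rw [List.map_append, hl']; rfl, fun j k y hy => ?_⟩
    rw [opsOf_append] at hy
    by_cases hj : o.pid = j
    · subst hj
      rw [show opsOf o.pid [x] = [x] from opsOf_singleton_self x, List.getElem?_append] at hy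
      split at hy
      · exact ht _ k y hy
      · obtain ⟨h₁, h₂⟩ := List.getElem?_eq_some_iff.1 hy
        simp at h₁ h₂
        rw [← h₂, hx, show k = (opsOf o.pid l').length by omega]
    · rw [opsOf_singleton_of_ne (by exact hj), List.append_nil] at hy
      exact ht j k y hy

theorem OpBefore.of_untag {T : Type} {l : List (OpInst n M A B T)} {o₁ o₂ : Fin n × ℕ}
    (h : OpBefore (l.map OpInst.untag) o₁ o₂) : OpBefore l o₁ o₂ := by
  obtain ⟨l₁, hp, h₁, h₂, h₃⟩ := h
  rw [List.prefix_iff_eq_take, ← List.map_take] at hp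
  rw [hp, opsOf_untag, List.length_map] at h₁ h₂
  rw [opsOf_untag, List.length_map] at h₃
  exact ⟨_, List.take_prefix _ _, h₁, h₂, h₃⟩

theorem prefix_of_pairs {X Y : Type*} {l l' : List (X × Y × ℕ)}
    (h : l.map (fun c => (c.1, c.2.1)) <+: l'.map fun c => (c.1, c.2.1))
    (ht : ∀ (k : ℕ) c c', l[k]? = some c → l'[k]? = some c' → c.2.2 = c'.2.2) : l <+: l' := by
  refine prefix_of_getElem? fun k c hk => ?_
  have h₁ := getElem?_of_prefix h (k := k) (x := (c.1, c.2.1)) (by rw [List.getElem?_map, hk]; rfl)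
  rw [List.getElem?_map, Option.map_eq_some_iff] at h₁
  obtain ⟨c', hc', he⟩ := h₁
  have h₂ := ht k c c' hk hc'
  rw [hc']
  obtain ⟨x, y, z⟩ := c
  obtain ⟨x', y', z'⟩ := c'
  simp only [Prod.mk.injEq] at he h₂ ⊢
  simp [he.1, he.2, h₂]

/-- A linearization of the untagged history after the next return yields one of the recorded history
that contains the returning operation. -/
theorem Lin.exists_tagged {r : IdHistory n M A B} (hr : RecordOk r) {i : Fin n} {m : M} {a : A}
    {b : B} {t : ℕ} {cs : List (M × A × ℕ)} (hc : callsOf i r = cs ++ [(m, a, t)])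
    (hlen : cs.length = (retsOf i r).length) {l : List (OpInst n M A B Unit)}
    (hl : Lin S (r.map Act.untag ++ [.ret i m b ()]) l) :
    ∃ l', Lin S r l' ∧ RetIn l' t b := by
  -- Each operation receives the identity of the call with the same process and index. The default
  -- `0` plays no role, since every operation of `l` corresponds to a call in `r`.
  obtain ⟨l', rfl, ht⟩ := exists_tags
    (fun j k => (((callsOf j r)[k]?).map fun c => c.2.2).getD 0) l
  have htag : ∀ j (k : ℕ) o c, (opsOf j l')[k]? = some o → (callsOf j r)[k]? = some c →
      o.tag = c.2.2 := fun j k o c h₁ h₂ => by simpa [h₂] using ht j k o h₁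
  have hcalls : ∀ j, ((opsOf j l').map OpInst.callData).map (fun c => (c.1, c.2.1)) <+:
      (callsOf j r).map fun c => (c.1, c.2.1) := by
    intro j
    have := (hl.calls j).map fun c => (c.1, c.2.1)
    rw [callsOf_append, callsOf_cons_ret, callsOf_nil, List.append_nil] at this
    rw [← callPairs, ← callPairs_untag, callPairs]
    simpa [opsOf_untag, OpInst.callData, OpInst.untag, Function.comp_def] using this
  have hrets : ∀ j, (retsOf j (r.map Act.untag ++ [.ret i m b ()])).map (fun c => (c.1, c.2.1)) <+:
      ((opsOf j l').map OpInst.retData).map fun c => (c.1, c.2.1) := by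
    intro j
    have := (hl.rets j).map fun c => (c.1, c.2.1)
    simpa [opsOf_untag, OpInst.retData, OpInst.untag, Function.comp_def] using this
  refine ⟨l', ⟨?_, fun j => ?_, fun j => ?_, fun o₁ o₂ h₂ hb => ?_⟩, ?_⟩
  · have := hl.word
    rwa [opWord_untag] at this
  · refine prefix_of_pairs (hcalls j) fun k c c' h₁ h₂ => ?_
    rw [List.getElem?_map, Option.map_eq_some_iff] at h₁
    obtain ⟨o, ho, rfl⟩ := h₁
    exact htag j k o c' ho h₂
  · refine prefix_of_pairs (List.IsPrefix.trans ?_ (hrets j)) fun k c c' h₁ h₂ => ?_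
    · rw [retsOf_append, List.map_append]
      refine List.IsPrefix.trans ?_ (List.prefix_append _ _)
      rw [← retPairs, ← retPairs, retPairs_untag]
    · rw [List.getElem?_map, Option.map_eq_some_iff] at h₂
      obtain ⟨o, ho, rfl⟩ := h₂
      obtain ⟨a', ha'⟩ := hr.rets j k c h₁
      exact (htag j k o _ ho ha').symm
  · refine (hl.order o₁ o₂ (by rwa [opsOf_untag, List.length_map]) ?_).of_untag
    exact hb.untag.mono (List.prefix_append _ _)
  -- The new return has index `cs.length` in process `i`, as does the call `(m, a, t)`; so the
  -- operation at this index carries both the value `b` and the identity `t`.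
  · have h₁ : ((retsOf i (r.map Act.untag ++ [.ret i m b ()])).map
        fun c => (c.1, c.2.1))[cs.length]? = some (m, b) := by
      have hl₂ : (retPairs i (r.map Act.untag)).length = cs.length := by
        rw [retPairs_untag, length_retPairs, hlen]
      rw [retsOf_append, List.map_append, ← retPairs, ← hl₂,
        List.getElem?_append_right le_rfl]
      simp
    have h₂ := getElem?_of_prefix (hrets i) h₁
    rw [List.map_map, List.getElem?_map, Option.map_eq_some_iff] at h₂
    obtain ⟨o, ho, he⟩ := h₂
    refine ⟨o, (mem_opsOf.1 (List.mem_of_getElem? ho)).1, ?_, ?_⟩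
    · exact htag i _ o (m, a, t) ho (by rw [hc]; simp)
    · exact congrArg Prod.snd he

/-- Steps of process `i` in the operation `m(a)` with identity `t`. -/
def USolo (S : SeqSpec M A B) (i : Fin n) (m : M) (a : A) (t : ℕ)
    (x y : UMem n M A B × UPc n M A B) : Prop :=
  Relation.ReflTransGen (fun x y => UPcStep S i m a t x.1 x.2 y.1 y.2) x y

namespace USolo

variable {i : Fin n} {m : M} {a : A} {t : ℕ} {x y z : UMem n M A B × UPc n M A B}

theorem single {s s' : UMem n M A B} {pc pc' : UPc n M A B}
    (h : UPcStep S i m a t s pc s' pc') : USolo S i m a t (s, pc) (s', pc') :=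
  Relation.ReflTransGen.single h

theorem trans (h : USolo S i m a t x y) (h' : USolo S i m a t y z) : USolo S i m a t x z :=
  Relation.ReflTransGen.trans h h'

theorem step {s s' : UMem n M A B} {pc pc' : UPc n M A B} (h : USolo S i m a t x (s, pc))
    (h' : UPcStep S i m a t s pc s' pc') : USolo S i m a t x (s', pc') :=
  h.trans (single h')

theorem inv (hs : USolo S i m a t x y) {m₀ : M} {f : Fin n → Option (M × ULoc n M A B)}
    {h : History n M A B Unit}
    (hu : ∃ chain, UInv S chain x.1 (Function.update f i (some (m₀, .run m a t x.2))) h) :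
    ∃ chain, UInv S chain y.1 (Function.update f i (some (m₀, .run m a t y.2))) h := by
  induction hs with
  | refl => exact hu
  | tail _ hs ih =>
    obtain ⟨chain, hu⟩ := ih
    obtain ⟨new, -, hu'⟩ := hu.run (Function.update_self ..) hs
    rw [Function.update_idem] at hu'
    exact ⟨_, hu'⟩

theorem exec (hs : USolo S i m a t x y) {m₀ : M} {f g g' : Fin n → Option (M × ULoc n M A B)}
    (hg : g = Function.update f i (some (m₀, .run m a t x.2)))
    (hg' : g' = Function.update f i (some (m₀, .run m a t y.2))) :
    ∃ w, historyOf w = [] ∧ (USpec n S).sem.Exec (⟨x.1, g⟩ : (USpec n S).Config) w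
      (⟨y.1, g'⟩ : (USpec n S).Config) := by
  subst hg hg'
  refine ConcObject.exec_of_solo (O := USpec n S) (x := (x.1, .run m a t x.2))
    (y := (y.1, .run m a t y.2)) ?_ m₀ f
  induction hs with
  | refl => exact .refl
  | @tail y z _ hs ih =>
    refine ih.tail ⟨?_, .inl (.run _ _ _ _ _ _ _ hs)⟩
    obtain ⟨s₁, pc₁⟩ := y
    obtain ⟨s₂, pc₂⟩ := z
    replace hs : UPcStep S i m a t s₁ pc₁ s₂ pc₂ := hs
    cases hs <;> rfl

/-- The scan of the array `head` finds a node of maximal sequence number. -/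
theorem exists_scan (S : SeqSpec M A B) (i : Fin n) (m : M) (a : A) (t : ℕ) (s : UMem n M A B) :
    ∃ cur, USolo S i m a t (s, .scan 0 0) (s, .scan n cur) ∧
      (cur = 0 ∨ ∃ j, cur = s.list.head j) ∧
      ∀ j, (s.list.heap (s.list.head j)).seq ≤ (s.list.heap cur).seq := by
  have key : ∀ k ≤ n, ∃ cur, USolo S i m a t (s, .scan 0 0) (s, .scan k cur) ∧
      (cur = 0 ∨ ∃ j, cur = s.list.head j) ∧
      ∀ j : Fin n, j.val < k → (s.list.heap (s.list.head j)).seq ≤ (s.list.heap cur).seq := by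
    intro k
    induction k with
    | zero => exact fun _ => ⟨0, .refl, .inl rfl, fun j hj => by omega⟩
    | succ k ih =>
      intro hk
      obtain ⟨cur, h₁, h₂, h₃⟩ := ih (by omega)
      have hmax : (s.list.heap cur).seq ≤
            (s.list.heap (s.list.maxNode cur (s.list.head ⟨k, hk⟩))).seq ∧
          (s.list.heap (s.list.head ⟨k, hk⟩)).seq ≤
            (s.list.heap (s.list.maxNode cur (s.list.head ⟨k, hk⟩))).seq := by
        unfold ListMem.maxNode
        split <;> omega
      refine ⟨_, h₁.step (.scan s k cur hk), ?_, fun j hj => ?_⟩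
      · unfold ListMem.maxNode
        split
        · exact .inr ⟨_, rfl⟩
        · exact h₂
      · rcases Nat.lt_succ_iff_lt_or_eq.1 hj with hj | hj
        · exact (h₃ j hj).trans hmax.1
        · obtain rfl : j = ⟨k, hk⟩ := Fin.ext hj
          exact hmax.2
  obtain ⟨cur, h₁, h₂, h₃⟩ := key n le_rfl
  exact ⟨cur, h₁, h₂, fun j => h₃ j j.isLt⟩

end USolo

end Maximality

end ConcLat

namespace ConcLat

/-! ### The universal object simulates every linearizable object -/

section Maximality

variable {n : ℕ} {M A B : Type u} {S : SeqSpec M A B}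

open History

/-- The memory of `𝒰` after the history `h` if no operation has been announced without returning. -/
structure Resting (h : History n M A B Unit) (s : UMem n M A B) : Prop where
  record : s.record.map Act.untag = h
  returned : ∀ q : ℕ, q ≠ 0 → q < s.list.alloc → ∃ (j : Fin n) (m : M) (t : ℕ) (b : B),
    s.HasOp q t ∧ s.NodeRet q t b ∧ (m, b, t) ∈ retsOf j s.record
  -- The dummy process only covers the case `n = 0`, in which `head` has no entries.
  last : ∀ _ : Fin n, ∃ j, (s.list.heap (s.list.head j)).decideNext = none

namespace USolo

variable {i : Fin n} {m : M} {a : A} {t : ℕ} {chain : List ℕ} {s : UMem n M A B}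
  {g : Fin n → Option (M × ULoc n M A B)} {h : History n M A B Unit}

/-- A new operation that runs alone proposes its own node as the successor of the last node. -/
theorem exists_decide (hu : UInv S chain s g h) (hidle : ∀ j, procPc ULoc.pc (g j) = .idle)
    (hlast : ∃ j, (s.list.heap (s.list.head j)).decideNext = none) :
    ∃ cur, (s.list.heap cur).seq ≠ 0 ∧ (s.list.heap cur).decideNext = none ∧
      USolo S i m a t (s, .announce)
        (s.withList ((s.list.announceNew i ⟨some (t, m, a), none, none⟩).setHead i cur),
          .decide cur s.list.alloc) := by
  -- No process has an announced node still in use, so every allocated node has been inserted and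
  -- numbered.
  have hold : ∀ p < s.list.alloc, (s.list.heap p).seq ≠ 0 := fun p hp =>
    (hu.list.owner p hp).resolve_right fun ⟨j, _, hj⟩ => hj (hidle j)
  set s₁ := s.withList (s.list.announceNew i ⟨some (t, m, a), none, none⟩) with hs₁
  have hheap : ∀ q, q ≠ s.list.alloc → s₁.list.heap q = s.list.heap q := fun q hq => by
    rw [hs₁, UMem.withList_list, ListMem.announceNew_heap, if_neg hq]
  have hnew : (s₁.list.heap s.list.alloc).seq = 0 := by
    rw [hs₁, UMem.withList_list, ListMem.announceNew_heap, if_pos rfl]; rfl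
  have hne : ∀ q, (s.list.heap q).seq ≠ 0 → q ≠ s.list.alloc := fun q hq =>
    (hu.list.list.alloc q (hu.list.list.mem_of_seq hq)).ne
  obtain ⟨cur, hscan, hcur, hmax⟩ := exists_scan S i m a t s₁
  have hcur0 : (s.list.heap cur).seq ≠ 0 := by
    rcases hcur with rfl | ⟨j, rfl⟩
    · exact hu.list.list.seq_zero
    · exact hu.list.head j
  -- Some entry of `head` is the last node of the list, which has the greatest number; a scan that
  -- finds a maximal number therefore ends at this node.
  have hdec : (s.list.heap cur).decideNext = none := by
    obtain ⟨j, hj⟩ := hlast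
    have h₁ := hu.list.list.last_of_dec (hu.list.head j) hj
    obtain ⟨k, hk, hks⟩ := hu.list.list.nodeAt_of_seq hcur0
    have h₂ : (s.list.heap (s.list.head j)).seq ≤ (s.list.heap cur).seq := by
      have := hmax j
      rwa [show s₁.list.head j = s.list.head j from rfl, hheap _ (hne _ (hu.list.head j)),
        hheap _ (hne _ hcur0)] at this
    have h₃ := (hu.list.list.seq _ _ h₁).resolve_right fun hc => hu.list.head j hc.1
    obtain rfl : k = chain.length := by
      have := hk.le_length
      omega
    exact hk.right_unique h₁ ▸ hj
  refine ⟨cur, hcur0, hdec, ?_⟩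
  set s₂ := s.withList ((s.list.announceNew i ⟨some (t, m, a), none, none⟩).setHead i cur) with hs₂
  have hown : s₂.list.announce i = s.list.alloc := by
    simp [hs₂, UMem.withList, ListMem.announceNew, ListMem.setHead]
  have hhead : s₂.list.head i = cur := by
    simp [hs₂, UMem.withList, ListMem.setHead]
  have hrun : USolo S i m a t (s, .announce) (s₂, .prefer cur (s₂.list.helpOf i cur)) := by
    refine ((((((single (.announce s)).trans hscan).step (.scanEnd _ _ _ le_rfl)).step
      (s' := s₂) (.testLoop _ ?_)).step (.before _)).step (s' := s₂) (.help _ _)).trans ?_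
    · rw [show (s₁.withList (s₁.list.setHead i cur)) = s₂ from rfl, hown]; exact hnew
    · rw [hhead]; exact .refl
  -- Helping does not interfere: the entry consulted is the own node or an older node, which is
  -- numbered. In both cases the own node is preferred.
  by_cases hh : (s₂.list.heap (s₂.list.helpOf i cur)).seq = 0
  · have hp : s₂.list.helpOf i cur = s.list.alloc := by
      by_contra hc
      have hann : ∀ j, s₂.list.announce j = s.list.alloc ∨ s₂.list.announce j < s.list.alloc := by
        intro j
        rcases eq_or_ne j i with rfl | hj
        · exact .inl hown
        · refine .inr ?_
          rw [show s₂.list.announce j = s.list.announce j from Function.update_of_ne hj _ _]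
          exact hu.list.ann_lt j
      have hlt : s₂.list.helpOf i cur < s.list.alloc := (hann _).resolve_left hc
      rw [show s₂.list.heap = s₁.list.heap from rfl, hheap _ hlt.ne] at hh
      exact hold _ hlt hh
    have := hrun.step (.preferHelp _ _ _ hh)
    rwa [hp] at this
  · have := hrun.step (.preferOwn _ _ _ hh)
    rwa [hown] at this

/-- An operation that runs alone appends its own node, with the linearization `l`. -/
theorem exists_done {cur p : ℕ} {m₀ : M} {b : B} {l : List (IdOp n M A B)}
    {f : Fin n → Option (M × ULoc n M A B)}
    (hu : ∃ chain, UInv S chain s (Function.update f i (some (m₀, .run m a t (.decide cur p)))) h)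
    (hcur : (s.list.heap cur).seq ≠ 0) (hdec : (s.list.heap cur).decideNext = none)
    (hp : s.list.heap p = Node.fresh ⟨some (t, m, a), none, none⟩) (hp0 : p ≠ 0)
    (hown : s.list.announce i = p) (hl : IsLinearization S s.record l) (hb : RetIn l t b)
    (hold : ∀ q, q ≠ 0 → q ≠ p → q < s.list.alloc →
      ∃ t b, s.HasOp q t ∧ s.NodeRet q t b ∧ RetIn l t b) :
    ∃ s', USolo S i m a t (s, .decide cur p) (s', .done b) ∧
      s'.list.alloc = s.list.alloc ∧ s'.record = s.record ++ [.ret i m b t] ∧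
      s'.list.head i = p ∧ (s'.list.heap p).decideNext = none ∧
      (s'.list.heap p).data = ⟨some (t, m, a), some s.record, some l⟩ ∧
      ∀ q, q ≠ p → (s'.list.heap q).data = (s.list.heap q).data := by
  have hpc : cur ≠ p := by
    rintro rfl
    rw [hp] at hcur
    exact hcur rfl
  set s₁ := (s.withList (s.list.modify cur fun x => { x with decideNext := some p })).casHist p
    s.record with hs₁
  have h₁ : USolo S i m a t (s, .decide cur p) (s₁, .genLin cur p) :=
    ((single (.decideFirst _ _ _ hdec)).step (.readHist _ _ _)).step (.casHist _ _ _ _)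
  have hp₁ : s₁.list.heap p = ⟨⟨some (t, m, a), some s.record, none⟩, none, 0, none⟩ := by
    rw [hs₁, UMem.casHist_heap, if_pos rfl, UMem.withList_list, ListMem.modify_heap,
      if_neg hpc.symm, hp]
    rfl
  have hd₁ : ∀ q, q ≠ p → (s₁.list.heap q).data = (s.list.heap q).data := by
    intro q hq
    rw [hs₁, UMem.casHist_heap, if_neg hq, UMem.withList_list, ListMem.modify_heap]
    split <;> rfl
  -- `hold` covers every node up to `cur`, and `p` is not among these because it has no successor.
  -- So the prescribed `l` is a possible outcome of `genLin()`.
  have hgen : s₁.GenLin S cur p l := by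
    refine ⟨⟨s.record, by rw [hp₁], hl⟩, ⟨t, b, ⟨m, a, by rw [hp₁]⟩, hb⟩, fun q hq hqc => ?_⟩
    obtain ⟨chain, hu₁⟩ := h₁.inv hu
    obtain ⟨k, hk, hn⟩ := hu₁.list.list.nodeAt_of_inList hq
    have hqp : q ≠ p := by
      rintro rfl
      rcases hqc.cases_head with hc | ⟨x, hx, -⟩
      · exact hpc hc.symm
      · rw [ListMem.Next, hp₁] at hx
        cases hx
    have hq0 : q ≠ 0 := by
      rintro rfl
      exact hk.ne (hn.left_unique hu₁.list.list.nodup (nodeAt_zero _)).symm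
    obtain ⟨t', b', e₁, e₂, e₃⟩ := hold q hq0 hqp (hu₁.list.list.alloc q hn.mem)
    refine ⟨t', b', ?_, ?_, e₃⟩
    · rwa [UMem.HasOp, hd₁ q hqp]
    · rwa [UMem.NodeRet, hd₁ q hqp]
  set s₂ := (s₁.casLin p l).withList
    ((s₁.casLin p l).list.modify cur fun x => { x with next := some p }) with hs₂
  have h₂ : USolo S i m a t (s, .decide cur p) (s₂, .setSeq cur p) :=
    ((h₁.step (.genLin _ _ _ _ hgen)).step (.casLin _ _ _ _)).step (.link _ _ _)
  have hp₂ : s₂.list.heap p = ⟨⟨some (t, m, a), some s.record, some l⟩, none, 0, none⟩ := by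
    rw [hs₂, UMem.withList_list, ListMem.modify_heap, if_neg hpc.symm, UMem.casLin_heap, if_pos rfl,
      hp₁]
    rfl
  have hd₂ : ∀ q, q ≠ p → (s₂.list.heap q).data = (s.list.heap q).data := by
    intro q hq
    rw [hs₂, UMem.withList_list, ListMem.modify_heap, UMem.casLin_heap, if_neg hq, ← hd₁ q hq]
    split <;> rfl
  set s₃ := s₂.withList (((s₂.list.modify p fun x =>
    { x with seq := (s₂.list.heap cur).seq + 1 }).setHead i p).setHead i p) with hs₃
  have hown₃ : s₃.list.announce i = p := hown
  have hp₃ : s₃.list.heap p =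
      ⟨⟨some (t, m, a), some s.record, some l⟩, none, (s₂.list.heap cur).seq + 1, none⟩ := by
    rw [show s₃.list.heap = (s₂.list.modify p fun x =>
      { x with seq := (s₂.list.heap cur).seq + 1 }).heap from rfl, ListMem.modify_heap, if_pos rfl,
      hp₂]
  have hd₃ : ∀ q, q ≠ p → (s₃.list.heap q).data = (s.list.heap q).data := by
    intro q hq
    rw [show s₃.list.heap = (s₂.list.modify p fun x =>
      { x with seq := (s₂.list.heap cur).seq + 1 }).heap from rfl, ListMem.modify_heap, if_neg hq,
      hd₂ q hq]
  have h₃ : USolo S i m a t (s, .decide cur p) (s₃, .getRet) := by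
    have := (((h₂.step (.setSeq _ _ _)).step (.setHead _ _)).step (.testExit _ ?_)).step
      (.setHeadOwn _)
    · convert this using 2
      rw [hs₃, ← hown]
      rfl
    · rw [show ((s₂.withList (s₂.list.modify p fun x =>
        { x with seq := (s₂.list.heap cur).seq + 1 })).withList (ListMem.setHead
          (s₂.withList (s₂.list.modify p fun x =>
            { x with seq := (s₂.list.heap cur).seq + 1 })).list i p)).list.announce i = p from hown]
      exact (congrArg Node.seq hp₃).trans_ne (Nat.succ_ne_zero _)
  refine ⟨_, (h₃.step (.getRet _ p b ?_ ⟨m, a, by rw [hp₃]⟩ ⟨l, by rw [hp₃], hb⟩)).step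
    (.storeRet _ _), rfl, rfl, ?_, ?_, ?_, hd₃⟩
  · obtain ⟨chain, hu₃⟩ := h₃.inv hu
    exact hu₃.list.list.inList_of_seq (by rw [hp₃]; exact Nat.succ_ne_zero _) hp0
  · exact Function.update_self ..
  · exact congrArg Node.decideNext hp₃
  · exact congrArg Node.data hp₃

end USolo

/-- A linearization of the history with the return is transferred to the record, which contains the
call but not yet the return. All older nodes belong to returned operations, whose values occur in
every linearization of the record; hence `genLin()` may produce this one, and the operation returns
`b`. -/
theorem Resting.exists_done {i : Fin n} {m : M} {a : A} {t : ℕ} {b : B} {chain : List ℕ}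
    {s : UMem n M A B} {g : Fin n → Option (M × ULoc n M A B)} {h : History n M A B Unit}
    (hrest : Resting h s) (hu : UInv S chain s g h) (hidle : ∀ j, procPc ULoc.pc (g j) = .idle)
    (hi : g i = some (m, .run m a t .announce)) {l : List (OpInst n M A B Unit)}
    (hl : Lin S (h ++ [.ret i m b ()]) l) :
    ∃ s', USolo S i m a t (s, .announce) (s', .done b) ∧ Resting (h ++ [.ret i m b ()]) s' := by
  obtain ⟨-, -, -, cs, hcs, hlen⟩ := hu.recorded.sync_of hi
  rw [← hrest.record] at hl
  obtain ⟨l', hl', hb⟩ := hl.exists_tagged hu.recorded.record hcs hlen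
  obtain ⟨cur, hcur, hdec, hrun⟩ :=
    USolo.exists_decide (i := i) (m := m) (a := a) (t := t) hu hidle (hrest.last i)
  set s₁ := s.withList ((s.list.announceNew i ⟨some (t, m, a), none, none⟩).setHead i cur) with hs₁
  have hlt : ∀ q, (s.list.heap q).seq ≠ 0 → q < s.list.alloc := fun q hq =>
    hu.list.list.alloc q (hu.list.list.mem_of_seq hq)
  have hheap : ∀ q, s₁.list.heap q = if q = s.list.alloc then
      Node.fresh ⟨some (t, m, a), none, none⟩ else s.list.heap q :=
    fun q => ListMem.announceNew_heap s.list i _ q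
  have hold : ∀ q, q < s.list.alloc → s₁.list.heap q = s.list.heap q := fun q hq => by
    rw [hheap, if_neg hq.ne]
  have hu₁ := hrun.inv (m₀ := m) (f := g) (h := h)
    ⟨chain, by rw [← hi, Function.update_eq_self]; exact hu⟩
  have hret : ∀ q, q ≠ 0 → q < s.list.alloc → ∃ (j : Fin n) (m : M) (t : ℕ) (b : B),
      s₁.HasOp q t ∧ s₁.NodeRet q t b ∧ (m, b, t) ∈ retsOf j s.record := by
    intro q h0 hq
    obtain ⟨j, m', t', b', e₁, e₂, e₃⟩ := hrest.returned q h0 hq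
    refine ⟨j, m', t', b', ?_, ?_, e₃⟩
    · rwa [UMem.HasOp, hold q hq]
    · rwa [UMem.NodeRet, hold q hq]
  obtain ⟨s', hrun', halloc, hrec, hhead, hnone, hdata, hsame⟩ :=
    USolo.exists_done (b := b) (l := l') hu₁ (by rwa [hold _ (hlt _ hcur)])
      (by rwa [hold _ (hlt _ hcur)]) (by rw [hheap, if_pos rfl])
      (hu.list.list.alloc 0 (by simp)).ne' (Function.update_self ..)
      (hl'.isLinearization hu.recorded.record.alternating) hb (fun q h0 hq hqa => by
        have hqa : q < s.list.alloc + 1 := hqa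
        obtain ⟨j, m', t', b', e₁, e₂, e₃⟩ := hret q h0 (by omega)
        obtain ⟨o, ho, he⟩ := List.mem_map.1 ((hl'.rets j).subset e₃)
        refine ⟨t', b', e₁, e₂, o, (mem_opsOf.1 ho).1, ?_, ?_⟩
        · exact congrArg (fun x => x.2.2) he
        · exact congrArg (fun x => x.2.1) he)
  refine ⟨s', hrun.trans hrun', ?_, fun q h0 hq => ?_, fun _ => ⟨i, by rw [hhead, hnone]⟩⟩
  · rw [hrec, List.map_append, show s₁.record = s.record from rfl, hrest.record]
    rfl
  · rw [halloc] at hq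
    have hq : q < s.list.alloc + 1 := hq
    rcases Nat.lt_succ_iff_lt_or_eq.1 hq with hq | rfl
    · obtain ⟨j, m', t', b', e₁, e₂, e₃⟩ := hret q h0 hq
      refine ⟨j, m', t', b', ?_, ?_, ?_⟩
      · rwa [UMem.HasOp, hsame q hq.ne]
      · rwa [UMem.NodeRet, hsame q hq.ne]
      · rw [hrec]
        exact (retsOf_prefix (List.prefix_append _ _) j).subset e₃
    · refine ⟨i, m, t, b, ⟨m, a, by rw [hdata]⟩, ⟨l', by rw [hdata], hb⟩, ?_⟩
      rw [hrec, retsOf_append, retsOf_cons_ret_self]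
      simp

/-- The local states of a process of an arbitrary object and of the corresponding process of `𝒰`. -/
def Follows {L : Type u} (x : Option (M × L)) (y : Option (M × ULoc n M A B)) : Prop :=
  x = none ∧ y = none ∨ ∃ m l a t, x = some (m, l) ∧ y = some (m, .run m a t .announce)

theorem Follows.update {L : Type u} {f : Fin n → Option (M × L)}
    {g : Fin n → Option (M × ULoc n M A B)} (h : ∀ j, Follows (f j) (g j)) {i : Fin n}
    {x : Option (M × L)} {y : Option (M × ULoc n M A B)} (hxy : Follows x y) (j : Fin n) :
    Follows (Function.update f i x j) (Function.update g i y j) := by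
  rcases eq_or_ne j i with rfl | hj
  · simpa using hxy
  · simpa [hj] using h j

theorem Follows.idle {L : Type u} {x : Option (M × L)} {y : Option (M × ULoc n M A B)}
    (h : Follows x y) : procPc ULoc.pc y = .idle := by
  rcases h with ⟨-, rfl⟩ | ⟨m, l, a, t, -, rfl⟩ <;> rfl

/-- The configuration `c` of `O` is simulated by the configuration of `𝒰` with memory `s` and local
states `g`. -/
def USimulates (S : SeqSpec M A B) (O : ConcObject n M A B) (c : O.Config) (s : UMem n M A B)
    (g : Fin n → Option (M × ULoc n M A B)) : Prop :=
  ∃ w, O.sem.Exec O.sem.init w c ∧ (∃ chain, UInv S chain s g (historyOf w)) ∧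
    Resting (historyOf w) s ∧ ∀ i, Follows (c.proc i) (g i)

theorem ConcObject.Step.tau_of_eq {O : ConcObject n M A B} {s s' : O.Mem}
    {g g' : Fin n → Option (M × O.Loc)} {i : Fin n} {m : M} {l l' : O.Loc} (hi : g i = some (m, l))
    (hr : O.ret l = none) (hs : O.step i s l s' l') (hg : g' = Function.update g i (some (m, l'))) :
    O.Step ⟨s, g⟩ (.tau i) ⟨s', g'⟩ := by
  subst hg
  exact .tau ⟨s, g⟩ i m l l' s' hi hr hs

theorem ConcObject.Step.ret_of_eq {O : ConcObject n M A B} {s : O.Mem}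
    {g g' : Fin n → Option (M × O.Loc)} {i : Fin n} {m : M} {l : O.Loc} {b : B}
    (hi : g i = some (m, l)) (hr : O.ret l = some b) (hg : g' = Function.update g i none) :
    O.Step ⟨s, g⟩ (.ret i m b) ⟨s, g'⟩ := by
  subst hg
  exact .ret ⟨s, g⟩ i m l b hi hr

theorem uSpec_exec_call (S : SeqSpec M A B) {s : UMem n M A B}
    {g : Fin n → Option (M × ULoc n M A B)} {i : Fin n} (m : M) (a : A) (hi : g i = none) :
    (USpec n S).sem.Exec (⟨s, g⟩ : (USpec n S).Config) [.call i m a, .tau i, .tau i]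
      (⟨{ s with nextId := s.nextId + 1, record := s.record ++ [.call i m a s.nextId] },
        Function.update g i (some (m, .run m a s.nextId .announce))⟩ : (USpec n S).Config) := by
  have h₁ := ConcObject.Step.call (O := USpec n S) ⟨s, g⟩ i m a hi
  have h₂ := ConcObject.Step.tau_of_eq (O := USpec n S) (s := s)
    (g := Function.update g i (some (m, .genId m a)))
    (g' := Function.update g i (some (m, .run m a s.nextId .storeCall)))
    (Function.update_self ..) rfl (.inl (.genId _ _ _)) (Function.update_idem ..).symm
  have h₃ := ConcObject.Step.tau_of_eq (O := USpec n S) (s := { s with nextId := s.nextId + 1 })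
    (g' := Function.update g i (some (m, .run m a s.nextId .announce)))
    (Function.update_self ..) rfl (.inl (.run _ _ _ _ _ _ _ (.storeCall _)))
    (Function.update_idem ..).symm
  exact .cons h₁ (.cons h₂ (.single h₃))

theorem UInv.exists_announce {chain : List ℕ} {s : UMem n M A B}
    {g : Fin n → Option (M × ULoc n M A B)} {h : History n M A B Unit} (hu : UInv S chain s g h)
    {i : Fin n} (m : M) (a : A) (hi : g i = none) :
    ∃ chain, UInv S chain
      { s with nextId := s.nextId + 1, record := s.record ++ [.call i m a s.nextId] }
      (Function.update g i (some (m, .run m a s.nextId .announce))) (h ++ [.call i m a ()]) := by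
  have hu₁ := (hu.call m a hi).genId (Function.update_self ..)
  rw [Function.update_idem] at hu₁
  obtain ⟨new, -, hu₂⟩ := hu₁.run (Function.update_self ..) (.storeCall _)
  rw [Function.update_idem] at hu₂
  exact ⟨_, hu₂⟩

/-- `𝒰` records a call at once and then waits at the announcement, so internal steps of `O` are
matched by nothing. When `O` returns, the value is known, and the process of `𝒰` runs alone from its
announcement to its return. The nondeterminism of `genLin()` is thus resolved with hindsight. -/
theorem USimulates.step {O : ConcObject n M A B} (hO : O.sem.Linearizable S) {c c' : O.Config}
    {s : UMem n M A B} {g : Fin n → Option (M × ULoc n M A B)} {α : Label n M A B}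
    (h : USimulates S O c s g) (hs : O.Step c α c') :
    ∃ (v : List (Label n M A B)) (s' : UMem n M A B) (g' : Fin n → Option (M × ULoc n M A B)),
      (USpec n S).sem.Exec (⟨s, g⟩ : (USpec n S).Config) v (⟨s', g'⟩ : (USpec n S).Config) ∧
        historyOf v = historyOf [α] ∧ USimulates S O c' s' g' := by
  obtain ⟨w, hw, ⟨chain, hu⟩, hrest, hf⟩ := h
  have hw' := hw.append (.single hs)
  cases hs with
  | call i m a hi =>
    have hg : g i = none := by
      rcases hf i with ⟨-, hg⟩ | ⟨_, _, _, _, hx, -⟩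
      · exact hg
      · rw [hi] at hx; cases hx
    refine ⟨_, _, _, uSpec_exec_call S m a hg, rfl, _, hw', ?_, ⟨?_, fun q h0 hq => ?_, hrest.last⟩,
      Follows.update hf (.inr ⟨_, _, _, _, rfl, rfl⟩)⟩
    · rw [historyOf_append]
      exact hu.exists_announce m a hg
    · rw [historyOf_append, ← hrest.record]
      exact List.map_append
    · obtain ⟨j, m', t', b', e₁, e₂, e₃⟩ := hrest.returned q h0 hq
      exact ⟨j, m', t', b', e₁, e₂, (retsOf_prefix (List.prefix_append _ _) j).subset e₃⟩
  | tau i m l l' s' hi hr hs =>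
    refine ⟨[], s, g, .nil _, rfl, _, hw', ⟨chain, ?_⟩, ?_, fun j => ?_⟩
    · rwa [historyOf_append, historyOf_tau, List.append_nil]
    · rwa [historyOf_append, historyOf_tau, List.append_nil]
    · rcases eq_or_ne j i with rfl | hj
      · simp only [Function.update_self]
        rcases hf j with ⟨hx, -⟩ | ⟨m', l₁, a, t, hx, hg⟩
        · rw [hi] at hx; cases hx
        · rw [hi] at hx
          cases hx
          exact .inr ⟨_, _, _, _, rfl, hg⟩
      · simp only [Function.update_of_ne hj]
        exact hf j
  | ret i m l b hi hr =>
    obtain ⟨a, t, hg⟩ : ∃ a t, g i = some (m, .run m a t .announce) := by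
      rcases hf i with ⟨hx, -⟩ | ⟨m', l₁, a, t, hx, hg⟩
      · rw [hi] at hx; cases hx
      · rw [hi] at hx
        cases hx
        exact ⟨a, t, hg⟩
    -- Linearizability is applied to the history that ends with this return, so the linearization
    -- gives the returning operation the value `b`.
    obtain ⟨l₀, hl₀⟩ := hO _ _ hw'
    rw [historyOf_append, historyOf_ret] at hl₀
    obtain ⟨s', hrun, hrest'⟩ := hrest.exists_done hu (fun j => (hf j).idle) hg hl₀.lin
    have hgi : g = Function.update g i (some (m, .run m a t .announce)) := by
      rw [← hg, Function.update_eq_self]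
    obtain ⟨v, hv, hexec⟩ := hrun.exec hgi rfl
    dsimp only at hexec
    obtain ⟨chain', hu'⟩ := hrun.inv (m₀ := m) (f := g) (h := historyOf w)
      ⟨chain, by simpa only [← hgi] using hu⟩
    have hu'' := hu'.ret (Function.update_self ..)
    rw [Function.update_idem] at hu''
    have hret := ConcObject.Step.ret_of_eq (O := USpec n S) (s := s')
      (g := Function.update g i (some (m, .run m a t (.done b)))) (g' := Function.update g i none)
      (Function.update_self ..) rfl (Function.update_idem ..).symm
    have hexec' : (USpec n S).sem.Exec _ [Label.ret i m b] _ := .single hret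
    refine ⟨v ++ [Label.ret i m b], s', Function.update g i none, hexec.append hexec',
      by rw [historyOf_append, hv]; rfl, _, hw', ⟨chain', ?_⟩, ?_,
      Follows.update hf (.inl ⟨rfl, rfl⟩)⟩
    · rw [historyOf_append]; exact hu''
    · rw [historyOf_append]; exact hrest'

/-- `𝒰` simulates every linearizable object. -/
theorem sim_uSpec {O : ConcObject n M A B} (hO : O.sem.Linearizable S) :
    O.sem.Sim (USpec n S).sem := by
  refine ⟨fun c₁ (c₂ : (USpec n S).Config) => USimulates S O c₁ c₂.mem c₂.proc,
    ⟨[], .nil _, ⟨[], .init⟩, ⟨rfl, fun q h0 hq => ?_, fun i => ⟨i, rfl⟩⟩, fun _ => .inl ⟨rfl, rfl⟩⟩,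
    fun c₁ c₂ α c₁' h hs => ?_⟩
  · have hq : q < 1 := hq
    omega
  · obtain ⟨v, s', g', h₁, h₂, h₃⟩ := h.step hO hs
    exact ⟨v, (⟨s', g'⟩ : (USpec n S).Config), h₁, h₂, h₃⟩

end Maximality

end ConcLat

/-! ### The semilattice of classes -/

open ConcLat
theorem theorem2 {M A B : Type u} (n : ℕ) (Spec : SeqSpec M A B)
    (hdet : Spec.Deterministic) (hnb : Spec.NonBlocking) (Prog : Liveness) :
    IsPartialOrder (ClassSet n Spec Prog) (fun K₁ K₂ => K₁ ≤ K₂) ∧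
    (∀ K₁ K₂ : ClassSet n Spec Prog, ∃ K, IsLUB {K₁, K₂} K) ∧
    (∃ KU : ClassSet n Spec Prog, (USpec n Spec).sem ∈ KU.carrier ∧
      (∀ K : ClassSet n Spec Prog, (USpec n Spec).sem ∈ K.carrier → K = KU) ∧ IsTop KU) ∧
    (∃ KA : ClassSet n Spec Prog, (ASpec n Spec).sem ∈ KA.carrier ∧
      (∀ K : ClassSet n Spec Prog, (ASpec n Spec).sem ∈ K.carrier → K = KA) ∧ IsBot KA) := by
  have hU := mem_classOf _ (uSpec_admissible (n := n) hnb Prog)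
  have hA := mem_classOf _ (aSpec_admissible (n := n) hdet hnb Prog)
  refine ⟨ClassSet.isPartialOrder, ClassSet.exists_isLUB,
    ⟨_, hU, fun K hK => ClassSet.eq_of_mem hK hU, fun K => ?_⟩,
    ⟨_, hA, fun K hK => ClassSet.eq_of_mem hK hA, fun K => ?_⟩⟩
  -- Maximality uses only the linearizability of `O`; minimality also needs its liveness, through
  -- the termination of solo runs.
  · obtain ⟨O, hO, hK⟩ := K.exists_object
    exact ⟨_, hK, _, hU, sim_uSpec hO.1⟩
  · obtain ⟨O, hO, hK⟩ := K.exists_object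
    exact ⟨_, hA, _, hK, (aSpec_sim_atomic hdet hnb).trans (atomicLTS_sim hdet hO)⟩
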